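/- **Setting.** All complexes are over $\mathbb{Q}$, with homological grading. Let $P$ be an $S^1$-framed modular operad: a stable $\mathbb{S}$-module of chain complexes $P(g,I)$ ($g\ge 0$, $I$ a finite set of legs, $P(g,I)=0$ unless $2g-2+|I|>0$), with modular operad compositions along edges of graphs, and with mutually anticommuting degree-one operators $B_i$ ($i\in I$) satisfying $B_i^2=0$ and $\partial B_i+B_i\partial=0$, such that the compositions are equivariant under relabelling and under the circle actions at the uncontracted legs, and $P(h)B_{e,+}=P(h)B_{e,-}$ for the two ends of a contracted edge $e$. The motivating example is $P=\mathbb{M}^{\sf fr}$, $\mathbb{M}^{\sf fr}(g,n)=C_*(M^{\sf fr}_{g,n})$, the chains on the moduli spaces of smooth curves with framed marked points. Let $P(g,I)_{S^1}=\big(P(g,I)[u_i^{-1}:i\in I],\ \partial+\sum_i u_iB_i\big)$ with $|u_i|=-2$, and let $$FP(g,n)=\bigoplus_G\Big(D(G)\otimes\bigotimes_{v\in V_G}P(g(v),\mathrm{Leg}(v))_{S^1}\Big)_{\mathrm{Aut}(G)}$$ be the Feynman compactification: the sum is over isomorphism classes of connected stable graphs $G$ of genus $g$ with $n$ numbered leaves,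 $D(G)$ is spanned by $D_G=\bigotimes_{e\in E_G}D_e$ with $|D_e|=2$, and the differential is $\partial+uB+\delta$ with $\delta(D_G\otimes\alpha)=\sum_{e}D_{G/e}\otimes\rho_e(\alpha)$. Here the twisted sewing $\rho$ of two half-edges $h,h'$ is zero on monomials in which $u_h$ or $u_{h'}$ occurs with a nonzero exponent, and otherwise is $\alpha\mapsto c_{hh'}(B_h\alpha)$, the operadic contraction $c_{hh'}$ of $h,h'$ after applying $B_h$. On $$\overline{\mathfrak g}=\Big(\bigoplus_{(g,n)}FP(g,n)_{S_n}[1]\Big)[[\hbar,\lambda]],\qquad |\hbar|=|\lambda|=-2$$ (the shift $[1]$ raises degrees by one) let $\Delta$ be the sum of the twisted sewings of all unordered pairs of leaves, and let $\{x,y\}$ be the sum of the twisted sewings of a leaf of $x$ with a leaf of $y$. Let $\overline{\mathfrak g}$ have the differential $\partial+uB+\delta+\hbar\Delta$ and the bracket $[x,y]=(-1)^{|x|}\{x,y\}$, where $|x|$ is the degree in $FP$ (the sign of the shift). Let $\overline{\mathfrak g}^{\sf triv}$ be the same graded vector space with differential $\partial+uB+\delta$ and zero bracket. A marked graph $(G,f)$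 is a connected labelled graph $G$ with $m$ vertices and a bijection $f:\{1,\dots,m\}\to V_G$, $v_j=f(j)$; isomorphisms may permute the leaves but preserve $f$. For $\gamma_j\in FP(g(v_j),n_j)_{S_{n_j}}$ with $n_j=|\mathrm{Leg}(v_j)|$ put $$\mathcal K_{(G,f)}(\gamma_1,\dots,\gamma_m)=\sum_{\sigma_1,\dots,\sigma_m}D(G)\otimes\gamma_1^{\sigma_1}\otimes\cdots\otimes\gamma_m^{\sigma_m},$$ where $\sigma_j$ runs over all identifications of the leaves of $\gamma_j$ with $\mathrm{Leg}(v_j)$, the graphs underlying the $\gamma_j$ are inserted at the vertices $v_j$ through the $\sigma_j$, and the edges of $G$ are decorated by the $D_e$; $\mathcal K_{(G,f)}$ is zero on inputs of other types. Let $$\mathcal K_m=\sum_{(G,f)}\frac{\hbar^{\,b_1(G)}}{|\mathrm{Aut}(G,f)|}\,\mathcal K_{(G,f)}:\ \mathrm{Sym}^m(\overline{\mathfrak g}[1])\to\overline{\mathfrak g}^{\sf triv}[1],$$ extended linearly in $\hbar$ and $\lambda$, the sum being over isomorphism classes of marked graphs with $m$ vertices and $b_1(G)=\dim H^1(G)$.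 **Theorem.** All these operations are well defined, $\overline{\mathfrak g}$ and $\overline{\mathfrak g}^{\sf triv}$ are differential graded Lie algebras, and the maps $\mathcal K_m$ ($m\ge 1$) form an $L_\infty$ quasi-isomorphism $\mathcal K:\overline{\mathfrak g}\to\overline{\mathfrak g}^{\sf triv}$. Here the shifted DGLA $\mathfrak h[1]$ of a DGLA $\mathfrak h$ carries the operations $Q_1=d$ and $Q_2(x,y)=(-1)^{|x|}[x,y]$ with $|x|$ the degree in $\mathfrak h[1]$, and "quasi-isomorphism" means that the chain map $\mathcal K_1$ induces an isomorphism in homology. -/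

import Mathlib

open scoped DirectSum

universe u w

noncomputable section

/-! ## `S¹`-framed modular operads -/

/-- `f : K → I` identifies `K` with the set of legs of `I` other than `a` and `b`. -/
def LegsOff {I K : Type} (f : K → I) (a b : I) : Prop :=
  Function.Injective f ∧ ∀ c, (∃ k, f k = c) ↔ (c ≠ a ∧ c ≠ b)

/-- The sign `(-1)^n`, as a rational number. -/
def sgn (n : ℤ) : ℚ := (-1 : ℚ) ^ n

/-- An `S¹`-framed modular operad in chain complexes over `ℚ` (homological grading).

The stable `𝕊`-module is written without coordinates: `X g I d` is the degree `d` part of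
`P(g, I)` for a finite set `I` of legs, functorial in bijections of `I`; it vanishes unless
`2g - 2 + |I| > 0`.  The operadic compositions are given on the two kinds of one-edge graphs:
`loop a b` contracts a loop joining the legs `a` and `b` of one vertex, and `glue a b` contracts
an edge joining the leg `a` of one vertex to the leg `b` of another.  The remaining legs are
named by a set `K` through `f : K → I`, respectively `f : K → I ⊕ J`.  That iterated contractions
of any two edges of a graph agree is expressed by `loop_loop`, `loop_glue_left`,
`loop_glue_cross` and `glue_assoc` (the other configurations follow by `glue_comm`). -/
structure S1FramedModularOperad where
  X : ℕ → (I : Type) → [Finite I] → ℤ → Type u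
  [addCommGroup : ∀ (g : ℕ) (I : Type) [Finite I] (d : ℤ), AddCommGroup (X g I d)]
  [module : ∀ (g : ℕ) (I : Type) [Finite I] (d : ℤ), Module ℚ (X g I d)]
  /-- stability -/
  stable : ∀ (g : ℕ) (I : Type) [Finite I] (d : ℤ),
    2 * g + Nat.card I ≤ 2 → Subsingleton (X g I d)
  /-- relabelling of legs -/
  map : ∀ {g : ℕ} {I J : Type} [Finite I] [Finite J] {d : ℤ}, I ≃ J → (X g I d →ₗ[ℚ] X g J d)
  map_refl : ∀ {g : ℕ} {I : Type} [Finite I] {d : ℤ} (x : X g I d), map (Equiv.refl I) x = x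
  map_trans : ∀ {g : ℕ} {I J K : Type} [Finite I] [Finite J] [Finite K] {d : ℤ}
    (s : I ≃ J) (t : J ≃ K) (x : X g I d), map (s.trans t) x = map t (map s x)
  /-- the differential of the complex `P(g, I)` -/
  bd : ∀ {g : ℕ} {I : Type} [Finite I] {d e : ℤ}, e + 1 = d → (X g I d →ₗ[ℚ] X g I e)
  bd_bd : ∀ {g : ℕ} {I : Type} [Finite I] {c d e : ℤ} (h : d + 1 = c) (h' : e + 1 = d)
    (x : X g I c), bd h' (bd h x) = 0
  bd_map : ∀ {g : ℕ} {I J : Type} [Finite I] [Finite J] {d e : ℤ} (h : e + 1 = d) (s : I ≃ J)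
    (x : X g I d), bd h (map s x) = map s (bd h x)
  /-- the circle action at the leg `i` -/
  B : ∀ {g : ℕ} {I : Type} [Finite I] {d e : ℤ}, I → d + 1 = e → (X g I d →ₗ[ℚ] X g I e)
  B_self : ∀ {g : ℕ} {I : Type} [Finite I] {c d e : ℤ} (i : I) (h : c + 1 = d) (h' : d + 1 = e)
    (x : X g I c), B i h' (B i h x) = 0
  B_anticomm : ∀ {g : ℕ} {I : Type} [Finite I] {c d e : ℤ} (i j : I) (h : c + 1 = d)
    (h' : d + 1 = e) (x : X g I c), B i h' (B j h x) + B j h' (B i h x) = 0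
  bd_B : ∀ {g : ℕ} {I : Type} [Finite I] {c d e : ℤ} (i : I) (h : c + 1 = d) (h' : d + 1 = e)
    (x : X g I d), bd h' (B i h' x) + B i h (bd h x) = 0
  B_map : ∀ {g : ℕ} {I J : Type} [Finite I] [Finite J] {d e : ℤ} (i : I) (h : d + 1 = e)
    (s : I ≃ J) (x : X g I d), B (s i) h (map s x) = map s (B i h x)
  /-- contraction of a loop -/
  loop : ∀ {g k : ℕ} {I K : Type} [Finite I] [Finite K] {d : ℤ} (a b : I) (f : K → I),
    a ≠ b → LegsOff f a b → g + 1 = k → (X g I d →ₗ[ℚ] X k K d)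
  /-- contraction of an edge between two vertices -/
  glue : ∀ {g h k : ℕ} {I J K : Type} [Finite I] [Finite J] [Finite K] {c d e : ℤ}
    (a : I) (b : J) (f : K → I ⊕ J), LegsOff f (Sum.inl a) (Sum.inr b) →
    g + h = k → c + d = e → (X g I c →ₗ[ℚ] X h J d →ₗ[ℚ] X k K e)
  loop_symm : ∀ {g k : ℕ} {I K : Type} [Finite I] [Finite K] {d : ℤ} (a b : I) (f : K → I)
    (hab : a ≠ b) (hf : LegsOff f a b) (hf' : LegsOff f b a) (hk : g + 1 = k) (x : X g I d),
    loop b a f hab.symm hf' hk x = loop a b f hab hf hk x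
  glue_comm : ∀ {g h k : ℕ} {I J K : Type} [Finite I] [Finite J] [Finite K] {c d e : ℤ}
    (a : I) (b : J) (f : K → I ⊕ J) (f' : K → J ⊕ I) (hf : LegsOff f (Sum.inl a) (Sum.inr b))
    (hf' : LegsOff f' (Sum.inl b) (Sum.inr a)) (hk : g + h = k) (hk' : h + g = k)
    (he : c + d = e) (he' : d + c = e) (x : X g I c) (y : X h J d),
    (∀ l, f' l = (f l).swap) →
    glue b a f' hf' hk' he' y x = sgn (c * d) • glue a b f hf hk he x y
  /-- naturality under relabelling -/
  loop_map : ∀ {g k : ℕ} {I I' K K' : Type} [Finite I] [Finite I'] [Finite K] [Finite K'] {d : ℤ}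
    (a b : I) (f : K → I) (f' : K' → I') (s : I ≃ I') (t : K ≃ K') (hab : a ≠ b)
    (hab' : s a ≠ s b) (hf : LegsOff f a b) (hf' : LegsOff f' (s a) (s b)) (hk : g + 1 = k)
    (x : X g I d), (∀ l, f' (t l) = s (f l)) →
    loop (s a) (s b) f' hab' hf' hk (map s x) = map t (loop a b f hab hf hk x)
  glue_map : ∀ {g h k : ℕ} {I I' J J' K K' : Type} [Finite I] [Finite I'] [Finite J] [Finite J']
    [Finite K] [Finite K'] {c d e : ℤ} (a : I) (b : J) (f : K → I ⊕ J) (f' : K' → I' ⊕ J')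
    (s : I ≃ I') (r : J ≃ J') (t : K ≃ K') (hf : LegsOff f (Sum.inl a) (Sum.inr b))
    (hf' : LegsOff f' (Sum.inl (s a)) (Sum.inr (r b))) (hk : g + h = k) (he : c + d = e)
    (x : X g I c) (y : X h J d), (∀ l, f' (t l) = Sum.map s r (f l)) →
    glue (s a) (r b) f' hf' hk he (map s x) (map r y) = map t (glue a b f hf hk he x y)
  /-- the compositions are chain maps -/
  bd_loop : ∀ {g k : ℕ} {I K : Type} [Finite I] [Finite K] {d e : ℤ} (a b : I) (f : K → I)
    (hab : a ≠ b) (hf : LegsOff f a b) (hk : g + 1 = k) (h : e + 1 = d) (x : X g I d),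
    bd h (loop a b f hab hf hk x) = loop a b f hab hf hk (bd h x)
  bd_glue : ∀ {g h k : ℕ} {I J K : Type} [Finite I] [Finite J] [Finite K] {c c' d d' e e' : ℤ}
    (a : I) (b : J) (f : K → I ⊕ J) (hf : LegsOff f (Sum.inl a) (Sum.inr b)) (hk : g + h = k)
    (he : c + d = e) (he₁ : c' + d = e') (he₂ : c + d' = e') (hc : c' + 1 = c) (hd : d' + 1 = d)
    (hee : e' + 1 = e) (x : X g I c) (y : X h J d),
    bd hee (glue a b f hf hk he x y) =
      glue a b f hf hk he₁ (bd hc x) y + sgn c • glue a b f hf hk he₂ x (bd hd y)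
  /-- the compositions are equivariant for the circle actions at the remaining legs -/
  B_loop : ∀ {g k : ℕ} {I K : Type} [Finite I] [Finite K] {d e : ℤ} (a b : I) (f : K → I)
    (hab : a ≠ b) (hf : LegsOff f a b) (hk : g + 1 = k) (h : d + 1 = e) (l : K) (x : X g I d),
    B l h (loop a b f hab hf hk x) = loop a b f hab hf hk (B (f l) h x)
  B_glue_left : ∀ {g h k : ℕ} {I J K : Type} [Finite I] [Finite J] [Finite K] {c c' d e e' : ℤ}
    (a : I) (b : J) (f : K → I ⊕ J) (hf : LegsOff f (Sum.inl a) (Sum.inr b)) (hk : g + h = k)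
    (he : c + d = e) (he' : c' + d = e') (hc : c + 1 = c') (hee : e + 1 = e') (l : K) (i : I)
    (x : X g I c) (y : X h J d), f l = Sum.inl i →
    B l hee (glue a b f hf hk he x y) = glue a b f hf hk he' (B i hc x) y
  B_glue_right : ∀ {g h k : ℕ} {I J K : Type} [Finite I] [Finite J] [Finite K] {c d d' e e' : ℤ}
    (a : I) (b : J) (f : K → I ⊕ J) (hf : LegsOff f (Sum.inl a) (Sum.inr b)) (hk : g + h = k)
    (he : c + d = e) (he' : c + d' = e') (hd : d + 1 = d') (hee : e + 1 = e') (l : K) (j : J)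
    (x : X g I c) (y : X h J d), f l = Sum.inr j →
    B l hee (glue a b f hf hk he x y) = sgn c • glue a b f hf hk he' x (B j hd y)
  /-- invariance under simultaneous rotation at the two ends of a contracted edge -/
  loop_B : ∀ {g k : ℕ} {I K : Type} [Finite I] [Finite K] {d e : ℤ} (a b : I) (f : K → I)
    (hab : a ≠ b) (hf : LegsOff f a b) (hk : g + 1 = k) (h : d + 1 = e) (x : X g I d),
    loop a b f hab hf hk (B a h x) = loop a b f hab hf hk (B b h x)
  glue_B : ∀ {g h k : ℕ} {I J K : Type} [Finite I] [Finite J] [Finite K] {c c' d d' e : ℤ}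
    (a : I) (b : J) (f : K → I ⊕ J) (hf : LegsOff f (Sum.inl a) (Sum.inr b)) (hk : g + h = k)
    (he : c' + d = e) (he' : c + d' = e) (hc : c + 1 = c') (hd : d + 1 = d')
    (x : X g I c) (y : X h J d),
    glue a b f hf hk he (B a hc x) y = sgn c • glue a b f hf hk he' x (B b hd y)
  /-- two loops at one vertex -/
  loop_loop : ∀ {g k k' : ℕ} {I K L M : Type} [Finite I] [Finite K] [Finite L] [Finite M] {d : ℤ}
    (a b : I) (a' b' : L) (c d' : K) (f : K → I) (h : L → I) (f' : M → K) (h' : M → L)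
    (hab : a ≠ b) (hab' : a' ≠ b') (hcd : c ≠ d') (hcd' : f c ≠ f d')
    (hf : LegsOff f a b) (hh : LegsOff h (f c) (f d')) (hf' : LegsOff f' c d')
    (hh' : LegsOff h' a' b') (hk : g + 1 = k) (hk' : k + 1 = k') (x : X g I d),
    h a' = a → h b' = b → (∀ m, f (f' m) = h (h' m)) →
    loop c d' f' hcd hf' hk' (loop a b f hab hf hk x) =
      loop a' b' h' hab' hh' hk' (loop (f c) (f d') h hcd' hh hk x)
  /-- a loop at one of the two vertices that are glued -/
  loop_glue_left : ∀ {g g' h k k' : ℕ} {I J K L M : Type} [Finite I] [Finite J] [Finite K]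
    [Finite L] [Finite M] {c d e : ℤ} (p q : I) (a' : L) (b : J) (p' q' : K) (f : L → I)
    (h₁ : M → L ⊕ J) (f' : K → I ⊕ J) (h' : M → K) (hpq : p ≠ q) (hpq' : p' ≠ q')
    (hf : LegsOff f p q) (hh₁ : LegsOff h₁ (Sum.inl a') (Sum.inr b))
    (hf' : LegsOff f' (Sum.inl (f a')) (Sum.inr b)) (hh' : LegsOff h' p' q') (hg : g + 1 = g')
    (hk : g + h = k) (hk' : k + 1 = k') (hk'' : g' + h = k') (he : c + d = e)
    (x : X g I c) (y : X h J d),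
    f' p' = Sum.inl p → f' q' = Sum.inl q → (∀ m, f' (h' m) = Sum.map f id (h₁ m)) →
    glue a' b h₁ hh₁ hk'' he (loop p q f hpq hf hg x) y =
      loop p' q' h' hpq' hh' hk' (glue (f a') b f' hf' hk he x y)
  /-- two edges joining the same two vertices -/
  loop_glue_cross : ∀ {g h k k' : ℕ} {I J K L M : Type} [Finite I] [Finite J] [Finite K]
    [Finite L] [Finite M] {c d e : ℤ} (a p : I) (b q : J) (p₁ q₁ : K) (a₁ b₁ : L)
    (f : K → I ⊕ J) (f' : L → I ⊕ J) (h₁ : M → K) (h₂ : M → L) (hpq : p₁ ≠ q₁) (hab : a₁ ≠ b₁)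
    (hf : LegsOff f (Sum.inl a) (Sum.inr b)) (hf' : LegsOff f' (Sum.inl p) (Sum.inr q))
    (hh₁ : LegsOff h₁ p₁ q₁) (hh₂ : LegsOff h₂ a₁ b₁) (hk : g + h = k) (hk' : k + 1 = k')
    (he : c + d = e) (x : X g I c) (y : X h J d),
    f p₁ = Sum.inl p → f q₁ = Sum.inr q → f' a₁ = Sum.inl a → f' b₁ = Sum.inr b →
    (∀ m, f (h₁ m) = f' (h₂ m)) →
    loop p₁ q₁ h₁ hpq hh₁ hk' (glue a b f hf hk he x y) =
      loop a₁ b₁ h₂ hab hh₂ hk' (glue p q f' hf' hk he x y)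
  /-- a chain of three vertices -/
  glue_assoc : ∀ {g₁ g₂ g₃ g₁₂ g₂₃ g : ℕ} {I J K A C N : Type} [Finite I] [Finite J] [Finite K]
    [Finite A] [Finite C] [Finite N] {d₁ d₂ d₃ d₁₂ d₂₃ d : ℤ} (i : I) (j j' : J) (k : K)
    (p : A) (q : C) (f : A → I ⊕ J) (f' : C → J ⊕ K) (h : N → A ⊕ K) (h' : N → I ⊕ C)
    (hf : LegsOff f (Sum.inl i) (Sum.inr j)) (hf' : LegsOff f' (Sum.inl j') (Sum.inr k))
    (hh : LegsOff h (Sum.inl p) (Sum.inr k)) (hh' : LegsOff h' (Sum.inl i) (Sum.inr q))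
    (h₁₂ : g₁ + g₂ = g₁₂) (h₂₃ : g₂ + g₃ = g₂₃) (hg : g₁₂ + g₃ = g) (hg' : g₁ + g₂₃ = g)
    (e₁₂ : d₁ + d₂ = d₁₂) (e₂₃ : d₂ + d₃ = d₂₃) (he : d₁₂ + d₃ = d) (he' : d₁ + d₂₃ = d)
    (x : X g₁ I d₁) (y : X g₂ J d₂) (z : X g₃ K d₃),
    f p = Sum.inr j' → f' q = Sum.inl j →
    (∀ n, Equiv.sumAssoc I J K (Sum.map f id (h n)) = Sum.map id f' (h' n)) →
    glue p k h hh hg he (glue i j f hf h₁₂ e₁₂ x y) z =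
      glue i q h' hh' hg' he' x (glue j' k f' hf' h₂₃ e₂₃ y z)

attribute [instance] S1FramedModularOperad.addCommGroup S1FramedModularOperad.module

section Graphs

variable {P : S1FramedModularOperad.{u}}

/-! ## Decorated graphs -/

/-- A graph `G` with a decoration `x_v · ∏ u_h^{-pow h}` of every vertex `v` by a monomial of
`P(genus v, leg v)[u_h⁻¹ : h ∈ leg v]`, where `x_v = dec v` is homogeneous of degree `deg v`, and
of every edge by its degree two symbol `D_e` (which needs no data).  Half-edges are the pairs
`⟨v, l⟩` with `l` a leg of `v`; `Adj` joins the two halves of an edge, and half-edges that are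
joined to nothing are the leaves.  The order on the vertices is the order of the tensor factors
`x_v`; it is used only for Koszul signs. -/
structure DecGraph (P : S1FramedModularOperad.{u}) where
  V : Type
  [finite : Finite V]
  [order : LinearOrder V]
  leg : V → Type
  [finite_leg : ∀ v, Finite (leg v)]
  Adj : (Σ v, leg v) → (Σ v, leg v) → Prop
  symm : ∀ {h k}, Adj h k → Adj k h
  irrefl : ∀ {h}, ¬ Adj h h
  unique : ∀ {h k l}, Adj h k → Adj h l → k = l
  genus : V → ℕ
  deg : V → ℤ
  dec : ∀ v, P.X (genus v) (leg v) (deg v)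
  pow : (Σ v, leg v) → ℕ

attribute [instance] DecGraph.finite DecGraph.order DecGraph.finite_leg

namespace DecGraph

/-- The half-edges. -/
abbrev Half (G : DecGraph P) : Type := Σ v, G.leg v

/-- The leaves. -/
abbrev Leaf (G : DecGraph P) : Type := {h : G.Half // ∀ k, ¬ G.Adj h k}

def leafCount (G : DecGraph P) : ℕ := Nat.card G.Leaf

/-- Twice the number of edges. -/
def edgeHalves (G : DecGraph P) : ℕ := Nat.card {h : G.Half // ∃ k, G.Adj h k}

def Connected (G : DecGraph P) : Prop :=
  Nonempty G.V ∧ ∀ v w : G.V,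
    Relation.ReflTransGen (fun v w => ∃ a b, G.Adj ⟨v, a⟩ ⟨w, b⟩) v w

/-- `∑ g(v) + dim H¹(G)` for a connected graph `G`, with `dim H¹(G) = |E| + 1 - |V|`. -/
def totalGenus (G : DecGraph P) : ℕ :=
  (∑ᶠ v, G.genus v) + (G.edgeHalves / 2 + 1 - Nat.card G.V)

/-- The homological degree of `D_G ⊗ ⨂_v x_v ∏ u_h^{-pow h}`, with `|D_e| = 2` and
`|u_h| = -2`. -/
def degree (G : DecGraph P) : ℤ :=
  (∑ᶠ v, G.deg v) + 2 * (∑ᶠ h, (G.pow h : ℤ)) + G.edgeHalves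

/-- `G` is a connected graph of genus `g` with `n` leaves, decorated in degree `e`. -/
def HasType (G : DecGraph P) (g n : ℕ) (e : ℤ) : Prop :=
  G.Connected ∧ G.totalGenus = g ∧ G.leafCount = n ∧ G.degree = e

open Classical in
/-- Replace the element of `P` at the vertex `v` by another one of the same degree. -/
def setDec (G : DecGraph P) (v : G.V) (x : P.X (G.genus v) (G.leg v) (G.deg v)) : DecGraph P :=
  { G with dec := Function.update G.dec v x }

/-- The decorated graph obtained from `G` by renaming vertices through `φ`, legs through `ψ`. -/
def relabel (G : DecGraph P) (W : Type) [Finite W] [LinearOrder W] (φ : W ≃ G.V) (l : W → Type)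
    [∀ w, Finite (l w)] (ψ : ∀ w, l w ≃ G.leg (φ w)) : DecGraph P where
  V := W
  leg := l
  Adj h k := G.Adj ⟨φ h.1, ψ h.1 h.2⟩ ⟨φ k.1, ψ k.1 k.2⟩
  symm := G.symm
  irrefl := G.irrefl
  unique {h k m} h₁ h₂ := by
    have e := G.unique h₁ h₂
    obtain ⟨k₁, k₂⟩ := k
    obtain ⟨m₁, m₂⟩ := m
    have e₁ : k₁ = m₁ := φ.injective (congrArg Sigma.fst e)
    subst e₁
    simp only [Sigma.mk.injEq, heq_eq_eq, true_and] at e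
    rw [(ψ k₁).injective e]
  genus w := G.genus (φ w)
  deg w := G.deg (φ w)
  dec w := P.map (ψ w).symm (G.dec (φ w))
  pow h := G.pow ⟨φ h.1, ψ h.1 h.2⟩

/-- The Koszul sign of the reordering `φ` of the tensor factors. -/
def relabelSign (G : DecGraph P) {W : Type} [LinearOrder W] (φ : W ≃ G.V) : ℚ :=
  sgn (∑ᶠ (p : W × W) (_ : p.1 < p.2 ∧ φ p.2 < φ p.1), G.deg (φ p.1) * G.deg (φ p.2))

/-- Remove the vertices in `S` from `G` and put a new first vertex in their place, decorated by
`y`, whose legs `L` are identified by `ι` with some half-edges at the removed vertices.  The other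
half-edges at the removed vertices disappear. -/
def replace (G : DecGraph P) (S : Set G.V) (L : Type) [Finite L] (γ : ℕ) (δ : ℤ)
    (y : P.X γ L δ) (ι : L → G.Half) (hι : Function.Injective ι) (hS : ∀ l, (ι l).1 ∈ S)
    (pow' : G.Half → ℕ) : DecGraph P :=
  let leg' : Option {v // v ∉ S} → Type := fun
    | none => L
    | some v => G.leg v.1
  let old : (Σ v, leg' v) → G.Half := fun
    | ⟨none, l⟩ => ι l
    | ⟨some v, l⟩ => ⟨v.1, l⟩
  have old_inj : Function.Injective old := by
    rintro ⟨_ | v, l⟩ ⟨_ | w, m⟩ h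
    · exact congrArg (Sigma.mk (β := leg') none) (hι h)
    · have e : (ι l).1 = w.1 := congrArg Sigma.fst h
      exact absurd (e ▸ hS l) w.2
    · have e : v.1 = (ι m).1 := congrArg Sigma.fst h
      exact absurd (e ▸ hS m) v.2
    · obtain ⟨v, hv⟩ := v
      obtain ⟨w, hw⟩ := w
      have e : v = w := congrArg Sigma.fst h
      subst e
      simp only [old, Sigma.mk.injEq, heq_eq_eq, true_and] at h
      subst h
      rfl
  { V := Option {v // v ∉ S}
    order := inferInstanceAs (LinearOrder (WithBot {v // v ∉ S}))
    leg := leg'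
    finite_leg := fun
      | none => inferInstanceAs (Finite L)
      | some v => inferInstanceAs (Finite (G.leg v.1))
    Adj := fun h k => G.Adj (old h) (old k)
    symm := G.symm
    irrefl := G.irrefl
    unique := fun h₁ h₂ => old_inj (G.unique h₁ h₂)
    genus := fun
      | none => γ
      | some v => G.genus v.1
    deg := fun
      | none => δ
      | some v => G.deg v.1
    dec := fun
      | none => y
      | some v => G.dec v.1
    pow := fun h => pow' (old h) }

/-- The sign of moving the factor `x_i` to the front. -/
def frontSign (G : DecGraph P) (i : G.V) : ℚ :=
  sgn (∑ᶠ (v) (_ : v < i), G.deg i * G.deg v)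

open Classical in
/-- The sign of moving the factors `x_i`, `x_j` (`i ≠ j`) to the front, in this order. -/
def frontSign₂ (G : DecGraph P) (i j : G.V) : ℚ :=
  sgn ((∑ᶠ (v) (_ : v < i ∧ v ≠ j), G.deg i * G.deg v) +
    (∑ᶠ (v) (_ : v < j ∧ v ≠ i), G.deg j * G.deg v) +
    (if j < i then G.deg i * G.deg j else 0))

/-- `x_i` is moved to the front and replaced by `y`; the exponents of the `u_h` become `pow'`. -/
def actAt (G : DecGraph P) (i : G.V) (δ : ℤ) (y : P.X (G.genus i) (G.leg i) δ)
    (pow' : G.Half → ℕ) : DecGraph P :=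
  G.replace {i} (G.leg i) (G.genus i) δ y (fun l => ⟨i, l⟩) sigma_mk_injective (fun _ => rfl) pow'

theorem legsOff_val {I : Type} (a b : I) :
    LegsOff (Subtype.val : {c : I // c ≠ a ∧ c ≠ b} → I) a b :=
  ⟨Subtype.val_injective, fun c => ⟨fun ⟨k, hk⟩ => hk ▸ k.2, fun h => ⟨⟨c, h⟩, rfl⟩⟩⟩

/-- The twisted self-sewing of the legs `a`, `b` of the vertex `i`: `x_i` is moved to the front
and replaced by the contraction of `B_a x_i`. -/
def sewLoop (G : DecGraph P) (i : G.V) (a b : G.leg i) (hab : a ≠ b) : DecGraph P :=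
  G.replace {i} {c : G.leg i // c ≠ a ∧ c ≠ b} (G.genus i + 1) (G.deg i + 1)
    (P.loop a b Subtype.val hab (legsOff_val a b) rfl (P.B a rfl (G.dec i)))
    (fun c => ⟨i, c.1⟩) (sigma_mk_injective.comp Subtype.val_injective) (fun _ => rfl) G.pow

/-- The twisted sewing of the leg `a` of the vertex `i` with the leg `b` of the vertex `j`: `x_i`
and `x_j` are moved to the front and replaced by the contraction of `B_a x_i ⊗ x_j`. -/
def sewEdge (G : DecGraph P) (i j : G.V) (hij : i ≠ j) (a : G.leg i) (b : G.leg j) : DecGraph P :=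
  G.replace {i, j} {c : G.leg i ⊕ G.leg j // c ≠ Sum.inl a ∧ c ≠ Sum.inr b}
    (G.genus i + G.genus j) (G.deg i + 1 + G.deg j)
    (P.glue a b Subtype.val (legsOff_val _ _) rfl rfl (P.B a rfl (G.dec i)) (G.dec j))
    (fun c => Sum.elim (Sigma.mk i) (Sigma.mk j) c.1)
    (by
      refine Function.Injective.comp ?_ Subtype.val_injective
      refine Function.Injective.sumElim sigma_mk_injective sigma_mk_injective ?_
      intro c d h
      exact hij (congrArg Sigma.fst h))
    (by rintro ⟨c | c, _⟩ <;> simp)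
    G.pow

/-- Disjoint union, with the vertices of `G 0` first, then those of `G 1`, and so on. -/
def disjUnion {m : ℕ} (G : Fin m → DecGraph P) : DecGraph P where
  V := Σₗ j, (G j).V
  finite := inferInstanceAs (Finite (Σ j, (G j).V))
  leg v := (G v.1).leg v.2
  Adj h k := ∃ e : h.1.1 = k.1.1, (G k.1.1).Adj (e ▸ ⟨h.1.2, h.2⟩) ⟨k.1.2, k.2⟩
  symm := by
    rintro ⟨⟨i, v⟩, a⟩ ⟨⟨j, w⟩, b⟩ ⟨e, h⟩
    obtain rfl : i = j := e
    exact ⟨rfl, (G i).symm h⟩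
  irrefl := by
    rintro ⟨⟨i, v⟩, a⟩ ⟨_, h⟩
    exact (G i).irrefl h
  unique := by
    rintro ⟨⟨i, v⟩, a⟩ ⟨⟨j, w⟩, b⟩ ⟨⟨j', w'⟩, b'⟩ ⟨e, h⟩ ⟨e', h'⟩
    obtain rfl : i = j := e
    obtain rfl : i = j' := e'
    exact congrArg (fun h : (G i).Half => (⟨⟨i, h.1⟩, h.2⟩ : Σ v : Σ j, (G j).V, (G v.1).leg v.2))
      ((G i).unique h h')
  genus v := (G v.1).genus v.2
  deg v := (G v.1).deg v.2
  dec v := (G v.1).dec v.2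
  pow h := (G h.1.1).pow ⟨h.1.2, h.2⟩

/-- A leaf of a disjoint union is a leaf of one of the graphs. -/
def leafPart {m : ℕ} (G : Fin m → DecGraph P) (h : (disjUnion G).Leaf) : Σ j, (G j).Leaf :=
  ⟨h.1.1.1, ⟨⟨h.1.1.2, h.1.2⟩, fun k hk => h.2 ⟨⟨h.1.1.1, k.1⟩, k.2⟩ ⟨rfl, hk⟩⟩⟩

theorem leafPart_injective {m : ℕ} (G : Fin m → DecGraph P) :
    Function.Injective (leafPart G) := by
  rintro ⟨⟨⟨i, v⟩, a⟩, h⟩ ⟨⟨⟨j, w⟩, b⟩, k⟩ e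
  obtain rfl : i = j := congrArg Sigma.fst e
  simp only [leafPart, Sigma.mk.injEq, heq_eq_eq, true_and, Subtype.mk.injEq] at e
  obtain ⟨rfl, rfl⟩ := e
  rfl

end DecGraph

/-! ## Marked graphs and graph insertion -/

/-- A labelled graph with `m` vertices marked by `0, …, m - 1`, where the half-edges at the vertex
`j` are numbered by `Fin (n j)`.  Every marked graph with valencies `n j` is isomorphic to one of
this form.  (The genus labels play no role here: they are those of the elements inserted.) -/
structure MarkedGraph {m : ℕ} (n : Fin m → ℕ) where
  Adj : (Σ j, Fin (n j)) → (Σ j, Fin (n j)) → Prop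
  symm : ∀ {a b}, Adj a b → Adj b a
  irrefl : ∀ {a}, ¬ Adj a a
  unique : ∀ {a b c}, Adj a b → Adj a c → b = c

namespace MarkedGraph

variable {m : ℕ} {n : Fin m → ℕ}

/-- An isomorphism of marked graphs: bijections of the half-edges at every vertex that respect the
edges. -/
def Iso (A A' : MarkedGraph n) : Type :=
  {σ : ∀ j, Equiv.Perm (Fin (n j)) //
    ∀ a b, A.Adj a b ↔ A'.Adj ⟨a.1, σ a.1 a.2⟩ ⟨b.1, σ b.1 b.2⟩}

/-- Isomorphism classes of marked graphs. -/
instance isoSetoid (n : Fin m → ℕ) : Setoid (MarkedGraph n) where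
  r A A' := Nonempty (Iso A A')
  iseqv :=
    { refl := fun A => ⟨⟨fun _ => Equiv.refl _, fun _ _ => Iff.rfl⟩⟩
      symm := by
        rintro A A' ⟨σ, h⟩
        refine ⟨⟨fun j => (σ j).symm, fun a b => ?_⟩⟩
        rw [h]
        simp
      trans := by
        rintro A A' A'' ⟨σ, h⟩ ⟨τ, h'⟩
        exact ⟨⟨fun j => (σ j).trans (τ j), fun a b => (h a b).trans (h' _ _)⟩⟩ }

/-- `|Aut(G, f)|` -/
def autCard (A : MarkedGraph n) : ℕ := Nat.card (Iso A A)

def Connected (A : MarkedGraph n) : Prop :=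
  0 < m ∧ ∀ i j : Fin m, Relation.ReflTransGen (fun i j => ∃ a b, A.Adj ⟨i, a⟩ ⟨j, b⟩) i j

/-- The number of edges. -/
def edgeCount (A : MarkedGraph n) : ℕ := Nat.card {a // ∃ b, A.Adj a b} / 2

/-- The graph obtained by inserting `G j` at the vertex `j` of `A`, its leaves being identified
with the half-edges at that vertex by `σ j`; the new edges are decorated by `D_e`. -/
def insert (A : MarkedGraph n) (G : Fin m → DecGraph P) (σ : ∀ j, (G j).Leaf ≃ Fin (n j)) :
    DecGraph P :=
  let U := DecGraph.disjUnion G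
  let pos : U.Leaf → Σ j, Fin (n j) := fun h =>
    ⟨(DecGraph.leafPart G h).1, σ _ (DecGraph.leafPart G h).2⟩
  have pos_inj : Function.Injective pos := by
    intro h k e
    refine DecGraph.leafPart_injective G ?_
    exact ((Equiv.sigmaCongrRight σ).injective e)
  { U with
    Adj := fun h k => U.Adj h k ∨ ∃ hl kl, A.Adj (pos ⟨h, hl⟩) (pos ⟨k, kl⟩)
    symm := by
      rintro h k (e | ⟨hl, kl, e⟩)
      · exact Or.inl (U.symm e)
      · exact Or.inr ⟨kl, hl, A.symm e⟩
    irrefl := by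
      rintro h (e | ⟨hl, kl, e⟩)
      · exact U.irrefl e
      · exact A.irrefl e
    unique := by
      rintro h k l (e | ⟨hl, kl, e⟩) (e' | ⟨hl', kl', e'⟩)
      · exact U.unique e e'
      · exact absurd e (hl' k)
      · exact absurd e' (hl l)
      · exact congrArg Subtype.val (pos_inj (A.unique e e')) }

end MarkedGraph

/-! ## The Feynman compactification -/

/-- The relations between decorated graphs: linearity in the decoration of every vertex, and
isomorphisms of graphs (which may permute the leaves) act with the Koszul sign. -/
def feynmanRelations (P : S1FramedModularOperad.{u}) (g n : ℕ) (e : ℤ) :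
    Submodule ℚ ({G : DecGraph P // G.HasType g n e} →₀ ℚ) :=
  Submodule.span ℚ
    ({r | ∃ (G : DecGraph P) (v : G.V) (x y : P.X (G.genus v) (G.leg v) (G.deg v))
        (h : (G.setDec v (x + y)).HasType g n e) (hx : (G.setDec v x).HasType g n e)
        (hy : (G.setDec v y).HasType g n e),
        r = Finsupp.single ⟨_, h⟩ 1 - Finsupp.single ⟨_, hx⟩ 1 - Finsupp.single ⟨_, hy⟩ 1} ∪
     {r | ∃ (G : DecGraph P) (v : G.V) (c : ℚ) (x : P.X (G.genus v) (G.leg v) (G.deg v))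
        (h : (G.setDec v (c • x)).HasType g n e) (hx : (G.setDec v x).HasType g n e),
        r = Finsupp.single ⟨_, h⟩ 1 - Finsupp.single ⟨_, hx⟩ c} ∪
     {r | ∃ (G : DecGraph P) (W : Type) (_ : Finite W) (_ : LinearOrder W) (φ : W ≃ G.V)
        (l : W → Type) (_ : ∀ w, Finite (l w)) (ψ : ∀ w, l w ≃ G.leg (φ w))
        (h : (G.relabel W φ l ψ).HasType g n e) (hG : G.HasType g n e),
        r = Finsupp.single ⟨_, h⟩ 1 - Finsupp.single ⟨_, hG⟩ (G.relabelSign φ)})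

/-- The degree `e` part of `FP(g, n)_{S_n}`, where
`FP(g, n) = ⨁_G (D(G) ⊗ ⨂_v P(g(v), leg v)_{S¹})_{Aut G}` over the isomorphism classes of stable
graphs of genus `g` with `n` numbered leaves.  The sum of coinvariants is the colimit over the
groupoid of such graphs; passing to `S_n`-coinvariants drops the numbering of the leaves.  Graphs
with an unstable vertex give zero, since `P` vanishes there. -/
abbrev Feynman (P : S1FramedModularOperad.{u}) (g n : ℕ) (e : ℤ) : Type (max 1 u) :=
  ({G : DecGraph P // G.HasType g n e} →₀ ℚ) ⧸ feynmanRelations P g n e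

/-- The degree `e` part of `⨁_{(g, n)} FP(g, n)_{S_n}`. -/
def FeynmanTotal (P : S1FramedModularOperad.{u}) (e : ℤ) : Type (max 1 u) :=
  ⨁ p : ℕ × ℕ, Feynman P p.1 p.2 e

instance (P : S1FramedModularOperad.{u}) (e : ℤ) : AddCommGroup (FeynmanTotal P e) :=
  inferInstanceAs (AddCommGroup (⨁ p : ℕ × ℕ, Feynman P p.1 p.2 e))

instance (P : S1FramedModularOperad.{u}) (e : ℤ) : Module ℚ (FeynmanTotal P e) :=
  inferInstanceAs (Module ℚ (⨁ p : ℕ × ℕ, Feynman P p.1 p.2 e))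

namespace DecGraph

open Classical in
/-- The class of a connected decorated graph of degree `e` (and zero for all other graphs). -/
def cls (e : ℤ) (G : DecGraph P) : FeynmanTotal P e :=
  if h : G.Connected ∧ G.degree = e then
    DirectSum.lof ℚ (ℕ × ℕ) (fun p => Feynman P p.1 p.2 e) (G.totalGenus, G.leafCount)
      (Submodule.Quotient.mk (Finsupp.single ⟨G, h.1, rfl, rfl, h.2⟩ 1))
  else 0

/-- The sum of the twisted sewings `ρ` over all ordered pairs of half-edges related by `R`.  The
twisted sewing of two half-edges vanishes unless the exponents of `u` at both are zero. -/
def twistedSewing (e : ℤ) (G : DecGraph P) (R : G.Half → G.Half → Prop) : FeynmanTotal P e :=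
  (∑ᶠ (i : G.V) (a : G.leg i) (b : G.leg i)
    (h : a ≠ b ∧ R ⟨i, a⟩ ⟨i, b⟩ ∧ G.pow ⟨i, a⟩ = 0 ∧ G.pow ⟨i, b⟩ = 0),
      G.frontSign i • cls e (G.sewLoop i a b h.1)) +
  ∑ᶠ (i : G.V) (j : G.V) (a : G.leg i) (b : G.leg j)
    (h : i ≠ j ∧ R ⟨i, a⟩ ⟨j, b⟩ ∧ G.pow ⟨i, a⟩ = 0 ∧ G.pow ⟨j, b⟩ = 0),
      G.frontSign₂ i j • cls e (G.sewEdge i j h.1 a b)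

open Classical in
/-- `(∂ + uB + δ) G`.  The third sum runs over the edges, each counted with both orders of its
half-edges. -/
def differential (e : ℤ) (G : DecGraph P) : FeynmanTotal P e :=
  (∑ᶠ i : G.V, G.frontSign i •
    cls e (G.actAt i (G.deg i - 1) (P.bd (sub_add_cancel _ 1) (G.dec i)) G.pow)) +
  (∑ᶠ (i : G.V) (a : G.leg i) (_ : G.pow ⟨i, a⟩ ≠ 0), G.frontSign i •
    cls e (G.actAt i (G.deg i + 1) (P.B a rfl (G.dec i))
      (Function.update G.pow ⟨i, a⟩ (G.pow ⟨i, a⟩ - 1)))) +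
  (1 / 2 : ℚ) • G.twistedSewing e G.Adj

/-- `Δ G`: twisted sewing of all unordered pairs of leaves. -/
def bv (e : ℤ) (G : DecGraph P) : FeynmanTotal P e :=
  (1 / 2 : ℚ) • G.twistedSewing e fun h k => (∀ l, ¬ G.Adj h l) ∧ (∀ l, ¬ G.Adj k l)

/-- `{G₁, G₂}`: twisted sewing of a leaf of `G₁` with a leaf of `G₂`. -/
def sewBracket (e : ℤ) (G₁ G₂ : DecGraph P) : FeynmanTotal P e :=
  (disjUnion ![G₁, G₂]).twistedSewing e fun h k =>
    h.1.1 = 0 ∧ k.1.1 = 1 ∧ (∀ l, ¬ (disjUnion ![G₁, G₂]).Adj h l) ∧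
      (∀ l, ¬ (disjUnion ![G₁, G₂]).Adj k l)

end DecGraph

/-- `𝒦_{(G, f)}(γ₁, …, γ_m)`: the sum over all identifications of the leaves of the `γ_j` with the
half-edges at the vertices. -/
def MarkedGraph.graphMap {m : ℕ} {n : Fin m → ℕ} (A : MarkedGraph n) (e : ℤ)
    (γ : Fin m → DecGraph P) : FeynmanTotal P e :=
  ∑ᶠ σ : ∀ j, (γ j).Leaf ≃ Fin (n j), (A.insert γ σ).cls e

/-- The sum of `𝒦_{(G, f)}(γ₁, …, γ_m) / |Aut(G, f)|` over the isomorphism classes of connected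
marked graphs `(G, f)` with first Betti number `b = |E| + 1 - m` whose valencies are the numbers of
leaves of the `γ_j`.  This is the coefficient of `ħ^b`, since `b = g - ∑ g(v_j)`. -/
def graphInsertion (b : ℕ) (e : ℤ) {m : ℕ} (γ : Fin m → DecGraph P) : FeynmanTotal P e :=
  ∑ᶠ (c : Quotient (MarkedGraph.isoSetoid fun j => (γ j).leafCount))
    (_ : c.out.Connected ∧ c.out.edgeCount + 1 = b + m),
      (1 / (c.out.autCard : ℚ)) • c.out.graphMap e γ

/-! ## From formulas on decorated graphs to linear maps -/

open Classical in
/-- The linear map on the degree `e` part with the values `f G` on connected decorated graphs, if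
there is one (it is then unique), and zero otherwise. -/
def linearExtension {M : Type*} [AddCommGroup M] [Module ℚ M] (e : ℤ) (f : DecGraph P → M) :
    FeynmanTotal P e →ₗ[ℚ] M :=
  if h : ∃ F : FeynmanTotal P e →ₗ[ℚ] M, ∀ G : DecGraph P,
    G.Connected → G.degree = e → F (G.cls e) = f G then h.choose else 0

open Classical in
/-- The multilinear map with the values `f G` on tuples of connected decorated graphs, if there is
one (it is then unique), and zero otherwise. -/
def multilinearExtension {M : Type*} [AddCommGroup M] [Module ℚ M] {m : ℕ} (e : Fin m → ℤ)
    (f : (Fin m → DecGraph P) → M) : MultilinearMap ℚ (fun j => FeynmanTotal P (e j)) M :=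
  if h : ∃ F : MultilinearMap ℚ (fun j => FeynmanTotal P (e j)) M, ∀ G : Fin m → DecGraph P,
    (∀ j, (G j).Connected ∧ (G j).degree = e j) → F (fun j => (G j).cls (e j)) = f G
  then h.choose else 0

end Graphs

/-! ## Differential graded Lie algebras and `L_∞`-morphisms -/

/-- The underlying data of a differential graded Lie algebra over `ℚ` (homological grading). -/
structure DGLieData where
  X : ℤ → Type w
  [addCommGroup : ∀ i, AddCommGroup (X i)]
  [module : ∀ i, Module ℚ (X i)]
  d : ∀ {i j : ℤ}, j + 1 = i → (X i →ₗ[ℚ] X j)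
  bracket : ∀ {i j k : ℤ}, i + j = k → (X i →ₗ[ℚ] X j →ₗ[ℚ] X k)

attribute [instance] DGLieData.addCommGroup DGLieData.module

/-- The axioms of a differential graded Lie algebra. -/
structure DGLieData.IsDGLA (L : DGLieData.{w}) : Prop where
  d_d : ∀ {i j k : ℤ} (h : j + 1 = i) (h' : k + 1 = j) (x : L.X i), L.d h' (L.d h x) = 0
  antisymm : ∀ {i j k : ℤ} (h : i + j = k) (h' : j + i = k) (x : L.X i) (y : L.X j),
    L.bracket h x y = -(sgn (i * j) • L.bracket h' y x)
  leibniz : ∀ {i i' j j' k k' : ℤ} (h : i + j = k) (h₁ : i' + j = k') (h₂ : i + j' = k')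
    (hi : i' + 1 = i) (hj : j' + 1 = j) (hk : k' + 1 = k) (x : L.X i) (y : L.X j),
    L.d hk (L.bracket h x y) = L.bracket h₁ (L.d hi x) y + sgn i • L.bracket h₂ x (L.d hj y)
  jacobi : ∀ {i j k ij jk ik n : ℤ} (hij : i + j = ij) (hjk : j + k = jk) (hik : i + k = ik)
    (h₁ : i + jk = n) (h₂ : ij + k = n) (h₃ : j + ik = n) (x : L.X i) (y : L.X j) (z : L.X k),
    L.bracket h₁ x (L.bracket hjk y z) =
      L.bracket h₂ (L.bracket hij x y) z + sgn (i * j) • L.bracket h₃ y (L.bracket hik x z)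

/-- A family of multilinear maps of degree zero `L[1]^m → L'[1]`; an element of degree `i` in `L`
has degree `i + 1` in `L[1]`. -/
abbrev LInftyMaps (L L' : DGLieData.{w}) : Type w :=
  ∀ (m : ℕ) (i : Fin m → ℤ) (k : ℤ), k + 1 = ∑ t, (i t + 1) →
    MultilinearMap ℚ (fun t => L.X (i t)) (L'.X k)

namespace LInftyMaps

variable {L L' : DGLieData.{w}} (K : LInftyMaps L L')

/-- Graded symmetry with respect to the degrees in `L[1]`. -/
def IsSymmetric : Prop :=
  ∀ (m : ℕ) (i : Fin m → ℤ) (k : ℤ) (h : k + 1 = ∑ t, (i t + 1)) (σ : Equiv.Perm (Fin m))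
    (h' : k + 1 = ∑ t, (i (σ t) + 1)) (x : ∀ t, L.X (i t)),
    K m (fun t => i (σ t)) k h' (fun t => x (σ t)) =
      sgn (∑ p : Fin m × Fin m with p.1 < p.2 ∧ σ p.2 < σ p.1,
        (i (σ p.1) + 1) * (i (σ p.2) + 1)) • K m i k h x

/-- `∑_t ± K(Q₁ x_t, x_1, …, x̂_t, …)`, where `Q₁ = d` on `L[1]`. -/
def insertDifferential {m : ℕ} (i : Fin (m + 1) → ℤ) (k : ℤ)
    (h : k + 2 = ∑ t, (i t + 1)) (x : ∀ t, L.X (i t)) : L'.X k :=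
  ∑ t, sgn (∑ s with s < t, (i t + 1) * (i s + 1)) •
    K (m + 1) (Fin.cons (i t - 1) fun s => i (t.succAbove s)) k
      (by
        rw [Fin.sum_univ_succAbove _ t] at h
        rw [Fin.sum_univ_succ]
        simp only [Fin.cons_zero, Fin.cons_succ]
        omega)
      (Fin.cons (α := fun s => L.X ((Fin.cons (i t - 1) fun s => i (t.succAbove s) :
        Fin (m + 1) → ℤ) s)) (L.d (sub_add_cancel (i t) 1) (x t)) fun s => x (t.succAbove s))

/-- `∑_{s < t} ± K(Q₂(x_s, x_t), x_1, …, x̂_s, …, x̂_t, …)`, where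
`Q₂(x, y) = (-1)^{|x|} [x, y]` on `L[1]`, `|x|` being the degree in `L[1]`.  It is written as half
the sum over all ordered pairs `(s, t)` of distinct indices, with `t = s.succAbove r`. -/
def insertBracket {m : ℕ} (i : Fin (m + 2) → ℤ) (k : ℤ)
    (h : k + 2 = ∑ t, (i t + 1)) (x : ∀ t, L.X (i t)) : L'.X k :=
  (1 / 2 : ℚ) • ∑ s : Fin (m + 2), ∑ r : Fin (m + 1),
    (sgn (∑ q with q < s, (i s + 1) * (i q + 1)) *
      sgn (∑ q with q < r, (i (s.succAbove r) + 1) * (i (s.succAbove q) + 1)) *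
      sgn (i s + 1)) •
    K (m + 1) (Fin.cons (i s + i (s.succAbove r)) fun q => i (s.succAbove (r.succAbove q))) k
      (by
        rw [Fin.sum_univ_succAbove _ s, Fin.sum_univ_succAbove _ r] at h
        rw [Fin.sum_univ_succ]
        simp only [Fin.cons_zero, Fin.cons_succ]
        omega)
      (Fin.cons (α := fun q => L.X ((Fin.cons (i s + i (s.succAbove r))
          fun q => i (s.succAbove (r.succAbove q)) : Fin (m + 1) → ℤ) q))
        (L.bracket rfl (x s) (x (s.succAbove r))) fun q => x (s.succAbove (r.succAbove q)))

/-- `K` applied to the subfamily `(x_t)_{t ∈ S}`, in increasing order. -/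
def onSubset {m : ℕ} (S : Finset (Fin m)) (i : Fin m → ℤ) (x : ∀ t, L.X (i t)) :
    L'.X (∑ t : Fin S.card, (i (S.orderEmbOfFin rfl t) + 1) - 1) :=
  K S.card (fun t => i (S.orderEmbOfFin rfl t)) _ (sub_add_cancel _ 1) fun t => x (S.orderEmbOfFin rfl t)

/-- `∑ ± Q₂(K(x_S), K(x_{Sᶜ}))` over the unordered partitions of the arguments into two nonempty
subsets `S` and `Sᶜ`, written as half the sum over the ordered ones. -/
def bracketSplit {m : ℕ} (i : Fin m → ℤ) (k : ℤ) (h : k + 2 = ∑ t, (i t + 1))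
    (x : ∀ t, L.X (i t)) : L'.X k :=
  (1 / 2 : ℚ) • ∑ S : {S : Finset (Fin m) // S.Nonempty ∧ Sᶜ.Nonempty},
    (sgn (∑ p : Fin m × Fin m with p.1 ∉ S.1 ∧ p.2 ∈ S.1 ∧ p.1 < p.2,
        (i p.1 + 1) * (i p.2 + 1)) * sgn (∑ t ∈ S.1, (i t + 1))) •
    L'.bracket
      (by
        have e : ∀ T : Finset (Fin m), ∑ t : Fin T.card, (i (T.orderEmbOfFin rfl t) + 1) =
            ∑ t ∈ T, (i t + 1) := fun T => by
          rw [← Finset.sum_coe_sort T]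
          exact (Fintype.sum_equiv (T.orderIsoOfFin rfl).toEquiv _ _ fun _ => rfl)
        rw [e, e]
        have := Finset.sum_add_sum_compl S.1 fun t => i t + 1
        omega)
      (K.onSubset S.1 i x) (K.onSubset S.1ᶜ i x)

/-- The equations of an `L_∞`-morphism from `L` to `L'`. -/
def IsLInftyMorphism : Prop :=
  K.IsSymmetric ∧
  (∀ (i : Fin 1 → ℤ) (k k' : ℤ) (h : k + 1 = ∑ t, (i t + 1)) (h' : k' + 2 = ∑ t, (i t + 1))
    (hk : k' + 1 = k) (x : ∀ t, L.X (i t)),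
    L'.d hk (K 1 i k h x) = K.insertDifferential i k' h' x) ∧
  ∀ (m : ℕ) (i : Fin (m + 2) → ℤ) (k k' : ℤ) (h : k + 1 = ∑ t, (i t + 1))
    (h' : k' + 2 = ∑ t, (i t + 1)) (hk : k' + 1 = k) (x : ∀ t, L.X (i t)),
    L'.d hk (K (m + 2) i k h x) + K.bracketSplit i k' h' x =
      K.insertDifferential i k' h' x + K.insertBracket i k' h' x

/-- The linear part `K₁ : L → L'`. -/
def linearPart (i : ℤ) (x : L.X i) : L'.X i :=
  K 1 (fun _ => i) i (by simp) fun _ => x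

/-- The linear part induces an isomorphism in homology. -/
def IsQuasiIso : Prop :=
  (∀ (i j k : ℤ) (h : j + 1 = i) (h' : i + 1 = k) (x : L.X i) (y : L'.X k), L.d h x = 0 →
    K.linearPart i x = L'.d h' y → ∃ z : L.X k, L.d h' z = x) ∧
  ∀ (i j k : ℤ) (h : j + 1 = i) (h' : i + 1 = k) (y : L'.X i), L'.d h y = 0 →
    ∃ (x : L.X i) (z : L'.X k), L.d h x = 0 ∧ y = K.linearPart i x + L'.d h' z

end LInftyMaps

/-! ## The compactified Sen-Zwiebach algebra -/

section SenZwiebach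

variable (P : S1FramedModularOperad.{u})

/-- `∂ + uB + δ` -/
def differential (e e' : ℤ) : FeynmanTotal P e →ₗ[ℚ] FeynmanTotal P e' :=
  linearExtension e fun G => G.differential e'

/-- `Δ` -/
def bv (e e' : ℤ) : FeynmanTotal P e →ₗ[ℚ] FeynmanTotal P e' :=
  linearExtension e fun G => G.bv e'

/-- `{-, -}` -/
def sewBracket (e₁ e₂ e' : ℤ) :
    FeynmanTotal P e₁ →ₗ[ℚ] FeynmanTotal P e₂ →ₗ[ℚ] FeynmanTotal P e' :=
  linearExtension e₁ fun G₁ : DecGraph P => linearExtension e₂ fun G₂ => G₁.sewBracket e' G₂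

/-- The coefficient of `ħ^b` in `∑ 𝒦_{(G, f)} / |Aut(G, f)|` on elements of degrees `e j`. -/
def graphInsertionMap (b : ℕ) {m : ℕ} (e : Fin m → ℤ) (e' : ℤ) :
    MultilinearMap ℚ (fun j => FeynmanTotal P (e j)) (FeynmanTotal P e') :=
  multilinearExtension e (graphInsertion b e')

/-- The operations are given by their formulas on decorated graphs, that is, the formulas are
compatible with the relations between decorated graphs. -/
def OperationsWellDefined : Prop :=
  (∀ (e e' : ℤ) (G : DecGraph P), G.Connected → G.degree = e →
    differential P e e' (G.cls e) = G.differential e') ∧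
  (∀ (e e' : ℤ) (G : DecGraph P), G.Connected → G.degree = e →
    bv P e e' (G.cls e) = G.bv e') ∧
  (∀ (e₁ e₂ e' : ℤ) (G₁ G₂ : DecGraph P), G₁.Connected → G₁.degree = e₁ → G₂.Connected →
    G₂.degree = e₂ → sewBracket P e₁ e₂ e' (G₁.cls e₁) (G₂.cls e₂) = G₁.sewBracket e' G₂) ∧
  ∀ (b m : ℕ) (e : Fin m → ℤ) (e' : ℤ) (G : Fin m → DecGraph P),
    (∀ j, (G j).Connected ∧ (G j).degree = e j) →
    graphInsertionMap P b e e' (fun j => (G j).cls (e j)) = graphInsertion b e' G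

/-- The degree `i` part of `(⨁_{(g, n)} FP(g, n)_{S_n}[1])[[ħ, λ]]`: the coefficient `x a b` of
`ħ^a λ^b` has degree `i - 1 + 2a + 2b` in `FP`, as `|ħ| = |λ| = -2` and the shift `[1]` raises
degrees by one. -/
abbrev GBar (i : ℤ) : Type (max 1 u) :=
  ∀ a b : ℕ, FeynmanTotal P (i - 1 + 2 * a + 2 * b)

variable {P} in
/-- The coefficient of `ħ^a λ^b`. -/
def GBar.coeff {i : ℤ} (a b : ℕ) : GBar P i →ₗ[ℚ] FeynmanTotal P (i - 1 + 2 * a + 2 * b) :=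
  LinearMap.proj b ∘ₗ LinearMap.proj a

/-- `∂ + uB + δ`, extended linearly in `ħ` and `λ`. -/
def GBar.diff (i j : ℤ) : GBar P i →ₗ[ℚ] GBar P j :=
  LinearMap.pi fun a => LinearMap.pi fun b => differential P _ _ ∘ₗ GBar.coeff a b

/-- `ħΔ` -/
def GBar.hbarBV (i j : ℤ) : GBar P i →ₗ[ℚ] GBar P j :=
  LinearMap.pi fun a => LinearMap.pi fun b =>
    match a with
    | 0 => 0
    | a' + 1 => bv P _ _ ∘ₗ GBar.coeff a' b

/-- The bracket, extended bilinearly in `ħ` and `λ`.  The bracket of `FP` is graded symmetric of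
degree one; the sign `(-1)^{|x|}`, with `|x|` the degree in `FP`, makes it a graded antisymmetric
bracket of degree zero after the shift `[1]`. -/
def GBar.bracket (i j k : ℤ) : GBar P i →ₗ[ℚ] GBar P j →ₗ[ℚ] GBar P k :=
  LinearMap.mk₂ ℚ
    (fun x y a b => ∑ p ∈ Finset.HasAntidiagonal.antidiagonal a, ∑ q ∈ Finset.HasAntidiagonal.antidiagonal b,
      sgn (i - 1) • sewBracket P _ _ _ (x p.1 q.1) (y p.2 q.2))
    (fun x x' y => by
      funext a b
      simp only [Pi.add_apply, map_add, LinearMap.add_apply, smul_add, Finset.sum_add_distrib])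
    (fun c x y => by
      funext a b
      simp only [Pi.smul_apply, map_smul, LinearMap.smul_apply, Finset.smul_sum, smul_comm c])
    (fun x y y' => by
      funext a b
      simp only [Pi.add_apply, map_add, smul_add, Finset.sum_add_distrib])
    (fun c x y => by
      funext a b
      simp only [Pi.smul_apply, map_smul, Finset.smul_sum, smul_comm c])

/-- The compactified Sen-Zwiebach algebra `(⨁ FP(g, n)_{S_n}[1])[[ħ, λ]]` with the differential
`∂ + uB + δ + ħΔ` and the bracket `{-, -}`. -/
def gBar : DGLieData.{max 1 u} where
  X := GBar P
  d _ := GBar.diff P _ _ + GBar.hbarBV P _ _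
  bracket _ := GBar.bracket P _ _ _

/-- The same graded vector space with the differential `∂ + uB + δ` and zero bracket. -/
def gBarTriv : DGLieData.{max 1 u} where
  X := GBar P
  d _ := GBar.diff P _ _
  bracket _ := 0

/-- The maps `𝒦_m = ∑ 𝒦_{(G, f)} / |Aut(G, f)|`, linear in `ħ` and `λ`: the coefficient of
`ħ^a λ^b` in `𝒦_m(x_1, …, x_m)` is the sum over `A 0 + A 1 + ⋯ + A m = a` and
`B 1 + ⋯ + B m = b` of the insertions of the coefficients of `ħ^{A j} λ^{B j}` in the `x_j` into the
marked graphs with first Betti number `A 0`. -/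
def graphInsertionMaps : LInftyMaps (gBar P) (gBarTriv P) := fun m i k _ =>
  MultilinearMap.pi fun a => MultilinearMap.pi fun b =>
    ∑ A ∈ Finset.Nat.antidiagonalTuple (m + 1) a, ∑ B ∈ Finset.Nat.antidiagonalTuple m b,
      (graphInsertionMap P (A 0) (fun t => i t - 1 + 2 * (A t.succ) + 2 * (B t))
        (k - 1 + 2 * a + 2 * b)).compLinearMap fun t => GBar.coeff (A t.succ) (B t)

end SenZwiebach

end

set_option linter.unusedSectionVars false

noncomputable section

/-! ## Signs -/

theorem sgn_zero : sgn 0 = 1 := by simp [sgn]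

theorem sgn_one : sgn 1 = -1 := by simp [sgn]

theorem sgn_add (a b : ℤ) : sgn (a + b) = sgn a * sgn b := by
  simp [sgn, zpow_add₀]

theorem sgn_neg (a : ℤ) : sgn (-a) = sgn a := by
  rcases Int.even_or_odd a with h | h
  · simp [sgn, h.neg_one_zpow]
  · simp [sgn, h.neg_one_zpow]

theorem sgn_sub (a b : ℤ) : sgn (a - b) = sgn a * sgn b := by
  rw [sub_eq_add_neg, sgn_add, sgn_neg]

theorem sgn_eq_or (a : ℤ) : sgn a = 1 ∨ sgn a = -1 := by
  rcases Int.even_or_odd a with h | h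
  · left; simp [sgn, h.neg_one_zpow]
  · right; simp [sgn, h.neg_one_zpow]

theorem sgn_mul_self (a : ℤ) : sgn a * sgn a = 1 := by
  rcases sgn_eq_or a with h | h <;> simp [h]

theorem sgn_two_mul (a : ℤ) : sgn (2 * a) = 1 := by
  rw [two_mul, sgn_add, sgn_mul_self]

theorem sgn_congr {a b : ℤ} (h : Even (a - b)) : sgn a = sgn b := by
  have e : a = b + (a - b) := by ring
  rw [e, sgn_add]
  obtain ⟨c, hc⟩ := h
  rw [hc, sgn_add, sgn_mul_self, mul_one]

/-! ## Corollas with labelled legs -/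

/-- A corolla whose legs are elements of `H`, decorated by an element of `P`. -/
structure Cor (P : S1FramedModularOperad.{u}) (H : Type) [Finite H] where
  legs : Set H
  genus : ℕ
  deg : ℤ
  dec : P.X genus legs deg

namespace Cor

variable {P : S1FramedModularOperad.{u}} {H : Type} [Finite H]

/-- The label of an element of a disjoint union of sets of labels. -/
abbrev lab {s t : Set H} : s ⊕ t → H := Sum.elim Subtype.val Subtype.val

theorem lab_injective {s t : Set H} (h : Disjoint s t) :
    Function.Injective (lab : s ⊕ t → H) := by
  refine Function.Injective.sumElim Subtype.val_injective Subtype.val_injective ?_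
  intro a b e
  exact Set.disjoint_left.1 h a.2 (e ▸ b.2)

/-- The label-preserving map from the legs of a sewn corolla to the legs of its parts. -/
def split (s t : Set H) (h k : H) (l : ((s ∪ t) \ {h, k} : Set H)) : s ⊕ t :=
  open Classical in if hl : l.1 ∈ s then Sum.inl ⟨l, hl⟩ else Sum.inr ⟨l, l.2.1.resolve_left hl⟩

theorem lab_split (s t : Set H) (h k : H) (l : ((s ∪ t) \ {h, k} : Set H)) :
    lab (split s t h k l) = l := by
  unfold split
  split_ifs <;> rfl

theorem legsOff_of_lab {s : Set H} {K : Set H} {h k : H} (hh : h ∈ s) (hk : k ∈ s)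
    (hK : K = s \ {h, k}) (f : K → s) (hf : ∀ l, (f l : H) = l) :
    LegsOff f ⟨h, hh⟩ ⟨k, hk⟩ := by
  subst hK
  refine ⟨fun a b e => Subtype.ext (by rw [← hf a, ← hf b, e]), fun c => ⟨?_, ?_⟩⟩
  · rintro ⟨l, rfl⟩
    have := l.2.2
    rw [← hf l] at this
    simp only [Set.mem_insert_iff, Set.mem_singleton_iff, not_or] at this
    exact ⟨fun e => this.1 (congrArg Subtype.val e), fun e => this.2 (congrArg Subtype.val e)⟩
  · rintro ⟨h₁, h₂⟩
    refine ⟨⟨c, c.2, ?_⟩, Subtype.ext (hf _)⟩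
    simp only [Set.mem_insert_iff, Set.mem_singleton_iff, not_or]
    exact ⟨fun e => h₁ (Subtype.ext e), fun e => h₂ (Subtype.ext e)⟩

theorem legsOff_of_lab_sum {s t : Set H} {K : Set H} {h k : H} (hd : Disjoint s t) (hh : h ∈ s)
    (hk : k ∈ t) (hK : K = (s ∪ t) \ {h, k}) (f : K → s ⊕ t) (hf : ∀ l, lab (f l) = l) :
    LegsOff f (Sum.inl ⟨h, hh⟩) (Sum.inr ⟨k, hk⟩) := by
  subst hK
  have inj := lab_injective hd
  refine ⟨fun a b e => Subtype.ext (by rw [← hf a, ← hf b, e]), fun c => ⟨?_, ?_⟩⟩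
  · rintro ⟨l, rfl⟩
    have := l.2.2
    rw [← hf l] at this
    simp only [Set.mem_insert_iff, Set.mem_singleton_iff, not_or] at this
    exact ⟨fun e => this.1 (by rw [e]; rfl), fun e => this.2 (by rw [e]; rfl)⟩
  · rintro ⟨h₁, h₂⟩
    have hc : lab c ∈ s ∪ t := by
      rcases c with c | c
      · exact Or.inl c.2
      · exact Or.inr c.2
    refine ⟨⟨lab c, hc, ?_⟩, inj (hf _)⟩
    simp only [Set.mem_insert_iff, Set.mem_singleton_iff, not_or]
    exact ⟨fun e => h₁ (inj e), fun e => h₂ (inj e)⟩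

open Classical in
/-- The circle action at the leg `h`; zero if `h` is not a leg. -/
def actMap (h : H) (g : ℕ) (s : Set H) (d : ℤ) : P.X g s d →ₗ[ℚ] P.X g s (d + 1) :=
  if hs : h ∈ s then P.B ⟨h, hs⟩ rfl else 0

open Classical in
/-- Contraction of a loop joining the legs `h` and `k`; zero if they are not distinct legs. -/
def loopMap (h k : H) (g : ℕ) (s : Set H) (d : ℤ) :
    P.X g s d →ₗ[ℚ] P.X (g + 1) (s \ {h, k} : Set H) d :=
  if hs : h ∈ s ∧ k ∈ s ∧ h ≠ k then
    P.loop ⟨h, hs.1⟩ ⟨k, hs.2.1⟩ (fun l => ⟨l, l.2.1⟩) (fun e => hs.2.2 (congrArg Subtype.val e))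
      (legsOff_of_lab hs.1 hs.2.1 rfl _ fun _ => rfl) rfl
  else 0

open Classical in
/-- Contraction of an edge joining the legs `h` and `k` of two corollas; zero if they are not legs
or if the sets of legs are not disjoint. -/
def glueMap (h k : H) (g g' : ℕ) (s t : Set H) (c d : ℤ) :
    P.X g s c →ₗ[ℚ] P.X g' t d →ₗ[ℚ] P.X (g + g') ((s ∪ t) \ {h, k} : Set H) (c + d) :=
  if hs : h ∈ s ∧ k ∈ t ∧ Disjoint s t then
    P.glue ⟨h, hs.1⟩ ⟨k, hs.2.1⟩ (split s t h k)
      (legsOff_of_lab_sum hs.2.2 hs.1 hs.2.1 rfl _ (lab_split s t h k)) rfl rfl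
  else 0

/-- The differential. -/
def bd (x : Cor P H) : Cor P H := ⟨x.legs, x.genus, x.deg - 1, P.bd (sub_add_cancel _ 1) x.dec⟩

/-- The circle action at the leg `h`. -/
def act (h : H) (x : Cor P H) : Cor P H := ⟨x.legs, x.genus, x.deg + 1, actMap h _ _ _ x.dec⟩

/-- Contraction of a loop. -/
def loop (h k : H) (x : Cor P H) : Cor P H :=
  ⟨x.legs \ {h, k}, x.genus + 1, x.deg, loopMap h k _ _ _ x.dec⟩

/-- Contraction of an edge. -/
def glue (h k : H) (x y : Cor P H) : Cor P H :=
  ⟨(x.legs ∪ y.legs) \ {h, k}, x.genus + y.genus, x.deg + y.deg,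
    glueMap h k _ _ _ _ _ _ x.dec y.dec⟩

/-- Multiplication of the decoration by a scalar. -/
def smul (c : ℚ) (x : Cor P H) : Cor P H := { x with dec := c • x.dec }

theorem act_of_mem {h : H} {x : Cor P H} (hx : h ∈ x.legs) {e : ℤ} (he : x.deg + 1 = e) :
    act h x = ⟨x.legs, x.genus, e, P.B ⟨h, hx⟩ he x.dec⟩ := by
  subst he
  simp only [act, actMap, dif_pos hx]

theorem act_of_notMem {h : H} {x : Cor P H} (hx : h ∉ x.legs) : (act h x).dec = 0 := by
  simp only [act, actMap, dif_neg hx, LinearMap.zero_apply]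
  rfl

theorem loop_eq {h k : H} {x : Cor P H} (hh : h ∈ x.legs) (hk : k ∈ x.legs) (hhk : h ≠ k)
    {K : Set H} {g : ℕ} (hK : K = x.legs \ {h, k}) (hg : x.genus + 1 = g) (f : K → x.legs)
    (hf : ∀ l, (f l : H) = l) (hne : (⟨h, hh⟩ : x.legs) ≠ ⟨k, hk⟩)
    (ho : LegsOff f ⟨h, hh⟩ ⟨k, hk⟩) :
    loop h k x = ⟨K, g, x.deg, P.loop ⟨h, hh⟩ ⟨k, hk⟩ f hne ho hg x.dec⟩ := by
  subst hK hg
  obtain rfl : f = fun l => ⟨l, l.2.1⟩ := funext fun l => Subtype.ext (hf l)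
  simp only [loop, loopMap, dif_pos (show h ∈ x.legs ∧ k ∈ x.legs ∧ h ≠ k from ⟨hh, hk, hhk⟩)]

theorem loop_dec_eq_zero {h k : H} {x : Cor P H} (hs : ¬ (h ∈ x.legs ∧ k ∈ x.legs ∧ h ≠ k)) :
    (loop h k x).dec = 0 := by
  simp only [loop, loopMap, dif_neg hs, LinearMap.zero_apply]
  rfl

theorem glue_eq {h k : H} {x y : Cor P H} (hh : h ∈ x.legs) (hk : k ∈ y.legs)
    (hd : Disjoint x.legs y.legs) {K : Set H} {g : ℕ} {e : ℤ}
    (hK : K = (x.legs ∪ y.legs) \ {h, k}) (hg : x.genus + y.genus = g) (he : x.deg + y.deg = e)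
    (f : K → x.legs ⊕ y.legs) (hf : ∀ l, lab (f l) = l)
    (ho : LegsOff f (Sum.inl ⟨h, hh⟩) (Sum.inr ⟨k, hk⟩)) :
    glue h k x y = ⟨K, g, e, P.glue ⟨h, hh⟩ ⟨k, hk⟩ f ho hg he x.dec y.dec⟩ := by
  subst hK hg he
  obtain rfl : f = split _ _ _ _ :=
    funext fun l => lab_injective hd ((hf l).trans (lab_split _ _ _ _ l).symm)
  simp only [glue, glueMap,
    dif_pos (show h ∈ x.legs ∧ k ∈ y.legs ∧ Disjoint x.legs y.legs from ⟨hh, hk, hd⟩)]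

theorem glue_dec_eq_zero {h k : H} {x y : Cor P H}
    (hs : ¬ (h ∈ x.legs ∧ k ∈ y.legs ∧ Disjoint x.legs y.legs)) : (glue h k x y).dec = 0 := by
  simp only [glue, glueMap, dif_neg hs, LinearMap.zero_apply]
  rfl

theorem eq_of_dec_eq_zero {x y : Cor P H} (hx : x.dec = 0) (hy : y.dec = 0)
    (hl : x.legs = y.legs) (hg : x.genus = y.genus) (hd : x.deg = y.deg) : x = y := by
  obtain ⟨s, g, d, x⟩ := x
  obtain ⟨s', g', d', y⟩ := y
  obtain rfl : s = s' := hl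
  obtain rfl : g = g' := hg
  obtain rfl : d = d' := hd
  obtain rfl : x = 0 := hx
  obtain rfl : y = 0 := hy
  rfl

/-! ### Contractions -/

theorem loop_symm (h k : H) (x : Cor P H) : loop k h x = loop h k x := by
  by_cases hs : h ∈ x.legs ∧ k ∈ x.legs ∧ h ≠ k
  · obtain ⟨hh, hk, hne⟩ := hs
    have hne' : (⟨h, hh⟩ : x.legs) ≠ ⟨k, hk⟩ := fun e => hne (congrArg Subtype.val e)
    rw [loop_eq hk hh hne.symm (K := x.legs \ {h, k}) (by rw [Set.pair_comm]) rfl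
        (fun l => ⟨l, l.2.1⟩) (fun _ => rfl) hne'.symm
        (legsOff_of_lab _ _ (by rw [Set.pair_comm]) _ fun _ => rfl),
      loop_eq hh hk hne rfl rfl (fun l => ⟨l, l.2.1⟩) (fun _ => rfl) hne'
        (legsOff_of_lab _ _ rfl _ fun _ => rfl), P.loop_symm]
  · refine eq_of_dec_eq_zero (loop_dec_eq_zero fun e => hs ⟨e.2.1, e.1, e.2.2.symm⟩)
      (loop_dec_eq_zero hs) ?_ rfl rfl
    simp only [loop, Set.pair_comm]

theorem glue_comm (h k : H) (x y : Cor P H) :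
    glue k h y x = smul (sgn (x.deg * y.deg)) (glue h k x y) := by
  by_cases hs : h ∈ x.legs ∧ k ∈ y.legs ∧ Disjoint x.legs y.legs
  · obtain ⟨hh, hk, hd⟩ := hs
    have hK : (x.legs ∪ y.legs) \ {h, k} = (y.legs ∪ x.legs) \ {k, h} := by
      rw [Set.pair_comm, Set.union_comm]
    have hf : ∀ l, lab ((split x.legs y.legs h k l).swap) = l := fun l => by
      conv_rhs => rw [← lab_split _ _ _ _ l]
      cases split x.legs y.legs h k l <;> rfl
    have ho := legsOff_of_lab_sum hd hh hk rfl _ (lab_split x.legs y.legs h k)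
    have ho' := legsOff_of_lab_sum hd.symm hk hh hK (fun l => (split x.legs y.legs h k l).swap) hf
    rw [glue_eq hk hh hd.symm hK (Nat.add_comm _ _) (add_comm _ _) _ hf ho',
      glue_eq hh hk hd rfl rfl rfl _ (lab_split x.legs y.legs h k) ho,
      P.glue_comm _ _ (split x.legs y.legs h k) _ ho ho' rfl (Nat.add_comm _ _) rfl (add_comm _ _)
        _ _ fun _ => rfl]
    rfl
  · refine eq_of_dec_eq_zero (glue_dec_eq_zero fun e => hs ⟨e.2.1, e.1, e.2.2.symm⟩) ?_ ?_
      (Nat.add_comm _ _) (add_comm _ _)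
    · simp only [smul, glue_dec_eq_zero hs, smul_zero]
      rfl
    · simp only [glue, smul, Set.pair_comm, Set.union_comm]

theorem loop_loop {h k h' k' : H} {x : Cor P H} (hh : h ∈ x.legs) (hk : k ∈ x.legs)
    (hh' : h' ∈ x.legs) (hk' : k' ∈ x.legs) (h₁ : h ≠ k) (h₂ : h' ≠ k') (h₃ : h ≠ h')
    (h₄ : h ≠ k') (h₅ : k ≠ h') (h₆ : k ≠ k') :
    loop h' k' (loop h k x) = loop h k (loop h' k' x) := by
  have n₁ : (⟨h, hh⟩ : x.legs) ≠ ⟨k, hk⟩ := fun e => h₁ (congrArg Subtype.val e)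
  have n₂ : (⟨h', hh'⟩ : x.legs) ≠ ⟨k', hk'⟩ := fun e => h₂ (congrArg Subtype.val e)
  have o₁ : LegsOff (fun l : (x.legs \ {h, k} : Set H) => (⟨l, l.2.1⟩ : x.legs)) ⟨h, hh⟩ ⟨k, hk⟩ :=
    legsOff_of_lab hh hk rfl _ fun _ => rfl
  have o₂ : LegsOff (fun l : (x.legs \ {h', k'} : Set H) => (⟨l, l.2.1⟩ : x.legs))
    ⟨h', hh'⟩ ⟨k', hk'⟩ := legsOff_of_lab hh' hk' rfl _ fun _ => rfl
  have m₁ : h' ∈ x.legs \ {h, k} := by simp [hh', h₃.symm, h₅.symm]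
  have m₂ : k' ∈ x.legs \ {h, k} := by simp [hk', h₄.symm, h₆.symm]
  have m₃ : h ∈ x.legs \ {h', k'} := by simp [hh, h₃, h₄]
  have m₄ : k ∈ x.legs \ {h', k'} := by simp [hk, h₅, h₆]
  have hK : (x.legs \ {h, k}) \ {h', k'} = (x.legs \ {h', k'}) \ {h, k} := by
    rw [Set.sdiff_sdiff_comm]
  have o₃ := legsOff_of_lab m₁ m₂ rfl (fun l => ⟨l, l.2.1⟩) fun _ => rfl
  have o₄ := legsOff_of_lab m₃ m₄ hK (fun l => ⟨l, hK.subset l.2 |>.1⟩) fun _ => rfl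
  rw [loop_eq hh hk h₁ rfl rfl _ (fun _ => rfl) n₁ o₁,
    loop_eq hh' hk' h₂ rfl rfl _ (fun _ => rfl) n₂ o₂,
    loop_eq (x := ⟨x.legs \ {h, k}, _, _, _⟩) m₁ m₂ h₂ rfl rfl _ (fun _ => rfl)
      (fun e => h₂ (congrArg Subtype.val e)) o₃,
    loop_eq (x := ⟨x.legs \ {h', k'}, _, _, _⟩) m₃ m₄ h₁ hK rfl _ (fun _ => rfl)
      (fun e => h₁ (congrArg Subtype.val e)) o₄]
  congr 1
  exact P.loop_loop (K := (x.legs \ {h, k} : Set H)) (L := (x.legs \ {h', k'} : Set H)) ⟨h, hh⟩ ⟨k, hk⟩ ⟨h, m₃⟩ ⟨k, m₄⟩ ⟨h', m₁⟩ ⟨k', m₂⟩ _ _ _ _ n₁ _ _ n₂ o₁ o₂ o₃ o₄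
    rfl rfl x.dec rfl rfl fun _ => rfl

theorem glue_loop {h k h' k' : H} {x y : Cor P H} (hh : h ∈ x.legs) (hk : k ∈ x.legs)
    (hh' : h' ∈ x.legs) (hk' : k' ∈ y.legs) (hd : Disjoint x.legs y.legs) (h₁ : h ≠ k)
    (h₃ : h ≠ h') (h₅ : k ≠ h') :
    glue h' k' (loop h k x) y = loop h k (glue h' k' x y) := by
  have h₄ : h ≠ k' := fun e => Set.disjoint_left.1 hd hh (e ▸ hk')
  have h₆ : k ≠ k' := fun e => Set.disjoint_left.1 hd hk (e ▸ hk')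
  have n₁ : (⟨h, hh⟩ : x.legs) ≠ ⟨k, hk⟩ := fun e => h₁ (congrArg Subtype.val e)
  have o₁ : LegsOff (fun l : (x.legs \ {h, k} : Set H) => (⟨l, l.2.1⟩ : x.legs)) ⟨h, hh⟩ ⟨k, hk⟩ :=
    legsOff_of_lab hh hk rfl _ fun _ => rfl
  have o₂ := legsOff_of_lab_sum hd hh' hk' rfl _ (lab_split x.legs y.legs h' k')
  have m₁ : h' ∈ x.legs \ {h, k} := by simp [hh', h₃.symm, h₅.symm]
  have m₃ : h ∈ (x.legs ∪ y.legs) \ {h', k'} := by simp [hh, h₃, h₄]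
  have m₄ : k ∈ (x.legs ∪ y.legs) \ {h', k'} := by simp [hk, h₅, h₆]
  have hd' : Disjoint (x.legs \ {h, k}) y.legs := hd.mono_left Set.sdiff_subset
  have hK : ((x.legs \ {h, k}) ∪ y.legs) \ {h', k'} = ((x.legs ∪ y.legs) \ {h', k'}) \ {h, k} := by
    ext l
    have a₁ : l ∈ y.legs → l ≠ h := fun hl e => Set.disjoint_left.1 hd hh (e ▸ hl)
    have a₂ : l ∈ y.legs → l ≠ k := fun hl e => Set.disjoint_left.1 hd hk (e ▸ hl)
    simp only [Set.mem_sdiff, Set.mem_union, Set.mem_insert_iff, Set.mem_singleton_iff]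
    tauto
  have o₃ := legsOff_of_lab_sum hd' m₁ hk' rfl _ (lab_split _ y.legs h' k')
  have o₄ := legsOff_of_lab m₃ m₄ hK (fun l => ⟨l, hK.subset l.2 |>.1⟩) fun _ => rfl
  rw [loop_eq hh hk h₁ rfl rfl _ (fun _ => rfl) n₁ o₁,
    glue_eq hh' hk' hd rfl rfl rfl _ (lab_split _ _ _ _) o₂,
    glue_eq (x := ⟨x.legs \ {h, k}, _, _, _⟩) m₁ hk' hd' rfl (Nat.add_right_comm _ _ _) rfl _
      (lab_split _ _ _ _) o₃,
    loop_eq (x := ⟨(x.legs ∪ y.legs) \ {h', k'}, _, _, _⟩) m₃ m₄ h₁ hK rfl _ (fun _ => rfl)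
      (fun e => h₁ (congrArg Subtype.val e)) o₄]
  congr 1
  refine P.loop_glue_left ⟨h, hh⟩ ⟨k, hk⟩ ⟨h', m₁⟩ ⟨k', hk'⟩ ⟨h, m₃⟩ ⟨k, m₄⟩ _ _ _ _ n₁ _ o₁ o₃ o₂
    o₄ rfl rfl rfl _ rfl x.dec y.dec (lab_injective hd (lab_split _ _ _ _ _))
    (lab_injective hd (lab_split _ _ _ _ _)) fun m => lab_injective hd ?_
  rw [lab_split]
  conv_lhs => rw [← lab_split _ _ _ _ m]
  cases split (x.legs \ {h, k}) y.legs h' k' m <;> rfl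

theorem loop_glue_cross {h k h' k' : H} {x y : Cor P H} (hh : h ∈ x.legs) (hk : k ∈ y.legs)
    (hh' : h' ∈ x.legs) (hk' : k' ∈ y.legs) (hd : Disjoint x.legs y.legs) (h₃ : h ≠ h')
    (h₆ : k ≠ k') :
    loop h' k' (glue h k x y) = loop h k (glue h' k' x y) := by
  have hne : ∀ {a b}, a ∈ x.legs → b ∈ y.legs → a ≠ b :=
    fun ha hb e => Set.disjoint_left.1 hd ha (e ▸ hb)
  have h₁ := hne hh hk
  have h₂ := hne hh' hk'
  have h₄ := hne hh hk'
  have h₅ := (hne hh' hk).symm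
  have o₁ := legsOff_of_lab_sum hd hh hk rfl _ (lab_split x.legs y.legs h k)
  have o₂ := legsOff_of_lab_sum hd hh' hk' rfl _ (lab_split x.legs y.legs h' k')
  have m₁ : h' ∈ (x.legs ∪ y.legs) \ {h, k} := by simp [hh', h₃.symm, h₅.symm]
  have m₂ : k' ∈ (x.legs ∪ y.legs) \ {h, k} := by simp [hk', h₄.symm, h₆.symm]
  have m₃ : h ∈ (x.legs ∪ y.legs) \ {h', k'} := by simp [hh, h₃, h₄]
  have m₄ : k ∈ (x.legs ∪ y.legs) \ {h', k'} := by simp [hk, h₅, h₆]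
  have hK : ((x.legs ∪ y.legs) \ {h, k}) \ {h', k'} = ((x.legs ∪ y.legs) \ {h', k'}) \ {h, k} := by
    rw [Set.sdiff_sdiff_comm]
  have o₃ := legsOff_of_lab m₁ m₂ rfl (fun l => ⟨l, l.2.1⟩) fun _ => rfl
  have o₄ := legsOff_of_lab m₃ m₄ hK (fun l => ⟨l, hK.subset l.2 |>.1⟩) fun _ => rfl
  rw [glue_eq hh hk hd rfl rfl rfl _ (lab_split _ _ _ _) o₁,
    glue_eq hh' hk' hd rfl rfl rfl _ (lab_split _ _ _ _) o₂,
    loop_eq (x := ⟨(x.legs ∪ y.legs) \ {h, k}, _, _, _⟩) m₁ m₂ h₂ rfl rfl _ (fun _ => rfl)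
      (fun e => h₂ (congrArg Subtype.val e)) o₃,
    loop_eq (x := ⟨(x.legs ∪ y.legs) \ {h', k'}, _, _, _⟩) m₃ m₄ h₁ hK rfl _ (fun _ => rfl)
      (fun e => h₁ (congrArg Subtype.val e)) o₄]
  congr 1
  refine P.loop_glue_cross ⟨h, hh⟩ ⟨h', hh'⟩ ⟨k, hk⟩ ⟨k', hk'⟩ ⟨h', m₁⟩ ⟨k', m₂⟩ ⟨h, m₃⟩ ⟨k, m₄⟩
    _ _ _ _ _ _ o₁ o₂ o₃ o₄ rfl rfl rfl x.dec y.dec ?_ ?_ ?_ ?_ fun m => ?_ <;>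
  refine lab_injective hd ?_ <;> simp only [lab_split] <;> rfl

theorem glue_assoc {h k h' k' : H} {x y z : Cor P H} (hh : h ∈ x.legs) (hk : k ∈ y.legs)
    (hh' : h' ∈ y.legs) (hk' : k' ∈ z.legs) (hxy : Disjoint x.legs y.legs)
    (hxz : Disjoint x.legs z.legs) (hyz : Disjoint y.legs z.legs) (h₅ : k ≠ h') :
    glue h' k' (glue h k x y) z = glue h k x (glue h' k' y z) := by
  have o₁ := legsOff_of_lab_sum hxy hh hk rfl _ (lab_split x.legs y.legs h k)
  have o₂ := legsOff_of_lab_sum hyz hh' hk' rfl _ (lab_split y.legs z.legs h' k')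
  have m₁ : h' ∈ (x.legs ∪ y.legs) \ {h, k} := by
    have : h' ≠ h := fun e => Set.disjoint_left.1 hxy hh (e ▸ hh')
    simp [hh', h₅.symm, this]
  have m₂ : k ∈ (y.legs ∪ z.legs) \ {h', k'} := by
    have : k ≠ k' := fun e => Set.disjoint_left.1 hyz hk (e ▸ hk')
    simp [hk, h₅, this]
  have d₁ : Disjoint ((x.legs ∪ y.legs) \ {h, k}) z.legs :=
    (hxz.union_left hyz).mono_left Set.sdiff_subset
  have d₂ : Disjoint x.legs ((y.legs ∪ z.legs) \ {h', k'}) :=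
    (hxy.union_right hxz).mono_right Set.sdiff_subset
  have hK : ((x.legs ∪ y.legs) \ {h, k} ∪ z.legs) \ {h', k'} =
      (x.legs ∪ (y.legs ∪ z.legs) \ {h', k'}) \ {h, k} := by
    ext l
    have a₁ : l ∈ z.legs → l ≠ h := fun hl e => Set.disjoint_left.1 hxz hh (e ▸ hl)
    have a₂ : l ∈ z.legs → l ≠ k := fun hl e => Set.disjoint_left.1 hyz hk (e ▸ hl)
    have a₃ : l ∈ x.legs → l ≠ h' := fun hl e => Set.disjoint_left.1 hxy hl (e ▸ hh')
    have a₄ : l ∈ x.legs → l ≠ k' := fun hl e => Set.disjoint_left.1 hxz hl (e ▸ hk')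
    simp only [Set.mem_sdiff, Set.mem_union, Set.mem_insert_iff, Set.mem_singleton_iff]
    tauto
  let r : (((x.legs ∪ y.legs) \ {h, k} ∪ z.legs) \ {h', k'} : Set H) →
      x.legs ⊕ ((y.legs ∪ z.legs) \ {h', k'} : Set H) := fun l => split _ _ h k ⟨l, hK.subset l.2⟩
  have hr : ∀ l, lab (r l) = l := fun l => lab_split _ _ _ _ _
  have o₃ := legsOff_of_lab_sum d₁ m₁ hk' rfl _ (lab_split _ z.legs h' k')
  have o₄ := legsOff_of_lab_sum d₂ hh m₂ hK r hr
  rw [glue_eq hh hk hxy rfl rfl rfl _ (lab_split _ _ _ _) o₁,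
    glue_eq hh' hk' hyz rfl rfl rfl _ (lab_split _ _ _ _) o₂,
    glue_eq (x := ⟨(x.legs ∪ y.legs) \ {h, k}, _, _, _⟩) m₁ hk' d₁ rfl rfl rfl _
      (lab_split _ _ _ _) o₃,
    glue_eq (y := ⟨(y.legs ∪ z.legs) \ {h', k'}, _, _, _⟩) hh m₂ d₂ hK (Nat.add_assoc _ _ _).symm
      (add_assoc _ _ _).symm r hr o₄]
  congr 1
  refine P.glue_assoc ⟨h, hh⟩ ⟨k, hk⟩ ⟨h', hh'⟩ ⟨k', hk'⟩ ⟨h', m₁⟩ ⟨k, m₂⟩ _ _ _ _ o₁ o₂ o₃ o₄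
    rfl rfl rfl _ rfl rfl rfl _ x.dec y.dec z.dec (lab_injective hxy (lab_split _ _ _ _ _))
    (lab_injective hyz (lab_split _ _ _ _ _)) fun n => ?_
  have inj : Function.Injective
      (Sum.elim Subtype.val (Sum.elim Subtype.val Subtype.val) : x.legs ⊕ (y.legs ⊕ z.legs) → H) := by
    refine Function.Injective.sumElim Subtype.val_injective (lab_injective hyz) ?_
    rintro a (b | b) e
    · exact Set.disjoint_left.1 hxy a.2 (e ▸ b.2)
    · exact Set.disjoint_left.1 hxz a.2 (e ▸ b.2)
  refine inj ?_
  trans (n : H)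
  · conv_rhs => rw [← lab_split _ _ _ _ n]
    rcases split ((x.legs ∪ y.legs) \ {h, k}) z.legs h' k' n with a | a
    · have := lab_split _ _ _ _ a
      simp only [Sum.map_inl]
      rcases hs : split x.legs y.legs h k a with b | b <;> rw [hs] at this <;> exact this
    · rfl
  · conv_lhs => rw [← hr n]
    rcases r n with a | a
    · rfl
    · exact (lab_split _ _ _ _ a).symm

end Cor

end

noncomputable section

namespace Cor

variable {P : S1FramedModularOperad.{u}} {H : Type} [Finite H]

/-! ### Compatibility of the circle actions and the differential with contractions -/

theorem bd_loop (h k : H) (x : Cor P H) : bd (loop h k x) = loop h k (bd x) := by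
  by_cases hs : h ∈ x.legs ∧ k ∈ x.legs ∧ h ≠ k
  · obtain ⟨hh, hk, hne⟩ := hs
    have hne' : (⟨h, hh⟩ : x.legs) ≠ ⟨k, hk⟩ := fun e => hne (congrArg Subtype.val e)
    have ho := legsOff_of_lab hh hk rfl (fun l => ⟨l, l.2.1⟩) fun _ => rfl
    rw [loop_eq hh hk hne rfl rfl _ (fun _ => rfl) hne' ho,
      loop_eq (x := bd x) hh hk hne rfl rfl _ (fun _ => rfl) hne' ho]
    simp only [bd, P.bd_loop]
    rfl
  · refine eq_of_dec_eq_zero ?_ (loop_dec_eq_zero (x := bd x) hs) rfl rfl rfl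
    simp only [bd, loop_dec_eq_zero hs, map_zero]
    rfl

theorem act_loop {h k l : H} (hl : l ≠ h) (hl' : l ≠ k) (x : Cor P H) :
    act l (loop h k x) = loop h k (act l x) := by
  by_cases hs : h ∈ x.legs ∧ k ∈ x.legs ∧ h ≠ k
  · obtain ⟨hh, hk, hne⟩ := hs
    have hne' : (⟨h, hh⟩ : x.legs) ≠ ⟨k, hk⟩ := fun e => hne (congrArg Subtype.val e)
    have ho := legsOff_of_lab hh hk rfl (fun l => ⟨l, l.2.1⟩) fun _ => rfl
    by_cases hx : l ∈ x.legs
    · have hx' : l ∈ x.legs \ {h, k} := by simp [hx, hl, hl']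
      rw [loop_eq hh hk hne rfl rfl _ (fun _ => rfl) hne' ho,
        act_of_mem (x := ⟨x.legs \ {h, k}, x.genus + 1, x.deg, _⟩) hx' rfl, act_of_mem hx rfl,
        loop_eq (x := ⟨x.legs, x.genus, x.deg + 1, _⟩) hh hk hne rfl rfl _ (fun _ => rfl) hne' ho,
        P.B_loop]
    · refine eq_of_dec_eq_zero (act_of_notMem fun e => hx e.1) ?_ rfl rfl rfl
      simp only [loop, act_of_notMem hx, map_zero]
      rfl
  · refine eq_of_dec_eq_zero ?_ (loop_dec_eq_zero (x := act l x) hs) rfl rfl rfl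
    simp only [act, loop_dec_eq_zero hs, map_zero]
    rfl

theorem loop_act (h k : H) (x : Cor P H) : loop h k (act h x) = loop h k (act k x) := by
  by_cases hs : h ∈ x.legs ∧ k ∈ x.legs ∧ h ≠ k
  · obtain ⟨hh, hk, hne⟩ := hs
    have hne' : (⟨h, hh⟩ : x.legs) ≠ ⟨k, hk⟩ := fun e => hne (congrArg Subtype.val e)
    have ho := legsOff_of_lab hh hk rfl (fun l => ⟨l, l.2.1⟩) fun _ => rfl
    rw [act_of_mem hh rfl, act_of_mem hk rfl,
      loop_eq (x := ⟨x.legs, x.genus, x.deg + 1, _⟩) hh hk hne rfl rfl _ (fun _ => rfl) hne' ho,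
      loop_eq (x := ⟨x.legs, x.genus, x.deg + 1, _⟩) hh hk hne rfl rfl _ (fun _ => rfl) hne' ho, P.loop_B]
  · exact eq_of_dec_eq_zero (loop_dec_eq_zero (x := act h x) hs)
      (loop_dec_eq_zero (x := act k x) hs) rfl rfl rfl

end Cor

/-! ## Functions on lists of corollas -/

open Cor

variable {P : S1FramedModularOperad.{u}} {H : Type} [Finite H]
variable {M : Type w} [AddCommGroup M] [Module ℚ M]

/-- Functions on lists of corollas that are linear in the decorations and graded symmetric. -/
structure Compat (f : List (Cor P H) → M) : Prop where
  add : ∀ {s : Set H} {g : ℕ} {d : ℤ} (x y : P.X g ↥s d) (l : List (Cor P H)),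
    f (⟨s, g, d, x + y⟩ :: l) = f (⟨s, g, d, x⟩ :: l) + f (⟨s, g, d, y⟩ :: l)
  smul : ∀ (c : ℚ) {s : Set H} {g : ℕ} {d : ℤ} (x : P.X g ↥s d) (l : List (Cor P H)),
    f (⟨s, g, d, c • x⟩ :: l) = c • f (⟨s, g, d, x⟩ :: l)
  swap : ∀ (l₁ : List (Cor P H)) (a b : Cor P H) (l₂ : List (Cor P H)),
    f (l₁ ++ a :: b :: l₂) = sgn (a.deg * b.deg) • f (l₁ ++ b :: a :: l₂)

/-- A linear operation on decorations of degree `n`. -/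
structure IsLin (n : ℤ) (θ : Cor P H → Cor P H) : Prop where
  deg : ∀ x, (θ x).deg = x.deg + n
  lin : ∀ (s : Set H) (g : ℕ) (d : ℤ), ∃ (s' : Set H) (g' : ℕ) (d' : ℤ)
    (φ : P.X g s d →ₗ[ℚ] P.X g' s' d'), ∀ x, θ ⟨s, g, d, x⟩ = ⟨s', g', d', φ x⟩

theorem isLin_bd : IsLin (-1) (bd : Cor P H → Cor P H) :=
  ⟨fun _ => rfl, fun _ _ _ => ⟨_, _, _, P.bd (sub_add_cancel _ 1), fun _ => rfl⟩⟩

theorem isLin_act (h : H) : IsLin 1 (act h : Cor P H → Cor P H) :=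
  ⟨fun _ => rfl, fun _ _ _ => ⟨_, _, _, actMap h _ _ _, fun _ => rfl⟩⟩

theorem isLin_loop (h k : H) : IsLin 0 (loop h k : Cor P H → Cor P H) :=
  ⟨fun _ => (add_zero _).symm, fun _ _ _ => ⟨_, _, _, loopMap h k _ _ _, fun _ => rfl⟩⟩

theorem isLin_glue (h k : H) (x : Cor P H) : IsLin x.deg (glue h k x) :=
  ⟨fun _ => add_comm _ _, fun _ _ _ => ⟨_, _, _, glueMap h k _ _ _ _ _ _ x.dec, fun _ => rfl⟩⟩

namespace Compat

variable {f : List (Cor P H) → M} (hf : Compat f)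
include hf

theorem swap_head (a b : Cor P H) (l : List (Cor P H)) :
    f (a :: b :: l) = sgn (a.deg * b.deg) • f (b :: a :: l) := hf.swap [] a b l

theorem cons (x : Cor P H) : Compat fun l => f (x :: l) where
  add y z l := by
    rw [hf.swap_head, hf.add, smul_add, hf.swap_head x, hf.swap_head x]
  smul c _ _ _ y l := by
    rw [hf.swap_head, hf.smul, hf.swap_head x, smul_comm]
  swap l₁ := hf.swap (x :: l₁)

theorem append (l : List (Cor P H)) : Compat fun l' => f (l ++ l') := by
  induction l generalizing f with
  | nil => exact hf
  | cons x l ih => exact ih (hf.cons x)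

theorem append_right (l : List (Cor P H)) : Compat fun l' => f (l' ++ l) where
  add x y l' := hf.add x y _
  smul c _ _ _ x l' := hf.smul c x _
  swap l₁ a b l₂ := by simpa using hf.swap l₁ a b (l₂ ++ l)

theorem eq_zero {x : Cor P H} (hx : x.dec = 0) (l : List (Cor P H)) : f (x :: l) = 0 := by
  obtain ⟨s, g, d, x⟩ := x
  obtain rfl : x = 0 := hx
  have := hf.smul 0 (0 : P.X g s d) l
  rwa [zero_smul, zero_smul] at this

theorem cor_smul (c : ℚ) (x : Cor P H) (l : List (Cor P H)) :
    f (Cor.smul c x :: l) = c • f (x :: l) := hf.smul c x.dec l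

theorem lin_add {n : ℤ} {θ : Cor P H → Cor P H} (hθ : IsLin n θ) {s : Set H} {g : ℕ} {d : ℤ} (x y : P.X g ↥s d)
    (l : List (Cor P H)) :
    f (θ ⟨s, g, d, x + y⟩ :: l) = f (θ ⟨s, g, d, x⟩ :: l) + f (θ ⟨s, g, d, y⟩ :: l) := by
  obtain ⟨s', g', d', φ, h⟩ := hθ.lin s g d
  simp only [h, map_add, hf.add]

theorem lin_smul {n : ℤ} {θ : Cor P H → Cor P H} (hθ : IsLin n θ) (c : ℚ) {s : Set H} {g : ℕ} {d : ℤ} (x : P.X g ↥s d)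
    (l : List (Cor P H)) :
    f (θ ⟨s, g, d, c • x⟩ :: l) = c • f (θ ⟨s, g, d, x⟩ :: l) := by
  obtain ⟨s', g', d', φ, h⟩ := hθ.lin s g d
  simp only [h, map_smul, hf.smul]

theorem map {N : Type*} [AddCommGroup N] [Module ℚ N] (Λ : M →ₗ[ℚ] N) :
    Compat fun l => Λ (f l) where
  add x y l := by rw [hf.add, map_add]
  smul c _ _ _ x l := by rw [hf.smul, map_smul]
  swap l₁ a b l₂ := by rw [hf.swap, map_smul]

end Compat

theorem Compat.fun_add {f g : List (Cor P H) → M} (hf : Compat f) (hg : Compat g) :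
    Compat fun l => f l + g l where
  add x y l := by rw [hf.add, hg.add]; abel
  smul c _ _ _ x l := by rw [hf.smul, hg.smul, smul_add]
  swap l₁ a b l₂ := by rw [hf.swap, hg.swap, smul_add]

theorem Compat.fun_smul {f : List (Cor P H) → M} (hf : Compat f) (c : ℚ) :
    Compat fun l => c • f l := hf.map (LinearMap.lsmul ℚ M c)

theorem Compat.fun_zero : Compat fun _ : List (Cor P H) => (0 : M) :=
  ⟨fun _ _ _ => (add_zero 0).symm, fun _ _ _ _ _ _ => (smul_zero _).symm,
    fun _ _ _ _ => (smul_zero _).symm⟩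

theorem Compat.fun_sum {ι : Type*} (s : Finset ι) {f : ι → List (Cor P H) → M}
    (hf : ∀ i ∈ s, Compat (f i)) : Compat fun l => ∑ i ∈ s, f i l := by
  classical
  induction s using Finset.induction_on with
  | empty => simpa using Compat.fun_zero
  | insert a s ha ih =>
    simp only [Finset.sum_insert ha]
    exact (hf _ (Finset.mem_insert_self _ _)).fun_add
      (ih fun i hi => hf i (Finset.mem_insert_of_mem hi))

/-! ### Derivations -/

/-- The derivation of degree `n` extending `θ`, followed by `f`. -/
def der (θ : Cor P H → Cor P H) (n : ℤ) : List (Cor P H) → (List (Cor P H) → M) → M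
  | [], _ => 0
  | x :: l, f => f (θ x :: l) + sgn (n * x.deg) • der θ n l fun l' => f (x :: l')

theorem der_nil (θ : Cor P H → Cor P H) (n : ℤ) (f : List (Cor P H) → M) : der θ n [] f = 0 := rfl

theorem der_cons (θ : Cor P H → Cor P H) (n : ℤ) (x : Cor P H) (l : List (Cor P H))
    (f : List (Cor P H) → M) :
    der θ n (x :: l) f = f (θ x :: l) + sgn (n * x.deg) • der θ n l fun l' => f (x :: l') := rfl

theorem der_map (θ : Cor P H → Cor P H) (n : ℤ) {N : Type*} [AddCommGroup N] [Module ℚ N]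
    (Λ : M →ₗ[ℚ] N) (l : List (Cor P H)) (f : List (Cor P H) → M) :
    der θ n l (fun l' => Λ (f l')) = Λ (der θ n l f) := by
  induction l generalizing f with
  | nil => simp [der_nil]
  | cons x l ih => simp [der_cons, ih]

theorem der_add (θ : Cor P H → Cor P H) (n : ℤ) (l : List (Cor P H))
    (f g : List (Cor P H) → M) :
    der θ n l (fun l' => f l' + g l') = der θ n l f + der θ n l g := by
  induction l generalizing f g with
  | nil => simp [der_nil]
  | cons x l ih => simp only [der_cons, ih, smul_add]; abel

theorem der_smul (θ : Cor P H → Cor P H) (n : ℤ) (l : List (Cor P H))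
    (c : ℚ) (f : List (Cor P H) → M) :
    der θ n l (fun l' => c • f l') = c • der θ n l f :=
  der_map θ n (LinearMap.lsmul ℚ M c) l f

theorem der_fun_zero (θ : Cor P H → Cor P H) (n : ℤ) (l : List (Cor P H)) :
    der θ n l (fun _ => (0 : M)) = 0 := by
  simpa using der_smul θ n l 0 (fun _ => (0 : M))

theorem der_sum (θ : Cor P H → Cor P H) (n : ℤ) (l : List (Cor P H)) {ι : Type*} (s : Finset ι)
    (f : ι → List (Cor P H) → M) :
    der θ n l (fun l' => ∑ i ∈ s, f i l') = ∑ i ∈ s, der θ n l (f i) := by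
  classical
  induction s using Finset.induction_on with
  | empty => simp [der_fun_zero]
  | insert a s ha ih => simp only [Finset.sum_insert ha, der_add, ih]

/-- The values of a derivation depend only on the lists in which one entry is replaced. -/
theorem der_congr (θ : Cor P H → Cor P H) (n : ℤ) (l : List (Cor P H)) {f g : List (Cor P H) → M}
    (h : ∀ l₁ x l₂, l = l₁ ++ x :: l₂ → f (l₁ ++ θ x :: l₂) = g (l₁ ++ θ x :: l₂)) :
    der θ n l f = der θ n l g := by
  induction l generalizing f g with
  | nil => rfl
  | cons x l ih =>
    rw [der_cons, der_cons, show f (θ x :: l) = g (θ x :: l) from h [] x l rfl]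
    congr 2
    exact ih fun l₁ y l₂ e => h (x :: l₁) y l₂ (by rw [e]; rfl)

/-- The total degree of a list of corollas. -/
def degSum (l : List (Cor P H)) : ℤ := (l.map Cor.deg).sum

@[simp] theorem degSum_nil : degSum ([] : List (Cor P H)) = 0 := rfl

@[simp] theorem degSum_cons (x : Cor P H) (l : List (Cor P H)) :
    degSum (x :: l) = x.deg + degSum l := by simp [degSum]

@[simp] theorem degSum_append (l l' : List (Cor P H)) :
    degSum (l ++ l') = degSum l + degSum l' := by simp [degSum]

theorem der_append (θ : Cor P H → Cor P H) (n : ℤ) (l l' : List (Cor P H))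
    (f : List (Cor P H) → M) :
    der θ n (l ++ l') f = der θ n l (fun m => f (m ++ l')) +
      sgn (n * degSum l) • der θ n l' fun m => f (l ++ m) := by
  induction l generalizing f with
  | nil => simp [der_nil, sgn_zero]
  | cons x l ih =>
    simp only [List.cons_append, der_cons, ih, degSum_cons, mul_add, sgn_add, smul_add, smul_smul,
      add_assoc]

theorem Compat.der {f : List (Cor P H) → M} (hf : Compat f) {n : ℤ} {θ : Cor P H → Cor P H}
    (hθ : IsLin n θ) : Compat fun l => der θ n l f where
  add x y l := by
    simp only [der_cons, hf.lin_add hθ, hf.add, der_add, smul_add]; abel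
  smul c _ _ _ x l := by
    simp only [der_cons, hf.lin_smul hθ, hf.smul, der_smul, smul_add, smul_comm c]
  swap l₁ a b l₂ := by
    induction l₁ generalizing f with
    | nil =>
      have e : (fun l' => f (a :: b :: l')) = fun l' => sgn (a.deg * b.deg) • f (b :: a :: l') :=
        funext fun l' => hf.swap_head a b l'
      simp only [List.nil_append, der_cons, e, der_smul]
      rw [hf.swap_head (θ a) b, hf.swap_head a (θ b), hθ.deg, hθ.deg]
      simp only [add_mul, mul_add, sgn_add, smul_add, smul_smul, mul_comm _ n]
      rcases sgn_eq_or (n * a.deg) with h₁ | h₁ <;> rcases sgn_eq_or (n * b.deg) with h₂ | h₂ <;>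
        simp only [h₁, h₂] <;> module
    | cons x l₁ ih =>
      have e := hf.swap (θ x :: l₁) a b l₂
      simp only [List.cons_append] at e
      simp only [List.cons_append, der_cons, ih (hf.cons x), smul_add, smul_comm (sgn (n * x.deg)),
        e]

/-- Two derivations supercommute up to the derivation extending the supercommutator. -/
theorem der_der {a b c : Cor P H → Cor P H} {n m : ℤ} (ha : IsLin n a) (hb : IsLin m b)
    (h : ∀ f : List (Cor P H) → M, Compat f → ∀ x l,
      f (b (a x) :: l) = f (c x :: l) + sgn (n * m) • f (a (b x) :: l))
    {f : List (Cor P H) → M} (hf : Compat f) (l : List (Cor P H)) :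
    der a n l (fun l' => der b m l' f) =
      der c (n + m) l f + sgn (n * m) • der b m l (fun l' => der a n l' f) := by
  induction l generalizing f with
  | nil => simp [der_nil]
  | cons x l ih =>
    simp only [der_cons, der_add, der_smul, ih (hf.cons x), h f hf, ha.deg, hb.deg, smul_add,
      smul_smul, mul_add, add_mul, sgn_add, mul_comm m n]
    rcases sgn_eq_or (n * x.deg) with h₁ | h₁ <;> rcases sgn_eq_or (m * x.deg) with h₂ | h₂ <;>
      rcases sgn_eq_or (n * m) with h₃ | h₃ <;> simp only [h₁, h₂, h₃] <;> module

theorem der_comb {a b : Cor P H → Cor P H} {n : ℤ} (θ : Cor P H → Cor P H) (c c' : ℚ)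
    (h : ∀ f : List (Cor P H) → M, Compat f → ∀ x l,
      f (θ x :: l) = c • f (a x :: l) + c' • f (b x :: l))
    {f : List (Cor P H) → M} (hf : Compat f) (l : List (Cor P H)) :
    der θ n l f = c • der a n l f + c' • der b n l f := by
  induction l generalizing f with
  | nil => simp [der_nil]
  | cons x l ih => simp only [der_cons, ih (hf.cons x), h f hf]; module

theorem der_eq_zero {θ : Cor P H → Cor P H} {n : ℤ} {f : List (Cor P H) → M} (hf : Compat f)
    {l : List (Cor P H)} (h : ∀ x ∈ l, (θ x).dec = 0) : der θ n l f = 0 := by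
  induction l generalizing f with
  | nil => rfl
  | cons x l ih =>
    rw [der_cons, hf.eq_zero (h x List.mem_cons_self),
      ih (hf.cons x) fun y hy => h y (List.mem_cons_of_mem _ hy)]
    simp

/-! ### Contractions -/

/-- The contraction of the half-edges `h` and `k`, followed by `f`. -/
def ctr (h k : H) : List (Cor P H) → (List (Cor P H) → M) → M
  | [], _ => 0
  | x :: l, f => f (loop h k x :: l) + (der (glue h k x) x.deg l f + der (glue k h x) x.deg l f) +
      ctr h k l fun l' => f (x :: l')

theorem ctr_nil (h k : H) (f : List (Cor P H) → M) : ctr h k [] f = 0 := rfl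

theorem ctr_cons (h k : H) (x : Cor P H) (l : List (Cor P H)) (f : List (Cor P H) → M) :
    ctr h k (x :: l) f = f (loop h k x :: l) +
      (der (glue h k x) x.deg l f + der (glue k h x) x.deg l f) +
      ctr h k l fun l' => f (x :: l') := rfl

theorem ctr_map (h k : H) {N : Type*} [AddCommGroup N] [Module ℚ N]
    (Λ : M →ₗ[ℚ] N) (l : List (Cor P H)) (f : List (Cor P H) → M) :
    ctr h k l (fun l' => Λ (f l')) = Λ (ctr h k l f) := by
  induction l generalizing f with
  | nil => simp [ctr_nil]
  | cons x l ih => simp [ctr_cons, ih, der_map]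

theorem ctr_add (h k : H) (l : List (Cor P H)) (f g : List (Cor P H) → M) :
    ctr h k l (fun l' => f l' + g l') = ctr h k l f + ctr h k l g := by
  induction l generalizing f g with
  | nil => simp [ctr_nil]
  | cons x l ih => simp only [ctr_cons, ih, der_add]; abel

theorem ctr_smul (h k : H) (l : List (Cor P H)) (c : ℚ) (f : List (Cor P H) → M) :
    ctr h k l (fun l' => c • f l') = c • ctr h k l f :=
  ctr_map h k (LinearMap.lsmul ℚ M c) l f

theorem ctr_symm (h k : H) (l : List (Cor P H)) (f : List (Cor P H) → M) :
    ctr k h l f = ctr h k l f := by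
  induction l generalizing f with
  | nil => rfl
  | cons x l ih =>
    rw [ctr_cons, ctr_cons, ih, loop_symm h k x, add_comm (der (glue k h x) _ _ _)]

theorem glue_add_left (h k : H) {s : Set H} {g : ℕ} {d : ℤ} (x x' : P.X g ↥s d) {f : List (Cor P H) → M}
    (hf : Compat f) (y : Cor P H) (l : List (Cor P H)) :
    f (glue h k ⟨s, g, d, x + x'⟩ y :: l) =
      (1 : ℚ) • f (glue h k ⟨s, g, d, x⟩ y :: l) + (1 : ℚ) • f (glue h k ⟨s, g, d, x'⟩ y :: l) := by
  simp only [glue, map_add, LinearMap.add_apply, hf.add, one_smul]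

theorem glue_smul_left (h k : H) (c : ℚ) {s : Set H} {g : ℕ} {d : ℤ} (x : P.X g ↥s d) {f : List (Cor P H) → M}
    (hf : Compat f) (y : Cor P H) (l : List (Cor P H)) :
    f (glue h k ⟨s, g, d, c • x⟩ y :: l) =
      c • f (glue h k ⟨s, g, d, x⟩ y :: l) + (0 : ℚ) • f (glue h k ⟨s, g, d, x⟩ y :: l) := by
  simp only [glue, map_smul, LinearMap.smul_apply, hf.smul, zero_smul, add_zero]

theorem Compat.ctr {f : List (Cor P H) → M} (hf : Compat f) (h k : H) :
    Compat fun l => ctr h k l f where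
  add {s : Set H} {g : ℕ} {d : ℤ} x y l := by
    have e₁ := der_comb (n := d) _ 1 1 (fun f hf => glue_add_left h k x y (f := f) hf) hf l
    have e₂ := der_comb (n := d) _ 1 1 (fun f hf => glue_add_left k h x y (f := f) hf) hf l
    simp only [ctr_cons, hf.lin_add (isLin_loop h k), hf.add, ctr_add, e₁, e₂]
    module
  smul c s g d x l := by
    have e₁ := der_comb (n := d) _ c 0 (fun f hf => glue_smul_left h k c x (f := f) hf) hf l
    have e₂ := der_comb (n := d) _ c 0 (fun f hf => glue_smul_left k h c x (f := f) hf) hf l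
    simp only [ctr_cons, hf.lin_smul (isLin_loop h k), hf.smul, ctr_smul, e₁, e₂]
    module
  swap l₁ a b l₂ := by
    induction l₁ generalizing f with
    | nil =>
      have e : (fun l' => f (a :: b :: l')) = fun l' => sgn (a.deg * b.deg) • f (b :: a :: l') :=
        funext fun l' => hf.swap_head a b l'
      simp only [List.nil_append, ctr_cons, der_cons, e, ctr_smul]
      rw [hf.swap_head (Cor.loop h k a) b, hf.swap_head a (Cor.loop h k b), Cor.glue_comm h k a b,
        Cor.glue_comm k h a b, hf.cor_smul, hf.cor_smul]
      have l₁ : ∀ x : Cor P H, (Cor.loop h k x).deg = x.deg := fun _ => rfl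
      rw [l₁, l₁]
      simp only [mul_comm b.deg a.deg]
      rcases sgn_eq_or (a.deg * b.deg) with h₁ | h₁ <;> simp only [h₁] <;> module
    | cons x l₁ ih =>
      have e := hf.swap (Cor.loop h k x :: l₁) a b l₂
      simp only [List.cons_append] at e
      simp only [List.cons_append, ctr_cons, ih (hf.cons x), smul_add, e,
        (hf.der (isLin_glue _ _ x)).swap l₁ a b l₂]

end

noncomputable section

open Cor

variable {P : S1FramedModularOperad.{u}} {H : Type} [Finite H]
variable {M : Type w} [AddCommGroup M] [Module ℚ M]

theorem Compat.mk_congr {f : List (Cor P H) → M} {x y : Cor P H} (h : x = y)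
    (l : List (Cor P H)) : f (x :: l) = f (y :: l) := by rw [h]

namespace Compat

variable {f : List (Cor P H) → M} (hf : Compat f)
include hf

theorem bd_glue (h k : H) (x y : Cor P H) (l : List (Cor P H)) :
    f (bd (glue h k x y) :: l) =
      f (glue h k (bd x) y :: l) + sgn (-1 * x.deg) • f (glue h k x (bd y) :: l) := by
  by_cases hs : h ∈ x.legs ∧ k ∈ y.legs ∧ Disjoint x.legs y.legs
  · obtain ⟨hh, hk, hd⟩ := hs
    obtain ⟨s, g, c, x⟩ := x
    obtain ⟨t, g', d, y⟩ := y
    dsimp only at hh hk hd ⊢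
    have ho := legsOff_of_lab_sum hd hh hk rfl _ (lab_split s t h k)
    have e₁ : c - 1 + d = c + d - 1 := by ring
    have e₂ : c + (d - 1) = c + d - 1 := by ring
    simp only [bd]
    rw [glue_eq (x := ⟨s, g, c - 1, _⟩) (y := ⟨t, g', d, y⟩) hh hk hd rfl rfl e₁ _
        (lab_split _ _ _ _) ho,
      glue_eq (x := ⟨s, g, c, x⟩) (y := ⟨t, g', d - 1, _⟩) hh hk hd rfl rfl e₂ _
        (lab_split _ _ _ _) ho, neg_one_mul, sgn_neg]
    have e₃ := glue_eq (x := ⟨s, g, c, x⟩) (y := ⟨t, g', d, y⟩) hh hk hd rfl rfl rfl _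
      (lab_split _ _ _ _) ho
    simp only [glue, Cor.mk.injEq, heq_eq_eq, true_and] at e₃
    simp only [glue, e₃]
    rw [← hf.smul, ← hf.add]
    refine mk_congr ?_ l
    exact congrArg (Cor.mk ((s ∪ t) \ {h, k}) (g + g') (c + d - 1)) (P.bd_glue ⟨h, hh⟩ ⟨k, hk⟩ _ ho
      rfl rfl e₁ e₂ (sub_add_cancel _ 1) (sub_add_cancel _ 1) (sub_add_cancel _ 1) x y)
  · rw [hf.eq_zero (glue_dec_eq_zero (x := bd x) hs), hf.eq_zero (glue_dec_eq_zero (y := bd y) hs),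
      hf.eq_zero (by simp only [bd, glue_dec_eq_zero hs, map_zero]; rfl)]
    simp

theorem act_glue {h k m : H} (hm : m ≠ h) (hm' : m ≠ k) (x y : Cor P H) (l : List (Cor P H)) :
    f (act m (glue h k x y) :: l) =
      f (glue h k (act m x) y :: l) + sgn (1 * x.deg) • f (glue h k x (act m y) :: l) := by
  by_cases hs : h ∈ x.legs ∧ k ∈ y.legs ∧ Disjoint x.legs y.legs
  · obtain ⟨hh, hk, hd⟩ := hs
    have ho := legsOff_of_lab_sum hd hh hk rfl _ (lab_split x.legs y.legs h k)
    have e₁ : x.deg + 1 + y.deg = x.deg + y.deg + 1 := by ring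
    have e₂ : x.deg + (y.deg + 1) = x.deg + y.deg + 1 := by ring
    have z₁ : m ∉ x.legs → f (glue h k (act m x) y :: l) = 0 := fun hx => hf.eq_zero (by
      simp only [glue, act_of_notMem hx, map_zero]; rfl) l
    have z₂ : m ∉ y.legs → f (glue h k x (act m y) :: l) = 0 := fun hx => hf.eq_zero (by
      simp only [glue, act_of_notMem hx, map_zero]; rfl) l
    rw [one_mul]
    by_cases hx : m ∈ x.legs
    · have hy : m ∉ y.legs := Set.disjoint_left.1 hd hx
      have hx' : m ∈ (x.legs ∪ y.legs) \ {h, k} := by simp [hx, hm, hm']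
      rw [z₂ hy, smul_zero, add_zero, glue_eq hh hk hd rfl rfl rfl _ (lab_split _ _ _ _) ho,
        act_of_mem hx rfl,
        glue_eq (x := ⟨x.legs, x.genus, x.deg + 1, _⟩) hh hk hd rfl rfl e₁ _ (lab_split _ _ _ _) ho,
        act_of_mem (x := ⟨(x.legs ∪ y.legs) \ {h, k}, x.genus + y.genus, x.deg + y.deg, _⟩) hx' rfl]
      refine mk_congr ?_ l
      exact congrArg (Cor.mk ((x.legs ∪ y.legs) \ {h, k}) (x.genus + y.genus) (x.deg + y.deg + 1))
        (P.B_glue_left ⟨h, hh⟩ ⟨k, hk⟩ _ ho rfl rfl e₁ rfl rfl ⟨m, hx'⟩ ⟨m, hx⟩ x.dec y.dec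
          (lab_injective hd (lab_split _ _ _ _ _)))
    · by_cases hy : m ∈ y.legs
      · have hy' : m ∈ (x.legs ∪ y.legs) \ {h, k} := by simp [hy, hm, hm']
        rw [z₁ hx, zero_add, glue_eq hh hk hd rfl rfl rfl _ (lab_split _ _ _ _) ho,
          act_of_mem hy rfl,
          glue_eq (y := ⟨y.legs, y.genus, y.deg + 1, _⟩) hh hk hd rfl rfl e₂ _ (lab_split _ _ _ _) ho,
          act_of_mem (x := ⟨(x.legs ∪ y.legs) \ {h, k}, x.genus + y.genus, x.deg + y.deg, _⟩) hy' rfl, ← hf.smul]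
        refine mk_congr ?_ l
        exact congrArg (Cor.mk ((x.legs ∪ y.legs) \ {h, k}) (x.genus + y.genus) (x.deg + y.deg + 1))
          (P.B_glue_right ⟨h, hh⟩ ⟨k, hk⟩ _ ho rfl rfl e₂ rfl rfl ⟨m, hy'⟩ ⟨m, hy⟩ x.dec y.dec
            (lab_injective hd (lab_split _ _ _ _ _)))
      · rw [z₁ hx, z₂ hy, hf.eq_zero (act_of_notMem (x := glue h k x y) fun e => e.1.elim hx hy)]
        simp
  · rw [hf.eq_zero (glue_dec_eq_zero (x := act m x) hs),
      hf.eq_zero (glue_dec_eq_zero (y := act m y) hs),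
      hf.eq_zero (by simp only [act, glue_dec_eq_zero hs, map_zero]; rfl)]
    simp

theorem glue_act (h k : H) (x y : Cor P H) (l : List (Cor P H)) :
    f (glue h k (act h x) y :: l) = sgn x.deg • f (glue h k x (act k y) :: l) := by
  by_cases hs : h ∈ x.legs ∧ k ∈ y.legs ∧ Disjoint x.legs y.legs
  · obtain ⟨hh, hk, hd⟩ := hs
    have ho := legsOff_of_lab_sum hd hh hk rfl _ (lab_split x.legs y.legs h k)
    have e₂ : x.deg + (y.deg + 1) = x.deg + 1 + y.deg := by ring
    rw [act_of_mem hh rfl, act_of_mem hk rfl,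
      glue_eq (x := ⟨x.legs, x.genus, x.deg + 1, _⟩) hh hk hd rfl rfl rfl _ (lab_split _ _ _ _) ho,
      glue_eq (y := ⟨y.legs, y.genus, y.deg + 1, _⟩) hh hk hd rfl rfl e₂ _ (lab_split _ _ _ _) ho,
      ← hf.smul]
    refine mk_congr ?_ l
    exact congrArg (Cor.mk ((x.legs ∪ y.legs) \ {h, k}) (x.genus + y.genus) (x.deg + 1 + y.deg))
      (P.glue_B ⟨h, hh⟩ ⟨k, hk⟩ _ ho rfl rfl e₂ rfl rfl x.dec y.dec)
  · rw [hf.eq_zero (glue_dec_eq_zero (x := act h x) hs),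
      hf.eq_zero (glue_dec_eq_zero (y := act k y) hs), smul_zero]

theorem bd_bd (x : Cor P H) (l : List (Cor P H)) : f (bd (bd x) :: l) = 0 :=
  hf.eq_zero (P.bd_bd _ _ _) l

theorem act_act (h k : H) (x : Cor P H) (l : List (Cor P H)) :
    f (act h (act k x) :: l) + f (act k (act h x) :: l) = 0 := by
  by_cases hh : h ∈ x.legs
  · by_cases hk : k ∈ x.legs
    · rw [act_of_mem hh rfl, act_of_mem hk rfl, act_of_mem (x := ⟨x.legs, x.genus, x.deg + 1, _⟩) hh rfl,
        act_of_mem (x := ⟨x.legs, x.genus, x.deg + 1, _⟩) hk rfl, ← hf.add, P.B_anticomm]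
      exact hf.eq_zero rfl l
    · have z : (act h (act k x)).dec = 0 := by
        change actMap h _ _ _ (act k x).dec = 0
        rw [act_of_notMem hk]
        exact map_zero _
      rw [hf.eq_zero z, hf.eq_zero (act_of_notMem (x := act h x) hk), add_zero]
  · have z : (act k (act h x)).dec = 0 := by
      change actMap k _ _ _ (act h x).dec = 0
      rw [act_of_notMem hh]
      exact map_zero _
    rw [hf.eq_zero z, hf.eq_zero (act_of_notMem (x := act k x) hh), add_zero]

theorem bd_act (h : H) (x : Cor P H) (l : List (Cor P H)) :
    f (bd (act h x) :: l) + f (act h (bd x) :: l) = 0 := by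
  by_cases hh : h ∈ x.legs
  · have e₁ : x.deg - 1 + 1 = x.deg := by ring
    have e₂ : (⟨x.legs, x.genus, x.deg + 1 - 1, P.bd (sub_add_cancel _ 1) (P.B ⟨h, hh⟩ rfl x.dec)⟩ :
        Cor P H) = ⟨x.legs, x.genus, x.deg, P.bd rfl (P.B ⟨h, hh⟩ rfl x.dec)⟩ := by
      have : ∀ (e : ℤ) (he : e + 1 = x.deg + 1),
          (⟨x.legs, x.genus, e, P.bd he (P.B ⟨h, hh⟩ rfl x.dec)⟩ : Cor P H) =
            ⟨x.legs, x.genus, x.deg, P.bd rfl (P.B ⟨h, hh⟩ rfl x.dec)⟩ := by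
        intro e he
        obtain rfl : e = x.deg := by omega
        rfl
      exact this _ _
    rw [act_of_mem hh rfl, act_of_mem (x := bd x) hh e₁]
    simp only [bd]
    rw [e₂, ← hf.add]
    exact hf.eq_zero (P.bd_B ⟨h, hh⟩ e₁ rfl x.dec) l
  · have z : (bd (act h x)).dec = 0 := by
      simp only [bd, act_of_notMem hh, map_zero]
      rfl
    rw [hf.eq_zero z, hf.eq_zero (act_of_notMem (x := bd x) hh), add_zero]

end Compat

/-! ### Commutation of contractions with derivations -/

theorem ctr_der {θ : Cor P H → Cor P H} {n : ℤ} (hθ : IsLin n θ) {h k : H}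
    (hl : ∀ x, θ (loop h k x) = loop h k (θ x))
    (hg : ∀ f : List (Cor P H) → M, Compat f → ∀ x y l, f (θ (glue h k x y) :: l) =
      f (glue h k (θ x) y :: l) + sgn (n * x.deg) • f (glue h k x (θ y) :: l))
    (hg' : ∀ f : List (Cor P H) → M, Compat f → ∀ x y l, f (θ (glue k h x y) :: l) =
      f (glue k h (θ x) y :: l) + sgn (n * x.deg) • f (glue k h x (θ y) :: l))
    {f : List (Cor P H) → M} (hf : Compat f) (l : List (Cor P H)) :
    ctr h k l (fun l' => der θ n l' f) = der θ n l (fun l' => ctr h k l' f) := by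
  induction l generalizing f with
  | nil => rfl
  | cons x l ih =>
    have d₁ := der_der (c := Cor.glue h k (θ x)) (isLin_glue h k x) hθ (fun f hf y l => by
      rw [hg f hf, mul_comm n]) hf l
    have d₂ := der_der (c := Cor.glue k h (θ x)) (isLin_glue k h x) hθ (fun f hf y l => by
      rw [hg' f hf, mul_comm n]) hf l
    have e : (Cor.loop h k x).deg = x.deg := rfl
    simp only [ctr_cons, der_cons, ctr_add, ctr_smul, der_add, ih (hf.cons x), d₁, d₂, hl, e,
      hθ.deg, mul_comm x.deg n]
    module

theorem ctr_bd (h k : H) {f : List (Cor P H) → M} (hf : Compat f) (l : List (Cor P H)) :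
    ctr h k l (fun l' => der bd (-1) l' f) = der bd (-1) l (fun l' => ctr h k l' f) :=
  ctr_der isLin_bd (bd_loop h k) (fun _ hf => hf.bd_glue h k) (fun _ hf => hf.bd_glue k h) hf l

theorem ctr_act {h k m : H} (hm : m ≠ h) (hm' : m ≠ k) {f : List (Cor P H) → M} (hf : Compat f)
    (l : List (Cor P H)) :
    ctr h k l (fun l' => der (act m) 1 l' f) = der (act m) 1 l (fun l' => ctr h k l' f) :=
  ctr_der (isLin_act m) (act_loop hm hm') (fun _ hf => hf.act_glue hm hm')
    (fun _ hf => hf.act_glue hm' hm) hf l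

theorem der_bd_bd {f : List (Cor P H) → M} (hf : Compat f) (l : List (Cor P H)) :
    der bd (-1) l (fun l' => der bd (-1) l' f) = 0 := by
  have := der_der isLin_bd isLin_bd (c := fun x => ⟨x.legs, x.genus, x.deg + (-1 + -1), 0⟩)
    (fun f hf x l => by
      rw [hf.bd_bd, hf.eq_zero rfl, smul_zero, add_zero]) hf l
  rw [der_eq_zero hf fun _ _ => rfl, neg_one_mul, neg_neg, sgn_one, zero_add] at this
  have h₂ : (2 : ℚ) • der bd (-1) l (fun l' => der bd (-1) l' f) = 0 := by
    rw [two_smul]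
    nth_rewrite 1 [this]
    simp
  exact (smul_eq_zero.1 h₂).resolve_left two_ne_zero

theorem der_bd_act (h : H) {f : List (Cor P H) → M} (hf : Compat f) (l : List (Cor P H)) :
    der bd (-1) l (fun l' => der (act h) 1 l' f) =
      -der (act h) 1 l (fun l' => der bd (-1) l' f) := by
  have := der_der isLin_bd (isLin_act h) (c := fun x => ⟨x.legs, x.genus, x.deg + (-1 + 1), 0⟩)
    (fun f hf x l => by
      rw [hf.eq_zero (x := ⟨_, _, _, 0⟩) rfl, mul_one, sgn_neg, sgn_one, zero_add, neg_one_smul]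
      exact eq_neg_of_add_eq_zero_right (hf.bd_act h x l)) hf l
  rw [this, der_eq_zero hf fun _ _ => rfl, mul_one, sgn_neg, sgn_one]
  simp

theorem der_act_act (h k : H) {f : List (Cor P H) → M} (hf : Compat f) (l : List (Cor P H)) :
    der (act h) 1 l (fun l' => der (act k) 1 l' f) =
      -der (act k) 1 l (fun l' => der (act h) 1 l' f) := by
  have := der_der (isLin_act h) (isLin_act k) (c := fun x => ⟨x.legs, x.genus, x.deg + (1 + 1), 0⟩)
    (fun f hf x l => by
      rw [hf.eq_zero (x := ⟨_, _, _, 0⟩) rfl, mul_one, sgn_one, zero_add, neg_one_smul]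
      exact eq_neg_of_add_eq_zero_left (hf.act_act k h x l)) hf l
  rw [this, der_eq_zero hf fun _ _ => rfl, mul_one, sgn_one]
  simp

/-! ### Permutations -/

theorem exists_sign_of_perm {L L' : List (Cor P H)} (h : L.Perm L') :
    ∃ s : ℚ, s * s = 1 ∧ ∀ {M : Type w} [AddCommGroup M] [Module ℚ M] (f : List (Cor P H) → M),
      Compat f → f L = s • f L' := by
  induction h with
  | nil => exact ⟨1, by norm_num, fun f _ => (one_smul _ _).symm⟩
  | cons x _ ih =>
    obtain ⟨s, hs, h⟩ := ih
    exact ⟨s, hs, fun f hf => h _ (hf.cons x)⟩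
  | swap x y l => exact ⟨_, sgn_mul_self _, fun f hf => hf.swap_head _ _ _⟩
  | trans _ _ ih₁ ih₂ =>
    obtain ⟨s, hs, h⟩ := ih₁
    obtain ⟨t, ht, h'⟩ := ih₂
    exact ⟨s * t, by rw [mul_mul_mul_comm, hs, ht, one_mul], fun f hf => by
      rw [h f hf, h' f hf, smul_smul]⟩

/-- The sets of legs are pairwise disjoint. -/
def Disj (L : List (Cor P H)) : Prop := (L.map Cor.legs).Pairwise Disjoint

/-- All legs of the corollas in a list. -/
def labels (L : List (Cor P H)) : Set H := {h | ∃ s ∈ L.map Cor.legs, h ∈ s}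

theorem Disj.perm {L L' : List (Cor P H)} (h : Disj L) (hp : L.Perm L') : Disj L' :=
  (hp.map Cor.legs).pairwise h fun h => h.symm

theorem mem_labels {L : List (Cor P H)} {h : H} : h ∈ labels L ↔ ∃ x ∈ L, h ∈ x.legs := by
  simp [labels]

theorem labels_perm {L L' : List (Cor P H)} (hp : L.Perm L') : labels L = labels L' := by
  ext h
  simp only [mem_labels, hp.mem_iff]

theorem labels_cons (x : Cor P H) (L : List (Cor P H)) : labels (x :: L) = x.legs ∪ labels L := by
  ext h
  simp [mem_labels]

theorem labels_append (L L' : List (Cor P H)) : labels (L ++ L') = labels L ∪ labels L' := by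
  ext h
  simp [labels]
  grind

theorem disj_cons {x : Cor P H} {L : List (Cor P H)} :
    Disj (x :: L) ↔ Disjoint x.legs (labels L) ∧ Disj L := by
  unfold Disj
  rw [List.map_cons, List.pairwise_cons]
  refine and_congr_left fun _ => ⟨fun h => ?_, fun h s hs => ?_⟩
  · rw [Set.disjoint_left]
    rintro a ha ⟨s, hs, has⟩
    exact Set.disjoint_left.1 (h s hs) ha has
  · rw [Set.disjoint_left] at h ⊢
    exact fun a ha has => h ha ⟨s, hs, has⟩

theorem Disj.notMem {x : Cor P H} {L : List (Cor P H)} (hL : Disj (x :: L)) {h : H}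
    (hx : h ∈ x.legs) : h ∉ labels L := Set.disjoint_left.1 (disj_cons.1 hL).1 hx

theorem perm_cons_of_mem {L : List (Cor P H)} {x : Cor P H} (hx : x ∈ L) :
    ∃ l, L.Perm (x :: l) := by
  classical exact ⟨_, List.perm_cons_erase hx⟩

theorem perm_cons_of_mem_of_ne {x y : Cor P H} {L : List (Cor P H)} (hy : y ∈ x :: L)
    (hne : y ≠ x) : ∃ l, L.Perm (y :: l) :=
  perm_cons_of_mem ((List.mem_cons.1 hy).resolve_left hne)

/-! ### Evaluation of contractions -/

theorem ctr_eq_zero {h k : H} {f : List (Cor P H) → M} (hf : Compat f) {L : List (Cor P H)}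
    (hL : h ∉ labels L) : ctr h k L f = 0 := by
  induction L generalizing f with
  | nil => rfl
  | cons x l ih =>
    rw [labels_cons, Set.mem_union, not_or] at hL
    rw [ctr_cons, hf.eq_zero (loop_dec_eq_zero fun e => hL.1 e.1),
      der_eq_zero hf fun y _ => glue_dec_eq_zero fun e => hL.1 e.1,
      der_eq_zero hf fun y hy => glue_dec_eq_zero fun e => hL.2 (mem_labels.2 ⟨y, hy, e.2.1⟩),
      ih (hf.cons x) hL.2]
    simp

theorem ctr_eq_zero' {h k : H} {f : List (Cor P H) → M} (hf : Compat f) {L : List (Cor P H)}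
    (hL : k ∉ labels L) : ctr h k L f = 0 := by
  rw [← ctr_symm, ctr_eq_zero hf hL]

theorem ctr_skip {h k : H} {f : List (Cor P H) → M} (hf : Compat f) {x : Cor P H}
    (L : List (Cor P H)) (hh : h ∉ x.legs) (hk : k ∉ x.legs) :
    ctr h k (x :: L) f = ctr h k L fun l => f (x :: l) := by
  rw [ctr_cons, hf.eq_zero (loop_dec_eq_zero fun e => hh e.1),
    der_eq_zero hf fun y _ => glue_dec_eq_zero fun e => hh e.1,
    der_eq_zero hf fun y _ => glue_dec_eq_zero fun e => hk e.1]
  simp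

theorem ctr_loop {h k : H} {f : List (Cor P H) → M} (hf : Compat f) {x : Cor P H}
    {L : List (Cor P H)} (hh : h ∉ labels L) (hk : k ∉ labels L) :
    ctr h k (x :: L) f = f (loop h k x :: L) := by
  rw [ctr_cons,
    der_eq_zero hf fun y hy => glue_dec_eq_zero fun e => hk (mem_labels.2 ⟨y, hy, e.2.1⟩),
    der_eq_zero hf fun y hy => glue_dec_eq_zero fun e => hh (mem_labels.2 ⟨y, hy, e.2.1⟩),
    ctr_eq_zero (hf.cons x) hh]
  simp

theorem ctr_edge {h k : H} {f : List (Cor P H) → M} (hf : Compat f) {x y : Cor P H}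
    {L : List (Cor P H)} (hh : h ∉ labels (y :: L)) (hk : k ∉ labels L) (hx : k ∉ x.legs) :
    ctr h k (x :: y :: L) f = f (glue h k x y :: L) := by
  rw [ctr_cons, hf.eq_zero (loop_dec_eq_zero fun e => hx e.2.1), der_cons,
    der_eq_zero (hf.cons y) fun z hz => glue_dec_eq_zero fun e => hk (mem_labels.2 ⟨z, hz, e.2.1⟩),
    der_eq_zero hf fun z _ => glue_dec_eq_zero fun e => hx e.1, ctr_eq_zero (hf.cons x) hh]
  simp

theorem der_vanish {θ : Cor P H → Cor P H} {n : ℤ} (L : List (Cor P H))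
    {f : List (Cor P H) → M}
    (h : ∀ l₁ x l₂, L = l₁ ++ x :: l₂ → f (l₁ ++ θ x :: l₂) = 0) : der θ n L f = 0 := by
  rw [der_congr θ n L (g := fun _ => 0) h, der_fun_zero]

theorem ctr_vanish {h k m : H} {f : List (Cor P H) → M} (L : List (Cor P H))
    (hf : ∀ L' : List (Cor P H), m ∉ labels L' → f L' = 0) (hL : m ∉ labels L) :
    ctr h k L f = 0 := by
  induction L generalizing f with
  | nil => rfl
  | cons x l ih =>
    have hL' := hL
    rw [labels_cons, Set.mem_union, not_or] at hL
    have key : ∀ a b, der (glue a b x) x.deg l f = 0 := fun a b => by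
      refine der_vanish l fun l₁ y l₂ e => hf _ ?_
      subst e
      have h₁ := hL.1
      have h₂ := hL.2
      simp only [labels_append, labels_cons, Set.mem_union, not_or] at h₂ ⊢
      exact ⟨h₂.1, fun e => e.1.elim h₁ h₂.2.1, h₂.2.2⟩
    rw [ctr_cons, key, key, ih (fun L' h' => hf _ ?_) hL.2, hf]
    · simp
    · rw [labels_cons]
      exact fun e => e.elim (fun e => hL.1 e.1) hL.2
    · rw [labels_cons]
      exact fun e => e.elim hL.1 h'

theorem Cor.notMem_loop {h k a : H} {x : Cor P H} (ha : a ∉ x.legs) : a ∉ (loop h k x).legs :=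
  fun e => ha e.1

theorem Cor.notMem_glue {h k a : H} {x y : Cor P H} (ha : a ∉ x.legs) (ha' : a ∉ y.legs) :
    a ∉ (glue h k x y).legs :=
  fun e => e.1.elim ha ha'

/-- The two orders of contracting two disjoint pairs of half-edges agree. -/
def CtrComm (M : Type w) [AddCommGroup M] [Module ℚ M] (h k h' k' : H) (L : List (Cor P H)) :
    Prop :=
  ∀ f : List (Cor P H) → M, Compat f →
    ctr h k L (fun l => ctr h' k' l f) = ctr h' k' L (fun l => ctr h k l f)

namespace CtrComm

variable {h k h' k' : H} {L L' : List (Cor P H)} {x y z w : Cor P H}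

theorem symm (H₀ : CtrComm M h k h' k' L) : CtrComm M h' k' h k L :=
  fun f hf => (H₀ f hf).symm

theorem flip_left (H₀ : CtrComm M h k h' k' L) : CtrComm M k h h' k' L := fun f hf => by
  simpa only [ctr_symm h k] using H₀ f hf

theorem flip_right (H₀ : CtrComm M h k h' k' L) : CtrComm M h k k' h' L := H₀.symm.flip_left.symm

theorem of_perm (hp : L.Perm L') (H₀ : CtrComm M h k h' k' L') : CtrComm M h k h' k' L :=
  fun f hf => by
    obtain ⟨s, _, hs⟩ := exists_sign_of_perm hp
    rw [hs _ ((hf.ctr h' k').ctr h k), hs _ ((hf.ctr h k).ctr h' k'), H₀ f hf]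

theorem of_notMem (hL : h ∉ labels L) : CtrComm M h k h' k' L := fun f hf => by
  rw [ctr_eq_zero (hf.ctr h' k') hL, ctr_vanish L (fun L' e => ctr_eq_zero hf e) hL]

theorem cfg₁ (hL : Disj (x :: L)) (hh : h ∈ x.legs) (hk : k ∈ x.legs) (hh' : h' ∈ x.legs)
    (hk' : k' ∈ x.legs) (h₁ : h ≠ k) (h₂ : h' ≠ k') (h₃ : h ≠ h') (h₄ : h ≠ k') (h₅ : k ≠ h')
    (h₆ : k ≠ k') : CtrComm M h k h' k' (x :: L) := fun f hf => by
  have nh := hL.notMem hh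
  have nk := hL.notMem hk
  have nh' := hL.notMem hh'
  have nk' := hL.notMem hk'
  rw [ctr_loop (hf.ctr _ _) nh nk, ctr_loop hf nh' nk', ctr_loop (hf.ctr _ _) nh' nk',
    ctr_loop hf nh nk, Cor.loop_loop hh hk hh' hk' h₁ h₂ h₃ h₄ h₅ h₆]

theorem cfg₂ (hL : Disj (x :: y :: L)) (hh : h ∈ x.legs) (hk : k ∈ x.legs) (hh' : h' ∈ x.legs)
    (hk' : k' ∈ y.legs) (h₁ : h ≠ k) (h₃ : h ≠ h') (h₅ : k ≠ h') :
    CtrComm M h k h' k' (x :: y :: L) := fun f hf => by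
  have nh := hL.notMem hh
  have nk := hL.notMem hk
  have nh' := hL.notMem hh'
  have hL' := disj_cons.1 hL
  have nk' := hL'.2.notMem hk'
  have hd : Disjoint x.legs y.legs := hL'.1.mono_right (by simp [labels_cons])
  have nx := Set.disjoint_right.1 hd hk'
  have sub : labels L ⊆ labels (y :: L) := by simp [labels_cons]
  rw [ctr_loop (hf.ctr _ _) nh nk, ctr_edge hf nh' nk' (notMem_loop nx),
    ctr_edge (hf.ctr _ _) nh' nk' nx, ctr_loop hf (fun e => nh (sub e)) fun e => nk (sub e),
    Cor.glue_loop hh hk hh' hk' hd h₁ h₃ h₅]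

theorem cfg₃ (hL : Disj (x :: y :: L)) (hh : h ∈ x.legs) (hk : k ∈ x.legs) (hh' : h' ∈ y.legs)
    (hk' : k' ∈ y.legs) : CtrComm M h k h' k' (x :: y :: L) := fun f hf => by
  have nh := hL.notMem hh
  have nk := hL.notMem hk
  have hL' := disj_cons.1 hL
  have nh' := hL'.2.notMem hh'
  have nk' := hL'.2.notMem hk'
  have hd : Disjoint x.legs y.legs := hL'.1.mono_right (by simp [labels_cons])
  have nx := Set.disjoint_right.1 hd hh'
  have nx' := Set.disjoint_right.1 hd hk'
  have ny : ∀ a, a ∉ labels (y :: L) → a ∉ labels (loop h' k' y :: L) := fun a ha e => ha (by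
    rw [labels_cons] at e ⊢
    exact e.imp_left fun e => e.1)
  rw [ctr_loop (hf.ctr _ _) nh nk, ctr_skip hf _ (notMem_loop nx) (notMem_loop nx'),
    ctr_loop (hf.cons _) nh' nk', ctr_skip (hf.ctr _ _) _ nx nx',
    ctr_loop ((hf.ctr _ _).cons _) nh' nk', ctr_loop hf (ny _ nh) (ny _ nk)]

theorem cfg₄ (hL : Disj (x :: y :: z :: L)) (hh : h ∈ x.legs) (hk : k ∈ x.legs)
    (hh' : h' ∈ y.legs) (hk' : k' ∈ z.legs) : CtrComm M h k h' k' (x :: y :: z :: L) :=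
  fun f hf => by
  have nh := hL.notMem hh
  have nk := hL.notMem hk
  have hL' := disj_cons.1 hL
  have nh' := hL'.2.notMem hh'
  have hL'' := disj_cons.1 hL'.2
  have nk' := hL''.2.notMem hk'
  have nx : h' ∉ x.legs := Set.disjoint_right.1 hL'.1 (by simp [labels_cons, hh'])
  have nx' : k' ∉ x.legs := Set.disjoint_right.1 hL'.1 (by simp [labels_cons, hk'])
  have ny' : k' ∉ y.legs := Set.disjoint_right.1 hL''.1 (by simp [labels_cons, hk'])
  have ny : ∀ a, a ∉ labels (y :: z :: L) → a ∉ labels (glue h' k' y z :: L) := fun a ha e => ha (by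
    rw [labels_cons] at e
    simp only [labels_cons, Set.mem_union]
    rcases e with ⟨e | e, -⟩ | e <;> simp [e])
  rw [ctr_loop (hf.ctr _ _) nh nk, ctr_skip hf _ (notMem_loop nx) (notMem_loop nx'),
    ctr_edge (hf.cons _) nh' nk' ny', ctr_skip (hf.ctr _ _) _ nx nx',
    ctr_edge ((hf.ctr _ _).cons _) nh' nk' ny', ctr_loop hf (ny _ nh) (ny _ nk)]

theorem cfg₅ (hL : Disj (x :: y :: L)) (hh : h ∈ x.legs) (hk : k ∈ y.legs) (hh' : h' ∈ x.legs)
    (hk' : k' ∈ y.legs) (h₃ : h ≠ h') (h₆ : k ≠ k') :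
    CtrComm M h k h' k' (x :: y :: L) := fun f hf => by
  have nh := hL.notMem hh
  have nh' := hL.notMem hh'
  have hL' := disj_cons.1 hL
  have nk := hL'.2.notMem hk
  have nk' := hL'.2.notMem hk'
  have hd : Disjoint x.legs y.legs := hL'.1.mono_right (by simp [labels_cons])
  have nx := Set.disjoint_right.1 hd hk
  have nx' := Set.disjoint_right.1 hd hk'
  have sub : labels L ⊆ labels (y :: L) := by simp [labels_cons]
  rw [ctr_edge (hf.ctr _ _) nh nk nx, ctr_edge (hf.ctr _ _) nh' nk' nx',
    ctr_loop hf (fun e => nh (sub e)) nk, ctr_loop hf (fun e => nh' (sub e)) nk',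
    Cor.loop_glue_cross hh hk hh' hk' hd h₃ h₆]

theorem cfg₆ (hL : Disj (x :: y :: z :: L)) (hh : h ∈ x.legs) (hk : k ∈ y.legs)
    (hh' : h' ∈ y.legs) (hk' : k' ∈ z.legs) (h₅ : k ≠ h') :
    CtrComm M h k h' k' (x :: y :: z :: L) := fun f hf => by
  have nh := hL.notMem hh
  have hL' := disj_cons.1 hL
  have nk := hL'.2.notMem hk
  have nh' := hL'.2.notMem hh'
  have hL'' := disj_cons.1 hL'.2
  have nk' := hL''.2.notMem hk'
  have dxy : Disjoint x.legs y.legs := hL'.1.mono_right (by simp [labels_cons])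
  have dxz : Disjoint x.legs z.legs := hL'.1.mono_right (by
    simp [labels_cons, Set.subset_union_of_subset_right])
  have dyz : Disjoint y.legs z.legs := hL''.1.mono_right (by simp [labels_cons])
  have sub : labels L ⊆ labels (z :: L) := by simp [labels_cons]
  have ny : ∀ a, a ∉ labels (y :: z :: L) → a ∉ labels (glue h' k' y z :: L) := fun a ha e => ha (by
    rw [labels_cons] at e
    simp only [labels_cons, Set.mem_union]
    rcases e with ⟨e | e, -⟩ | e <;> simp [e])
  rw [ctr_edge (hf.ctr _ _) nh nk (Set.disjoint_right.1 dxy hk),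
    ctr_edge hf nh' nk' (notMem_glue (Set.disjoint_right.1 dxz hk')
      (Set.disjoint_right.1 dyz hk')),
    ctr_skip (hf.ctr _ _) _ (Set.disjoint_right.1 dxy hh') (Set.disjoint_right.1 dxz hk'),
    ctr_edge ((hf.ctr _ _).cons _) nh' nk' (Set.disjoint_right.1 dyz hk'),
    ctr_edge hf (ny _ nh) (fun e => nk (sub e)) (Set.disjoint_right.1 dxy hk),
    Cor.glue_assoc hh hk hh' hk' dxy dxz dyz h₅]

theorem cfg₇ (hL : Disj (x :: y :: z :: w :: L)) (hh : h ∈ x.legs) (hk : k ∈ y.legs)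
    (hh' : h' ∈ z.legs) (hk' : k' ∈ w.legs) :
    CtrComm M h k h' k' (x :: y :: z :: w :: L) := fun f hf => by
  have nh := hL.notMem hh
  have hx := disj_cons.1 hL
  have nk := hx.2.notMem hk
  have hy := disj_cons.1 hx.2
  have nh' := hy.2.notMem hh'
  have hz := disj_cons.1 hy.2
  have nk' := hz.2.notMem hk'
  have mem : ∀ {a : H} {s t : Set H}, Disjoint s t → a ∈ t → a ∉ s :=
    fun hd ha => Set.disjoint_right.1 hd ha
  have kx : k ∉ x.legs := mem hx.1 (by simp [labels_cons, hk])
  have hx' : h' ∉ x.legs := mem hx.1 (by simp [labels_cons, hh'])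
  have kx' : k' ∉ x.legs := mem hx.1 (by simp [labels_cons, hk'])
  have hy' : h' ∉ y.legs := mem hy.1 (by simp [labels_cons, hh'])
  have ky' : k' ∉ y.legs := mem hy.1 (by simp [labels_cons, hk'])
  have kz' : k' ∉ z.legs := mem hz.1 (by simp [labels_cons, hk'])
  have ny : ∀ a, a ∉ labels (z :: w :: L) → a ∉ labels (glue h' k' z w :: L) := fun a ha e => ha (by
    rw [labels_cons] at e
    simp only [labels_cons, Set.mem_union]
    rcases e with ⟨e | e, -⟩ | e <;> simp [e])
  have nh₂ : h ∉ labels (y :: glue h' k' z w :: L) := by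
    rw [labels_cons] at nh ⊢
    exact fun e => e.elim (fun e => nh (Or.inl e)) (ny h fun e => nh (Or.inr e))
  rw [ctr_edge (hf.ctr _ _) nh nk kx, ctr_skip hf _ (notMem_glue hx' hy')
      (notMem_glue kx' ky'), ctr_edge (hf.cons _) nh' nk' kz',
    ctr_skip (hf.ctr _ _) _ hx' kx', ctr_skip ((hf.ctr _ _).cons _) _ hy' ky',
    ctr_edge (((hf.ctr _ _).cons _).cons _) nh' nk' kz', ctr_edge hf nh₂ (ny _ nk) kx]

end CtrComm

theorem ctrComm {h k h' k' : H} {L : List (Cor P H)} (hL : Disj L) (h₁ : h ≠ k) (h₂ : h' ≠ k')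
    (h₃ : h ≠ h') (h₄ : h ≠ k') (h₅ : k ≠ h') (h₆ : k ≠ k') : CtrComm M h k h' k' L := by
  by_cases mh : h ∈ labels L
  swap
  · exact CtrComm.of_notMem mh
  by_cases mk : k ∈ labels L
  swap
  · exact (CtrComm.of_notMem mk).flip_left
  by_cases mh' : h' ∈ labels L
  swap
  · exact (CtrComm.of_notMem mh').symm
  by_cases mk' : k' ∈ labels L
  swap
  · exact (CtrComm.of_notMem mk').symm.flip_right
  obtain ⟨x, hx, mx⟩ := mem_labels.1 mh
  obtain ⟨y, hy, my⟩ := mem_labels.1 mk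
  obtain ⟨x', hx', mx'⟩ := mem_labels.1 mh'
  obtain ⟨y', hy', my'⟩ := mem_labels.1 mk'
  have two : ∀ {x y : Cor P H}, x ∈ L → y ∈ L → y ≠ x → ∃ l, L.Perm (x :: y :: l) := by
    intro x y hx hy hne
    obtain ⟨l, hl⟩ := perm_cons_of_mem hx
    obtain ⟨l', hl'⟩ := perm_cons_of_mem_of_ne (hl.mem_iff.1 hy) hne
    exact ⟨l', hl.trans (hl'.cons x)⟩
  have three : ∀ {x y z : Cor P H}, x ∈ L → y ∈ L → z ∈ L → y ≠ x → z ≠ x → z ≠ y →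
      ∃ l, L.Perm (x :: y :: z :: l) := by
    intro x y z hx hy hz hne h₁ h₂
    obtain ⟨l, hl⟩ := two hx hy hne
    obtain ⟨l', hl'⟩ := perm_cons_of_mem_of_ne
      ((List.mem_cons.1 (hl.mem_iff.1 hz)).resolve_left h₁) h₂
    exact ⟨l', hl.trans ((hl'.cons y).cons x)⟩
  by_cases exy : y = x
  · subst exy
    by_cases exy' : y' = x'
    · subst exy'
      by_cases e : y' = y
      · subst e
        obtain ⟨l, hl⟩ := perm_cons_of_mem hx
        exact .of_perm hl (.cfg₁ (hL.perm hl) mx my mx' my' h₁ h₂ h₃ h₄ h₅ h₆)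
      · obtain ⟨l, hl⟩ := two hx hx' e
        exact .of_perm hl (.cfg₃ (hL.perm hl) mx my mx' my')
    · by_cases e : x' = y
      · subst e
        obtain ⟨l, hl⟩ := two hx hy' exy'
        exact .of_perm hl (.cfg₂ (hL.perm hl) mx my mx' my' h₁ h₃ h₅)
      · by_cases e' : y' = y
        · subst e'
          obtain ⟨l, hl⟩ := two hx hx' e
          exact (CtrComm.of_perm hl (.cfg₂ (hL.perm hl) mx my my' mx' h₁ h₄ h₆)).flip_right
        · obtain ⟨l, hl⟩ := three hx hx' hy' e e' exy'
          exact .of_perm hl (.cfg₄ (hL.perm hl) mx my mx' my')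
  · by_cases exy' : y' = x'
    · subst exy'
      by_cases e : y' = x
      · subst e
        obtain ⟨l, hl⟩ := two hx hy exy
        exact (CtrComm.of_perm hl (.cfg₂ (hL.perm hl) mx' my' mx my h₂ h₃.symm h₄.symm)).symm
      · by_cases e' : y' = y
        · subst e'
          obtain ⟨l, hl⟩ := two hy hx (Ne.symm exy)
          exact (CtrComm.of_perm hl
            (.cfg₂ (hL.perm hl) mx' my' my mx h₂ h₅.symm h₆.symm)).symm.flip_left
        · obtain ⟨l, hl⟩ := three hx' hx hy (Ne.symm e) (Ne.symm e') exy
          exact (CtrComm.of_perm hl (.cfg₄ (hL.perm hl) mx' my' mx my)).symm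
    · by_cases e : x' = x
      · subst e
        by_cases e' : y' = y
        · subst e'
          obtain ⟨l, hl⟩ := two hx hy exy
          exact .of_perm hl (.cfg₅ (hL.perm hl) mx my mx' my' h₃ h₆)
        · obtain ⟨l, hl⟩ := three hy hx hy' (Ne.symm exy) e' exy'
          exact (CtrComm.of_perm hl (.cfg₆ (hL.perm hl) my mx mx' my' h₃)).flip_left
      · by_cases e' : x' = y
        · subst e'
          by_cases e'' : y' = x
          · subst e''
            obtain ⟨l, hl⟩ := two hx hx' exy
            exact (CtrComm.of_perm hl (.cfg₅ (hL.perm hl) mx my my' mx' h₄ h₅)).flip_right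
          · obtain ⟨l, hl⟩ := three hx hy hy' exy e'' exy'
            exact .of_perm hl (.cfg₆ (hL.perm hl) mx my mx' my' h₅)
        · by_cases e₁ : y' = x
          · subst e₁
            obtain ⟨l, hl⟩ := three hy hx hx' (Ne.symm exy) e' e
            exact (CtrComm.of_perm hl
              (.cfg₆ (hL.perm hl) my mx my' mx' h₄)).flip_left.flip_right
          · by_cases e₂ : y' = y
            · subst e₂
              obtain ⟨l, hl⟩ := three hx hy hx' exy e e'
              exact (CtrComm.of_perm hl (.cfg₆ (hL.perm hl) mx my my' mx' h₆)).flip_right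
            · obtain ⟨l, hl⟩ := three hx hy hx' exy e e'
              have := (List.mem_cons.1 ((List.mem_cons.1 (hl.mem_iff.1 hy')).resolve_left
                e₁)).resolve_left e₂
              obtain ⟨l', hl'⟩ := perm_cons_of_mem_of_ne this exy'
              have hp := hl.trans (((hl'.cons x').cons y).cons x)
              exact .of_perm hp (.cfg₇ (hL.perm hp) mx my mx' my')

end

noncomputable section

open Cor

variable {P : S1FramedModularOperad.{u}} {H : Type} [Finite H]
variable {M : Type w} [AddCommGroup M] [Module ℚ M]

/-- A partial matching on a set of half-edges. -/
@[ext]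
structure Matching (H : Type) where
  Adj : H → H → Prop
  symm : ∀ {h k}, Adj h k → Adj k h
  irrefl : ∀ {h}, ¬ Adj h h
  unique : ∀ {h k l}, Adj h k → Adj h l → k = l

/-! ### Connectivity -/

/-- A list of sets of half-edges is connected by `A` if it is not empty and every colouring that
is constant along the edges of `A` is constant. -/
def ConnL (A : H → H → Prop) (S : List (Set H)) : Prop :=
  S ≠ [] ∧ ∀ c : List (Set H × Bool), c.map Prod.fst = S →
    (∀ x ∈ c, ∀ y ∈ c, ∀ h ∈ x.1, ∀ k ∈ y.1, A h k → x.2 = y.2) → ∀ x ∈ c, ∀ y ∈ c, x.2 = y.2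

theorem List.Perm.exists_map_eq {α β : Type*} {f : α → β} {l : List β} {m : List β}
    (h : l.Perm m) : ∀ c : List α, c.map f = l → ∃ c', c.Perm c' ∧ c'.map f = m := by
  induction h with
  | nil => exact fun c hc => ⟨c, .refl _, hc⟩
  | cons x _ ih =>
    intro c hc
    obtain ⟨a, c, rfl, rfl, e⟩ := List.map_eq_cons_iff.1 hc
    obtain ⟨c', hp, rfl⟩ := ih c e
    exact ⟨a :: c', hp.cons a, rfl⟩
  | swap x y l =>
    intro c hc
    obtain ⟨a, c, rfl, rfl, e⟩ := List.map_eq_cons_iff.1 hc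
    obtain ⟨b, c, rfl, rfl, rfl⟩ := List.map_eq_cons_iff.1 e
    exact ⟨b :: a :: c, .swap _ _ _, rfl⟩
  | trans _ _ ih₁ ih₂ =>
    intro c hc
    obtain ⟨c', hp, e⟩ := ih₁ c hc
    obtain ⟨c'', hp', e'⟩ := ih₂ c' e
    exact ⟨c'', hp.trans hp', e'⟩

namespace ConnL

variable {A A' : H → H → Prop} {S T : List (Set H)}

theorem perm (h : ConnL A S) (hp : S.Perm T) : ConnL A T := by
  refine ⟨fun e => h.1 (by subst e; exact hp.eq_nil), fun c hc hA x hx y hy => ?_⟩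
  obtain ⟨c', hp', e⟩ := hp.symm.exists_map_eq c hc
  exact h.2 c' e (fun x hx y hy => hA x (hp'.mem_iff.2 hx) y (hp'.mem_iff.2 hy)) x
    (hp'.mem_iff.1 hx) y (hp'.mem_iff.1 hy)

theorem perm_iff (hp : S.Perm T) : ConnL A S ↔ ConnL A T :=
  ⟨fun h => h.perm hp, fun h => h.perm hp.symm⟩

/-- Only the edges between half-edges in the list matter. -/
theorem congr_adj (h : ∀ s ∈ S, ∀ t ∈ S, ∀ a ∈ s, ∀ b ∈ t, (A a b ↔ A' a b)) :
    ConnL A S ↔ ConnL A' S := by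
  refine and_congr_right fun _ => forall₂_congr fun c hc => imp_congr_left ?_
  refine forall₂_congr fun x hx => forall₂_congr fun y hy => forall₂_congr fun a ha =>
    forall₂_congr fun b hb => imp_congr_left ?_
  subst hc
  exact h _ (List.mem_map_of_mem hx) _ (List.mem_map_of_mem hy) a ha b hb

theorem mono (h : ConnL A S) (hA : ∀ a b, A a b → A' a b) : ConnL A' S :=
  ⟨h.1, fun c hc hc' => h.2 c hc fun x hx y hy a ha b hb e => hc' x hx y hy a ha b hb (hA a b e)⟩

theorem append (hS : ConnL A S) (hT : ConnL A T) {s t : Set H} (hs : s ∈ S) (ht : t ∈ T) {h k : H}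
    (hh : h ∈ s) (hk : k ∈ t) (hA : A h k) : ConnL A (S ++ T) := by
  refine ⟨by simp [hS.1], fun c hc hc' => ?_⟩
  obtain ⟨c₁, c₂, rfl, rfl, rfl⟩ := List.map_eq_append_iff.1 hc
  have h₁ := hS.2 c₁ rfl fun x hx y hy =>
    hc' x (List.mem_append_left _ hx) y (List.mem_append_left _ hy)
  have h₂ := hT.2 c₂ rfl fun x hx y hy =>
    hc' x (List.mem_append_right _ hx) y (List.mem_append_right _ hy)
  obtain ⟨x, hx, rfl⟩ := List.mem_map.1 hs
  obtain ⟨y, hy, rfl⟩ := List.mem_map.1 ht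
  have h₃ := hc' x (List.mem_append_left _ hx) y (List.mem_append_right _ hy) h hh k hk hA
  have h₄ : ∀ z ∈ c₁ ++ c₂, z.2 = x.2 := by
    intro z hz
    rcases List.mem_append.1 hz with hz | hz
    · exact h₁ z hz x hx
    · exact (h₂ z hz y hy).trans h₃.symm
  exact fun z hz z' hz' => (h₄ z hz).trans (h₄ z' hz').symm

theorem loop_iff (A : Matching H) {s : Set H} {h k : H} (hh : h ∈ s) (hk : k ∈ s) (hA : A.Adj h k)
    (hS : (s :: S).Pairwise Disjoint) : ConnL A.Adj (s :: S) ↔ ConnL A.Adj (s \ {h, k} :: S) := by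
  have key : ∀ a ∈ s, ∀ t ∈ S, ∀ b ∈ t, A.Adj a b → a ∈ s \ {h, k} := by
    intro a ha t ht b hb e
    have hd := Set.disjoint_left.1 (List.pairwise_cons.1 hS |>.1 t ht)
    refine ⟨ha, ?_⟩
    rintro (rfl | rfl)
    · exact hd hk (A.unique hA e ▸ hb)
    · exact hd hh (A.unique (A.symm hA) e ▸ hb)
  constructor
  · refine fun H₀ => ⟨List.cons_ne_nil _ _, fun c hc hc' => ?_⟩
    obtain ⟨⟨_, b⟩, c, rfl, rfl, rfl⟩ := List.map_eq_cons_iff.1 hc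
    have := H₀.2 ((s, b) :: c) rfl ?_
    · simpa using this
    · simp only [List.mem_cons, forall_eq_or_imp] at hc' ⊢
      refine ⟨⟨by simp, fun y hy a ha b hb e => hc'.1.2 y hy a ?_ b hb e⟩,
        fun y hy => ⟨fun b hb a ha e => hc'.2 y hy |>.1 b hb a ?_ e, (hc'.2 y hy).2⟩⟩
      · exact key a ha y.1 (List.mem_map_of_mem hy) b hb e
      · exact key a ha y.1 (List.mem_map_of_mem hy) b hb (A.symm e)
  · refine fun H₀ => ⟨List.cons_ne_nil _ _, fun c hc hc' => ?_⟩
    obtain ⟨⟨_, b⟩, c, rfl, rfl, rfl⟩ := List.map_eq_cons_iff.1 hc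
    have := H₀.2 ((_, b) :: c) rfl ?_
    · simpa using this
    · simp only [List.mem_cons, forall_eq_or_imp] at hc' ⊢
      exact ⟨⟨by simp, fun y hy a ha b hb e => hc'.1.2 y hy a ha.1 b hb e⟩,
        fun y hy => ⟨fun b hb a ha e => (hc'.2 y hy).1 b hb a ha.1 e, (hc'.2 y hy).2⟩⟩

theorem edge_iff (A : Matching H) {s t : Set H} {h k : H} (hh : h ∈ s) (hk : k ∈ t)
    (hA : A.Adj h k) (hS : (s :: t :: S).Pairwise Disjoint) :
    ConnL A.Adj (s :: t :: S) ↔ ConnL A.Adj ((s ∪ t) \ {h, k} :: S) := by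
  simp only [List.pairwise_cons, List.mem_cons, forall_eq_or_imp] at hS
  have key : ∀ a ∈ s ∪ t, ∀ u ∈ S, ∀ b ∈ u, A.Adj a b → a ∈ (s ∪ t) \ {h, k} := by
    intro a ha u hu b hb e
    refine ⟨ha, ?_⟩
    rintro (rfl | rfl)
    · exact Set.disjoint_left.1 (hS.2.1 u hu) hk (A.unique hA e ▸ hb)
    · exact Set.disjoint_left.1 (hS.1.2 u hu) hh (A.unique (A.symm hA) e ▸ hb)
  constructor
  · refine fun H₀ => ⟨List.cons_ne_nil _ _, fun c hc hc' => ?_⟩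
    obtain ⟨⟨_, b⟩, c, rfl, rfl, rfl⟩ := List.map_eq_cons_iff.1 hc
    have := H₀.2 ((s, b) :: (t, b) :: c) rfl ?_
    · simp only [List.mem_cons, forall_eq_or_imp] at this ⊢
      exact ⟨this.1.2, fun a ha => (this.2.2 a ha).2⟩
    · simp only [List.mem_cons, forall_eq_or_imp] at hc' ⊢
      have h₁ : ∀ y ∈ c, ∀ a ∈ s ∪ t, ∀ b' ∈ y.1, A.Adj a b' → b = y.2 := fun y hy a ha b' hb e =>
        hc'.1.2 y hy a (key a ha y.1 (List.mem_map_of_mem hy) b' hb e) b' hb e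
      refine ⟨⟨by simp, by simp, fun y hy a ha => h₁ y hy a (Or.inl ha)⟩,
        ⟨by simp, by simp, fun y hy a ha => h₁ y hy a (Or.inr ha)⟩,
        fun y hy => ⟨fun b' hb a ha e => (h₁ y hy a (Or.inl ha) b' hb (A.symm e)).symm,
          fun b' hb a ha e => (h₁ y hy a (Or.inr ha) b' hb (A.symm e)).symm, (hc'.2 y hy).2⟩⟩
  · refine fun H₀ => ⟨List.cons_ne_nil _ _, fun c hc hc' => ?_⟩
    obtain ⟨⟨_, b⟩, c, rfl, rfl, hc₂⟩ := List.map_eq_cons_iff.1 hc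
    obtain ⟨⟨_, b₂⟩, c, rfl, rfl, rfl⟩ := List.map_eq_cons_iff.1 hc₂
    simp only [List.mem_cons, forall_eq_or_imp] at hc'
    obtain rfl : b = b₂ := hc'.1.2.1 h hh k hk hA
    have := H₀.2 ((_, b) :: c) rfl ?_
    · simp only [List.mem_cons, forall_eq_or_imp] at this ⊢
      exact ⟨⟨by simp, by simp, this.1.2⟩, ⟨by simp, by simp, this.1.2⟩,
        fun a ha => ⟨(this.2 a ha).1, this.2 a ha⟩⟩
    · simp only [List.mem_cons, forall_eq_or_imp]
      refine ⟨⟨by simp, fun y hy a ha => ?_⟩, fun y hy => ⟨fun a ha b' hb => ?_,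
        (hc'.2.2 y hy).2.2⟩⟩
      · exact ha.1.elim (hc'.1.2.2 y hy a) (hc'.2.1.2.2 y hy a)
      · exact hb.1.elim ((hc'.2.2 y hy).1 a ha b') ((hc'.2.2 y hy).2.1 a ha b')

end ConnL

/-! ### Twisted sewing -/

/-- The twisted sewing of the half-edges `h` and `k`, followed by `f`. -/
def sew (h k : H) (L : List (Cor P H)) (f : List (Cor P H) → M) : M :=
  der (act h) 1 L fun l => ctr h k l f

theorem Compat.sew {f : List (Cor P H) → M} (hf : Compat f) (h k : H) :
    Compat fun l => sew h k l f :=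
  (hf.ctr h k).der (isLin_act h)

theorem sew_map (h k : H) {N : Type*} [AddCommGroup N] [Module ℚ N] (Λ : M →ₗ[ℚ] N)
    (l : List (Cor P H)) (f : List (Cor P H) → M) : sew h k l (fun l' => Λ (f l')) = Λ (sew h k l f) := by
  simp only [sew, ctr_map, der_map]

theorem sew_add (h k : H) (l : List (Cor P H)) (f g : List (Cor P H) → M) :
    sew h k l (fun l' => f l' + g l') = sew h k l f + sew h k l g := by
  simp only [sew, ctr_add, der_add]

theorem sew_smul (h k : H) (l : List (Cor P H)) (c : ℚ) (f : List (Cor P H) → M) :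
    sew h k l (fun l' => c • f l') = c • sew h k l f := by
  simp only [sew, ctr_smul, der_smul]

theorem sew_fun_zero (h k : H) (l : List (Cor P H)) : sew h k l (fun _ => (0 : M)) = 0 := by
  simpa using sew_smul h k l 0 (fun _ => (0 : M))

theorem sew_sum (h k : H) (l : List (Cor P H)) {ι : Type*} (s : Finset ι)
    (f : ι → List (Cor P H) → M) :
    sew h k l (fun l' => ∑ i ∈ s, f i l') = ∑ i ∈ s, sew h k l (f i) := by
  classical
  induction s using Finset.induction_on with
  | empty => simp [sew_fun_zero]
  | insert a s ha ih => simp only [Finset.sum_insert ha, sew_add, ih]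

theorem der_act_eq_zero {h : H} {f : List (Cor P H) → M} (hf : Compat f) {L : List (Cor P H)}
    (hL : h ∉ labels L) : der (act h) 1 L f = 0 :=
  der_eq_zero hf fun x hx => act_of_notMem fun e => hL (mem_labels.2 ⟨x, hx, e⟩)

theorem der_act_cons {h : H} {f : List (Cor P H) → M} (hf : Compat f) {x : Cor P H}
    {L : List (Cor P H)} (hL : h ∉ labels L) : der (act h) 1 (x :: L) f = f (act h x :: L) := by
  rw [der_cons, der_act_eq_zero (hf.cons x) hL, smul_zero, add_zero]

theorem sew_loop {h k : H} {f : List (Cor P H) → M} (hf : Compat f) {x : Cor P H}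
    {L : List (Cor P H)} (hh : h ∉ labels L) (hk : k ∉ labels L) :
    sew h k (x :: L) f = f (loop h k (act h x) :: L) := by
  rw [sew, der_act_cons (hf.ctr h k) hh, ctr_loop hf hh hk]

theorem sew_edge {h k : H} {f : List (Cor P H) → M} (hf : Compat f) {x y : Cor P H}
    {L : List (Cor P H)} (hh : h ∉ labels (y :: L)) (hk : k ∉ labels L) (hx : k ∉ x.legs) :
    sew h k (x :: y :: L) f = f (glue h k (act h x) y :: L) := by
  rw [sew, der_act_cons (hf.ctr h k) hh, ctr_edge (x := act h x) hf hh hk hx]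

theorem sew_eq_zero {h k : H} {f : List (Cor P H) → M} (hf : Compat f) {L : List (Cor P H)}
    (hL : h ∉ labels L ∨ k ∉ labels L) : sew h k L f = 0 := by
  rcases hL with hL | hL
  · exact der_act_eq_zero (hf.ctr h k) hL
  · refine der_vanish L fun l₁ x l₂ e => ctr_eq_zero' hf ?_
    subst e
    simpa only [labels_append, labels_cons, show (act h x).legs = x.legs from rfl] using hL

theorem sew_self {h : H} {f : List (Cor P H) → M} (hf : Compat f) {L : List (Cor P H)}
    (hL : Disj L) : sew h h L f = 0 := by
  by_cases hh : h ∈ labels L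
  · obtain ⟨x, hx, hx'⟩ := mem_labels.1 hh
    obtain ⟨l, hl⟩ := perm_cons_of_mem hx
    obtain ⟨s, -, hs⟩ := exists_sign_of_perm hl
    have nh := (hL.perm hl).notMem hx'
    rw [hs _ (hf.sew h h), sew_loop hf nh nh,
      hf.eq_zero (loop_dec_eq_zero fun e => e.2.2 rfl), smul_zero]
  · exact sew_eq_zero hf (Or.inl hh)

/-- A twisted sewing is zero or, up to a factor, the value at a single list. -/
theorem sew_cases (h k : H) {L : List (Cor P H)} (hL : Disj L) :
    (∀ {M : Type w} [AddCommGroup M] [Module ℚ M] (f : List (Cor P H) → M), Compat f →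
      sew h k L f = 0) ∨
    ∃ (s : ℚ) (L' : List (Cor P H)),
      (∀ {M : Type w} [AddCommGroup M] [Module ℚ M] (f : List (Cor P H) → M), Compat f →
        sew h k L f = s • f L') ∧
      h ≠ k ∧ h ∈ labels L ∧ k ∈ labels L ∧ Disj L' ∧ labels L' = labels L \ {h, k} ∧
      degSum L' = degSum L + 1 ∧ ∀ A : Matching H, A.Adj h k →
        (ConnL A.Adj (L.map Cor.legs) ↔ ConnL A.Adj (L'.map Cor.legs)) := by
  by_cases hne : h = k
  · subst hne
    exact Or.inl fun f hf => sew_self hf hL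
  by_cases hh : h ∈ labels L
  swap
  · exact Or.inl fun f hf => sew_eq_zero hf (Or.inl hh)
  by_cases hk : k ∈ labels L
  swap
  · exact Or.inl fun f hf => sew_eq_zero hf (Or.inr hk)
  right
  obtain ⟨x, hx, mx⟩ := mem_labels.1 hh
  obtain ⟨l, hl⟩ := perm_cons_of_mem hx
  by_cases mk : k ∈ x.legs
  · have hd := hL.perm hl
    obtain ⟨s, -, hs⟩ := exists_sign_of_perm hl
    refine ⟨s, loop h k (act h x) :: l, fun f hf => ?_, hne, hh, hk, ?_, ?_, ?_, fun A hA => ?_⟩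
    · rw [hs _ (hf.sew h k), sew_loop hf (hd.notMem mx) (hd.notMem mk)]
    · rw [disj_cons] at hd ⊢
      exact ⟨hd.1.mono_left Set.sdiff_subset, hd.2⟩
    · have n₁ := hd.notMem mx
      have n₂ := hd.notMem mk
      rw [labels_perm hl, labels_cons, labels_cons]
      ext a
      simp only [loop, act, Set.mem_union, Set.mem_sdiff, Set.mem_insert_iff,
        Set.mem_singleton_iff]
      have : a ∈ labels l → a ≠ h ∧ a ≠ k := fun ha =>
        ⟨fun e => n₁ (e ▸ ha), fun e => n₂ (e ▸ ha)⟩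
      tauto
    · have := (hl.map Cor.deg).sum_eq
      simp only [degSum, List.map_cons, List.sum_cons, this, loop, act]
      ring
    · rw [ConnL.perm_iff (hl.map Cor.legs)]
      exact ConnL.loop_iff A mx mk hA hd
  · obtain ⟨y, hy, my⟩ := mem_labels.1 hk
    have hyx : y ≠ x := fun e => mk (e ▸ my)
    obtain ⟨l', hl'⟩ := perm_cons_of_mem_of_ne (hl.mem_iff.1 hy) hyx
    have hp := hl.trans (hl'.cons x)
    have hd := hL.perm hp
    obtain ⟨s, -, hs⟩ := exists_sign_of_perm hp
    have hd₂ := (disj_cons.1 hd).2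
    refine ⟨s, glue h k (act h x) y :: l', fun f hf => ?_, hne, hh, hk, ?_, ?_, ?_, fun A hA => ?_⟩
    · rw [hs _ (hf.sew h k), sew_edge hf (hd.notMem mx) (hd₂.notMem my) mk]
    · have h₁ := disj_cons.1 hd
      rw [labels_cons, Set.disjoint_union_right] at h₁
      rw [disj_cons] at hd₂ ⊢
      exact ⟨(h₁.1.2.union_left hd₂.1).mono_left Set.sdiff_subset, hd₂.2⟩
    · have n₁ := hd.notMem mx
      have n₂ := hd₂.notMem my
      rw [labels_cons] at n₁
      rw [labels_perm hp, labels_cons, labels_cons, labels_cons]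
      ext a
      simp only [glue, act, Set.mem_union, Set.mem_sdiff, Set.mem_insert_iff,
        Set.mem_singleton_iff]
      have : a ∈ labels l' → a ≠ h ∧ a ≠ k := fun ha =>
        ⟨fun e => n₁ (e ▸ Or.inr ha), fun e => n₂ (e ▸ ha)⟩
      tauto
    · have := (hp.map Cor.deg).sum_eq
      simp only [degSum, List.map_cons, List.sum_cons, this, glue, act]
      ring
    · rw [ConnL.perm_iff (hp.map Cor.legs)]
      exact ConnL.edge_iff A mx my hA hd

theorem sew_symm {f : List (Cor P H) → M} (hf : Compat f) (h k : H) {L : List (Cor P H)}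
    (hL : Disj L) : sew k h L f = sew h k L f := by
  by_cases hh : h ∈ labels L
  swap
  · rw [sew_eq_zero hf (Or.inl hh), sew_eq_zero hf (Or.inr hh)]
  by_cases hk : k ∈ labels L
  swap
  · rw [sew_eq_zero hf (Or.inl hk), sew_eq_zero hf (Or.inr hk)]
  obtain ⟨x, hx, mx⟩ := mem_labels.1 hh
  obtain ⟨l, hl⟩ := perm_cons_of_mem hx
  by_cases mk : k ∈ x.legs
  · have hd := hL.perm hl
    obtain ⟨s, -, hs⟩ := exists_sign_of_perm hl
    rw [hs _ (hf.sew h k), hs _ (hf.sew k h), sew_loop hf (hd.notMem mx) (hd.notMem mk),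
      sew_loop hf (hd.notMem mk) (hd.notMem mx), loop_act k h, loop_symm h k]
  · obtain ⟨y, hy, my⟩ := mem_labels.1 hk
    have hyx : y ≠ x := fun e => mk (e ▸ my)
    obtain ⟨l', hl'⟩ := perm_cons_of_mem_of_ne (hl.mem_iff.1 hy) hyx
    have hp := hl.trans (hl'.cons x)
    have hd := hL.perm hp
    obtain ⟨s, -, hs⟩ := exists_sign_of_perm hp
    have hd₂ := (disj_cons.1 hd).2
    have n₁ := hd.notMem mx
    have nk := hd₂.notMem my
    have n₂ : k ∉ labels (x :: l') := by
      rw [labels_cons]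
      exact fun e => e.elim mk nk
    rw [labels_cons, Set.mem_union, not_or] at n₁
    rw [hs _ (hf.sew h k), hs _ (hf.sew k h), (hf.sew k h).swap_head,
      sew_edge hf (hd.notMem mx) nk mk, sew_edge hf n₂ n₁.2 n₁.1, Cor.glue_comm h k x (act k y),
      hf.cor_smul, hf.glue_act h k x y]
    simp only [act, mul_add, mul_one, sgn_add, smul_smul]
    congr 2
    rw [← mul_assoc, sgn_mul_self, one_mul]

theorem Disj.der {θ : Cor P H → Cor P H} (hθ : ∀ x, (θ x).legs = x.legs) {l₁ l₂ : List (Cor P H)}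
    {x : Cor P H} (h : Disj (l₁ ++ x :: l₂)) : Disj (l₁ ++ θ x :: l₂) := by
  simpa only [Disj, List.map_append, List.map_cons, hθ] using h

theorem sew_sew {f : List (Cor P H) → M} (hf : Compat f) (h k h' k' : H) {L : List (Cor P H)}
    (hL : Disj L) :
    sew h k L (fun l => sew h' k' l f) = -sew h' k' L (fun l => sew h k l f) := by
  by_cases hd : h = h' ∨ h = k' ∨ k = h' ∨ k = k'
  · have key : ∀ a b a' b' : H, (a = a' ∨ a = b' ∨ b = a' ∨ b = b') →
        sew a b L (fun l => sew a' b' l f) = 0 := by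
      intro a b a' b' e
      rcases sew_cases a b hL with h₀ | ⟨s, L', h₁, -, -, -, -, h₂, -⟩
      · exact h₀ _ (hf.sew a' b')
      · rw [h₁ _ (hf.sew a' b'), sew_eq_zero hf, smul_zero]
        rw [h₂]
        by_contra! hc
        rcases e with rfl | rfl | rfl | rfl
        · exact hc.1.2 (Or.inl rfl)
        · exact hc.2.2 (Or.inl rfl)
        · exact hc.1.2 (Or.inr rfl)
        · exact hc.2.2 (Or.inr rfl)
    rw [key h k h' k' hd, key h' k' h k (by tauto), neg_zero]
  · simp only [not_or] at hd
    by_cases e : h = k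
    · subst e
      rw [sew_self (hf.sew h' k') hL]
      rcases sew_cases h' k' hL with h₀ | ⟨s, L', h₁, -, -, -, h₃, -⟩
      · rw [h₀ _ (hf.sew h h), neg_zero]
      · rw [h₁ _ (hf.sew h h), sew_self hf h₃, smul_zero, neg_zero]
    by_cases e' : h' = k'
    · subst e'
      rw [sew_self (hf.sew h k) hL]
      rcases sew_cases h k hL with h₀ | ⟨s, L', h₁, -, -, -, h₃, -⟩
      · rw [h₀ _ (hf.sew h' h'), neg_zero]
      · rw [h₁ _ (hf.sew h' h'), sew_self hf h₃, smul_zero, neg_zero]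
    simp only [sew]
    simp only [ctr_act (Ne.symm hd.1) (Ne.symm hd.2.2.1) (hf.ctr h' k'),
      ctr_act hd.1 hd.2.1 (hf.ctr h k)]
    rw [der_act_act h h' ((hf.ctr h' k').ctr h k)]
    congr 1
    refine der_congr _ _ _ fun l₁ x l₂ e₁ => der_congr _ _ _ fun l₃ y l₄ e₂ => ?_
    have h₁ : Disj (l₁ ++ act h' x :: l₂) := Disj.der (θ := act h') (x := x) (fun _ => rfl) (by rw [← e₁]; exact hL)
    have h₂ : Disj (l₃ ++ act h y :: l₄) := Disj.der (θ := act h) (x := y) (fun _ => rfl) (by rw [← e₂]; exact h₁)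
    exact ctrComm h₂ e e' hd.1 hd.2.1 hd.2.2.1 hd.2.2.2 f hf

theorem sew_bd {f : List (Cor P H) → M} (hf : Compat f) (h k : H) (L : List (Cor P H)) :
    sew h k L (fun l => der bd (-1) l f) = -der bd (-1) L (fun l => sew h k l f) := by
  simp only [sew, ctr_bd h k hf, der_bd_act h (hf.ctr h k), neg_neg]

theorem sew_act {f : List (Cor P H) → M} (hf : Compat f) {h k m : H} (hm : m ≠ h) (hm' : m ≠ k)
    (L : List (Cor P H)) :
    sew h k L (fun l => der (act m) 1 l f) = -der (act m) 1 L (fun l => sew h k l f) := by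
  simp only [sew, ctr_act hm hm' hf, der_act_act m h (hf.ctr h k), neg_neg]

theorem der_act_self {f : List (Cor P H) → M} (hf : Compat f) (h : H) (L : List (Cor P H)) :
    der (act h) 1 L (fun l => der (act h) 1 l f) = 0 := by
  have := der_act_act h h hf L
  have h₂ : (2 : ℚ) • der (act h) 1 L (fun l => der (act h) 1 l f) = 0 := by
    rw [two_smul]
    nth_rewrite 1 [this]
    simp
  exact (smul_eq_zero.1 h₂).resolve_left two_ne_zero

theorem act_sew_left {f : List (Cor P H) → M} (hf : Compat f) (h k : H) (L : List (Cor P H)) :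
    der (act h) 1 L (fun l => sew h k l f) = 0 := der_act_self (hf.ctr h k) h L

theorem act_sew_right {f : List (Cor P H) → M} (hf : Compat f) (h k : H) {L : List (Cor P H)}
    (hL : Disj L) : der (act k) 1 L (fun l => sew h k l f) = 0 := by
  rw [der_congr (g := fun l => sew k h l f), act_sew_left hf]
  exact fun l₁ x l₂ e => sew_symm hf k h (Disj.der (θ := act k) (x := x) (fun _ => rfl) (by rw [← e]; exact hL))

/-! ### Operators on decorated lists -/

/-- The elements of a finite type. -/
def allOf (H : Type) [Finite H] : Finset H := @Finset.univ H (Fintype.ofFinite H)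

@[simp] theorem mem_allOf (h : H) : h ∈ allOf H := by simp [allOf]

open Classical in
/-- `∑ u_h B_h`, followed by `f`. -/
def opU (p : H → ℕ) (L : List (Cor P H)) (f : (H → ℕ) → List (Cor P H) → M) : M :=
  ∑ h ∈ allOf H, if p h ≠ 0 then der (act h) 1 L (f (Function.update p h (p h - 1))) else 0

/-- `∂ + uB`, followed by `f`. -/
def opI (p : H → ℕ) (L : List (Cor P H)) (f : (H → ℕ) → List (Cor P H) → M) : M :=
  der bd (-1) L (f p) + opU p L f

open Classical in
/-- The sum of the twisted sewings of all ordered pairs of half-edges related by `R`, followed by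
`f`. -/
def opS (R : H → H → Prop) (p : H → ℕ) (L : List (Cor P H)) (f : (H → ℕ) → List (Cor P H) → M) : M :=
  ∑ h ∈ allOf H, ∑ k ∈ allOf H,
    if R h k ∧ p h = 0 ∧ p k = 0 then sew h k L (f p) else 0

variable {f : (H → ℕ) → List (Cor P H) → M} (hf : ∀ p, Compat (f p))

theorem opU_map (p : H → ℕ) {N : Type*} [AddCommGroup N] [Module ℚ N] (Λ : M →ₗ[ℚ] N)
    (L : List (Cor P H)) (f : (H → ℕ) → List (Cor P H) → M) :
    opU p L (fun p' l => Λ (f p' l)) = Λ (opU p L f) := by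
  simp only [opU, der_map, map_sum]
  refine Finset.sum_congr rfl fun h _ => ?_
  split_ifs <;> simp

theorem opI_map (p : H → ℕ) {N : Type*} [AddCommGroup N] [Module ℚ N] (Λ : M →ₗ[ℚ] N)
    (L : List (Cor P H)) (f : (H → ℕ) → List (Cor P H) → M) :
    opI p L (fun p' l => Λ (f p' l)) = Λ (opI p L f) := by
  simp only [opI, opU_map, der_map, map_add]

theorem opS_map (R : H → H → Prop) (p : H → ℕ) {N : Type*} [AddCommGroup N] [Module ℚ N]
    (Λ : M →ₗ[ℚ] N) (L : List (Cor P H)) (f : (H → ℕ) → List (Cor P H) → M) :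
    opS R p L (fun p' l => Λ (f p' l)) = Λ (opS R p L f) := by
  simp only [opS, sew_map, map_sum]
  refine Finset.sum_congr rfl fun h _ => Finset.sum_congr rfl fun k _ => ?_
  split_ifs <;> simp

theorem opU_add (p : H → ℕ) (L : List (Cor P H)) (f g : (H → ℕ) → List (Cor P H) → M) :
    opU p L (fun p' l => f p' l + g p' l) = opU p L f + opU p L g := by
  simp only [opU, der_add, ← Finset.sum_add_distrib]
  refine Finset.sum_congr rfl fun h _ => ?_
  split_ifs <;> simp

theorem opI_add (p : H → ℕ) (L : List (Cor P H)) (f g : (H → ℕ) → List (Cor P H) → M) :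
    opI p L (fun p' l => f p' l + g p' l) = opI p L f + opI p L g := by
  simp only [opI, opU_add, der_add]
  abel

theorem opS_add (R : H → H → Prop) (p : H → ℕ) (L : List (Cor P H))
    (f g : (H → ℕ) → List (Cor P H) → M) :
    opS R p L (fun p' l => f p' l + g p' l) = opS R p L f + opS R p L g := by
  simp only [opS, sew_add, ← Finset.sum_add_distrib]
  refine Finset.sum_congr rfl fun h _ => Finset.sum_congr rfl fun k _ => ?_
  split_ifs <;> simp

theorem opI_smul (p : H → ℕ) (L : List (Cor P H)) (c : ℚ) (f : (H → ℕ) → List (Cor P H) → M) :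
    opI p L (fun p' l => c • f p' l) = c • opI p L f := opI_map p (LinearMap.lsmul ℚ M c) L f

theorem opS_smul (R : H → H → Prop) (p : H → ℕ) (L : List (Cor P H)) (c : ℚ)
    (f : (H → ℕ) → List (Cor P H) → M) :
    opS R p L (fun p' l => c • f p' l) = c • opS R p L f :=
  opS_map R p (LinearMap.lsmul ℚ M c) L f

theorem opI_sum (p : H → ℕ) (L : List (Cor P H)) {ι : Type*} (s : Finset ι)
    (f : ι → (H → ℕ) → List (Cor P H) → M) :
    opI p L (fun p' l => ∑ i ∈ s, f i p' l) = ∑ i ∈ s, opI p L (f i) := by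
  classical
  induction s using Finset.induction_on with
  | empty => simpa using opI_smul p L 0 (fun _ _ => (0 : M))
  | insert a s ha ih => simp only [Finset.sum_insert ha, opI_add, ih]

theorem opS_sum (R : H → H → Prop) (p : H → ℕ) (L : List (Cor P H)) {ι : Type*} (s : Finset ι)
    (f : ι → (H → ℕ) → List (Cor P H) → M) :
    opS R p L (fun p' l => ∑ i ∈ s, f i p' l) = ∑ i ∈ s, opS R p L (f i) := by
  classical
  induction s using Finset.induction_on with
  | empty => simpa using opS_smul R p L 0 (fun _ _ => (0 : M))
  | insert a s ha ih => simp only [Finset.sum_insert ha, opS_add, ih]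

include hf

theorem compat_opU (p : H → ℕ) : Compat fun L => opU p L f := by
  refine Compat.fun_sum _ fun h _ => ?_
  split_ifs
  · exact (hf _).der (isLin_act h)
  · exact Compat.fun_zero

theorem compat_opI (p : H → ℕ) : Compat fun L => opI p L f :=
  ((hf p).der isLin_bd).fun_add (compat_opU hf p)

theorem compat_opS (R : H → H → Prop) (p : H → ℕ) : Compat fun L => opS R p L f := by
  refine Compat.fun_sum _ fun h _ => Compat.fun_sum _ fun k _ => ?_
  split_ifs
  · exact (hf p).sew h k
  · exact Compat.fun_zero

theorem opI_opI (p : H → ℕ) (L : List (Cor P H)) :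
    opI p L (fun p' l => opI p' l f) = 0 := by
  classical
  have h₁ : opU p L (fun p' l => der bd (-1) l (f p')) =
      -der bd (-1) L (fun l => opU p l f) := by
    simp only [opU, der_sum, ← Finset.sum_neg_distrib]
    refine Finset.sum_congr rfl fun h _ => ?_
    by_cases hp : p h = 0
    · simp [hp, der_fun_zero]
    · simp only [ne_eq, hp, not_false_eq_true, if_true]
      rw [der_bd_act h (hf _), neg_neg]
  have h₂ : opU p L (fun p' l => opU p' l f) = 0 := by
    have e : opU p L (fun p' l => opU p' l f) = ∑ h ∈ allOf H, ∑ k ∈ allOf H,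
        if p h ≠ 0 ∧ Function.update p h (p h - 1) k ≠ 0 then
          der (act h) 1 L (fun l => der (act k) 1 l (f (Function.update
            (Function.update p h (p h - 1)) k (Function.update p h (p h - 1) k - 1)))) else 0 := by
      simp only [opU, der_sum]
      refine Finset.sum_congr rfl fun h _ => ?_
      by_cases hp : p h = 0
      · simp [hp]
      · simp only [ne_eq, hp, not_false_eq_true, if_true, true_and]
        refine Finset.sum_congr rfl fun k _ => ?_
        split_ifs
        · exact der_fun_zero _ _ _
        · rfl
    have e' : opU p L (fun p' l => opU p' l f) = -opU p L (fun p' l => opU p' l f) := by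
      rw [e]
      conv_lhs => rw [Finset.sum_comm]
      rw [← Finset.sum_neg_distrib]
      refine Finset.sum_congr rfl fun h _ => ?_
      rw [← Finset.sum_neg_distrib]
      refine Finset.sum_congr rfl fun k _ => ?_
      by_cases hk : k = h
      · subst hk
        split_ifs
        · exact der_act_act _ _ (hf _) L
        · simp
      · have hk' : h ≠ k := Ne.symm hk
        simp only [Function.update_of_ne hk', Function.update_of_ne hk, and_comm (a := p h ≠ 0)]
        rw [Function.update_comm hk]
        split_ifs
        · exact der_act_act _ _ (hf _) L
        · simp
    have h₂ : (2 : ℚ) • opU p L (fun p' l => opU p' l f) = 0 := by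
      rw [two_smul]
      nth_rewrite 1 [e']
      simp
    exact (smul_eq_zero.1 h₂).resolve_left two_ne_zero
  have h₃ : opI p L (fun p' l => opI p' l f) =
      der bd (-1) L (fun l => der bd (-1) l (f p)) + der bd (-1) L (fun l => opU p l f) +
        (opU p L (fun p' l => der bd (-1) l (f p')) + opU p L (fun p' l => opU p' l f)) := by
    simp only [opI, der_add, opU_add]
  rw [h₃, h₁, h₂, der_bd_bd (hf p)]
  simp

theorem opI_opS (R : H → H → Prop) (p : H → ℕ) {L : List (Cor P H)} (hL : Disj L) :
    opI p L (fun p' l => opS R p' l f) = -opS R p L (fun p' l => opI p' l f) := by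
  classical
  have h₁ : der bd (-1) L (fun l => opS R p l f) =
      -opS R p L (fun p' l => der bd (-1) l (f p')) := by
    simp only [opS, der_sum, ← Finset.sum_neg_distrib]
    refine Finset.sum_congr rfl fun h _ => Finset.sum_congr rfl fun k _ => ?_
    split_ifs
    · rw [sew_bd (hf p), neg_neg]
    · simp [der_fun_zero]
  have h₂ : opU p L (fun p' l => opS R p' l f) = -opS R p L (fun p' l => opU p' l f) := by
    have e₁ : opU p L (fun p' l => opS R p' l f) = ∑ h ∈ allOf H, ∑ k ∈ allOf H, ∑ m ∈ allOf H,
        if p m ≠ 0 ∧ R h k ∧ Function.update p m (p m - 1) h = 0 ∧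
          Function.update p m (p m - 1) k = 0 then
          der (act m) 1 L (fun l => sew h k l (f (Function.update p m (p m - 1)))) else 0 := by
      simp only [opU, opS, der_sum]
      have : ∀ m ∈ allOf H, (if p m ≠ 0 then ∑ h ∈ allOf H, ∑ k ∈ allOf H, der (act m) 1 L
          (fun l => if R h k ∧ Function.update p m (p m - 1) h = 0 ∧
            Function.update p m (p m - 1) k = 0 then sew h k l (f (Function.update p m (p m - 1)))
            else 0) else 0) = ∑ h ∈ allOf H, ∑ k ∈ allOf H,
          if p m ≠ 0 ∧ R h k ∧ Function.update p m (p m - 1) h = 0 ∧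
            Function.update p m (p m - 1) k = 0 then
            der (act m) 1 L (fun l => sew h k l (f (Function.update p m (p m - 1)))) else 0 := by
        intro m _
        by_cases hp : p m = 0
        · simp [hp]
        · simp only [ne_eq, hp, not_false_eq_true, if_true, true_and]
          refine Finset.sum_congr rfl fun h _ => Finset.sum_congr rfl fun k _ => ?_
          split_ifs
          · rfl
          · exact der_fun_zero _ _ _
      rw [Finset.sum_congr rfl this, Finset.sum_comm]
      exact Finset.sum_congr rfl fun h _ => Finset.sum_comm
    rw [e₁]
    simp only [opS, ← Finset.sum_neg_distrib]
    refine Finset.sum_congr rfl fun h _ => Finset.sum_congr rfl fun k _ => ?_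
    by_cases hc : R h k ∧ p h = 0 ∧ p k = 0
    · obtain ⟨hR, hh, hk⟩ := hc
      simp only [hR, hh, hk, true_and, and_true, if_true, opU, sew_sum, ← Finset.sum_neg_distrib]
      refine Finset.sum_congr rfl fun m _ => ?_
      by_cases hm : p m = 0
      · simp [hm, sew_fun_zero]
      · have n₁ : m ≠ h := fun e => hm (e ▸ hh)
        have n₂ : m ≠ k := fun e => hm (e ▸ hk)
        simp only [Function.update_of_ne n₁.symm, Function.update_of_ne n₂.symm, hh, hk, ne_eq, hm,
          not_false_eq_true, and_self, if_true]
        rw [sew_act (hf _) n₁ n₂, neg_neg]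
    · rw [if_neg hc, neg_zero]
      refine Finset.sum_eq_zero fun m _ => ?_
      split_ifs with h'
      · by_cases n₁ : m = h
        · subst n₁
          exact act_sew_left (hf _) _ _ _
        · by_cases n₂ : m = k
          · subst n₂
            exact act_sew_right (hf _) _ _ hL
          · rw [Function.update_of_ne (Ne.symm n₁), Function.update_of_ne (Ne.symm n₂)] at h'
            exact absurd h'.2 hc
      · rfl
  have h₃ : opI p L (fun p' l => opS R p' l f) = der bd (-1) L (fun l => opS R p l f) +
      opU p L (fun p' l => opS R p' l f) := rfl
  have h₄ : opS R p L (fun p' l => opI p' l f) =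
      opS R p L (fun p' l => der bd (-1) l (f p')) + opS R p L (fun p' l => opU p' l f) := by
    simp only [opI, opS_add]
  rw [h₃, h₄, h₁, h₂, neg_add]

theorem opS_opS (R R' : H → H → Prop) (p : H → ℕ) {L : List (Cor P H)} (hL : Disj L) :
    opS R p L (fun p' l => opS R' p' l f) = -opS R' p L (fun p' l => opS R p' l f) := by
  classical
  have e : ∀ R R' : H → H → Prop, opS R p L (fun p' l => opS R' p' l f) =
      ∑ h ∈ allOf H, ∑ k ∈ allOf H, ∑ h' ∈ allOf H, ∑ k' ∈ allOf H,
        if (R h k ∧ p h = 0 ∧ p k = 0) ∧ R' h' k' ∧ p h' = 0 ∧ p k' = 0 then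
          sew h k L (fun l => sew h' k' l (f p)) else 0 := by
    intro R R'
    simp only [opS, sew_sum]
    refine Finset.sum_congr rfl fun h _ => Finset.sum_congr rfl fun k _ => ?_
    by_cases hc : R h k ∧ p h = 0 ∧ p k = 0
    · rw [if_pos hc]
      refine Finset.sum_congr rfl fun h' _ => Finset.sum_congr rfl fun k' _ => ?_
      by_cases hc' : R' h' k' ∧ p h' = 0 ∧ p k' = 0
      · simp only [if_pos hc', if_pos (And.intro hc hc')]
      · simp only [if_neg hc', if_neg fun e : _ ∧ _ => hc' e.2, sew_fun_zero]
    · rw [if_neg hc]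
      refine (Finset.sum_eq_zero fun h' _ => Finset.sum_eq_zero fun k' _ => ?_).symm
      rw [if_neg fun e => hc e.1]
  rw [e, e]
  have swap : ∀ F : H → H → H → H → M, (∑ h ∈ allOf H, ∑ k ∈ allOf H, ∑ h' ∈ allOf H,
      ∑ k' ∈ allOf H, F h k h' k') = ∑ h' ∈ allOf H, ∑ k' ∈ allOf H, ∑ h ∈ allOf H,
      ∑ k ∈ allOf H, F h k h' k' := by
    intro F
    have := Finset.sum_comm (s := allOf H ×ˢ allOf H) (t := allOf H ×ˢ allOf H)
      (f := fun x y => F x.1 x.2 y.1 y.2)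
    simpa only [Finset.sum_product] using this
  rw [swap]
  simp only [← Finset.sum_neg_distrib]
  refine Finset.sum_congr rfl fun h' _ => Finset.sum_congr rfl fun k' _ =>
    Finset.sum_congr rfl fun h _ => Finset.sum_congr rfl fun k _ => ?_
  by_cases hc : (R h k ∧ p h = 0 ∧ p k = 0) ∧ R' h' k' ∧ p h' = 0 ∧ p k' = 0
  · rw [if_pos hc, if_pos hc.symm]
    exact sew_sew (hf p) h k h' k' hL
  · rw [if_neg hc, if_neg fun e => hc e.symm, neg_zero]

end

noncomputable section

open Cor

/-! ### Enumerations of linearly ordered finite types -/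

/-- The elements of a finite linear order, in increasing order. -/
def enum (V : Type) [Finite V] [LinearOrder V] : List V := (allOf V).sort (· ≤ ·)

section Enum

variable {V : Type} [Finite V] [LinearOrder V]

theorem enum_pairwise : (enum V).Pairwise (· < ·) := Finset.sortedLT_sort _ |>.pairwise

@[simp] theorem mem_enum (v : V) : v ∈ enum V := by simp [enum]

theorem enum_nodup : (enum V).Nodup := enum_pairwise.imp ne_of_lt

theorem eq_enum {l : List V} (h : l.Pairwise (· < ·)) (hm : ∀ v, v ∈ l) : l = enum V :=
  h.eq_of_mem_iff enum_pairwise fun v => by simp [hm]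

theorem enum_fin (n : ℕ) : enum (Fin n) = List.finRange n :=
  (eq_enum (List.pairwise_lt_finRange n) fun v => List.mem_finRange v).symm

theorem finsum_eq_enum {N : Type*} [AddCommMonoid N] (f : V → N) :
    ∑ᶠ v, f v = ((enum V).map f).sum := by
  classical
  rw [← List.sum_toFinset f enum_nodup, finsum_eq_sum_of_support_subset]
  intro v _
  simp

theorem finsum_allOf {V : Type} [Finite V] {N : Type*} [AddCommMonoid N] (f : V → N) :
    ∑ᶠ v, f v = ∑ v ∈ allOf V, f v :=
  finsum_eq_sum_of_support_subset f fun v _ => by simp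

end Enum

theorem List.sum_map_congr {α N : Type*} [AddCommMonoid N] {l : List α} {f g : α → N}
    (h : ∀ a ∈ l, f a = g a) : (l.map f).sum = (l.map g).sum := by
  rw [List.map_congr_left h]

theorem List.sum_map_smul' {α N : Type*} [AddCommMonoid N] [DistribMulAction ℚ N] (c : ℚ)
    (l : List α) (f : α → N) : (l.map fun a => c • f a).sum = c • (l.map f).sum := by
  induction l with
  | nil => simp
  | cons a l ih => simp [ih]

variable {P : S1FramedModularOperad.{u}} {H : Type} [Finite H]
variable {M : Type w} [AddCommGroup M] [Module ℚ M]

/-! ### Reordering blocks -/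

theorem Compat.cons_append {f : List (Cor P H) → M} (hf : Compat f) (x : Cor P H)
    (b l : List (Cor P H)) :
    f (x :: (b ++ l)) = sgn (x.deg * degSum b) • f (b ++ x :: l) := by
  induction b generalizing f with
  | nil => simp [sgn_zero]
  | cons y b ih =>
    rw [List.cons_append, hf.swap_head, ih (hf.cons y), smul_smul, ← sgn_add, degSum_cons, mul_add]
    rfl

theorem Compat.append_swap {f : List (Cor P H) → M} (hf : Compat f) (a b l : List (Cor P H)) :
    f (a ++ (b ++ l)) = sgn (degSum a * degSum b) • f (b ++ (a ++ l)) := by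
  induction a generalizing f with
  | nil => simp [sgn_zero]
  | cons x a ih =>
    rw [List.cons_append, ih (hf.cons x), hf.cons_append, smul_smul, ← sgn_add, degSum_cons,
      add_mul, add_comm]
    rfl

section Blocks

variable {V : Type} [LinearOrder V] (c : V → List (Cor P H))

/-- The sign exponent of moving block `v` to the front. -/
def frontExp (vs : List V) (v : V) : ℤ :=
  (vs.map fun w => if w < v then degSum (c v) * degSum (c w) else 0).sum

theorem frontExp_cons (vs : List V) (v w : V) :
    frontExp c (w :: vs) v = (if w < v then degSum (c v) * degSum (c w) else 0) +
      frontExp c vs v := by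
  simp [frontExp]

theorem frontExp_eq_zero {vs : List V} {v : V} (h : ∀ w ∈ vs, v < w) : frontExp c vs v = 0 := by
  unfold frontExp
  rw [List.sum_map_congr (g := fun _ => 0) fun w hw => if_neg (h w hw).le.not_gt]
  simp

theorem Compat.front {f : List (Cor P H) → M} (hf : Compat f) {vs : List V}
    (hs : vs.Pairwise (· < ·)) {v : V} (hv : v ∈ vs) :
    f (vs.flatMap c) =
      sgn (frontExp c vs v) • f (c v ++ (vs.filter (· ≠ v)).flatMap c) := by
  induction vs generalizing f with
  | nil => cases hv
  | cons w vs ih =>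
    rw [List.pairwise_cons] at hs
    by_cases e : v = w
    · subst e
      have : vs.filter (· ≠ v) = vs :=
        List.filter_eq_self.2 fun a ha => by simpa using (hs.1 a ha).ne'
      rw [List.filter_cons_of_neg (by simp), this, frontExp_cons, frontExp_eq_zero c hs.1]
      simp [sgn_zero]
    · have hv' := (List.mem_cons.1 hv).resolve_left e
      rw [List.filter_cons_of_pos (by simpa using Ne.symm e), frontExp_cons, if_pos (hs.1 v hv'),
        List.flatMap_cons, List.flatMap_cons, ih (hf.append (c w)) hs.2 hv', hf.append_swap,
        smul_smul, ← sgn_add, add_comm, mul_comm (degSum (c w))]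

theorem der_blocks {f : List (Cor P H) → M} (hf : Compat f) {θ : Cor P H → Cor P H} {n : ℤ}
    (hθ : IsLin n θ) {vs : List V} (hs : vs.Pairwise (· < ·)) :
    der θ n (vs.flatMap c) f = (vs.map fun v => sgn (frontExp c vs v) •
      der θ n (c v) fun l => f (l ++ (vs.filter (· ≠ v)).flatMap c)).sum := by
  induction vs generalizing f with
  | nil => rfl
  | cons w vs ih =>
    rw [List.pairwise_cons] at hs
    have e : vs.filter (· ≠ w) = vs :=
      List.filter_eq_self.2 fun a ha => by simpa using (hs.1 a ha).ne'
    rw [List.flatMap_cons, der_append, ih (hf.append (c w)) hs.2, List.map_cons, List.sum_cons,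
      List.filter_cons_of_neg (by simp), e, frontExp_cons, frontExp_eq_zero c hs.1,
      ← List.sum_map_smul']
    simp only [lt_self_iff_false, if_false, add_zero, sgn_zero, one_smul]
    congr 1
    refine List.sum_map_congr fun v hv => ?_
    have hwv := hs.1 v hv
    rw [List.filter_cons_of_pos (by simpa using hwv.ne), frontExp_cons, if_pos hwv,
      List.flatMap_cons, smul_smul, ← der_smul, ← der_smul]
    refine der_congr _ _ _ fun l₁ x l₂ e => ?_
    have hd : degSum (l₁ ++ θ x :: l₂) = degSum (c v) + n := by
      rw [e]
      simp only [degSum_append, degSum_cons, hθ.deg]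
      ring
    rw [hf.append_swap (c w), hd, smul_smul]
    simp only [← sgn_add]
    congr 1
    apply sgn_congr
    ring_nf
    exact ⟨n * degSum (c w), by ring⟩

theorem exists_insert {l : List V} (hl : l.Pairwise (· < ·)) {v : V} (hv : v ∉ l) :
    ∃ l' : List V, l'.Pairwise (· < ·) ∧ l'.Perm (v :: l) ∧
      ∀ f : List (Cor P H) → M, Compat f →
        f (c v ++ l.flatMap c) = sgn (frontExp c l v) • f (l'.flatMap c) := by
  induction l with
  | nil => exact ⟨[v], List.pairwise_singleton _ _, .refl _, fun f _ => by simp [frontExp, sgn_zero]⟩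
  | cons w l ih =>
    have hl' := List.pairwise_cons.1 hl
    rw [List.mem_cons, not_or] at hv
    rcases lt_or_gt_of_ne hv.1 with h | h
    · have hlt : ∀ a ∈ w :: l, v < a := by
        intro a ha
        rcases List.mem_cons.1 ha with rfl | ha
        · exact h
        · exact h.trans (hl'.1 a ha)
      exact ⟨v :: w :: l, List.pairwise_cons.2 ⟨hlt, hl⟩, .refl _, fun f _ => by
        rw [frontExp_eq_zero c hlt, sgn_zero, one_smul]; rfl⟩
    · obtain ⟨l', h₁, h₂, h₃⟩ := ih hl'.2 hv.2
      refine ⟨w :: l', List.pairwise_cons.2 ⟨fun a ha => ?_, h₁⟩,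
        (h₂.cons w).trans (.swap _ _ _), fun f hf => ?_⟩
      · rcases List.mem_cons.1 (h₂.mem_iff.1 ha) with rfl | ha
        · exact h
        · exact hl'.1 a ha
      · rw [List.flatMap_cons, hf.append_swap, h₃ _ (hf.append (c w)), smul_smul, ← sgn_add,
          frontExp_cons, if_pos h, List.flatMap_cons]

/-- The sign exponent of sorting the images of `ws` under `φ`. -/
def sortExp {W : Type} [LinearOrder W] (φ : W → V) (ws : List W) : ℤ :=
  (ws.map fun a => (ws.map fun b =>
    if a < b ∧ φ b < φ a then degSum (c (φ a)) * degSum (c (φ b)) else 0).sum).sum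

theorem exists_sort {W : Type} [LinearOrder W] {φ : W → V} (hφ : Function.Injective φ) {ws : List W}
    (hs : ws.Pairwise (· < ·)) :
    ∃ l' : List V, l'.Pairwise (· < ·) ∧ l'.Perm (ws.map φ) ∧
      ∀ f : List (Cor P H) → M, Compat f →
        f (ws.flatMap fun a => c (φ a)) = sgn (sortExp c φ ws) • f (l'.flatMap c) := by
  induction ws with
  | nil => exact ⟨[], List.Pairwise.nil, .refl _, fun f _ => by simp [sortExp, sgn_zero]⟩
  | cons w ws ih =>
    have hs' := List.pairwise_cons.1 hs
    obtain ⟨l, h₁, h₂, h₃⟩ := ih hs'.2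
    have hw : φ w ∉ l := by
      rw [h₂.mem_iff, List.mem_map]
      rintro ⟨a, ha, e⟩
      exact (hs'.1 a ha).ne' (hφ e)
    obtain ⟨l', k₁, k₂, k₃⟩ := exists_insert c h₁ hw (M := M)
    refine ⟨l', k₁, k₂.trans (h₂.cons _), fun f hf => ?_⟩
    rw [List.flatMap_cons, h₃ _ (hf.append (c (φ w))), k₃ f hf, smul_smul, ← sgn_add]
    congr 2
    have e₁ : frontExp c l (φ w) = (ws.map fun b =>
        if φ b < φ w then degSum (c (φ w)) * degSum (c (φ b)) else 0).sum := by
      rw [frontExp, (h₂.map _).sum_eq, List.map_map]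
      rfl
    rw [e₁, sortExp, sortExp]
    simp only [List.map_cons, List.sum_cons, lt_self_iff_false, false_and, if_false, zero_add]
    rw [add_comm]
    congr 1
    · exact List.sum_map_congr fun b hb => by simp only [hs'.1 b hb, true_and]
    · refine List.sum_map_congr fun a ha => ?_
      rw [if_neg fun e => (hs'.1 a ha).not_gt e.1, zero_add]

theorem Compat.sort [Finite V] {W : Type} [Finite W] [LinearOrder W] (φ : W ≃ V)
    {f : List (Cor P H) → M} (hf : Compat f) :
    f ((enum W).flatMap fun a => c (φ a)) =
      sgn (sortExp c φ (enum W)) • f ((enum V).flatMap c) := by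
  obtain ⟨l, h₁, h₂, h₃⟩ := exists_sort (M := M) c φ.injective enum_pairwise
  rw [h₃ f hf, eq_enum h₁ fun v => ?_]
  rw [h₂.mem_iff, List.mem_map]
  exact ⟨φ.symm v, by simp⟩

end Blocks

/-! ### Sewing inside blocks and between blocks -/

theorem sew_append_left {f : List (Cor P H) → M} (hf : Compat f) {h k : H} (l : List (Cor P H))
    {r : List (Cor P H)} (hh : h ∉ labels r) (hk : k ∉ labels r) :
    sew h k (l ++ r) f = sew h k l fun m => f (m ++ r) := by
  have key : ∀ (l : List (Cor P H)) {f : List (Cor P H) → M}, Compat f →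
      ctr h k (l ++ r) f = ctr h k l fun m => f (m ++ r) := by
    intro l
    induction l with
    | nil => exact fun hf => ctr_eq_zero hf hh
    | cons x l ih =>
      intro f hf
      rw [List.cons_append, ctr_cons, ih (hf.cons x), ctr_cons, der_append, der_append,
        der_eq_zero (l := r) (hf.append l)
          fun y hy => glue_dec_eq_zero fun e => hk (mem_labels.2 ⟨y, hy, e.2.1⟩),
        der_eq_zero (l := r) (hf.append l)
          fun y hy => glue_dec_eq_zero fun e => hh (mem_labels.2 ⟨y, hy, e.2.1⟩)]
      simp only [smul_zero, add_zero]
      rfl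
  rw [sew, der_append, der_act_eq_zero ((hf.ctr h k).append l) hh, smul_zero, add_zero]
  exact der_congr _ _ _ fun l₁ x l₂ _ => key _ hf

theorem sew_append_right {f : List (Cor P H) → M} (hf : Compat f) {h k : H}
    {l : List (Cor P H)} (r : List (Cor P H)) (hh : h ∉ labels l) (hk : k ∉ labels l) :
    sew h k (l ++ r) f = sgn (degSum l) • sew h k r fun m => f (l ++ m) := by
  have key : ∀ (l : List (Cor P H)), h ∉ labels l → k ∉ labels l → ∀ {f : List (Cor P H) → M},
      Compat f → ∀ r, ctr h k (l ++ r) f = ctr h k r fun m => f (l ++ m) := by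
    intro l
    induction l with
    | nil => exact fun _ _ _ _ _ => rfl
    | cons x l ih =>
      intro hh hk f hf r
      rw [labels_cons, Set.mem_union, not_or] at hh hk
      rw [List.cons_append, ctr_skip hf _ hh.1 hk.1, ih hh.2 hk.2 (hf.cons x)]
      rfl
  rw [sew, der_append, der_act_eq_zero ((hf.ctr h k).append_right r) hh, zero_add, one_mul]
  congr 1
  exact der_congr _ _ _ fun l₁ x l₂ _ => key l hh hk hf _

end

noncomputable section

open Cor

variable {P : S1FramedModularOperad.{u}}

namespace DecGraph

/-! ### Classes of decorated graphs -/

/-- The inclusion of a summand. -/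
def inclusion (P : S1FramedModularOperad.{u}) (g n : ℕ) (e : ℤ) :
    Feynman P g n e →ₗ[ℚ] FeynmanTotal P e :=
  DirectSum.lof ℚ (ℕ × ℕ) (fun p => Feynman P p.1 p.2 e) (g, n)

theorem cls_of_hasType {G : DecGraph P} {g n : ℕ} {e : ℤ} (h : G.HasType g n e) :
    G.cls e = inclusion P g n e (Submodule.Quotient.mk (Finsupp.single ⟨G, h⟩ 1)) := by
  obtain ⟨h₁, rfl, rfl, h₂⟩ := h
  exact dif_pos ⟨h₁, h₂⟩

theorem cls_eq_zero {G : DecGraph P} {e : ℤ} (h : ¬ (G.Connected ∧ G.degree = e)) : G.cls e = 0 :=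
  dif_neg h

theorem cls_setDec_add (G : DecGraph P) (e : ℤ) (v : G.V)
    (x y : P.X (G.genus v) (G.leg v) (G.deg v)) :
    (G.setDec v (x + y)).cls e = (G.setDec v x).cls e + (G.setDec v y).cls e := by
  by_cases h : G.Connected ∧ G.degree = e
  · have hG : ∀ z, (G.setDec v z).HasType G.totalGenus G.leafCount e := fun _ =>
      ⟨h.1, rfl, rfl, h.2⟩
    rw [cls_of_hasType (hG _), cls_of_hasType (hG _), cls_of_hasType (hG _), ← map_add,
      ← Submodule.Quotient.mk_add]
    congr 1
    refine (Submodule.Quotient.eq _).2 (Submodule.subset_span (Or.inl (Or.inl ?_)))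
    exact ⟨G, v, x, y, hG _, hG _, hG _, sub_add_eq_sub_sub _ _ _⟩
  · rw [cls_eq_zero (G := G.setDec v (x + y)) h, cls_eq_zero (G := G.setDec v x) h,
      cls_eq_zero (G := G.setDec v y) h, add_zero]

theorem cls_setDec_smul (G : DecGraph P) (e : ℤ) (v : G.V) (c : ℚ)
    (x : P.X (G.genus v) (G.leg v) (G.deg v)) :
    (G.setDec v (c • x)).cls e = c • (G.setDec v x).cls e := by
  by_cases h : G.Connected ∧ G.degree = e
  · have hG : ∀ z, (G.setDec v z).HasType G.totalGenus G.leafCount e := fun _ =>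
      ⟨h.1, rfl, rfl, h.2⟩
    rw [cls_of_hasType (hG _), cls_of_hasType (hG _), ← map_smul, ← Submodule.Quotient.mk_smul,
      Finsupp.smul_single, smul_eq_mul, mul_one]
    congr 1
    refine (Submodule.Quotient.eq _).2 (Submodule.subset_span (Or.inl (Or.inr ?_)))
    exact ⟨G, v, c, x, hG _, hG _, rfl⟩
  · rw [cls_eq_zero (G := G.setDec v (c • x)) h, cls_eq_zero (G := G.setDec v x) h, smul_zero]

section Relabel

variable (G : DecGraph P) {W : Type} [Finite W] [LinearOrder W] (φ : W ≃ G.V) {l : W → Type}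
  [∀ w, Finite (l w)] (ψ : ∀ w, l w ≃ G.leg (φ w))

/-- The bijection of half-edges of a relabelling. -/
def relabelHalf : (Σ w, l w) ≃ G.Half := (Equiv.sigmaCongrRight ψ).trans (φ.sigmaCongrLeft)

theorem relabel_adj (h k : Σ w, l w) :
    (G.relabel W φ l ψ).Adj h k ↔ G.Adj (G.relabelHalf φ ψ h) (G.relabelHalf φ ψ k) := Iff.rfl

theorem connected_relabel (hG : G.Connected) : (G.relabel W φ l ψ).Connected := by
  obtain ⟨⟨v⟩, h⟩ := hG
  refine ⟨⟨φ.symm v⟩, fun (a b : W) => ?_⟩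
  have key : ∀ v w : G.V, Relation.ReflTransGen (fun v w => ∃ a b, G.Adj ⟨v, a⟩ ⟨w, b⟩) v w →
      Relation.ReflTransGen (fun v w => ∃ a b, (G.relabel W φ l ψ).Adj ⟨v, a⟩ ⟨w, b⟩)
        (φ.symm v) (φ.symm w) := by
    intro v w hvw
    induction hvw with
    | refl => exact .refl
    | @tail y z _ h ih =>
      obtain ⟨c, d, hcd⟩ := h
      refine ih.tail ⟨((G.relabelHalf φ ψ).symm ⟨y, c⟩).2, ((G.relabelHalf φ ψ).symm ⟨z, d⟩).2, ?_⟩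
      have e₁ := (G.relabelHalf φ ψ).apply_symm_apply ⟨y, c⟩
      have e₂ := (G.relabelHalf φ ψ).apply_symm_apply ⟨z, d⟩
      rw [← e₁, ← e₂] at hcd
      exact hcd
  have := key (φ a) (φ b) (h _ _)
  rwa [φ.symm_apply_apply, φ.symm_apply_apply] at this

theorem edgeHalves_relabel : (G.relabel W φ l ψ).edgeHalves = G.edgeHalves := by
  refine Nat.card_congr ((G.relabelHalf φ ψ).subtypeEquiv fun h => ?_)
  refine ⟨fun ⟨k, hk⟩ => ⟨_, hk⟩, fun ⟨k, hk⟩ => ⟨(G.relabelHalf φ ψ).symm k, ?_⟩⟩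
  rw [relabel_adj, Equiv.apply_symm_apply]
  exact hk

theorem hasType_relabel {g n : ℕ} {e : ℤ} (hG : G.HasType g n e) :
    (G.relabel W φ l ψ).HasType g n e := by
  obtain ⟨h₁, h₂, h₃, h₄⟩ := hG
  refine ⟨G.connected_relabel φ ψ h₁, ?_, ?_, ?_⟩
  · rw [← h₂, totalGenus, totalGenus, edgeHalves_relabel]
    congr 1
    · exact finsum_comp_equiv φ (f := G.genus)
    · exact congrArg _ (Nat.card_congr φ)
  · rw [← h₃]
    refine Nat.card_congr ((G.relabelHalf φ ψ).subtypeEquiv fun h => ?_)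
    refine ⟨fun hk k => ?_, fun hk k => hk _⟩
    have := hk ((G.relabelHalf φ ψ).symm k)
    rwa [relabel_adj, Equiv.apply_symm_apply] at this
  · rw [← h₄, degree, degree, edgeHalves_relabel]
    congr 2
    · exact finsum_comp_equiv φ (f := G.deg)
    · exact congrArg _ (finsum_comp_equiv (G.relabelHalf φ ψ) (f := fun h => (G.pow h : ℤ)))

theorem hasType_of_relabel {g n : ℕ} {e : ℤ} (hG : (G.relabel W φ l ψ).HasType g n e) :
    G.HasType g n e := by
  have h := (G.relabel W φ l ψ).hasType_relabel (W := G.V) (l := G.leg) φ.symm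
    (fun v => (Equiv.cast (by rw [Equiv.apply_symm_apply])).trans (ψ (φ.symm v)).symm) hG
  have hc : G.Connected := by
    refine ⟨⟨φ hG.1.1.some⟩, fun v w => ?_⟩
    have := hG.1.2 (φ.symm v) (φ.symm w)
    have key : ∀ a b : W, Relation.ReflTransGen
        (fun v w => ∃ a b, (G.relabel W φ l ψ).Adj ⟨v, a⟩ ⟨w, b⟩) a b →
        Relation.ReflTransGen (fun v w => ∃ a b, G.Adj ⟨v, a⟩ ⟨w, b⟩) (φ a) (φ b) := by
      intro a b hab
      induction hab with
      | refl => exact .refl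
      | tail _ h ih =>
        obtain ⟨c, d, hcd⟩ := h
        exact ih.tail ⟨_, _, hcd⟩
    simpa using key _ _ this
  obtain ⟨-, h₂, h₃, h₄⟩ := G.hasType_relabel φ ψ ⟨hc, rfl, rfl, rfl⟩
  obtain ⟨-, k₂, k₃, k₄⟩ := hG
  exact ⟨hc, h₂.symm.trans k₂, h₃.symm.trans k₃, h₄.symm.trans k₄⟩

theorem cls_relabel (e : ℤ) : (G.relabel W φ l ψ).cls e = G.relabelSign φ • G.cls e := by
  by_cases h : G.Connected ∧ G.degree = e
  · have hG : G.HasType G.totalGenus G.leafCount e := ⟨h.1, rfl, rfl, h.2⟩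
    have hR := G.hasType_relabel φ ψ hG
    rw [cls_of_hasType hG, cls_of_hasType hR, ← map_smul, ← Submodule.Quotient.mk_smul,
      Finsupp.smul_single, smul_eq_mul, mul_one]
    congr 1
    refine (Submodule.Quotient.eq _).2 (Submodule.subset_span (Or.inr ?_))
    exact ⟨G, W, _, _, φ, l, _, ψ, hR, hG, rfl⟩
  · rw [cls_eq_zero h, smul_zero]
    refine cls_eq_zero fun h' => h ?_
    have := G.hasType_of_relabel φ ψ ⟨h'.1, rfl, rfl, h'.2⟩
    exact ⟨this.1, this.2.2.2⟩

end Relabel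

/-- Isomorphic decorated graphs have the same class up to the Koszul sign. -/
theorem cls_iso {G G' : DecGraph P} (e : ℤ) (φ : G'.V ≃ G.V) (ψ : ∀ w, G'.leg w ≃ G.leg (φ w))
    (hA : ∀ h k, G'.Adj h k ↔ G.Adj ⟨φ h.1, ψ h.1 h.2⟩ ⟨φ k.1, ψ k.1 k.2⟩)
    (hg : ∀ w, G'.genus w = G.genus (φ w)) (hd : ∀ w, G'.deg w = G.deg (φ w))
    (hdec : ∀ w, HEq (G'.dec w) (P.map (ψ w).symm (G.dec (φ w))))
    (hp : ∀ h, G'.pow h = G.pow ⟨φ h.1, ψ h.1 h.2⟩) :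
    G'.cls e = G.relabelSign φ • G.cls e := by
  rw [← G.cls_relabel φ ψ e]
  obtain ⟨V, leg, Adj, symm, irrefl, unique, genus, deg, dec, pow⟩ := G'
  change V ≃ G.V at φ
  change ∀ w, leg w ≃ G.leg (φ w) at ψ
  change ∀ h k : Σ v, leg v, Adj h k ↔ _ at hA
  change ∀ w : V, genus w = _ at hg
  change ∀ w : V, deg w = _ at hd
  change ∀ w : V, HEq (dec w) _ at hdec
  change ∀ h : Σ v, leg v, pow h = _ at hp
  obtain rfl : genus = fun w => G.genus (φ w) := funext hg
  obtain rfl : deg = fun w => G.deg (φ w) := funext hd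
  obtain rfl : pow = fun h => G.pow ⟨φ h.1, ψ h.1 h.2⟩ := funext hp
  obtain rfl : Adj = fun h k => G.Adj ⟨φ h.1, ψ h.1 h.2⟩ ⟨φ k.1, ψ k.1 k.2⟩ :=
    funext fun h => funext fun k => propext (hA h k)
  obtain rfl : dec = fun w => P.map (ψ w).symm (G.dec (φ w)) := funext fun w => eq_of_heq (hdec w)
  rfl

/-! ### Linear maps out of the Feynman compactification -/

theorem span_cls (e : ℤ) :
    Submodule.span ℚ {x : FeynmanTotal P e | ∃ G : DecGraph P, G.Connected ∧ G.degree = e ∧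
      x = G.cls e} = ⊤ := by
  rw [eq_top_iff]
  rintro x -
  induction x using DirectSum.induction_on with
  | zero => exact Submodule.zero_mem _
  | add x y hx hy => exact Submodule.add_mem _ hx hy
  | of i x =>
    obtain ⟨x, rfl⟩ := Submodule.Quotient.mk_surjective _ x
    induction x using Finsupp.induction_linear with
    | zero =>
      rw [Submodule.Quotient.mk_zero, map_zero]
      exact Submodule.zero_mem _
    | add x y hx hy =>
      rw [Submodule.Quotient.mk_add, map_add]
      exact Submodule.add_mem _ hx hy
    | single G c =>
      have := cls_of_hasType G.2
      rw [show (Finsupp.single G c : _ →₀ ℚ) = c • Finsupp.single G 1 by simp,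
        Submodule.Quotient.mk_smul]
      change inclusion P i.1 i.2 e _ ∈ _
      rw [map_smul]
      refine Submodule.smul_mem _ _ (Submodule.subset_span ⟨G.1, G.2.1, G.2.2.2.2, ?_⟩)
      rw [this]

theorem linearMap_ext {M : Type*} [AddCommGroup M] [Module ℚ M] {e : ℤ}
    {F F' : FeynmanTotal P e →ₗ[ℚ] M}
    (h : ∀ G : DecGraph P, G.Connected → G.degree = e → F (G.cls e) = F' (G.cls e)) : F = F' := by
  refine LinearMap.ext_on (span_cls e) ?_
  rintro _ ⟨G, h₁, h₂, rfl⟩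
  exact h G h₁ h₂

/-- A function on decorated graphs that respects the relations between them. -/
structure Respects {M : Type*} [AddCommGroup M] [Module ℚ M] (f : DecGraph P → M) : Prop where
  add : ∀ (G : DecGraph P) (v : G.V) (x y : P.X (G.genus v) (G.leg v) (G.deg v)),
    f (G.setDec v (x + y)) = f (G.setDec v x) + f (G.setDec v y)
  smul : ∀ (G : DecGraph P) (v : G.V) (c : ℚ) (x : P.X (G.genus v) (G.leg v) (G.deg v)),
    f (G.setDec v (c • x)) = c • f (G.setDec v x)
  relabel : ∀ (G : DecGraph P) (W : Type) [Finite W] [LinearOrder W] (φ : W ≃ G.V)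
    (l : W → Type) [∀ w, Finite (l w)] (ψ : ∀ w, l w ≃ G.leg (φ w)),
    f (G.relabel W φ l ψ) = G.relabelSign φ • f G

theorem Respects.exists_linearMap {M : Type*} [AddCommGroup M] [Module ℚ M] {f : DecGraph P → M}
    (hf : Respects f) (e : ℤ) : ∃ F : FeynmanTotal P e →ₗ[ℚ] M, ∀ G : DecGraph P,
      G.Connected → G.degree = e → F (G.cls e) = f G := by
  have hle : ∀ g n, feynmanRelations P g n e ≤
      LinearMap.ker (Finsupp.linearCombination ℚ
        fun G : {G : DecGraph P // G.HasType g n e} => f G.1) := by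
    intro g n
    rw [feynmanRelations, Submodule.span_le]
    rintro r ((⟨G, v, x, y, h, hx, hy, rfl⟩ | ⟨G, v, c, x, h, hx, rfl⟩) |
      ⟨G, W, _, _, φ, l, _, ψ, h, hG, rfl⟩)
    · simp [hf.add]
    · simp [hf.smul]
    · simp [hf.relabel]
  refine ⟨DirectSum.toModule ℚ (ℕ × ℕ) M fun p =>
    (feynmanRelations P p.1 p.2 e).liftQ _ (hle p.1 p.2), fun G h₁ h₂ => ?_⟩
  rw [cls_of_hasType ⟨h₁, rfl, rfl, h₂⟩]
  refine (DirectSum.toModule_lof ℚ (M := fun p : ℕ × ℕ => Feynman P p.1 p.2 e) _ _).trans ?_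
  simp

theorem Respects.linearExtension_cls {M : Type*} [AddCommGroup M] [Module ℚ M] {f : DecGraph P → M}
    (hf : Respects f) {e : ℤ} {G : DecGraph P} (h₁ : G.Connected) (h₂ : G.degree = e) :
    linearExtension e f (G.cls e) = f G := by
  have h := hf.exists_linearMap e
  rw [linearExtension, dif_pos h]
  exact h.choose_spec G h₁ h₂

end DecGraph

end

noncomputable section

open Cor

variable {P : S1FramedModularOperad.{u}} {H : Type} [Finite H]

theorem Cor.mk_map_eq (x : Cor P H) {t : Set H} (e : x.legs ≃ t) (he : ∀ l, (e l : H) = l) :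
    (⟨t, x.genus, x.deg, P.map e x.dec⟩ : Cor P H) = x := by
  obtain rfl : t = x.legs := by
    ext a
    exact ⟨fun ha => by simpa [← he] using (e.symm ⟨a, ha⟩).2,
      fun ha => by simpa [he] using (e ⟨a, ha⟩).2⟩
  obtain rfl : e = Equiv.refl _ := Equiv.ext fun l => Subtype.ext (he l)
  rw [P.map_refl]

theorem Cor.mk_map_congr {I J : Type} [Finite I] [Finite J] {g : ℕ} {d : ℤ} {s t : Set H}
    (e : I ≃ s) (e' : J ≃ t) (f : I ≃ J) (h : ∀ i, (e' (f i) : H) = e i) (x : P.X g I d) :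
    (⟨s, g, d, P.map e x⟩ : Cor P H) = ⟨t, g, d, P.map e' (P.map f x)⟩ := by
  have := Cor.mk_map_eq ⟨s, g, d, P.map e x⟩ (e.symm.trans (f.trans e')) fun l => by simp [h]
  have he : e.trans (e.symm.trans (f.trans e')) = f.trans e' := by
    ext i
    simp
  refine this.symm.trans (congrArg (Cor.mk t g d) ?_)
  change P.map (e.symm.trans (f.trans e')) (P.map e x) = P.map e' (P.map f x)
  rw [← P.map_trans, ← P.map_trans, he]

namespace DecGraph

/-! ### The list of decorated corollas of a graph -/

section ListOf

variable (G : DecGraph P) (lab : G.Half ↪ H)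

/-- The names of the legs of `v`. -/
def legEquiv (v : G.V) : G.leg v ≃ Set.range fun l => lab ⟨v, l⟩ :=
  Equiv.ofInjective _ (lab.injective.comp sigma_mk_injective)

/-- The decorated corolla at `v`. -/
def cor (v : G.V) : Cor P H :=
  ⟨Set.range fun l => lab ⟨v, l⟩, G.genus v, G.deg v, P.map (G.legEquiv lab v) (G.dec v)⟩

/-- The decorated corollas of `G`, in the order of the vertices. -/
def listOf : List (Cor P H) := (enum G.V).map (G.cor lab)

theorem labels_map_cor (l : List G.V) :
    labels (l.map (G.cor lab)) = {h | ∃ v ∈ l, ∃ a, lab ⟨v, a⟩ = h} := by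
  ext h
  simp [mem_labels, cor]

theorem labels_listOf : labels (G.listOf lab) = Set.range lab := by
  ext h
  simp only [listOf, labels_map_cor, mem_enum, true_and, Set.mem_ofPred_eq, Set.mem_range,
    Sigma.exists]

theorem disjoint_cor {v w : G.V} (h : v ≠ w) : Disjoint (G.cor lab v).legs (G.cor lab w).legs := by
  rw [Set.disjoint_left]
  rintro _ ⟨a, rfl⟩ ⟨b, e⟩
  exact h (congrArg Sigma.fst (lab.injective e)).symm

theorem disj_map_cor {l : List G.V} (h : l.Nodup) : Disj (l.map (G.cor lab)) := by
  rw [Disj, List.map_map, List.pairwise_map]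
  exact h.imp fun e => G.disjoint_cor lab e

theorem disj_listOf : Disj (G.listOf lab) := G.disj_map_cor lab enum_nodup

theorem degSum_listOf : degSum (G.listOf lab) = ∑ᶠ v, G.deg v := by
  rw [finsum_eq_enum, degSum, listOf, List.map_map]
  rfl

theorem cor_setDec_self (v : G.V) (z : P.X (G.genus v) (G.leg v) (G.deg v)) :
    (G.setDec v z).cor lab v =
      ⟨Set.range fun l => lab ⟨v, l⟩, G.genus v, G.deg v, P.map (G.legEquiv lab v) z⟩ := by
  have : (G.setDec v z).dec v = z := Function.update_self _ _ _
  exact congrArg (fun y => (⟨Set.range fun l => lab ⟨v, l⟩, G.genus v, G.deg v,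
    P.map (G.legEquiv lab v) y⟩ : Cor P H)) this

theorem cor_setDec_of_ne {v w : G.V} (h : w ≠ v) (z : P.X (G.genus v) (G.leg v) (G.deg v)) :
    (G.setDec v z).cor lab w = G.cor lab w := by
  have : (G.setDec v z).dec w = G.dec w := Function.update_of_ne h _ _
  exact congrArg (fun y => (⟨Set.range fun l => lab ⟨w, l⟩, G.genus w, G.deg w,
    P.map (G.legEquiv lab w) y⟩ : Cor P H)) this

theorem listOf_setDec (v : G.V) : ∃ l₁ l₂ : List (Cor P H),
    ∀ z : P.X (G.genus v) (G.leg v) (G.deg v), (G.setDec v z).listOf lab =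
      l₁ ++ ⟨Set.range fun l => lab ⟨v, l⟩, G.genus v, G.deg v, P.map (G.legEquiv lab v) z⟩ :: l₂ := by
  obtain ⟨l₁, l₂, e⟩ := List.append_of_mem (mem_enum v)
  have hn : (l₁ ++ v :: l₂).Nodup := e ▸ enum_nodup
  rw [List.nodup_append, List.nodup_cons] at hn
  refine ⟨l₁.map (G.cor lab), l₂.map (G.cor lab), fun z => ?_⟩
  have key : ∀ (c : G.V → Cor P H) (x : Cor P H), c v = x → (∀ w, w ≠ v → c w = G.cor lab w) →
      (enum G.V).map c = l₁.map (G.cor lab) ++ x :: l₂.map (G.cor lab) := by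
    rintro c _ rfl hc
    rw [e, List.map_append, List.map_cons]
    congr 1
    · exact List.map_congr_left fun w hw => hc w (hn.2.2 w hw v (List.mem_cons_self ..))
    · congr 1
      exact List.map_congr_left fun w hw => hc w fun h => hn.2.1.1 (h ▸ hw)
  exact key _ _ (G.cor_setDec_self lab v z) fun w hw => G.cor_setDec_of_ne lab hw z

theorem cor_relabel {W : Type} [Finite W] [LinearOrder W] (φ : W ≃ G.V) (l : W → Type)
    [∀ w, Finite (l w)] (ψ : ∀ w, l w ≃ G.leg (φ w)) (w : W) :
    (G.relabel W φ l ψ).cor ((G.relabelHalf φ ψ).toEmbedding.trans lab) w = G.cor lab (φ w) :=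
  (Cor.mk_map_congr (G.legEquiv lab (φ w)) _ (ψ w).symm
    (fun i => congrArg (fun a => lab ⟨φ w, a⟩) ((ψ w).apply_symm_apply i)) (G.dec (φ w))).symm

theorem flatMap_pure_cor {W : Type} (ws : List W) (c : W → Cor P H) :
    (ws.flatMap fun w => [c w]) = ws.map c := by
  induction ws with
  | nil => rfl
  | cons w ws ih => simp [ih]

theorem relabelSign_eq {W : Type} [Finite W] [LinearOrder W] (φ : W ≃ G.V) :
    G.relabelSign φ = sgn (sortExp (fun v => [G.cor lab v]) φ (enum W)) := by
  rw [relabelSign, sortExp]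
  congr 1
  have hfin : ∀ S : Set (W × W), S.Finite := fun S => S.toFinite
  simp only [finsum_eq_if, degSum_cons, degSum_nil, add_zero]
  rw [finsum_curry _ (hfin _), finsum_eq_enum]
  refine List.sum_map_congr fun a _ => ?_
  rw [finsum_eq_enum]
  refine List.sum_map_congr fun b _ => ?_
  split_ifs <;> rfl

variable {M : Type w} [AddCommGroup M] [Module ℚ M]

theorem compat_listOf_relabel {g : List (Cor P H) → M} (hg : Compat g) {W : Type} [Finite W]
    [LinearOrder W] (φ : W ≃ G.V) (l : W → Type) [∀ w, Finite (l w)]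
    (ψ : ∀ w, l w ≃ G.leg (φ w)) :
    g ((G.relabel W φ l ψ).listOf ((G.relabelHalf φ ψ).toEmbedding.trans lab)) =
      G.relabelSign φ • g (G.listOf lab) := by
  have e₁ : (G.relabel W φ l ψ).listOf ((G.relabelHalf φ ψ).toEmbedding.trans lab) =
      (enum W).flatMap fun w => [G.cor lab (φ w)] := by
    rw [flatMap_pure_cor]
    exact List.map_congr_left fun w _ => G.cor_relabel lab φ l ψ w
  have e₂ : G.listOf lab = (enum G.V).flatMap fun v => [G.cor lab v] := by
    rw [flatMap_pure_cor]; rfl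
  rw [e₁, e₂, G.relabelSign_eq lab φ]
  exact hg.sort (fun v => [G.cor lab v]) φ

end ListOf

/-- `G` is presented by the matching `A` and the exponents `p` on the set of half-edges `H`. -/
structure IsLab (G : DecGraph P) (lab : G.Half ↪ H) (A : Matching H) (p : H → ℕ) : Prop where
  adj : ∀ h k, G.Adj h k ↔ A.Adj (lab h) (lab k)
  pow : ∀ h, G.pow h = p (lab h)

/-! ### The decorated graph of a list -/

/-- The graph with a given list of decorated corollas. -/
def ofList (L : List (Cor P H)) (hL : Disj L) (A : Matching H) (p : H → ℕ) : DecGraph P where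
  V := Fin L.length
  leg i := (L.get i).legs
  Adj h k := A.Adj h.2 k.2
  symm := A.symm
  irrefl := A.irrefl
  unique {h k l} h₁ h₂ := by
    obtain ⟨i, a, ha⟩ := k
    obtain ⟨j, b, hb⟩ := l
    obtain rfl : a = b := A.unique h₁ h₂
    obtain rfl : i = j := by
      by_contra hij
      rw [Disj, List.pairwise_map] at hL
      have := List.pairwise_iff_get.1 hL
      rcases lt_or_gt_of_ne hij with h | h
      · exact Set.disjoint_left.1 (this _ _ h) ha hb
      · exact Set.disjoint_left.1 (this _ _ h) hb ha
    rfl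
  genus i := (L.get i).genus
  deg i := (L.get i).deg
  dec i := (L.get i).dec
  pow h := p h.2

section OfList

variable {L : List (Cor P H)} (hL : Disj L) (A : Matching H) (p : H → ℕ)

/-- The names of the half-edges of the graph of a list. -/
def ofListLab : (ofList L hL A p).Half ↪ H where
  toFun h := h.2.1
  inj' := by
    rintro ⟨i, a, ha⟩ ⟨j, b, hb⟩ e
    obtain rfl : a = b := e
    obtain rfl : i = j := by
      by_contra hij
      rw [Disj, List.pairwise_map] at hL
      have := List.pairwise_iff_get.1 hL
      rcases lt_or_gt_of_ne hij with h | h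
      · exact Set.disjoint_left.1 (this _ _ h) ha hb
      · exact Set.disjoint_left.1 (this _ _ h) hb ha
    rfl

theorem isLab_ofList : (ofList L hL A p).IsLab (ofListLab hL A p) A p :=
  ⟨fun _ _ => Iff.rfl, fun _ => rfl⟩

theorem cor_ofList (i : Fin L.length) :
    (ofList L hL A p).cor (ofListLab hL A p) i = L.get i :=
  Cor.mk_map_eq (L.get i) ((ofList L hL A p).legEquiv (ofListLab hL A p) i) fun _ => rfl

theorem listOf_ofList : (ofList L hL A p).listOf (ofListLab hL A p) = L := by
  refine (List.map_congr_left fun i _ => cor_ofList hL A p i).trans ?_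
  change (enum (Fin L.length)).map L.get = L
  rw [enum_fin, ← List.ofFn_eq_map]
  exact List.ofFn_get L

end OfList

open Classical in
/-- The class of the graph of a list. -/
def clsL (e : ℤ) (A : Matching H) (p : H → ℕ) (L : List (Cor P H)) : FeynmanTotal P e :=
  if hL : Disj L then (ofList L hL A p).cls e else 0

theorem heq_dec (G : DecGraph P) (lab : G.Half ↪ H) {v : G.V} {x : Cor P H} (hx : x = G.cor lab v)
    (ψ : x.legs ≃ G.leg v) (hψ : ∀ l, lab ⟨v, ψ l⟩ = l) :
    HEq x.dec (P.map ψ.symm (G.dec v)) := by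
  subst hx
  have : ψ.symm = G.legEquiv lab v := by
    exact Equiv.ext fun l => Subtype.ext ((hψ _).symm.trans
      (congrArg (fun a => lab ⟨v, a⟩) (ψ.apply_symm_apply l)))
  rw [this]
  rfl

theorem relabelSign_of_strictMono (G : DecGraph P) {W : Type} [LinearOrder W] (φ : W ≃ G.V)
    (h : StrictMono φ) : G.relabelSign φ = 1 := by
  have : ∀ p : W × W, ¬ (p.1 < p.2 ∧ φ p.2 < φ p.1) := fun p e => (h e.1).not_gt e.2
  simp only [relabelSign, this, finsum_false, finsum_zero, sgn_zero]

theorem cls_eq_clsL {G : DecGraph P} {lab : G.Half ↪ H} {A : Matching H} {p : H → ℕ}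
    (h : G.IsLab lab A p) (e : ℤ) : G.cls e = clsL e A p (G.listOf lab) := by
  have hlen : (G.listOf lab).length = (enum G.V).length := List.length_map _
  let φ : Fin (G.listOf lab).length ≃ G.V :=
    (finCongr hlen).trans (List.Nodup.getEquivOfForallMemList _ enum_nodup mem_enum)
  have hφ : ∀ i, (G.listOf lab).get i = G.cor lab (φ i) := fun i => by
    exact List.getElem_map ..
  have hmono : StrictMono φ := fun i j hij => List.pairwise_iff_get.1 (enum_pairwise (V := G.V))
    (Fin.cast hlen i) (Fin.cast hlen j) hij
  let ψ : ∀ i, ((G.listOf lab).get i).legs ≃ G.leg (φ i) := fun i =>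
    (Equiv.setCongr (congrArg Cor.legs (hφ i))).trans (G.legEquiv lab (φ i)).symm
  have hψ : ∀ i l, lab ⟨φ i, ψ i l⟩ = l.1 := fun i l => by
    exact congrArg Subtype.val ((G.legEquiv lab (φ i)).apply_symm_apply
      (Equiv.setCongr (congrArg Cor.legs (hφ i)) l))
  have := cls_iso (G := G) (G' := ofList (G.listOf lab) (G.disj_listOf lab) A p) e φ ψ
    (fun a b => by
      rw [h.adj]
      exact iff_of_eq (congrArg₂ A.Adj (hψ a.1 a.2).symm (hψ b.1 b.2).symm))
    (fun i => congrArg Cor.genus (hφ i)) (fun i => congrArg Cor.deg (hφ i))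
    (fun i => heq_dec G lab (hφ i) (ψ i) (hψ i)) (fun a => by
      rw [h.pow]
      exact congrArg p (hψ a.1 a.2).symm)
  have hs := relabelSign_of_strictMono G φ hmono
  rw [clsL, dif_pos (G.disj_listOf lab)]
  exact (this.trans ((congrArg (· • G.cls e) hs).trans (one_smul _ _))).symm

theorem clsL_congr {e : ℤ} {A A' : Matching H} {p p' : H → ℕ} {L : List (Cor P H)}
    (hA : ∀ h ∈ labels L, ∀ k ∈ labels L, (A.Adj h k ↔ A'.Adj h k))
    (hp : ∀ h ∈ labels L, p h = p' h) : clsL e A p L = clsL e A' p' L := by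
  by_cases hL : Disj L
  · have hm : ∀ a : (ofList L hL A p).Half, a.2.1 ∈ labels L := fun a =>
      mem_labels.2 ⟨_, List.get_mem _ _, a.2.2⟩
    have := cls_eq_clsL (G := ofList L hL A p) (lab := ofListLab hL A p) (A := A') (p := p')
      ⟨fun a b => hA _ (hm a) _ (hm b), fun a => hp _ (hm a)⟩ e
    rw [listOf_ofList] at this
    rw [← this, clsL, dif_pos hL]
  · rw [clsL, clsL, dif_neg hL, dif_neg hL]

theorem clsL_not_disj {e : ℤ} {A : Matching H} {p : H → ℕ} {L : List (Cor P H)} (hL : ¬ Disj L) :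
    clsL e A p L = 0 := dif_neg hL

theorem clsL_eq_cls {e : ℤ} {A : Matching H} {p : H → ℕ} {L : List (Cor P H)} (hL : Disj L) :
    clsL e A p L = (ofList L hL A p).cls e := dif_pos hL

theorem exists_clsL_cons (e : ℤ) (A : Matching H) (p : H → ℕ) {s : Set H} {g : ℕ} {d : ℤ}
    {l : List (Cor P H)} (hL : Disj (⟨s, g, d, (0 : P.X g s d)⟩ :: l)) :
    ∃ (G : DecGraph P) (v : G.V) (ε : P.X g s d →ₗ[ℚ] P.X (G.genus v) (G.leg v) (G.deg v)),
      ∀ z, clsL e A p (⟨s, g, d, z⟩ :: l) = (G.setDec v (ε z)).cls e := by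
  set G := ofList _ hL A p
  let v : G.V := (0 : Fin (l.length + 1))
  refine ⟨G, v, LinearMap.id, fun z => ?_⟩
  have h : (G.setDec v z).IsLab (ofListLab hL A p) A p := ⟨fun _ _ => Iff.rfl, fun _ => rfl⟩
  refine Eq.trans ?_ (cls_eq_clsL h e).symm
  have key : ∀ (c c' : Fin (l.length + 1) → Cor P H) (x y : Cor P H), c 0 = x →
      (∀ j : Fin l.length, c j.succ = c' j.succ) → (enum (Fin (l.length + 1))).map c' = y :: l →
      x :: l = (enum (Fin (l.length + 1))).map c := by
    rintro c c' _ y rfl h h'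
    rw [enum_fin, List.finRange_succ, List.map_cons, List.map_map] at h' ⊢
    exact congrArg (c 0 :: ·) ((List.cons.inj h').2.symm.trans
      (List.map_congr_left fun j _ => (h j).symm))
  congr 1
  refine key _ _ _ _ ?_ (fun j => G.cor_setDec_of_ne _ (Fin.succ_ne_zero j) z)
    (listOf_ofList hL A p)
  refine (G.cor_setDec_self (ofListLab hL A p) v z).trans ?_
  exact Cor.mk_map_eq ⟨s, g, d, z⟩ (G.legEquiv (ofListLab hL A p) v) fun _ => rfl

theorem swap_inversion_iff {N i : ℕ} (hi : i < N) (hj : i + 1 < N) (m n : Fin N) :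
    (m < n ∧ Equiv.swap ⟨i, hi⟩ ⟨i + 1, hj⟩ n < Equiv.swap (⟨i, hi⟩ : Fin N) ⟨i + 1, hj⟩ m) ↔
      (m, n) = (⟨i, hi⟩, ⟨i + 1, hj⟩) := by
  obtain ⟨m, hm⟩ := m
  obtain ⟨n, hn⟩ := n
  simp only [Equiv.swap_apply_def, Prod.mk.injEq, Fin.mk.injEq, Fin.mk_lt_mk]
  split_ifs <;> simp only [Fin.mk_lt_mk] <;> omega

theorem map_get_swap {α : Type*} (l₁ l₂ : List α) (a b : α)
    (hi : l₁.length < (l₁ ++ b :: a :: l₂).length)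
    (hj : l₁.length + 1 < (l₁ ++ b :: a :: l₂).length) :
    (List.finRange (l₁ ++ b :: a :: l₂).length).map
      (fun i => (l₁ ++ b :: a :: l₂).get (Equiv.swap ⟨_, hi⟩ ⟨_, hj⟩ i)) = l₁ ++ a :: b :: l₂ := by
  refine List.ext_getElem (by simp) fun n h₁ h₂ => ?_
  simp only [List.getElem_map, List.getElem_finRange, Equiv.swap_apply_def]
  rcases lt_trichotomy n l₁.length with h | rfl | h
  · grind
  · grind
  · rcases Nat.eq_or_lt_of_le h with rfl | h'
    · grind
    · grind

theorem clsL_swap (e : ℤ) (A : Matching H) (p : H → ℕ) (l₁ : List (Cor P H)) (a b : Cor P H)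
    (l₂ : List (Cor P H)) :
    clsL e A p (l₁ ++ a :: b :: l₂) = sgn (a.deg * b.deg) • clsL e A p (l₁ ++ b :: a :: l₂) := by
  have hp : (l₁ ++ a :: b :: l₂).Perm (l₁ ++ b :: a :: l₂) := (List.Perm.swap b a l₂).append_left l₁
  by_cases hL : Disj (l₁ ++ b :: a :: l₂)
  swap
  · rw [clsL_not_disj hL, clsL_not_disj fun h => hL (h.perm hp), smul_zero]
  set L := l₁ ++ b :: a :: l₂ with hLdef
  set G := ofList L hL A p
  have hi : l₁.length < L.length := by simp [hLdef]
  have hj : l₁.length + 1 < L.length := by simp [hLdef]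
  let φ : Fin L.length ≃ G.V := Equiv.swap ⟨_, hi⟩ ⟨_, hj⟩
  let lab := (G.relabelHalf φ (fun i => Equiv.refl (G.leg (φ i)))).toEmbedding.trans
    (ofListLab hL A p)
  have h : (G.relabel (Fin L.length) φ (fun i => G.leg (φ i)) fun i => Equiv.refl _).IsLab
      lab A p := ⟨fun _ _ => Iff.rfl, fun _ => rfl⟩
  have h₁ := G.cls_relabel φ (fun i => Equiv.refl (G.leg (φ i))) e
  have key : ∀ c : Fin L.length → Cor P H,
      (∀ i, c i = L.get (Equiv.swap ⟨_, hi⟩ ⟨_, hj⟩ i)) →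
      (enum (Fin L.length)).map c = l₁ ++ a :: b :: l₂ := by
    intro c hc
    rw [enum_fin, List.map_congr_left fun i _ => hc i]
    exact map_get_swap l₁ l₂ a b hi hj
  have hl : (G.relabel (Fin L.length) φ (fun i => G.leg (φ i)) fun i => Equiv.refl _).listOf lab =
      l₁ ++ a :: b :: l₂ := key _ fun i =>
    (G.cor_relabel (ofListLab hL A p) φ _ (fun i => Equiv.refl (G.leg (φ i))) i).trans
      (cor_ofList hL A p (φ i))
  rw [cls_eq_clsL h, hl] at h₁
  rw [h₁, clsL_eq_cls hL]
  congr 1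
  rw [relabelSign]
  congr 1
  have hc : ∀ q : Fin L.length × Fin L.length, (q.1 < q.2 ∧ φ q.2 < φ q.1) ↔
      q = (⟨_, hi⟩, ⟨_, hj⟩) := fun q => swap_inversion_iff hi hj q.1 q.2
  simp only [hc]
  rw [finsum_eq_single _ (⟨_, hi⟩, ⟨_, hj⟩) fun q hq => by simp [hq]]
  have e₁ : G.deg (φ ⟨_, hi⟩) = a.deg := by
    change (L.get (Equiv.swap _ _ _)).deg = _
    simp [hLdef]
  have e₂ : G.deg (φ ⟨_, hj⟩) = b.deg := by
    change (L.get (Equiv.swap _ _ _)).deg = _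
    simp [hLdef]
  simp [e₁, e₂]

theorem compat_clsL (e : ℤ) (A : Matching H) (p : H → ℕ) :
    Compat (clsL e A p : List (Cor P H) → FeynmanTotal P e) where
  add {s g d} x y l := by
    by_cases hL : Disj (⟨s, g, d, (0 : P.X g s d)⟩ :: l)
    · obtain ⟨G, v, ε, h⟩ := exists_clsL_cons e A p hL
      rw [h, h, h, map_add, cls_setDec_add]
    · have : ∀ z : P.X g s d, clsL e A p (⟨s, g, d, z⟩ :: l) = 0 := fun z => clsL_not_disj hL
      rw [this, this, this, add_zero]
  smul c {s g d} x l := by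
    by_cases hL : Disj (⟨s, g, d, (0 : P.X g s d)⟩ :: l)
    · obtain ⟨G, v, ε, h⟩ := exists_clsL_cons e A p hL
      rw [h, h, map_smul, cls_setDec_smul]
    · have : ∀ z : P.X g s d, clsL e A p (⟨s, g, d, z⟩ :: l) = 0 := fun z => clsL_not_disj hL
      rw [this, this, smul_zero]
  swap := clsL_swap e A p

end DecGraph

end

noncomputable section

open Cor

variable {P : S1FramedModularOperad.{u}} {H : Type} [Finite H]

theorem sum_allOf_embedding {N : Type*} {X : Type} [Finite X] [AddCommMonoid N]
    (lab : X ↪ H) (F : H → N) (h₀ : ∀ h, h ∉ Set.range lab → F h = 0) :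
    ∑ h ∈ allOf H, F h = ∑ x ∈ allOf X, F (lab x) := by
  classical
  rw [← Finset.sum_map (allOf X) lab F]
  refine (Finset.sum_subset (fun h _ => mem_allOf h) fun h _ hh => h₀ h ?_).symm
  rintro ⟨x, rfl⟩
  exact hh (Finset.mem_map_of_mem _ (mem_allOf x))

theorem sum_allOf_sigma {V : Type} [Finite V] {leg : V → Type} [∀ v, Finite (leg v)] {N : Type*}
    [AddCommMonoid N] (F : (Σ v, leg v) → N) :
    ∑ h ∈ allOf (Σ v, leg v), F h = ∑ v ∈ allOf V, ∑ a ∈ allOf (leg v), F ⟨v, a⟩ := by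
  rw [Finset.sum_sigma']
  refine Finset.sum_congr ?_ fun _ _ => rfl
  ext
  simp

theorem sum_eq_add_ite {V : Type*} [DecidableEq V] {N : Type*} [AddCommMonoid N] {s : Finset V}
    {i : V} (hi : i ∈ s) (u : V → N) :
    ∑ j ∈ s, u j = u i + ∑ j ∈ s, if i ≠ j then u j else 0 := by
  rw [← Finset.add_sum_erase s u hi, ← Finset.add_sum_erase s (fun j => if i ≠ j then u j else 0) hi]
  simp only [ne_eq, not_true, if_false, zero_add]
  congr 1
  refine Finset.sum_congr rfl fun j hj => ?_
  rw [if_pos (Finset.ne_of_mem_erase hj).symm]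

namespace DecGraph

section Replace

variable (G : DecGraph P) (S : Set G.V) (K : Type) [Finite K] (γ : ℕ) (δ : ℤ)
  (y : P.X γ K δ) (ι : K → G.Half) (hι : Function.Injective ι) (hS : ∀ l, (ι l).1 ∈ S)
  (pow' : G.Half → ℕ) (lab : G.Half ↪ H)

/-- The half-edges of `G.replace` as half-edges of `G`. -/
def replaceOld : (G.replace S K γ δ y ι hι hS pow').Half → G.Half
  | ⟨none, l⟩ => ι l
  | ⟨some v, l⟩ => ⟨v.1, l⟩

theorem replaceOld_injective : Function.Injective (G.replaceOld S K γ δ y ι hι hS pow') := by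
  rintro ⟨_ | v, l⟩ ⟨_ | w, m⟩ h
  · exact congrArg (fun l => (⟨none, l⟩ : (G.replace S K γ δ y ι hι hS pow').Half)) (hι h)
  · have e : (ι l).1 = w.1 := congrArg Sigma.fst h
    exact absurd (e ▸ hS l) w.2
  · have e : v.1 = (ι m).1 := congrArg Sigma.fst h
    exact absurd (e ▸ hS m) v.2
  · obtain ⟨v, hv⟩ := v
    obtain ⟨w, hw⟩ := w
    obtain rfl : v = w := congrArg Sigma.fst h
    obtain rfl : l = m := by
      exact sigma_mk_injective (β := G.leg) h
    rfl

/-- The names of the half-edges of `G.replace`. -/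
def replaceLab : (G.replace S K γ δ y ι hι hS pow').Half ↪ H :=
  ⟨fun h => lab (G.replaceOld S K γ δ y ι hι hS pow' h),
    lab.injective.comp (G.replaceOld_injective S K γ δ y ι hι hS pow')⟩

theorem isLab_replace {A : Matching H} {p p' : H → ℕ} (h : G.IsLab lab A p)
    (hp : ∀ k, pow' k = p' (lab k)) :
    (G.replace S K γ δ y ι hι hS pow').IsLab (G.replaceLab S K γ δ y ι hι hS pow' lab) A p' where
  adj := by
    rintro ⟨_ | v, l⟩ ⟨_ | w, m⟩
    · exact h.adj (ι l) (ι m)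
    · exact h.adj (ι l) ⟨w.1, m⟩
    · exact h.adj ⟨v.1, l⟩ (ι m)
    · exact h.adj ⟨v.1, l⟩ ⟨w.1, m⟩
  pow := by
    rintro ⟨_ | v, l⟩
    · exact hp (ι l)
    · exact hp ⟨v.1, l⟩

theorem map_enum_option {V : Type} [Finite V] [LinearOrder V] (S : Set V) [DecidablePred (· ∈ S)]
    {C : Type*} (c : Option {v // v ∉ S} → C) (x : C) (c' : V → C) (h₀ : c none = x)
    (h₁ : ∀ v, c (some v) = c' v.1) :
    (@enum (Option {v // v ∉ S}) _ (inferInstanceAs (LinearOrder (WithBot {v // v ∉ S})))).map c =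
      x :: ((enum V).filter (· ∉ S)).map c' := by
  have e₁ : none :: (enum {v // v ∉ S}).map some = @enum (Option {v // v ∉ S}) _
      (inferInstanceAs (LinearOrder (WithBot {v // v ∉ S}))) := by
    refine @eq_enum (Option {v // v ∉ S}) _ (inferInstanceAs (LinearOrder (WithBot {v // v ∉ S}))) _
      (List.pairwise_cons.2 ⟨fun a ha => ?_, ?_⟩) fun v => ?_
    · obtain ⟨b, -, rfl⟩ := List.mem_map.1 ha
      exact WithBot.bot_lt_coe b
    · exact List.pairwise_map.2 (enum_pairwise.imp fun h => WithBot.coe_lt_coe.2 h)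
    · cases v <;> simp
  have e₂ : (enum {v // v ∉ S}).map Subtype.val = (enum V).filter (· ∉ S) := by
    refine List.Pairwise.eq_of_mem_iff (r := (· < ·))
      (List.pairwise_map.2 (enum_pairwise.imp fun h => h)) (enum_pairwise.filter _) fun v => ?_
    simp
  refine (congrArg (List.map c) e₁.symm).trans ?_
  rw [← e₂, List.map_cons, h₀, List.map_map, List.map_map]
  congr 1
  exact List.map_congr_left fun v _ => h₁ v

open Classical in
theorem listOf_replace (hK : Function.Injective fun l => lab (ι l)) :
    (G.replace S K γ δ y ι hι hS pow').listOf (G.replaceLab S K γ δ y ι hι hS pow' lab) =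
      ⟨Set.range fun l => lab (ι l), γ, δ, P.map (Equiv.ofInjective _ hK) y⟩ ::
        ((enum G.V).filter (· ∉ S)).map (G.cor lab) :=
  map_enum_option S _ _ _ rfl fun _ => rfl

open Classical in
theorem cls_replace {A : Matching H} {p p' : H → ℕ} (h : G.IsLab lab A p)
    (hp : ∀ k, pow' k = p' (lab k)) (e : ℤ) :
    (G.replace S K γ δ y ι hι hS pow').cls e = clsL e A p'
      (⟨Set.range fun l => lab (ι l), γ, δ, P.map (Equiv.ofInjective _ (lab.injective.comp hι)) y⟩ ::
        ((enum G.V).filter (· ∉ S)).map (G.cor lab)) := by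
  rw [cls_eq_clsL (G.isLab_replace S K γ δ y ι hι hS pow' lab h hp) e,
    G.listOf_replace S K γ δ y ι hι hS pow' lab (lab.injective.comp hι)]
  rfl

end Replace

section Bridge

variable {G : DecGraph P} {lab : G.Half ↪ H} {A : Matching H} {p : H → ℕ}

theorem cls_actAt (h : G.IsLab lab A p) (i : G.V) {δ : ℤ} (y : P.X (G.genus i) (G.leg i) δ)
    {pow' : G.Half → ℕ} {p' : H → ℕ} (hp : ∀ k, pow' k = p' (lab k)) (e : ℤ) :
    (G.actAt i δ y pow').cls e = clsL e A p'
      (⟨Set.range fun l => lab ⟨i, l⟩, G.genus i, δ, P.map (G.legEquiv lab i) y⟩ ::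
        ((enum G.V).filter (· ≠ i)).map (G.cor lab)) := by
  refine (G.cls_replace {i} (G.leg i) (G.genus i) δ y (fun l => ⟨i, l⟩) sigma_mk_injective
    (fun _ => rfl) pow' lab h hp e).trans ?_
  refine congrArg (fun l => clsL e A p' (_ :: l.map (G.cor lab))) (List.filter_congr fun v _ => ?_)
  simp

theorem bd_cor (i : G.V) : Cor.bd (G.cor lab i) = ⟨Set.range fun l => lab ⟨i, l⟩, G.genus i,
    G.deg i - 1, P.map (G.legEquiv lab i) (P.bd (sub_add_cancel _ 1) (G.dec i))⟩ :=
  congrArg (Cor.mk _ _ _) (P.bd_map _ _ _)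

theorem act_cor (i : G.V) (a : G.leg i) : Cor.act (lab ⟨i, a⟩) (G.cor lab i) =
    ⟨Set.range fun l => lab ⟨i, l⟩, G.genus i, G.deg i + 1,
      P.map (G.legEquiv lab i) (P.B a rfl (G.dec i))⟩ := by
  rw [act_of_mem (x := G.cor lab i) (h := lab ⟨i, a⟩) ⟨a, rfl⟩ rfl]
  exact congrArg (Cor.mk _ _ _) (P.B_map a rfl (G.legEquiv lab i) (G.dec i))

theorem loop_cor (i : G.V) (a b : G.leg i) (hab : a ≠ b) :
    Cor.loop (lab ⟨i, a⟩) (lab ⟨i, b⟩) (Cor.act (lab ⟨i, a⟩) (G.cor lab i)) =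
    ⟨Set.range fun c : {c : G.leg i // c ≠ a ∧ c ≠ b} => lab ⟨i, c.1⟩, G.genus i + 1, G.deg i + 1,
      P.map (Equiv.ofInjective _ (lab.injective.comp
        (sigma_mk_injective.comp Subtype.val_injective)))
        (P.loop a b Subtype.val hab (legsOff_val a b) rfl (P.B a rfl (G.dec i)))⟩ := by
  have hK : (Set.range fun c : {c : G.leg i // c ≠ a ∧ c ≠ b} => lab ⟨i, c.1⟩) =
      (Set.range fun l => lab ⟨i, l⟩) \ {lab ⟨i, a⟩, lab ⟨i, b⟩} := by
    ext x
    constructor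
    · rintro ⟨c, rfl⟩
      refine ⟨⟨c.1, rfl⟩, ?_⟩
      simp [lab.injective.eq_iff, c.2.1, c.2.2]
    · rintro ⟨⟨c, rfl⟩, hc⟩
      simp only [Set.mem_insert_iff, Set.mem_singleton_iff, lab.injective.eq_iff, Sigma.mk.injEq,
        heq_eq_eq, true_and, not_or] at hc
      exact ⟨⟨c, hc⟩, rfl⟩
  have hne : lab ⟨i, a⟩ ≠ lab ⟨i, b⟩ := fun e => hab (by simpa using lab.injective e)
  let f : (Set.range fun c : {c : G.leg i // c ≠ a ∧ c ≠ b} => lab ⟨i, c.1⟩) →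
      Set.range fun l => lab ⟨i, l⟩ := fun l => ⟨l.1, ((Set.ext_iff.1 hK l.1).1 l.2).1⟩
  have ho := legsOff_of_lab (s := Set.range fun l => lab ⟨i, l⟩) (h := lab ⟨i, a⟩)
    (k := lab ⟨i, b⟩) ⟨a, rfl⟩ ⟨b, rfl⟩ hK f fun _ => rfl
  rw [act_cor, loop_eq (x := ⟨Set.range fun l => lab ⟨i, l⟩, G.genus i, G.deg i + 1,
      P.map (G.legEquiv lab i) (P.B a rfl (G.dec i))⟩) ⟨a, rfl⟩ ⟨b, rfl⟩ hne hK rfl f (fun _ => rfl)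
      (fun e => hne (congrArg Subtype.val e)) ho]
  exact congrArg (Cor.mk _ _ _) (P.loop_map a b Subtype.val f (G.legEquiv lab i)
    (Equiv.ofInjective _ _) hab _ _ _ rfl _ fun _ => rfl)

theorem glue_cor (i j : G.V) (hij : i ≠ j) (a : G.leg i) (b : G.leg j) :
    Cor.glue (lab ⟨i, a⟩) (lab ⟨j, b⟩) (Cor.act (lab ⟨i, a⟩) (G.cor lab i)) (G.cor lab j) =
    ⟨Set.range fun c : {c : G.leg i ⊕ G.leg j // c ≠ Sum.inl a ∧ c ≠ Sum.inr b} =>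
        lab (Sum.elim (Sigma.mk i) (Sigma.mk j) c.1),
      G.genus i + G.genus j, G.deg i + 1 + G.deg j,
      P.map (Equiv.ofInjective _ (lab.injective.comp
        (((sigma_mk_injective (β := G.leg)).sumElim sigma_mk_injective
          fun _ _ h => hij (congrArg Sigma.fst h)).comp Subtype.val_injective)))
        (P.glue a b Subtype.val (legsOff_val _ _) rfl rfl (P.B a rfl (G.dec i)) (G.dec j))⟩ := by
  have hd := G.disjoint_cor lab hij
  have hK : (Set.range fun c : {c : G.leg i ⊕ G.leg j // c ≠ Sum.inl a ∧ c ≠ Sum.inr b} =>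
        lab (Sum.elim (Sigma.mk i) (Sigma.mk j) c.1)) =
      ((Set.range fun l => lab ⟨i, l⟩) ∪ (Set.range fun l => lab ⟨j, l⟩)) \
        {lab ⟨i, a⟩, lab ⟨j, b⟩} := by
    ext x
    constructor
    · rintro ⟨⟨c | c, hc⟩, rfl⟩
      · refine ⟨Or.inl ⟨c, rfl⟩, ?_⟩
        simp only [ne_eq, Sum.inl.injEq] at hc
        simp [lab.injective.eq_iff, hc.1, hij]
      · refine ⟨Or.inr ⟨c, rfl⟩, ?_⟩
        simp only [ne_eq, Sum.inr.injEq] at hc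
        simp [lab.injective.eq_iff, hc.2, hij.symm]
    · rintro ⟨⟨c, rfl⟩ | ⟨c, rfl⟩, hc⟩
      · refine ⟨⟨Sum.inl c, fun e => hc (Or.inl ?_), Sum.inl_ne_inr⟩, rfl⟩
        rw [Sum.inl.injEq] at e
        rw [e]
      · refine ⟨⟨Sum.inr c, Sum.inr_ne_inl, fun e => hc (Or.inr ?_)⟩, rfl⟩
        rw [Sum.inr.injEq] at e
        rw [e]
        rfl
  have hl := lab_split (Set.range fun l => lab ⟨i, l⟩) (Set.range fun l => lab ⟨j, l⟩)
    (lab ⟨i, a⟩) (lab ⟨j, b⟩)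
  let f : (Set.range fun c : {c : G.leg i ⊕ G.leg j // c ≠ Sum.inl a ∧ c ≠ Sum.inr b} =>
        lab (Sum.elim (Sigma.mk i) (Sigma.mk j) c.1)) →
      (Set.range fun l => lab ⟨i, l⟩) ⊕ (Set.range fun l => lab ⟨j, l⟩) :=
    fun l => split _ _ (lab ⟨i, a⟩) (lab ⟨j, b⟩) ⟨l.1, hK ▸ l.2⟩
  have hf : ∀ l, Cor.lab (f l) = l := fun l => hl _
  have ho := legsOff_of_lab_sum hd ⟨a, rfl⟩ ⟨b, rfl⟩ hK f hf
  rw [act_cor, glue_eq (x := ⟨Set.range fun l => lab ⟨i, l⟩, G.genus i, G.deg i + 1,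
      P.map (G.legEquiv lab i) (P.B a rfl (G.dec i))⟩) (y := G.cor lab j) ⟨a, rfl⟩ ⟨b, rfl⟩ hd hK rfl
      rfl f hf ho]
  refine congrArg (Cor.mk _ _ _) (P.glue_map a b Subtype.val f (G.legEquiv lab i)
    (G.legEquiv lab j) (Equiv.ofInjective _ _) _ _ rfl rfl _ _ ?_)
  rintro ⟨c, hc⟩
  refine lab_injective hd ((hf _).trans ?_)
  rcases c with c | c <;> rfl

theorem sewLoop_cls (h : G.IsLab lab A p) (i : G.V) (a b : G.leg i) (hab : a ≠ b) (e : ℤ) :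
    (G.sewLoop i a b hab).cls e = clsL e A p
      (Cor.loop (lab ⟨i, a⟩) (lab ⟨i, b⟩) (Cor.act (lab ⟨i, a⟩) (G.cor lab i)) ::
        ((enum G.V).filter (· ≠ i)).map (G.cor lab)) := by
  rw [loop_cor i a b hab]
  refine (G.cls_replace {i} _ _ _ _ (fun c : {c : G.leg i // c ≠ a ∧ c ≠ b} => ⟨i, c.1⟩)
    (sigma_mk_injective.comp Subtype.val_injective) (fun _ => rfl) G.pow lab h h.pow e).trans ?_
  refine congrArg (fun l => clsL e A p (_ :: l.map (G.cor lab))) (List.filter_congr fun v _ => ?_)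
  simp

theorem sewEdge_cls (h : G.IsLab lab A p) (i j : G.V) (hij : i ≠ j) (a : G.leg i) (b : G.leg j)
    (e : ℤ) :
    (G.sewEdge i j hij a b).cls e = clsL e A p
      (Cor.glue (lab ⟨i, a⟩) (lab ⟨j, b⟩) (Cor.act (lab ⟨i, a⟩) (G.cor lab i)) (G.cor lab j) ::
        (((enum G.V).filter (· ≠ j)).filter (· ≠ i)).map (G.cor lab)) := by
  rw [glue_cor i j hij a b, List.filter_filter]
  refine (G.cls_replace {i, j} _ _ _ _
    (fun c : {c : G.leg i ⊕ G.leg j // c ≠ Sum.inl a ∧ c ≠ Sum.inr b} =>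
      Sum.elim (Sigma.mk i) (Sigma.mk j) c.1)
    (((sigma_mk_injective (β := G.leg)).sumElim sigma_mk_injective
      fun _ _ h => hij (congrArg Sigma.fst h)).comp Subtype.val_injective)
    (by rintro ⟨c | c, _⟩ <;> simp) G.pow lab h h.pow e).trans ?_
  refine congrArg (fun l => clsL e A p (_ :: l.map (G.cor lab))) (List.filter_congr fun v _ => ?_)
  simp

end Bridge

end DecGraph

end

noncomputable section

open Cor

variable {P : S1FramedModularOperad.{u}} {H : Type} [Finite H]

theorem finsum_prop_eq {N : Type*} [AddCommMonoid N] {c : Prop} [Decidable c] (F : c → N) :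
    ∑ᶠ h : c, F h = if h : c then F h else 0 := by
  split_ifs with h
  · rw [finsum_eq_single F h fun x hx => absurd rfl hx]
  · have : IsEmpty c := ⟨h⟩
    exact finsum_of_isEmpty F

namespace DecGraph

variable {G : DecGraph P} {lab : G.Half ↪ H} {A : Matching H} {p : H → ℕ}
variable {M : Type w} [AddCommGroup M] [Module ℚ M]

theorem frontSign_eq (i : G.V) :
    G.frontSign i = sgn (frontExp (fun v => [G.cor lab v]) (enum G.V) i) := by
  classical
  rw [frontSign, frontExp, finsum_eq_enum]
  congr 1
  refine List.sum_map_congr fun v _ => ?_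
  simp only [finsum_eq_if, degSum_cons, degSum_nil, add_zero]
  rfl

theorem front_listOf {f : List (Cor P H) → M} (hf : Compat f) (i : G.V) :
    f (G.listOf lab) = G.frontSign i •
      f (G.cor lab i :: ((enum G.V).filter (· ≠ i)).map (G.cor lab)) := by
  have := hf.front (fun v => [G.cor lab v]) enum_pairwise (mem_enum i)
  rw [flatMap_pure_cor, flatMap_pure_cor, ← frontSign_eq] at this
  exact this

theorem front₂_listOf {f : List (Cor P H) → M} (hf : Compat f) {i j : G.V} (hij : i ≠ j) :
    f (G.listOf lab) = G.frontSign₂ i j • f (G.cor lab i :: G.cor lab j ::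
      (((enum G.V).filter (· ≠ j)).filter (· ≠ i)).map (G.cor lab)) := by
  classical
  have h := (hf.cons (G.cor lab j)).front (fun v => [G.cor lab v])
    (enum_pairwise.filter (· ≠ j)) (v := i) (by simpa using hij)
  rw [flatMap_pure_cor, flatMap_pure_cor] at h
  rw [front_listOf hf j, h, List.singleton_append, hf.swap_head, frontSign, smul_smul, smul_smul,
    ← sgn_add, ← sgn_add, frontSign₂]
  congr 1
  have e₁ : frontExp (fun v => [G.cor lab v]) ((enum G.V).filter (· ≠ j)) i =
      ∑ᶠ (v) (_ : v < i ∧ v ≠ j), G.deg i * G.deg v := by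
    rw [frontExp, finsum_eq_enum]
    generalize enum G.V = vs
    induction vs with
    | nil => rfl
    | cons v vs ih =>
      rw [List.map_cons, List.sum_cons, ← ih, finsum_eq_if]
      by_cases hv : v = j
      · simp [hv]
      · rw [List.filter_cons_of_pos (by simpa using hv), List.map_cons, List.sum_cons]
        simp [hv]
        rfl
  have e₂ : ∑ᶠ (v) (_ : v < j), G.deg j * G.deg v =
      (∑ᶠ (v) (_ : v < j ∧ v ≠ i), G.deg j * G.deg v) + if i < j then G.deg j * G.deg i else 0 := by
    have : ∀ v, ∑ᶠ (_ : v < j), G.deg j * G.deg v =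
        (∑ᶠ (_ : v < j ∧ v ≠ i), G.deg j * G.deg v) +
          if v = i then (if i < j then G.deg j * G.deg i else 0) else 0 := by
      intro v
      simp only [finsum_eq_if]
      by_cases hv : v = i
      · subst hv; simp
      · simp [hv]
    rw [finsum_congr this, finsum_add_distrib (Set.toFinite _) (Set.toFinite _)]
    congr 1
    rw [finsum_eq_single _ i fun v hv => if_neg hv, if_pos rfl]
  rw [e₁, e₂]
  apply sgn_congr
  rcases lt_or_gt_of_ne hij with h | h
  · rw [if_pos h, if_neg h.not_gt]
    exact ⟨G.deg i * G.deg j, by simp only [cor]; ring⟩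
  · rw [if_neg h.not_gt, if_pos h]
    exact ⟨0, by simp only [cor]; ring⟩

theorem notMem_rest {i : G.V} (a : G.leg i) {vs : List G.V} (h : i ∉ vs) :
    lab ⟨i, a⟩ ∉ labels (vs.map (G.cor lab)) := by
  rw [labels_map_cor]
  rintro ⟨v, hv, b, e⟩
  obtain rfl : v = i := congrArg Sigma.fst (lab.injective e)
  exact h hv

theorem sew_self_cls (h : G.IsLab lab A p) (e : ℤ) (i : G.V) {a b : G.leg i} (hab : a ≠ b) :
    sew (lab ⟨i, a⟩) (lab ⟨i, b⟩) (G.listOf lab) (clsL e A p) =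
      G.frontSign i • (G.sewLoop i a b hab).cls e := by
  rw [front_listOf ((compat_clsL e A p).sew _ _) i, sewLoop_cls h, sew_loop (compat_clsL e A p)]
  · exact notMem_rest a (by simp)
  · exact notMem_rest b (by simp)

theorem sew_ne_cls (h : G.IsLab lab A p) (e : ℤ) {i j : G.V} (hij : i ≠ j) (a : G.leg i)
    (b : G.leg j) :
    sew (lab ⟨i, a⟩) (lab ⟨j, b⟩) (G.listOf lab) (clsL e A p) =
      G.frontSign₂ i j • (G.sewEdge i j hij a b).cls e := by
  rw [front₂_listOf ((compat_clsL e A p).sew _ _) hij, sewEdge_cls h, sew_edge (compat_clsL e A p)]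
  · rw [← List.map_cons]
    exact notMem_rest a (by simp [hij])
  · exact notMem_rest b (by simp)
  · rintro ⟨c, hc⟩
    exact hij (congrArg Sigma.fst (lab.injective hc))

/-- Twisted sewing in terms of lists of corollas. -/
theorem twistedSewing_eq (h : G.IsLab lab A p) (e : ℤ) {R : G.Half → G.Half → Prop}
    {R' : H → H → Prop} (hR : ∀ a b, R a b ↔ R' (lab a) (lab b)) :
    G.twistedSewing e R = opS R' p (G.listOf lab) (clsL e A) := by
  classical
  set t : G.Half → G.Half → FeynmanTotal P e := fun a b =>
    if R a b ∧ G.pow a = 0 ∧ G.pow b = 0 then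
      sew (lab a) (lab b) (G.listOf lab) (clsL e A p) else 0 with ht
  have e₁ : opS R' p (G.listOf lab) (clsL e A) = ∑ a ∈ allOf G.Half, ∑ b ∈ allOf G.Half, t a b := by
    rw [opS, sum_allOf_embedding lab]
    · refine Finset.sum_congr rfl fun a _ => ?_
      rw [sum_allOf_embedding lab]
      · refine Finset.sum_congr rfl fun b _ => ?_
        simp only [ht, hR, h.pow]
      · intro k hk
        rw [sew_eq_zero (compat_clsL e A p) (Or.inr (by rwa [labels_listOf])), ite_self]
    · intro k hk
      refine Finset.sum_eq_zero fun b _ => ?_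
      rw [sew_eq_zero (compat_clsL e A p) (Or.inl (by rwa [labels_listOf])), ite_self]
  have e₂ : ∑ a ∈ allOf G.Half, ∑ b ∈ allOf G.Half, t a b =
      ∑ i ∈ allOf G.V, ∑ a ∈ allOf (G.leg i), ∑ b ∈ allOf (G.leg i), t ⟨i, a⟩ ⟨i, b⟩ +
      ∑ i ∈ allOf G.V, ∑ j ∈ allOf G.V, ∑ a ∈ allOf (G.leg i), ∑ b ∈ allOf (G.leg j),
        if i ≠ j then t ⟨i, a⟩ ⟨j, b⟩ else 0 := by
    rw [sum_allOf_sigma, ← Finset.sum_add_distrib]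
    refine Finset.sum_congr rfl fun i _ => ?_
    rw [Finset.sum_comm (s := allOf G.V), ← Finset.sum_add_distrib]
    refine Finset.sum_congr rfl fun a _ => ?_
    rw [sum_allOf_sigma, sum_eq_add_ite (mem_allOf i)]
    congr 1
    refine Finset.sum_congr rfl fun j _ => ?_
    split_ifs <;> simp
  rw [e₁, e₂, twistedSewing]
  simp only [finsum_allOf]
  congr 1
  · refine Finset.sum_congr rfl fun i _ => Finset.sum_congr rfl fun a _ =>
      Finset.sum_congr rfl fun b _ => ?_
    rw [finsum_prop_eq]
    by_cases hab : a = b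
    · subst hab
      rw [dif_neg fun h => h.1 rfl]
      simp only [ht]
      rw [sew_self (compat_clsL e A p) (G.disj_listOf lab), ite_self]
    · simp only [ht]
      by_cases hc : R ⟨i, a⟩ ⟨i, b⟩ ∧ G.pow ⟨i, a⟩ = 0 ∧ G.pow ⟨i, b⟩ = 0
      · rw [dif_pos ⟨hab, hc⟩, if_pos hc, sew_self_cls h]
      · rw [dif_neg fun e => hc e.2, if_neg hc]
  · refine Finset.sum_congr rfl fun i _ => Finset.sum_congr rfl fun j _ =>
      Finset.sum_congr rfl fun a _ => Finset.sum_congr rfl fun b _ => ?_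
    rw [finsum_prop_eq]
    by_cases hij : i = j
    · rw [dif_neg fun h => h.1 hij, if_neg (not_not.2 hij)]
    · rw [if_pos hij]
      simp only [ht]
      by_cases hc : R ⟨i, a⟩ ⟨j, b⟩ ∧ G.pow ⟨i, a⟩ = 0 ∧ G.pow ⟨j, b⟩ = 0
      · rw [dif_pos ⟨hij, hc⟩, if_pos hc, sew_ne_cls h e hij]
      · rw [dif_neg fun e => hc e.2, if_neg hc]

theorem der_listOf {f : List (Cor P H) → M} (hf : Compat f) {θ : Cor P H → Cor P H} {n : ℤ}
    (hθ : IsLin n θ) : der θ n (G.listOf lab) f = ∑ i ∈ allOf G.V, G.frontSign i •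
      f (θ (G.cor lab i) :: ((enum G.V).filter (· ≠ i)).map (G.cor lab)) := by
  have := der_blocks (fun v => [G.cor lab v]) hf hθ (enum_pairwise (V := G.V))
  rw [flatMap_pure_cor] at this
  refine this.trans ?_
  rw [← finsum_allOf, finsum_eq_enum]
  refine List.sum_map_congr fun i _ => ?_
  rw [← frontSign_eq, flatMap_pure_cor, der_cons, der_nil, smul_zero, add_zero]
  rfl

/-- `∂ + uB` in terms of lists of corollas. -/
theorem internal_eq (h : G.IsLab lab A p) (e : ℤ) :
    (∑ᶠ i : G.V, G.frontSign i •
      cls e (G.actAt i (G.deg i - 1) (P.bd (sub_add_cancel _ 1) (G.dec i)) G.pow)) +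
    (∑ᶠ (i : G.V) (a : G.leg i) (_ : G.pow ⟨i, a⟩ ≠ 0), G.frontSign i •
      cls e (G.actAt i (G.deg i + 1) (P.B a rfl (G.dec i))
        (open Classical in Function.update G.pow ⟨i, a⟩ (G.pow ⟨i, a⟩ - 1)))) =
    opI p (G.listOf lab) (clsL e A) := by
  classical
  rw [opI]
  congr 1
  · rw [der_listOf (compat_clsL e A p) isLin_bd, finsum_allOf]
    refine Finset.sum_congr rfl fun i _ => ?_
    rw [cls_actAt h i _ h.pow, bd_cor]
  · rw [opU, sum_allOf_embedding lab]
    · rw [sum_allOf_sigma]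
      simp only [finsum_allOf]
      refine Finset.sum_congr rfl fun i _ => Finset.sum_congr rfl fun a _ => ?_
      rw [finsum_eq_if, ← h.pow]
      split_ifs with hp
      · have hp' : ∀ k, Function.update G.pow ⟨i, a⟩ (G.pow ⟨i, a⟩ - 1) k =
            Function.update p (lab ⟨i, a⟩) (G.pow ⟨i, a⟩ - 1) (lab k) := by
          intro k
          by_cases hk : k = ⟨i, a⟩
          · subst hk; simp
          · rw [Function.update_of_ne hk, Function.update_of_ne (lab.injective.ne hk), h.pow]
        rw [cls_actAt h i _ hp', ← act_cor, front_listOf ((compat_clsL e A _).der (isLin_act _)) i,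
          der_act_cons (compat_clsL e A _) (notMem_rest a (by simp))]
      · rfl
    · intro k hk
      rw [der_act_eq_zero (compat_clsL e A _) (by rwa [labels_listOf]), ite_self]

/-- `∂ + uB + δ` for the edges `A`, followed by `f`. -/
def opQ (A : Matching H) (p : H → ℕ) (L : List (Cor P H)) (f : (H → ℕ) → List (Cor P H) → M) : M :=
  opI p L f + (1 / 2 : ℚ) • opS A.Adj p L f

theorem differential_eq (h : G.IsLab lab A p) (e : ℤ) :
    G.differential e = opQ A p (G.listOf lab) (clsL e A) := by
  rw [opQ, ← internal_eq h e, ← twistedSewing_eq h e h.adj]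
  rfl

end DecGraph

end

noncomputable section

open Cor

variable {P : S1FramedModularOperad.{u}} {H : Type} [Finite H]
variable {M : Type w} [AddCommGroup M] [Module ℚ M]

namespace Matching

/-- The pairs of half-edges that are not matched. -/
def leafPair (A : Matching H) (h k : H) : Prop :=
  (∀ l, ¬ A.Adj h l) ∧ ∀ l, ¬ A.Adj k l

/-- A set of half-edges is saturated if it contains the partners of its elements. -/
def Sat (A : Matching H) (S : Set H) : Prop := ∀ h ∈ S, ∀ k, A.Adj h k → k ∈ S

end Matching

open Classical in
/-- The degree of a decorated graph, in terms of its list of corollas. -/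
def degL (A : Matching H) (p : H → ℕ) (L : List (Cor P H)) : ℤ :=
  degSum L + 2 * (∑ h ∈ (allOf H).filter (· ∈ labels L), (p h : ℤ)) +
    ((allOf H).filter fun h => h ∈ labels L ∧ ∃ k ∈ labels L, A.Adj h k).card

/-- One term of the operator `∂ + uB + δ`. -/
structure Step (A : Matching H) (p : H → ℕ) (L : List (Cor P H)) (p' : H → ℕ)
    (L' : List (Cor P H)) : Prop where
  disj : Disj L'
  sub : labels L' ⊆ labels L
  leaf : ∀ x ∈ labels L, (∀ k, ¬ A.Adj x k) → x ∈ labels L'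
  sat : A.Sat (labels L) → A.Sat (labels L')
  pow : ∀ h, h ∉ labels L → p' h = p h
  conn : ConnL A.Adj (L'.map Cor.legs) ↔ ConnL A.Adj (L.map Cor.legs)
  deg : degL A p' L' + 1 = degL A p L

/-- One term of a twisted sewing. -/
structure SewStep (h k : H) (L L' : List (Cor P H)) : Prop where
  ne : h ≠ k
  left : h ∈ labels L
  right : k ∈ labels L
  disj : Disj L'
  labels : labels L' = labels L \ {h, k}
  deg : degSum L' = degSum L + 1
  conn : ∀ A : Matching H, A.Adj h k →
    (ConnL A.Adj (L.map Cor.legs) ↔ ConnL A.Adj (L'.map Cor.legs))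

theorem labels_mid {θ : Cor P H → Cor P H} (hθ : ∀ x, (θ x).legs = x.legs) (l₁ l₂ : List (Cor P H))
    (x : Cor P H) : labels (l₁ ++ θ x :: l₂) = labels (l₁ ++ x :: l₂) := by
  simp only [labels_append, labels_cons, hθ]

theorem opS_congr {R : H → H → Prop} {p : H → ℕ} {L : List (Cor P H)} (hL : Disj L)
    {f g : (H → ℕ) → List (Cor P H) → M} (hf : ∀ p, Compat (f p)) (hg : ∀ p, Compat (g p))
    (H₀ : ∀ h k L', R h k → p h = 0 → p k = 0 → SewStep h k L L' → f p L' = g p L') :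
    opS R p L f = opS R p L g := by
  classical
  refine Finset.sum_congr rfl fun h _ => Finset.sum_congr rfl fun k _ => ?_
  split_ifs with hc
  · rcases sew_cases h k hL with h₀ | ⟨s, L', h₁, h₂, h₃, h₄, h₅, h₆, h₇, h₈⟩
    · rw [h₀ _ (hf p), h₀ _ (hg p)]
    · rw [h₁ _ (hf p), h₁ _ (hg p), H₀ h k L' hc.1 hc.2.1 hc.2.2 ⟨h₂, h₃, h₄, h₅, h₆, h₇, h₈⟩]
  · rfl

/-- Half-edges outside the list do not matter for sewing. -/
theorem opS_congr_rel {R R' : H → H → Prop} {p : H → ℕ} {L : List (Cor P H)} (hL : Disj L)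
    {f : (H → ℕ) → List (Cor P H) → M} (hf : ∀ p, Compat (f p))
    (hR : ∀ h ∈ labels L, ∀ k ∈ labels L, h ≠ k → (R h k ↔ R' h k)) :
    opS R p L f = opS R' p L f := by
  classical
  refine Finset.sum_congr rfl fun h _ => Finset.sum_congr rfl fun k _ => ?_
  by_cases hh : h ∈ labels L
  · by_cases hk : k ∈ labels L
    · by_cases hne : h = k
      · subst hne
        rw [sew_self (hf p) hL, ite_self, ite_self]
      · simp only [hR h hh k hk hne]
    · rw [sew_eq_zero (hf p) (Or.inr hk), ite_self, ite_self]
  · rw [sew_eq_zero (hf p) (Or.inl hh), ite_self, ite_self]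

theorem degL_sew {A : Matching H} {p : H → ℕ} {L L' : List (Cor P H)} {h k : H}
    (hs : SewStep h k L L') (hA : A.Adj h k) (hh : p h = 0) (hk : p k = 0) :
    degL A p L' + 1 = degL A p L := by
  classical
  have e₁ : ∑ h ∈ (allOf H).filter (· ∈ labels L'), (p h : ℤ) =
      ∑ h ∈ (allOf H).filter (· ∈ labels L), (p h : ℤ) := by
    refine Finset.sum_subset (fun x => ?_) fun x hx hx' => ?_
    · simp only [Finset.mem_filter, mem_allOf, true_and, hs.labels]
      exact fun e => e.1
    · simp only [Finset.mem_filter, mem_allOf, true_and, hs.labels, Set.mem_sdiff,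
        Set.mem_insert_iff, Set.mem_singleton_iff, not_and, not_not] at hx hx'
      rcases hx' hx with rfl | rfl
      · exact_mod_cast hh
      · exact_mod_cast hk
  have e₂ : ((allOf H).filter fun a => a ∈ labels L ∧ ∃ b ∈ labels L, A.Adj a b) =
      insert h (insert k ((allOf H).filter fun a => a ∈ labels L' ∧ ∃ b ∈ labels L', A.Adj a b)) := by
    ext x
    simp only [Finset.mem_filter, mem_allOf, true_and, Finset.mem_insert, hs.labels, Set.mem_sdiff,
      Set.mem_insert_iff, Set.mem_singleton_iff, not_or]
    constructor
    · rintro ⟨hx, y, hy, hxy⟩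
      by_cases x₁ : x = h
      · exact Or.inl x₁
      by_cases x₂ : x = k
      · exact Or.inr (Or.inl x₂)
      refine Or.inr (Or.inr ⟨⟨hx, x₁, x₂⟩, y, ⟨hy, ?_, ?_⟩, hxy⟩)
      · rintro rfl
        exact x₂ (A.unique (A.symm hxy) hA)
      · rintro rfl
        exact x₁ (A.unique (A.symm hxy) (A.symm hA))
    · rintro (rfl | rfl | ⟨⟨hx, -⟩, y, ⟨hy, -⟩, hxy⟩)
      · exact ⟨hs.left, k, hs.right, hA⟩
      · exact ⟨hs.right, h, hs.left, A.symm hA⟩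
      · exact ⟨hx, y, hy, hxy⟩
  have e₃ : k ∉ (allOf H).filter fun a => a ∈ labels L' ∧ ∃ b ∈ labels L', A.Adj a b := by
    simp [hs.labels]
  have e₄ : h ∉ insert k ((allOf H).filter fun a => a ∈ labels L' ∧ ∃ b ∈ labels L', A.Adj a b) := by
    simp [hs.labels, hs.ne]
  rw [degL, degL, e₁, e₂, Finset.card_insert_of_notMem e₄, Finset.card_insert_of_notMem e₃, hs.deg]
  push_cast
  ring

theorem degL_sew_leaf {A : Matching H} {p : H → ℕ} {L L' : List (Cor P H)} {h k : H}
    (hs : SewStep h k L L') (hA : A.leafPair h k) (hh : p h = 0) (hk : p k = 0) :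
    degL A p L' = degL A p L + 1 := by
  classical
  have e₁ : ∑ h ∈ (allOf H).filter (· ∈ labels L'), (p h : ℤ) =
      ∑ h ∈ (allOf H).filter (· ∈ labels L), (p h : ℤ) := by
    refine Finset.sum_subset (fun x => ?_) fun x hx hx' => ?_
    · simp only [Finset.mem_filter, mem_allOf, true_and, hs.labels]
      exact fun e => e.1
    · simp only [Finset.mem_filter, mem_allOf, true_and, hs.labels, Set.mem_sdiff,
        Set.mem_insert_iff, Set.mem_singleton_iff, not_and, not_not] at hx hx'
      rcases hx' hx with rfl | rfl
      · exact_mod_cast hh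
      · exact_mod_cast hk
  have e₂ : ((allOf H).filter fun a => a ∈ labels L ∧ ∃ b ∈ labels L, A.Adj a b) =
      (allOf H).filter fun a => a ∈ labels L' ∧ ∃ b ∈ labels L', A.Adj a b := by
    ext x
    simp only [Finset.mem_filter, mem_allOf, true_and, hs.labels, Set.mem_sdiff,
      Set.mem_insert_iff, Set.mem_singleton_iff, not_or]
    constructor
    · rintro ⟨hx, y, hy, hxy⟩
      refine ⟨⟨hx, ?_, ?_⟩, y, ⟨hy, ?_, ?_⟩, hxy⟩
      · rintro rfl; exact hA.1 _ hxy
      · rintro rfl; exact hA.2 _ hxy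
      · rintro rfl; exact hA.1 _ (A.symm hxy)
      · rintro rfl; exact hA.2 _ (A.symm hxy)
    · rintro ⟨⟨hx, -⟩, y, ⟨hy, -⟩, hxy⟩
      exact ⟨hx, y, hy, hxy⟩
  rw [degL, degL, e₁, e₂, hs.deg]
  ring

theorem degL_mid {A : Matching H} {p : H → ℕ} {θ : Cor P H → Cor P H} {n : ℤ}
    (hθ : ∀ x, (θ x).legs = x.legs) (hd : ∀ x, (θ x).deg = x.deg + n) (l₁ l₂ : List (Cor P H))
    (x : Cor P H) : degL A p (l₁ ++ θ x :: l₂) = degL A p (l₁ ++ x :: l₂) + n := by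
  rw [degL, degL, labels_mid hθ]
  simp only [degSum_append, degSum_cons, hd]
  ring

theorem SewStep.step {A : Matching H} {p : H → ℕ} {L L' : List (Cor P H)} {h k : H}
    (hs : SewStep h k L L') (hA : A.Adj h k) (hh : p h = 0) (hk : p k = 0) : Step A p L p L' where
  disj := hs.disj
  sub := hs.labels ▸ Set.sdiff_subset
  leaf x hx hx' := by
    rw [hs.labels]
    refine ⟨hx, ?_⟩
    rintro (rfl | rfl)
    · exact hx' _ hA
    · exact hx' _ (A.symm hA)
  sat hS := by
    intro x hx y hxy
    rw [hs.labels] at hx ⊢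
    refine ⟨hS x hx.1 y hxy, ?_⟩
    rintro (rfl | rfl)
    · exact hx.2 (Or.inr (A.unique (A.symm hxy) hA))
    · exact hx.2 (Or.inl (A.unique (A.symm hxy) (A.symm hA)))
  pow _ _ := rfl
  conn := (hs.conn A hA).symm
  deg := degL_sew hs hA hh hk

theorem step_of_mid {A : Matching H} {p p' : H → ℕ} {θ : Cor P H → Cor P H}
    (hθ : ∀ x, (θ x).legs = x.legs) {l₁ l₂ : List (Cor P H)} {x : Cor P H}
    (hL : Disj (l₁ ++ x :: l₂)) (hp : ∀ h, h ∉ labels (l₁ ++ x :: l₂) → p' h = p h)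
    (hd : degL A p' (l₁ ++ θ x :: l₂) + 1 = degL A p (l₁ ++ x :: l₂)) :
    Step A p (l₁ ++ x :: l₂) p' (l₁ ++ θ x :: l₂) where
  disj := Disj.der hθ hL
  sub := (labels_mid hθ l₁ l₂ x).le
  leaf y hy _ := by rwa [labels_mid hθ]
  sat hS := by rwa [labels_mid hθ]
  pow := hp
  conn := by simp only [List.map_append, List.map_cons, hθ]
  deg := hd

theorem opI_congr {A : Matching H} {p : H → ℕ} {L : List (Cor P H)} (hL : Disj L)
    {f g : (H → ℕ) → List (Cor P H) → M} (hf : ∀ p, Compat (f p)) (hg : ∀ p, Compat (g p))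
    (H₀ : ∀ p' L', Step A p L p' L' → f p' L' = g p' L') :
    opI p L f = opI p L g := by
  classical
  rw [opI, opI]
  congr 1
  · refine der_congr _ _ _ fun l₁ x l₂ e => H₀ _ _ ?_
    subst e
    exact step_of_mid (p' := p) (θ := bd) (fun _ => rfl) hL (fun _ _ => rfl) (by
      rw [degL_mid (θ := bd) (n := -1) (fun _ => rfl) fun _ => rfl]
      ring)
  · refine Finset.sum_congr rfl fun h _ => ?_
    split_ifs with hp
    · by_cases hh : h ∈ labels L
      · refine der_congr _ _ _ fun l₁ x l₂ e => H₀ _ _ ?_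
        subst e
        refine step_of_mid (θ := act h) (fun _ => rfl) hL (fun k hk => ?_) ?_
        · rw [Function.update_of_ne]
          rintro rfl
          exact hk hh
        · rw [degL_mid (θ := act h) (n := 1) (fun _ => rfl) fun _ => rfl, degL, degL]
          have hm : h ∈ (allOf H).filter (· ∈ labels (l₁ ++ x :: l₂)) := by simpa using hh
          have e : ∑ k ∈ (allOf H).filter (· ∈ labels (l₁ ++ x :: l₂)),
              ((Function.update p h (p h - 1) k : ℕ) : ℤ) + 1 =
              ∑ k ∈ (allOf H).filter (· ∈ labels (l₁ ++ x :: l₂)), (p k : ℤ) := by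
            rw [← Finset.add_sum_erase _ _ hm, ← Finset.add_sum_erase _ (fun k => (p k : ℤ)) hm,
              Function.update_self, Finset.sum_congr rfl fun k hk => by
                rw [Function.update_of_ne (Finset.ne_of_mem_erase hk)]]
            have : 1 ≤ p h := Nat.one_le_iff_ne_zero.2 hp
            push_cast [this]
            ring
          rw [← e]
          ring
      · rw [der_act_eq_zero (hf _) hh, der_act_eq_zero (hg _) hh]
    · rfl

namespace DecGraph

theorem opQ_congr {A : Matching H} {p : H → ℕ} {L : List (Cor P H)} (hL : Disj L)
    {f g : (H → ℕ) → List (Cor P H) → M} (hf : ∀ p, Compat (f p)) (hg : ∀ p, Compat (g p))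
    (H₀ : ∀ p' L', Step A p L p' L' → f p' L' = g p' L') :
    opQ A p L f = opQ A p L g := by
  rw [opQ, opQ, opI_congr hL hf hg H₀,
    opS_congr hL hf hg fun h k L' hA hh hk hs => H₀ p L' (hs.step hA hh hk)]

theorem compat_opQ (A : Matching H) (p : H → ℕ) {f : (H → ℕ) → List (Cor P H) → M}
    (hf : ∀ p, Compat (f p)) : Compat fun L => opQ A p L f :=
  (compat_opI hf p).fun_add ((compat_opS hf A.Adj p).fun_smul _)

theorem opQ_map (A : Matching H) (p : H → ℕ) {N : Type*} [AddCommGroup N] [Module ℚ N]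
    (Λ : M →ₗ[ℚ] N) (L : List (Cor P H)) (f : (H → ℕ) → List (Cor P H) → M) :
    opQ A p L (fun p' l => Λ (f p' l)) = Λ (opQ A p L f) := by
  rw [opQ, opQ, opI_map, opS_map, map_add, map_smul]

theorem opQ_smul (A : Matching H) (p : H → ℕ) (L : List (Cor P H)) (c : ℚ)
    (f : (H → ℕ) → List (Cor P H) → M) : opQ A p L (fun p' l => c • f p' l) = c • opQ A p L f :=
  opQ_map A p (LinearMap.lsmul ℚ M c) L f

theorem opQ_fun_zero (A : Matching H) (p : H → ℕ) (L : List (Cor P H)) :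
    opQ A p L (fun _ _ => (0 : M)) = 0 := by
  simpa using opQ_smul A p L 0 fun _ _ => (0 : M)

theorem opS_fun_zero (R : H → H → Prop) (p : H → ℕ) (L : List (Cor P H)) :
    opS R p L (fun _ _ => (0 : M)) = 0 := by
  simpa using opS_smul R p L 0 fun _ _ => (0 : M)

theorem opQ_opS (A : Matching H) (R : H → H → Prop) (p : H → ℕ) {L : List (Cor P H)} (hL : Disj L)
    {f : (H → ℕ) → List (Cor P H) → M} (hf : ∀ p, Compat (f p)) :
    opQ A p L (fun p' l => opS R p' l f) = -opS R p L fun p' l => opQ A p' l f := by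
  simp only [opQ, opS_add, opS_smul]
  rw [opI_opS hf R p hL, opS_opS hf A.Adj R p hL, smul_neg, neg_add]

theorem opQ_opQ (A : Matching H) (p : H → ℕ) {L : List (Cor P H)} (hL : Disj L)
    {f : (H → ℕ) → List (Cor P H) → M} (hf : ∀ p, Compat (f p)) :
    opQ A p L (fun p' l => opQ A p' l f) = 0 := by
  have h := opS_opS hf A.Adj A.Adj p hL
  have h' : opS A.Adj p L (fun p' l => opS A.Adj p' l f) = 0 := by
    have : (2 : ℚ) • opS A.Adj p L (fun p' l => opS A.Adj p' l f) = 0 := by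
      rw [two_smul]
      nth_rewrite 1 [h]
      simp
    exact (smul_eq_zero.1 this).resolve_left two_ne_zero
  simp only [opQ, opS_add, opS_smul, opI_add, opI_smul]
  rw [opI_opI hf, h', opI_opS hf A.Adj p hL]
  simp

/-! ### Connectivity and degree -/

variable {G : DecGraph P} {lab : G.Half ↪ H} {A : Matching H} {p : H → ℕ}

theorem map_legs_listOf : (G.listOf lab).map Cor.legs =
    (enum G.V).map fun v => Set.range fun l => lab ⟨v, l⟩ := by
  rw [listOf, List.map_map]
  rfl

theorem exists_colouring {V α : Type*} {S : V → α} {vs : List V} (hn : vs.Nodup)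
    {c : List (α × Bool)} (hc : c.map Prod.fst = vs.map S) :
    ∃ col : V → Bool, c = vs.map fun v => (S v, col v) := by
  classical
  induction vs generalizing c with
  | nil => exact ⟨fun _ => true, by simpa using hc⟩
  | cons v vs ih =>
    obtain ⟨⟨s, b⟩, c, rfl, rfl, hc'⟩ := List.map_eq_cons_iff.1 hc
    rw [List.nodup_cons] at hn
    obtain ⟨col, rfl⟩ := ih hn.2 hc'
    refine ⟨Function.update col v b, ?_⟩
    rw [List.map_cons, Function.update_self]
    congr 1
    refine List.map_congr_left fun w hw => ?_
    rw [Function.update_of_ne]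
    rintro rfl
    exact hn.1 hw

theorem connected_iff (h : G.IsLab lab A p) :
    G.Connected ↔ ConnL A.Adj ((G.listOf lab).map Cor.legs) := by
  classical
  rw [map_legs_listOf]
  constructor
  · rintro ⟨⟨v₀⟩, hG⟩
    refine ⟨fun e => ?_, fun c hc hA => ?_⟩
    · have := mem_enum v₀
      rw [List.map_eq_nil_iff.1 e] at this
      cases this
    · obtain ⟨col, rfl⟩ := exists_colouring enum_nodup hc
      have hcol : ∀ v, (Set.range fun l => lab ⟨v, l⟩, col v) ∈ (enum G.V).map fun v =>
          (Set.range fun l => lab ⟨v, l⟩, col v) := fun v => List.mem_map.2 ⟨v, mem_enum v, rfl⟩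
      have hcon : ∀ v, col v₀ = col v := by
        intro v
        induction hG v₀ v with
        | refl => rfl
        | @tail y z _ hyz ih =>
          obtain ⟨a, b, hab⟩ := hyz
          exact ih.trans (hA _ (hcol y) _ (hcol z) _ ⟨a, rfl⟩ _ ⟨b, rfl⟩ ((h.adj _ _).1 hab))
      intro x hx y hy
      obtain ⟨v, -, rfl⟩ := List.mem_map.1 hx
      obtain ⟨w, -, rfl⟩ := List.mem_map.1 hy
      exact (hcon v).symm.trans (hcon w)
  · rintro ⟨h₀, hC⟩
    obtain ⟨v₀, -⟩ := List.exists_mem_of_ne_nil _ fun e : enum G.V = [] => h₀ (by rw [e]; rfl)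
    refine ⟨⟨v₀⟩, fun v w => ?_⟩
    have := hC ((enum G.V).map fun w => (Set.range fun l => lab ⟨w, l⟩,
      decide (Relation.ReflTransGen (fun v w => ∃ a b, G.Adj ⟨v, a⟩ ⟨w, b⟩) v w)))
      (by rw [List.map_map]; rfl) ?_
      (Set.range fun l => lab ⟨v, l⟩, decide (Relation.ReflTransGen
        (fun v w => ∃ a b, G.Adj ⟨v, a⟩ ⟨w, b⟩) v v)) (List.mem_map.2 ⟨v, mem_enum v, rfl⟩)
      (Set.range fun l => lab ⟨w, l⟩, decide (Relation.ReflTransGen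
        (fun v w => ∃ a b, G.Adj ⟨v, a⟩ ⟨w, b⟩) v w)) (List.mem_map.2 ⟨w, mem_enum w, rfl⟩)
    · simp only [decide_eq_decide] at this
      exact this.1 .refl
    · intro x hx y hy a ha b hb hab
      obtain ⟨v', -, rfl⟩ := List.mem_map.1 hx
      obtain ⟨w', -, rfl⟩ := List.mem_map.1 hy
      obtain ⟨a, rfl⟩ := ha
      obtain ⟨b, rfl⟩ := hb
      rw [← h.adj] at hab
      simp only [decide_eq_decide]
      exact ⟨fun e => e.tail ⟨a, b, hab⟩, fun e => e.tail ⟨b, a, G.symm hab⟩⟩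

theorem degree_eq (h : G.IsLab lab A p) : G.degree = degL A p (G.listOf lab) := by
  classical
  rw [degree, degL, degSum_listOf, labels_listOf]
  congr 2
  · rw [finsum_allOf]
    congr 1
    rw [Finset.sum_filter, sum_allOf_embedding lab]
    · exact Finset.sum_congr rfl fun a _ => by rw [if_pos ⟨a, rfl⟩, h.pow]
    · exact fun k hk => if_neg hk
  · have e : (allOf H).filter (fun x => x ∈ Set.range lab ∧ ∃ k ∈ Set.range lab, A.Adj x k) =
        ((allOf G.Half).filter fun a => ∃ b, G.Adj a b).map lab := by
      ext x
      simp only [Finset.mem_filter, mem_allOf, true_and, Finset.mem_map, Set.mem_range]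
      constructor
      · rintro ⟨⟨a, rfl⟩, _, ⟨b, rfl⟩, hab⟩
        exact ⟨a, ⟨b, (h.adj _ _).2 hab⟩, rfl⟩
      · rintro ⟨a, ⟨b, hab⟩, rfl⟩
        exact ⟨⟨a, rfl⟩, lab b, ⟨b, rfl⟩, (h.adj _ _).1 hab⟩
    rw [e, Finset.card_map, edgeHalves]
    have : Fintype G.Half := Fintype.ofFinite _
    rw [Nat.card_eq_fintype_card, Fintype.card_subtype]
    congr 1
    ext x
    simp

end DecGraph

end

noncomputable section

open Cor

variable {P : S1FramedModularOperad.{u}} {H : Type} [Finite H]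
variable {M : Type w} [AddCommGroup M] [Module ℚ M]

namespace DecGraph

theorem clsL_eq_zero {e : ℤ} {A : Matching H} {p : H → ℕ} {L : List (Cor P H)}
    (h : ¬ (ConnL A.Adj (L.map Cor.legs) ∧ degL A p L = e)) : clsL e A p L = 0 := by
  by_cases hL : Disj L
  · rw [clsL_eq_cls hL]
    refine cls_eq_zero fun h' => h ?_
    have e₁ := connected_iff (isLab_ofList hL (A := A) (p := p))
    have e₂ := degree_eq (isLab_ofList hL (A := A) (p := p))
    rw [listOf_ofList] at e₁ e₂
    exact ⟨e₁.1 h'.1, e₂ ▸ h'.2⟩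
  · exact clsL_not_disj hL

/-- The list `L` presents a connected graph of degree `e`. -/
structure Good (e : ℤ) (A : Matching H) (p : H → ℕ) (L : List (Cor P H)) : Prop where
  disj : Disj L
  sat : A.Sat (labels L)
  conn : ConnL A.Adj (L.map Cor.legs)
  deg : degL A p L = e

theorem Good.step {e e' : ℤ} {A : Matching H} {p p' : H → ℕ} {L L' : List (Cor P H)}
    (h : Good e A p L) (hs : Step A p L p' L') (he : e' + 1 = e) : Good e' A p' L' where
  disj := hs.disj
  sat := hs.sat h.sat
  conn := hs.conn.2 h.conn
  deg := by have := hs.deg; have := h.deg; omega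

/-- Sewing two leaves gives a connected graph if adding an edge does. -/
theorem good_of_sewStep {e e' : ℤ} {A : Matching H} {p : H → ℕ} {L L' : List (Cor P H)} {h k : H}
    (hsat : A.Sat (labels L)) (hdeg : degL A p L = e)
    (hconn : ∀ A' : Matching H, (∀ a b, A.Adj a b → A'.Adj a b) → A'.Adj h k →
      ConnL A'.Adj (L.map Cor.legs))
    (hs : SewStep h k L L') (hA : A.leafPair h k) (hh : p h = 0) (hk : p k = 0)
    (he : e + 1 = e') : Good e' A p L' where
  disj := hs.disj
  sat x hx y hxy := by
    rw [hs.labels] at hx ⊢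
    refine ⟨hsat x hx.1 y hxy, ?_⟩
    rintro (rfl | rfl)
    · exact hA.1 _ (A.symm hxy)
    · exact hA.2 _ (A.symm hxy)
  conn := by
    let A' : Matching H :=
      { Adj := fun a b => A.Adj a b ∨ (a = h ∧ b = k) ∨ (a = k ∧ b = h)
        symm := by
          rintro a b (e | ⟨rfl, rfl⟩ | ⟨rfl, rfl⟩)
          · exact Or.inl (A.symm e)
          · exact Or.inr (Or.inr ⟨rfl, rfl⟩)
          · exact Or.inr (Or.inl ⟨rfl, rfl⟩)
        irrefl := by
          rintro a (e | ⟨rfl, e⟩ | ⟨rfl, e⟩)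
          · exact A.irrefl e
          · exact hs.ne e
          · exact hs.ne e.symm
        unique := by
          rintro a b c (e | ⟨rfl, rfl⟩ | ⟨rfl, rfl⟩) (e' | ⟨h₁, h₂⟩ | ⟨h₁, h₂⟩)
          · exact A.unique e e'
          · exact absurd e (h₁ ▸ hA.1 b)
          · exact absurd e (h₁ ▸ hA.2 b)
          · exact absurd e' (hA.1 c)
          · exact h₂.symm
          · exact absurd h₁ hs.ne
          · exact absurd e' (hA.2 c)
          · exact absurd h₁.symm hs.ne
          · exact h₂.symm }
    have h₁ := (hs.conn A' (Or.inr (Or.inl ⟨rfl, rfl⟩))).1 (hconn A' (fun a b e => Or.inl e)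
      (Or.inr (Or.inl ⟨rfl, rfl⟩)))
    refine (ConnL.congr_adj fun s hs' t ht a ha b hb => ?_).1 h₁
    have ha' : a ∈ labels L' := ⟨s, hs', ha⟩
    rw [hs.labels] at ha'
    constructor
    · rintro (e | ⟨rfl, -⟩ | ⟨rfl, -⟩)
      · exact e
      · exact absurd (Or.inl rfl) ha'.2
      · exact absurd (Or.inr rfl) ha'.2
    · exact Or.inl
  deg := by rw [degL_sew_leaf hs hA hh hk, hdeg, he]

theorem Good.sewStep {e e' : ℤ} {A : Matching H} {p : H → ℕ} {L L' : List (Cor P H)} {h k : H}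
    (hL : Good e A p L) (hs : SewStep h k L L') (hA : A.leafPair h k) (hh : p h = 0) (hk : p k = 0)
    (he : e + 1 = e') : Good e' A p L' :=
  good_of_sewStep hL.sat hL.deg (fun _ h _ => hL.conn.mono h) hs hA hh hk he

theorem Good.congr_pow {e : ℤ} {A : Matching H} {p p' : H → ℕ} {L : List (Cor P H)}
    (h : Good e A p L) (hp : ∀ h ∈ labels L, p' h = p h) : Good e A p' L where
  disj := h.disj
  sat := h.sat
  conn := h.conn
  deg := by
    classical
    rw [← h.deg, degL, degL, Finset.sum_congr rfl fun x hx => by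
      rw [hp x (Finset.mem_filter.1 hx).2]]

/-! ### Presented graphs -/

variable (P) in
/-- A decorated graph presented by the matching `A` and the exponents `p`. -/
structure LabGraph (A : Matching H) (p : H → ℕ) where
  graph : DecGraph P
  lab : graph.Half ↪ H
  isLab : graph.IsLab lab A p
  sat : A.Sat (Set.range lab)

namespace LabGraph

variable {A : Matching H} {p : H → ℕ}

def list (Γ : LabGraph P A p) : List (Cor P H) := Γ.graph.listOf Γ.lab

theorem labels_list (Γ : LabGraph P A p) : labels Γ.list = Set.range Γ.lab := labels_listOf _ _

theorem disj (Γ : LabGraph P A p) : Disj Γ.list := disj_listOf _ _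

theorem cls_eq (Γ : LabGraph P A p) (e : ℤ) : Γ.graph.cls e = clsL e A p Γ.list :=
  cls_eq_clsL Γ.isLab e

theorem good (Γ : LabGraph P A p) {e : ℤ} (h : Γ.graph.Connected) (h' : Γ.graph.degree = e) :
    Good e A p Γ.list :=
  ⟨Γ.disj, by rw [labels_list]; exact Γ.sat, (connected_iff Γ.isLab).1 h,
    by rw [← h', degree_eq Γ.isLab]; rfl⟩

theorem connected (Γ : LabGraph P A p) {e : ℤ} (h : Good e A p Γ.list) : Γ.graph.Connected :=
  (connected_iff Γ.isLab).2 h.conn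

theorem degree (Γ : LabGraph P A p) {e : ℤ} (h : Good e A p Γ.list) : Γ.graph.degree = e :=
  (degree_eq Γ.isLab).trans h.deg

def ofList (L : List (Cor P H)) (hL : Disj L) (hA : A.Sat (labels L)) : LabGraph P A p where
  graph := DecGraph.ofList L hL A p
  lab := ofListLab hL A p
  isLab := isLab_ofList hL A p
  sat := by
    rw [← labels_listOf, listOf_ofList]
    exact hA

@[simp] theorem list_ofList (L : List (Cor P H)) (hL : Disj L) (hA : A.Sat (labels L)) :
    (ofList L hL hA : LabGraph P A p).list = L := listOf_ofList hL A p

theorem leaf_iff (Γ : LabGraph P A p) (a : Γ.graph.Half) :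
    (∀ b, ¬ Γ.graph.Adj a b) ↔ ∀ k, ¬ A.Adj (Γ.lab a) k := by
  refine ⟨fun h k hk => ?_, fun h b hb => h _ ((Γ.isLab.adj a b).1 hb)⟩
  obtain ⟨b, rfl⟩ := Γ.sat _ ⟨a, rfl⟩ k hk
  exact h b ((Γ.isLab.adj a b).2 hk)

end LabGraph

/-- The matching of the half-edges of a graph. -/
def matching (G : DecGraph P) : Matching G.Half := ⟨G.Adj, G.symm, G.irrefl, G.unique⟩

def LabGraph.self (G : DecGraph P) : LabGraph P G.matching G.pow where
  graph := G
  lab := Function.Embedding.refl _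
  isLab := ⟨fun _ _ => Iff.rfl, fun _ => rfl⟩
  sat := fun _ _ k _ => ⟨k, rfl⟩

/-- Functions on graphs that are given by compatible functions on lists of corollas respect the
relations between graphs. -/
theorem respects_of_compat {f : DecGraph P → M}
    (h : ∀ X : DecGraph P, ∃ (H : Type) (_ : Finite H) (A : Matching H) (p : H → ℕ)
      (lab : X.Half ↪ H) (_ : X.IsLab lab A p) (_ : A.Sat (Set.range lab))
      (g : List (Cor P H) → M), Compat g ∧
        ∀ Γ : LabGraph P A p, Set.range Γ.lab = Set.range lab → f Γ.graph = g Γ.list) :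
    Respects f where
  add G v x y := by
    obtain ⟨H, _, A, p, lab, hlab, hsat, g, hg, hf⟩ := h G
    obtain ⟨l₁, l₂, hl⟩ := G.listOf_setDec lab v
    have key : ∀ z, f (G.setDec v z) = g (l₁ ++ _ :: l₂) := fun z =>
      (hf ⟨G.setDec v z, lab, ⟨hlab.adj, hlab.pow⟩, hsat⟩ rfl).trans (congrArg g (hl z))
    rw [key, key, key, map_add]
    exact (hg.append l₁).add _ _ _
  smul G v c x := by
    obtain ⟨H, _, A, p, lab, hlab, hsat, g, hg, hf⟩ := h G
    obtain ⟨l₁, l₂, hl⟩ := G.listOf_setDec lab v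
    have key : ∀ z, f (G.setDec v z) = g (l₁ ++ _ :: l₂) := fun z =>
      (hf ⟨G.setDec v z, lab, ⟨hlab.adj, hlab.pow⟩, hsat⟩ rfl).trans (congrArg g (hl z))
    rw [key, key, map_smul]
    exact (hg.append l₁).smul _ _ _
  relabel G W _ _ φ l _ ψ := by
    obtain ⟨H, _, A, p, lab, hlab, hsat, g, hg, hf⟩ := h G
    have hr : Set.range ((G.relabelHalf φ ψ).toEmbedding.trans lab) = Set.range lab := by
      ext x
      constructor
      · rintro ⟨a, rfl⟩
        exact ⟨_, rfl⟩
      · rintro ⟨a, rfl⟩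
        exact ⟨(G.relabelHalf φ ψ).symm a, congrArg lab ((G.relabelHalf φ ψ).apply_symm_apply a)⟩
    rw [show f (G.relabel W φ l ψ) = _ from hf ⟨G.relabel W φ l ψ,
        (G.relabelHalf φ ψ).toEmbedding.trans lab, ⟨fun a b => hlab.adj _ _, fun a => hlab.pow _⟩,
        hr ▸ hsat⟩ hr,
      show f G = _ from hf ⟨G, lab, hlab, hsat⟩ rfl]
    exact G.compat_listOf_relabel lab hg φ l ψ

theorem respects_differential (e : ℤ) : Respects fun G : DecGraph P => G.differential e :=
  respects_of_compat fun X => ⟨X.Half, inferInstance, X.matching, X.pow, (LabGraph.self X).lab,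
    (LabGraph.self X).isLab, (LabGraph.self X).sat, fun L => opQ X.matching X.pow L
      (clsL e X.matching), compat_opQ _ _ fun p => compat_clsL _ _ p,
    fun Γ _ => differential_eq Γ.isLab e⟩

theorem LabGraph.bv_eq {A : Matching H} {p : H → ℕ} (Γ : LabGraph P A p) (e : ℤ) :
    Γ.graph.bv e = (1 / 2 : ℚ) • opS A.leafPair p Γ.list (clsL e A) := by
  rw [bv, twistedSewing_eq Γ.isLab e (R' := A.leafPair) fun a b => by
    rw [Γ.leaf_iff, Γ.leaf_iff]; rfl]
  rfl

theorem respects_bv (e : ℤ) : Respects fun G : DecGraph P => G.bv e :=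
  respects_of_compat fun X => ⟨X.Half, inferInstance, X.matching, X.pow, (LabGraph.self X).lab,
    (LabGraph.self X).isLab, (LabGraph.self X).sat, fun L => (1 / 2 : ℚ) •
      opS X.matching.leafPair X.pow L (clsL e X.matching),
    (compat_opS (fun p => compat_clsL _ _ p) _ _).fun_smul _, fun Γ _ => Γ.bv_eq e⟩

/-! ### Differential and BV operator on lists -/

variable {A : Matching H} {p : H → ℕ} {L : List (Cor P H)}

theorem differential_clsL {e e' : ℤ} (he : e' + 1 = e) (hL : Disj L) :
    _root_.differential P e e' (clsL e A p L) = opQ A p L (clsL e' A) := by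
  by_cases h : ConnL A.Adj (L.map Cor.legs) ∧ degL A p L = e
  · have hi := isLab_ofList hL (A := A) (p := p)
    have e₁ := connected_iff hi
    have e₂ := degree_eq hi
    have e₃ := differential_eq hi e'
    rw [listOf_ofList] at e₁ e₂ e₃
    rw [clsL_eq_cls hL, _root_.differential,
      (respects_differential e').linearExtension_cls (e₁.2 h.1) (e₂.trans h.2), e₃]
  · rw [clsL_eq_zero h, map_zero, opQ_congr (g := fun _ _ => 0) hL (fun p => compat_clsL e' A p)
      (fun _ => Compat.fun_zero) fun p' L' hs => clsL_eq_zero fun h' => h ?_, opQ_fun_zero]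
    exact ⟨hs.conn.1 h'.1, by have := hs.deg; have := h'.2; omega⟩

theorem bv_clsL {e : ℤ} (e' : ℤ) (h : Good e A p L) :
    _root_.bv P e e' (clsL e A p L) = (1 / 2 : ℚ) • opS A.leafPair p L (clsL e' A) := by
  have hΓ := LabGraph.list_ofList (p := p) L h.disj h.sat
  generalize LabGraph.ofList (p := p) L h.disj h.sat = Γ at hΓ
  subst hΓ
  rw [← Γ.cls_eq, _root_.bv, (respects_bv e').linearExtension_cls (Γ.connected h) (Γ.degree h),
    Γ.bv_eq]

theorem opQ_clsL_congr {e e' : ℤ} (he : e' + 1 = e) (h : Good e A p L)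
    {f g : (H → ℕ) → List (Cor P H) → M} (hf : ∀ p, Compat (f p)) (hg : ∀ p, Compat (g p))
    (H₀ : ∀ p' L', Step A p L p' L' → Good e' A p' L' → f p' L' = g p' L') :
    opQ A p L f = opQ A p L g :=
  opQ_congr h.disj hf hg fun p' L' hs => H₀ p' L' hs (h.step hs he)

/-! ### The differential and the BV operator square to zero and anticommute -/

theorem feynman_ext {e : ℤ} {F F' : FeynmanTotal P e →ₗ[ℚ] M}
    (h : ∀ {H : Type} [Finite H] (A : Matching H) (p : H → ℕ) (L : List (Cor P H)), Good e A p L →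
      F (clsL e A p L) = F' (clsL e A p L)) : F = F' := by
  refine linearMap_ext fun G h₁ h₂ => ?_
  have := h _ _ _ ((LabGraph.self G).good h₁ h₂)
  rwa [← LabGraph.cls_eq] at this

theorem differential_differential {e e' e'' : ℤ} (h : e' + 1 = e) (h' : e'' + 1 = e')
    (x : FeynmanTotal P e) :
    _root_.differential P e' e'' (_root_.differential P e e' x) = 0 := by
  refine LinearMap.congr_fun (f := _root_.differential P e' e'' ∘ₗ _root_.differential P e e')
    (g := 0) (feynman_ext fun A p L hL => ?_) x
  rw [LinearMap.comp_apply, differential_clsL h hL.disj, ← opQ_map,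
    opQ_congr hL.disj (fun p => (compat_clsL e' A p).map _)
      (fun p => compat_opQ A p fun p => compat_clsL e'' A p)
      fun p' L' hs => differential_clsL h' hs.disj,
    opQ_opQ A p hL.disj fun p => compat_clsL e'' A p, LinearMap.zero_apply]

theorem differential_bv {e e₁ e₂ e' : ℤ} (h₁ : e' + 1 = e₁) (h₂ : e₂ + 1 = e)
    (x : FeynmanTotal P e) :
    _root_.differential P e₁ e' (_root_.bv P e e₁ x) +
      _root_.bv P e₂ e' (_root_.differential P e e₂ x) = 0 := by
  refine LinearMap.congr_fun (f := _root_.differential P e₁ e' ∘ₗ _root_.bv P e e₁ +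
    _root_.bv P e₂ e' ∘ₗ _root_.differential P e e₂) (g := 0) (feynman_ext fun A p L hL => ?_) x
  rw [LinearMap.add_apply, LinearMap.comp_apply, LinearMap.comp_apply, bv_clsL e₁ hL, map_smul,
    ← opS_map, opS_congr hL.disj (fun p => (compat_clsL e₁ A p).map _)
      (fun p => compat_opQ A p fun p => compat_clsL e' A p)
      fun h k L' _ _ _ hs => differential_clsL h₁ hs.disj,
    differential_clsL h₂ hL.disj, ← opQ_map, opQ_clsL_congr h₂ hL
      (fun p => (compat_clsL e₂ A p).map _)
      (fun p => (compat_opS (fun p => compat_clsL e' A p) A.leafPair p).fun_smul _)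
      fun p' L' _ hG => bv_clsL e' hG, opQ_smul,
    opQ_opS A A.leafPair p hL.disj fun p => compat_clsL e' A p]
  simp

theorem opS_self {R : H → H → Prop} (hL : Disj L) {f : (H → ℕ) → List (Cor P H) → M}
    (hf : ∀ p, Compat (f p)) : opS R p L (fun p' l => opS R p' l f) = 0 := by
  have h := opS_opS hf R R p hL
  have : (2 : ℚ) • opS R p L (fun p' l => opS R p' l f) = 0 := by
    rw [two_smul]
    nth_rewrite 1 [h]
    simp
  exact (smul_eq_zero.1 this).resolve_left two_ne_zero

theorem bv_bv {e e₁ e' : ℤ} (h : e + 1 = e₁) (x : FeynmanTotal P e) :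
    _root_.bv P e₁ e' (_root_.bv P e e₁ x) = 0 := by
  refine LinearMap.congr_fun (f := _root_.bv P e₁ e' ∘ₗ _root_.bv P e e₁) (g := 0)
    (feynman_ext fun A p L hL => ?_) x
  rw [LinearMap.comp_apply, bv_clsL e₁ hL, map_smul, ← opS_map,
    opS_congr hL.disj (fun p => (compat_clsL e₁ A p).map _)
      (fun p => (compat_opS (fun p => compat_clsL e' A p) A.leafPair p).fun_smul _)
      fun h' k L' hA hh hk hs => bv_clsL e' (hL.sewStep hs hA hh hk h),
    opS_smul, opS_self hL.disj fun p => compat_clsL e' A p]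
  simp

end DecGraph

end

noncomputable section

open Cor

variable {P : S1FramedModularOperad.{u}} {H : Type} [Finite H]
variable {M : Type w} [AddCommGroup M] [Module ℚ M]

/-- The pairs consisting of an unmatched half-edge in `S` and one in `T`. -/
def Matching.cross (A : Matching H) (S T : Set H) (h k : H) : Prop :=
  h ∈ S ∧ k ∈ T ∧ A.leafPair h k

namespace DecGraph

/-! ### Disjoint unions -/

namespace LabGraph

variable {A : Matching H} {p : H → ℕ} {m : ℕ} (Γ : Fin m → LabGraph P A p)
  (hd : ∀ i j, i ≠ j → Disjoint (Set.range (Γ i).lab) (Set.range (Γ j).lab))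

/-- The disjoint union of presented graphs. -/
def union : LabGraph P A p where
  graph := disjUnion fun j => (Γ j).graph
  lab :=
    { toFun := fun h => (Γ h.1.1).lab ⟨h.1.2, h.2⟩
      inj' := by
        rintro ⟨⟨i, v⟩, a⟩ ⟨⟨j, w⟩, b⟩ e
        by_cases hij : i = j
        · subst hij
          have := (Γ i).lab.injective e
          cases this
          rfl
        · exact absurd rfl ((hd i j hij).ne_of_mem ⟨_, e⟩ ⟨_, rfl⟩) }
  isLab :=
    { adj := by
        rintro ⟨⟨i, v⟩, a⟩ ⟨⟨j, w⟩, b⟩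
        constructor
        · rintro ⟨e, h⟩
          obtain rfl : i = j := e
          exact ((Γ i).isLab.adj _ _).1 h
        · intro h
          have hm := (Γ i).sat _ ⟨⟨v, a⟩, rfl⟩ _ h
          by_cases hij : i = j
          · subst hij
            exact ⟨rfl, ((Γ i).isLab.adj _ _).2 h⟩
          · exact absurd rfl ((hd i j hij).ne_of_mem hm ⟨_, rfl⟩)
      pow := fun h => (Γ h.1.1).isLab.pow _ }
  sat := by
    rintro _ ⟨⟨⟨i, v⟩, a⟩, rfl⟩ k hk
    obtain ⟨b, rfl⟩ := (Γ i).sat _ ⟨⟨v, a⟩, rfl⟩ k hk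
    exact ⟨⟨⟨i, b.1⟩, b.2⟩, rfl⟩

theorem range_union : Set.range (union Γ hd).lab = ⋃ j, Set.range (Γ j).lab := by
  ext x
  rw [Set.mem_iUnion]
  constructor
  · rintro ⟨⟨⟨i, v⟩, a⟩, rfl⟩
    exact ⟨i, _, rfl⟩
  · rintro ⟨i, a, rfl⟩
    exact ⟨⟨⟨i, a.1⟩, a.2⟩, rfl⟩

theorem enum_sigmaLex {V : Fin m → Type} [∀ j, Finite (V j)] [∀ j, LinearOrder (V j)]
    [Finite (Σₗ j, V j)] :
    enum (Σₗ j, V j) = (List.finRange m).flatMap fun j => (enum (V j)).map fun v => toLex (⟨j, v⟩ : Σ j, V j) := by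
  refine (eq_enum (List.pairwise_flatMap.2 ⟨fun j _ => ?_, ?_⟩) fun v => ?_).symm
  · rw [List.pairwise_map]
    refine enum_pairwise.imp fun {v w} h => ?_
    exact Sigma.Lex.lt_def.2 (Or.inr ⟨rfl, h⟩)
  · refine (List.pairwise_lt_finRange m).imp fun {i j} hij x hx y hy => ?_
    obtain ⟨v, -, rfl⟩ := List.mem_map.1 hx
    obtain ⟨w, -, rfl⟩ := List.mem_map.1 hy
    exact Sigma.Lex.lt_def.2 (Or.inl hij)
  · exact List.mem_flatMap.2 ⟨v.1, List.mem_finRange _, List.mem_map.2 ⟨v.2, mem_enum _, rfl⟩⟩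

theorem list_union : (union Γ hd).list = (List.finRange m).flatMap fun j => (Γ j).list := by
  have : Finite (Σₗ j, (Γ j).graph.V) := inferInstanceAs (Finite (Σ j, (Γ j).graph.V))
  have key : ∀ c : (Σₗ j, (Γ j).graph.V) → Cor P H, (∀ j v, c (toLex ⟨j, v⟩) = (Γ j).graph.cor (Γ j).lab v) →
      (enum (Σₗ j, (Γ j).graph.V)).map c = (List.finRange m).flatMap fun j => (Γ j).list := by
    intro c hc
    rw [enum_sigmaLex, List.map_flatMap]
    congr 1
    funext j
    rw [List.map_map]
    exact List.map_congr_left fun v _ => hc j v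
  exact key _ fun j v => rfl

end LabGraph

/-- The half-edges of one component of a disjoint union. -/
def partLab {m : ℕ} (G : Fin m → DecGraph P) (j : Fin m) : (G j).Half ↪ (disjUnion G).Half where
  toFun h := ⟨⟨j, h.1⟩, h.2⟩
  inj' := by
    rintro ⟨v, a⟩ ⟨w, b⟩ e
    cases e
    rfl

/-- One component of a disjoint union. -/
def LabGraph.part {m : ℕ} (G : Fin m → DecGraph P) (j : Fin m) :
    LabGraph P (disjUnion G).matching (disjUnion G).pow where
  graph := G j
  lab := partLab G j
  isLab := ⟨fun a b => ⟨fun h => ⟨rfl, h⟩, fun ⟨_, h⟩ => h⟩, fun _ => rfl⟩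
  sat := by
    rintro _ ⟨a, rfl⟩ ⟨⟨j', v⟩, b⟩ ⟨e, h⟩
    obtain rfl : j = j' := e
    exact ⟨⟨v, b⟩, rfl⟩

theorem LabGraph.disjoint_part {m : ℕ} (G : Fin m → DecGraph P) (i j : Fin m) (hij : i ≠ j) :
    Disjoint (Set.range (part G i).lab) (Set.range (part G j).lab) := by
  rw [Set.disjoint_left]
  rintro _ ⟨a, rfl⟩ ⟨b, hb⟩
  exact hij (congrArg (fun x : (disjUnion G).Half => x.1.1) hb).symm

theorem respects_update {m : ℕ} {f : (Fin m → DecGraph P) → M}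
    (h : ∀ {H : Type} [Finite H] {A : Matching H} {p : H → ℕ} (Γ : Fin m → LabGraph P A p),
      (∀ i j, i ≠ j → Disjoint (Set.range (Γ i).lab) (Set.range (Γ j).lab)) →
      ∃ g : List (Cor P H) → M, Compat g ∧ ∀ Γ' : Fin m → LabGraph P A p,
        (∀ j, Set.range (Γ' j).lab = Set.range (Γ j).lab) →
        f (fun j => (Γ' j).graph) = g ((List.finRange m).flatMap fun j => (Γ' j).list))
    (G : Fin m → DecGraph P) (j : Fin m) : Respects fun X => f (Function.update G j X) := by
  suffices key : ∀ G' : Fin m → DecGraph P, ∃ (H : Type) (_ : Finite H) (A : Matching H) (p : H → ℕ)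
      (lab : (G' j).Half ↪ H) (_ : (G' j).IsLab lab A p) (_ : A.Sat (Set.range lab))
      (g : List (Cor P H) → M), Compat g ∧
        ∀ Γ : LabGraph P A p, Set.range Γ.lab = Set.range lab →
          f (Function.update G' j Γ.graph) = g Γ.list by
    refine respects_of_compat fun X => ?_
    have := key (Function.update G j X)
    simp only [Function.update_idem] at this
    generalize hX : Function.update G j X j = X' at this
    obtain rfl : X' = X := by rw [← hX, Function.update_self]
    exact this
  intro G'
  obtain ⟨g, hg, hf⟩ := h (LabGraph.part G') (LabGraph.disjoint_part G')
  obtain ⟨l₁, l₂, hl⟩ := List.append_of_mem (List.mem_finRange j)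
  have hn : (l₁ ++ j :: l₂).Nodup := hl ▸ List.nodup_finRange m
  rw [List.nodup_append, List.nodup_cons] at hn
  refine ⟨_, inferInstance, _, _, (LabGraph.part G' j).lab, (LabGraph.part G' j).isLab,
    (LabGraph.part G' j).sat, fun L => g (l₁.flatMap (fun i => (LabGraph.part G' i).list) ++
      (L ++ l₂.flatMap fun i => (LabGraph.part G' i).list)),
    (hg.append _).append_right _, fun Γ hΓ => ?_⟩
  have := hf (Function.update (LabGraph.part G') j Γ) fun i => by
    by_cases hi : i = j
    · subst hi
      rw [Function.update_self]
      exact hΓ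
    · rw [Function.update_of_ne hi]
  rw [hl, List.flatMap_append, List.flatMap_cons, Function.update_self] at this
  have e₁ : l₁.flatMap (fun i => (Function.update (LabGraph.part G') j Γ i).list) =
      l₁.flatMap (fun i => (LabGraph.part G' i).list) :=
    List.flatMap_congr fun i hi => by
      rw [Function.update_of_ne fun e => hn.2.2 i hi j (List.mem_cons_self ..) e]
  have e₂ : l₂.flatMap (fun i => (Function.update (LabGraph.part G') j Γ i).list) =
      l₂.flatMap (fun i => (LabGraph.part G' i).list) :=
    List.flatMap_congr fun i hi => by
      rw [Function.update_of_ne fun e => hn.2.1.1 (by subst e; exact hi)]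
  rw [e₁, e₂] at this
  refine Eq.trans (congrArg f ?_) this
  funext i
  by_cases hi : i = j
  · subst hi
    rw [Function.update_self, Function.update_self]
  · rw [Function.update_of_ne hi, Function.update_of_ne hi]
    rfl

/-! ### The bracket -/

theorem sewBracket_eq_twistedSewing (e : ℤ) (G : Fin 2 → DecGraph P) :
    (G 0).sewBracket e (G 1) = (disjUnion G).twistedSewing e fun h k =>
      h.1.1 = 0 ∧ k.1.1 = 1 ∧ (∀ l, ¬ (disjUnion G).Adj h l) ∧ ∀ l, ¬ (disjUnion G).Adj k l := by
  have h : ![G 0, G 1] = G := by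
    funext i
    fin_cases i <;> rfl
  rw [sewBracket]
  generalize ![G 0, G 1] = G' at h
  subst h
  rfl

theorem LabGraph.sewBracket_eq {A : Matching H} {p : H → ℕ} (Γ : Fin 2 → LabGraph P A p)
    (hd : ∀ i j, i ≠ j → Disjoint (Set.range (Γ i).lab) (Set.range (Γ j).lab)) (e : ℤ)
    {S T : Set H} (hS : Set.range (Γ 0).lab ⊆ S) (hT : Set.range (Γ 1).lab ⊆ T)
    (hST : Disjoint S T) :
    (Γ 0).graph.sewBracket e (Γ 1).graph =
      opS (A.cross S T) p ((Γ 0).list ++ (Γ 1).list) (clsL e A) := by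
  have hl : (Γ 0).list ++ (Γ 1).list = (union Γ hd).list := by
    rw [list_union]
    simp [List.finRange_succ]
  rw [hl]
  refine (sewBracket_eq_twistedSewing e fun j => (Γ j).graph).trans ?_
  refine twistedSewing_eq (union Γ hd).isLab e fun a b => ?_
  have key : ∀ a : (union Γ hd).graph.Half, (a.1.1 = 0 ↔ (union Γ hd).lab a ∈ S) ∧
      (a.1.1 = 1 ↔ (union Γ hd).lab a ∈ T) := by
    rintro ⟨⟨i, v⟩, a⟩
    have h₀ : i = 0 ∨ i = 1 := by fin_cases i <;> simp
    rcases h₀ with rfl | rfl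
    · have hm : (union Γ hd).lab ⟨⟨0, v⟩, a⟩ ∈ S := hS ⟨_, rfl⟩
      exact ⟨⟨fun _ => hm, fun _ => rfl⟩, ⟨fun h => absurd h (by simp),
        fun h => absurd h (Set.disjoint_left.1 hST hm)⟩⟩
    · have hm : (union Γ hd).lab ⟨⟨1, v⟩, a⟩ ∈ T := hT ⟨_, rfl⟩
      exact ⟨⟨fun h => absurd h (by simp), fun h => absurd hm (Set.disjoint_left.1 hST h)⟩,
        ⟨fun _ => hm, fun _ => rfl⟩⟩
  have h₁ := (union Γ hd).leaf_iff a
  have h₂ := (union Γ hd).leaf_iff b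
  exact and_congr (key a).1 (and_congr (key b).2 (and_congr h₁ h₂))

theorem respects_sewBracket_update (e : ℤ) (G : Fin 2 → DecGraph P) (j : Fin 2) :
    Respects fun X => ((Function.update G j X) 0).sewBracket e ((Function.update G j X) 1) := by
  refine respects_update (f := fun G => (G 0).sewBracket e (G 1))
    (fun {H} _ {A p} Γ hd => ⟨fun L => opS (A.cross (Set.range (Γ 0).lab) (Set.range (Γ 1).lab)) p L
      (clsL e A), compat_opS (fun p => compat_clsL e A p) _ _, fun Γ' h => ?_⟩) G j
  rw [LabGraph.sewBracket_eq Γ' (fun i j hij => by rw [h, h]; exact hd i j hij) e (h 0).le (h 1).le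
    (hd 0 1 (by decide))]
  simp [List.finRange_succ]

theorem respects_sewBracket_right (e : ℤ) (G : DecGraph P) :
    Respects fun X => G.sewBracket e X := by
  simpa using respects_sewBracket_update e ![G, G] 1

theorem respects_sewBracket_left (e : ℤ) (G : DecGraph P) :
    Respects fun X => X.sewBracket e G := by
  simpa using respects_sewBracket_update e ![G, G] 0

theorem sewBracket_cls {e₁ e₂ e' : ℤ} {G₁ G₂ : DecGraph P} (h₁ : G₁.Connected)
    (h₂ : G₁.degree = e₁) (h₃ : G₂.Connected) (h₄ : G₂.degree = e₂) :
    _root_.sewBracket P e₁ e₂ e' (G₁.cls e₁) (G₂.cls e₂) = G₁.sewBracket e' G₂ := by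
  have hr : Respects fun G₁ : DecGraph P =>
      linearExtension e₂ fun G₂ => G₁.sewBracket e' G₂ :=
    { add := fun G v x y => linearMap_ext fun X hX hX' => by
        rw [LinearMap.add_apply]
        simp only [(respects_sewBracket_right e' _).linearExtension_cls hX hX']
        exact (respects_sewBracket_left e' X).add G v x y
      smul := fun G v c x => linearMap_ext fun X hX hX' => by
        rw [LinearMap.smul_apply]
        simp only [(respects_sewBracket_right e' _).linearExtension_cls hX hX']
        exact (respects_sewBracket_left e' X).smul G v c x
      relabel := fun G W _ _ φ l _ ψ => linearMap_ext fun X hX hX' => by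
        rw [LinearMap.smul_apply]
        simp only [(respects_sewBracket_right e' _).linearExtension_cls hX hX']
        exact (respects_sewBracket_left e' X).relabel G W φ l ψ }
  rw [_root_.sewBracket, hr.linearExtension_cls h₁ h₂,
    (respects_sewBracket_right e' _).linearExtension_cls h₃ h₄]

theorem sewBracket_clsL {A : Matching H} {p : H → ℕ} {e₁ e₂ : ℤ} (e' : ℤ) {L₁ L₂ : List (Cor P H)}
    (h₁ : Good e₁ A p L₁) (h₂ : Good e₂ A p L₂) {S T : Set H} (hS : labels L₁ ⊆ S)
    (hT : labels L₂ ⊆ T) (hST : Disjoint S T) :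
    _root_.sewBracket P e₁ e₂ e' (clsL e₁ A p L₁) (clsL e₂ A p L₂) =
      opS (A.cross S T) p (L₁ ++ L₂) (clsL e' A) := by
  have e₁' := LabGraph.list_ofList (p := p) L₁ h₁.disj h₁.sat
  have e₂' := LabGraph.list_ofList (p := p) L₂ h₂.disj h₂.sat
  generalize LabGraph.ofList (p := p) L₁ h₁.disj h₁.sat = Γ₁ at e₁'
  generalize LabGraph.ofList (p := p) L₂ h₂.disj h₂.sat = Γ₂ at e₂'
  subst e₁' e₂'
  rw [LabGraph.labels_list] at hS hT
  rw [← Γ₁.cls_eq, ← Γ₂.cls_eq, sewBracket_cls (Γ₁.connected h₁) (Γ₁.degree h₁) (Γ₂.connected h₂)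
    (Γ₂.degree h₂)]
  refine LabGraph.sewBracket_eq ![Γ₁, Γ₂] (fun i j hij => ?_) e' hS hT hST
  have hd := hST.mono hS hT
  fin_cases i <;> fin_cases j
  · exact absurd rfl hij
  · exact hd
  · exact hd.symm
  · exact absurd rfl hij

end DecGraph

end

noncomputable section

open Cor

variable {P : S1FramedModularOperad.{u}} {H : Type} [Finite H]
variable {M : Type w} [AddCommGroup M] [Module ℚ M]

theorem even_sub_of_sgn_eq {a b : ℤ} (h : sgn a = sgn b) : Even (a - b) := by
  have h₁ : sgn (a - b) = 1 := by rw [sgn_sub, h, sgn_mul_self]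
  rcases Int.even_or_odd (a - b) with h₂ | h₂
  · exact h₂
  · rw [sgn, h₂.neg_one_zpow] at h₁
    norm_num at h₁

theorem sgn_mul_congr {a b c d : ℤ} (h : sgn a = sgn b) (h' : sgn c = sgn d) :
    sgn (a * c) = sgn (b * d) := by
  refine sgn_congr ?_
  rw [show a * c - b * d = (a - b) * c + b * (c - d) by ring]
  exact ((even_sub_of_sgn_eq h).mul_right c).add ((even_sub_of_sgn_eq h').mul_left b)

/-! ### Sewing operators for related pairs of half-edges -/

theorem opS_flip {R : H → H → Prop} {p : H → ℕ} {L : List (Cor P H)} (hL : Disj L)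
    {f : (H → ℕ) → List (Cor P H) → M} (hf : ∀ p, Compat (f p)) :
    opS (fun h k => R k h) p L f = opS R p L f := by
  classical
  rw [opS, opS, Finset.sum_comm]
  refine Finset.sum_congr rfl fun h _ => Finset.sum_congr rfl fun k _ => ?_
  rw [sew_symm (hf p) h k hL]
  exact if_congr (and_congr_right fun _ => and_comm) rfl rfl

theorem opS_or {R R' R'' : H → H → Prop} {p : H → ℕ} {L : List (Cor P H)} (hL : Disj L)
    {f : (H → ℕ) → List (Cor P H) → M} (hf : ∀ p, Compat (f p))
    (h₁ : ∀ h ∈ labels L, ∀ k ∈ labels L, (R h k ↔ R' h k ∨ R'' h k))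
    (h₂ : ∀ h k, ¬ (R' h k ∧ R'' h k)) :
    opS R p L f = opS R' p L f + opS R'' p L f := by
  classical
  rw [opS_congr_rel (R' := fun h k => R' h k ∨ R'' h k) hL hf fun h hh k hk _ => h₁ h hh k hk]
  simp only [opS, ← Finset.sum_add_distrib]
  refine Finset.sum_congr rfl fun h _ => Finset.sum_congr rfl fun k _ => ?_
  have := h₂ h k
  by_cases e₁ : R' h k <;> by_cases e₂ : R'' h k <;> simp_all

theorem opS_eq_zero {R : H → H → Prop} {p : H → ℕ} {L : List (Cor P H)} (hL : Disj L)
    {f : (H → ℕ) → List (Cor P H) → M} (hf : ∀ p, Compat (f p))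
    (h : ∀ h ∈ labels L, ∀ k ∈ labels L, ¬ R h k) : opS R p L f = 0 := by
  classical
  rw [opS_congr_rel (R' := fun _ _ => False) hL hf fun a ha b hb _ => iff_false_intro (h a ha b hb)]
  simp [opS]

theorem opS_append_left {R : H → H → Prop} {p : H → ℕ} (l r : List (Cor P H))
    {f : (H → ℕ) → List (Cor P H) → M} (hf : ∀ p, Compat (f p))
    (h : ∀ h k, R h k → h ∉ labels r ∧ k ∉ labels r) :
    opS R p (l ++ r) f = opS R p l fun p' m => f p' (m ++ r) := by
  classical
  refine Finset.sum_congr rfl fun a _ => Finset.sum_congr rfl fun b _ => ?_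
  split_ifs with hc
  · exact sew_append_left (hf p) l (h a b hc.1).1 (h a b hc.1).2
  · rfl

theorem opS_append_right {R : H → H → Prop} {p : H → ℕ} (l r : List (Cor P H))
    {f : (H → ℕ) → List (Cor P H) → M} (hf : ∀ p, Compat (f p))
    (h : ∀ h k, R h k → h ∉ labels l ∧ k ∉ labels l) :
    opS R p (l ++ r) f = sgn (degSum l) • opS R p r fun p' m => f p' (l ++ m) := by
  classical
  rw [opS, opS, Finset.smul_sum]
  refine Finset.sum_congr rfl fun a _ => ?_
  rw [Finset.smul_sum]
  refine Finset.sum_congr rfl fun b _ => ?_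
  split_ifs with hc
  · exact sew_append_right (hf p) r (h a b hc.1).1 (h a b hc.1).2
  · rw [smul_zero]

theorem opI_append (p : H → ℕ) (l r : List (Cor P H)) (f : (H → ℕ) → List (Cor P H) → M) :
    opI p (l ++ r) f = opI p l (fun p' m => f p' (m ++ r)) +
      sgn (degSum l) • opI p r fun p' m => f p' (l ++ m) := by
  classical
  simp only [opI, opU, der_append, smul_add, Finset.smul_sum]
  rw [add_add_add_comm, ← Finset.sum_add_distrib]
  congr 1
  · rw [neg_one_mul, sgn_neg]
  · refine Finset.sum_congr rfl fun h _ => ?_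
    split_ifs
    · norm_num
    · simp

theorem disj_append {L L' : List (Cor P H)} :
    Disj (L ++ L') ↔ Disj L ∧ Disj L' ∧ Disjoint (labels L) (labels L') := by
  rw [Disj, List.map_append, List.pairwise_append]
  refine and_congr_right fun _ => and_congr_right fun _ => ?_
  rw [Set.disjoint_left]
  constructor
  · rintro h a ⟨s, hs, ha⟩ ⟨t, ht, ha'⟩
    exact Set.disjoint_left.1 (h s hs t ht) ha ha'
  · intro h s hs t ht
    exact Set.disjoint_left.2 fun a ha ha' => h ⟨s, hs, ha⟩ ⟨t, ht, ha'⟩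

namespace DecGraph

variable {A : Matching H} {p : H → ℕ}

theorem opQ_append {l r : List (Cor P H)} (hd : Disj (l ++ r)) (hl : A.Sat (labels l))
    (hr : A.Sat (labels r)) {f : (H → ℕ) → List (Cor P H) → M} (hf : ∀ p, Compat (f p)) :
    opQ A p (l ++ r) f = opQ A p l (fun p' m => f p' (m ++ r)) +
      sgn (degSum l) • opQ A p r fun p' m => f p' (l ++ m) := by
  have hd' := disj_append.1 hd
  have hlr := Set.disjoint_left.1 hd'.2.2
  have e : opS A.Adj p (l ++ r) f = opS A.Adj p l (fun p' m => f p' (m ++ r)) +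
      sgn (degSum l) • opS A.Adj p r fun p' m => f p' (l ++ m) := by
    rw [opS_or (R' := fun h k => A.Adj h k ∧ h ∈ labels l ∧ k ∈ labels l)
      (R'' := fun h k => A.Adj h k ∧ h ∈ labels r ∧ k ∈ labels r) hd hf
      (fun h hh k hk => ?_) fun h k e => hlr e.1.2.1 e.2.2.1,
      opS_append_left l r hf fun h k e => ⟨hlr e.2.1, hlr e.2.2⟩,
      opS_append_right l r hf fun h k e => ⟨fun h' => hlr h' e.2.1, fun h' => hlr h' e.2.2⟩]
    · rw [opS_congr_rel (R' := A.Adj) hd'.1 (fun p => (hf p).append_right r)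
          fun h hh k hk _ => and_iff_left ⟨hh, hk⟩,
        opS_congr_rel (R' := A.Adj) hd'.2.1 (fun p => (hf p).append l)
          fun h hh k hk _ => and_iff_left ⟨hh, hk⟩]
    · constructor
      · intro e
        rw [labels_append] at hh
        rcases hh with hh | hh
        · exact Or.inl ⟨e, hh, hl h hh k e⟩
        · exact Or.inr ⟨e, hh, hr h hh k e⟩
      · rintro (e | e)
        · exact e.1
        · exact e.1
  rw [opQ, opI_append, e, opQ, opQ]
  module

theorem leafPair_symm {h k : H} : A.leafPair h k ↔ A.leafPair k h := and_comm

/-- A matching covers an even number of half-edges. -/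
theorem sgn_degSum {e : ℤ} {L : List (Cor P H)} (h : degL A p L = e) :
    sgn (degSum L) = sgn e := by
  classical
  refine sgn_congr ?_
  rw [← h, degL]
  suffices hc : Even ((allOf H).filter fun h => h ∈ labels L ∧ ∃ k ∈ labels L, A.Adj h k).card by
    obtain ⟨n, hn⟩ := hc
    exact ⟨-(∑ h ∈ (allOf H).filter (· ∈ labels L), (p h : ℤ)) - n, by rw [hn]; push_cast; ring⟩
  rw [← ZMod.natCast_eq_zero_iff_even, Finset.card_eq_sum_ones, Nat.cast_sum]
  have hx : ∀ a ∈ (allOf H).filter fun h => h ∈ labels L ∧ ∃ k ∈ labels L, A.Adj h k,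
      ∃ b, b ∈ labels L ∧ A.Adj a b := fun a ha => (Finset.mem_filter.1 ha).2.2
  refine Finset.sum_involution (fun a ha => (hx a ha).choose) (fun a ha => ?_) (fun a ha _ e => ?_)
    (fun a ha => ?_) fun a ha => ?_
  · exact CharTwo.add_self_eq_zero _
  · have := (hx a ha).choose_spec.2
    rw [e] at this
    exact A.irrefl this
  · exact Finset.mem_filter.2 ⟨mem_allOf _, (hx a ha).choose_spec.1, a,
      (Finset.mem_filter.1 ha).2.1, A.symm (hx a ha).choose_spec.2⟩
  · exact A.unique (hx _ (Finset.mem_filter.2 ⟨mem_allOf _, (hx a ha).choose_spec.1, a,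
      (Finset.mem_filter.1 ha).2.1, A.symm (hx a ha).choose_spec.2⟩)).choose_spec.2
      (A.symm (hx a ha).choose_spec.2)

/-! ### The identities of the bracket -/

theorem bracket_ext {e₁ e₂ : ℤ} {F : FeynmanTotal P e₁ → FeynmanTotal P e₂ → M}
    (h₁ : ∀ y, IsLinearMap ℚ fun x => F x y) (h₂ : ∀ x, IsLinearMap ℚ (F x))
    (h : ∀ {H : Type} [Finite H] (A : Matching H) (p : H → ℕ) (L₁ L₂ : List (Cor P H)),
      Good e₁ A p L₁ → Good e₂ A p L₂ → Disjoint (labels L₁) (labels L₂) →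
      F (clsL e₁ A p L₁) (clsL e₂ A p L₂) = 0) (x : FeynmanTotal P e₁) (y : FeynmanTotal P e₂) :
    F x y = 0 := by
  refine LinearMap.congr_fun (f := IsLinearMap.mk' _ (h₁ y)) (g := 0) (linearMap_ext
    fun G₁ a₁ b₁ => ?_) x
  refine LinearMap.congr_fun (f := IsLinearMap.mk' _ (h₂ (G₁.cls e₁))) (g := 0) (linearMap_ext
    fun G₂ a₂ b₂ => ?_) y
  have := h _ _ _ _ ((LabGraph.part ![G₁, G₂] 0).good a₁ b₁)
    ((LabGraph.part ![G₁, G₂] 1).good a₂ b₂) (by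
      rw [LabGraph.labels_list, LabGraph.labels_list]
      exact LabGraph.disjoint_part _ _ _ (by decide))
  rwa [← LabGraph.cls_eq, ← LabGraph.cls_eq] at this

theorem bracket_ext₃ {e₁ e₂ e₃ : ℤ}
    {F : FeynmanTotal P e₁ → FeynmanTotal P e₂ → FeynmanTotal P e₃ → M}
    (h₁ : ∀ y z, IsLinearMap ℚ fun x => F x y z) (h₂ : ∀ x z, IsLinearMap ℚ fun y => F x y z)
    (h₃ : ∀ x y, IsLinearMap ℚ (F x y))
    (h : ∀ {H : Type} [Finite H] (A : Matching H) (p : H → ℕ) (L₁ L₂ L₃ : List (Cor P H)),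
      Good e₁ A p L₁ → Good e₂ A p L₂ → Good e₃ A p L₃ → Disjoint (labels L₁) (labels L₂) →
      Disjoint (labels L₁) (labels L₃) → Disjoint (labels L₂) (labels L₃) →
      F (clsL e₁ A p L₁) (clsL e₂ A p L₂) (clsL e₃ A p L₃) = 0)
    (x : FeynmanTotal P e₁) (y : FeynmanTotal P e₂) (z : FeynmanTotal P e₃) : F x y z = 0 := by
  refine LinearMap.congr_fun (f := IsLinearMap.mk' _ (h₁ y z)) (g := 0) (linearMap_ext
    fun G₁ a₁ b₁ => ?_) x
  refine LinearMap.congr_fun (f := IsLinearMap.mk' _ (h₂ (G₁.cls e₁) z)) (g := 0) (linearMap_ext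
    fun G₂ a₂ b₂ => ?_) y
  refine LinearMap.congr_fun (f := IsLinearMap.mk' _ (h₃ (G₁.cls e₁) (G₂.cls e₂))) (g := 0)
    (linearMap_ext fun G₃ a₃ b₃ => ?_) z
  have := h _ _ _ _ _ ((LabGraph.part ![G₁, G₂, G₃] 0).good a₁ b₁)
    ((LabGraph.part ![G₁, G₂, G₃] 1).good a₂ b₂) ((LabGraph.part ![G₁, G₂, G₃] 2).good a₃ b₃)
    (by
      rw [LabGraph.labels_list, LabGraph.labels_list]
      exact LabGraph.disjoint_part _ _ _ (by decide))
    (by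
      rw [LabGraph.labels_list, LabGraph.labels_list]
      exact LabGraph.disjoint_part _ _ _ (by decide))
    (by
      rw [LabGraph.labels_list, LabGraph.labels_list]
      exact LabGraph.disjoint_part _ _ _ (by decide))
  rwa [← LabGraph.cls_eq, ← LabGraph.cls_eq, ← LabGraph.cls_eq] at this

theorem cross_flip (S T : Set H) : (fun h k => A.cross S T k h) = A.cross T S := by
  funext h k
  exact propext ⟨fun e => ⟨e.2.1, e.1, leafPair_symm.1 e.2.2⟩,
    fun e => ⟨e.2.1, e.1, leafPair_symm.1 e.2.2⟩⟩

theorem opS_cross_comm (S T : Set H) {L : List (Cor P H)} (hL : Disj L)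
    {f : (H → ℕ) → List (Cor P H) → M} (hf : ∀ p, Compat (f p)) :
    opS (A.cross S T) p L f = opS (A.cross T S) p L f := by
  rw [← cross_flip S T, opS_flip (R := A.cross S T) hL hf]

theorem sewBracket_comm {e₁ e₂ e' : ℤ} (x : FeynmanTotal P e₁) (y : FeynmanTotal P e₂) :
    _root_.sewBracket P e₁ e₂ e' x y = sgn (e₁ * e₂) • _root_.sewBracket P e₂ e₁ e' y x := by
  rw [← sub_eq_zero]
  refine bracket_ext (F := fun x y => _root_.sewBracket P e₁ e₂ e' x y -
    sgn (e₁ * e₂) • _root_.sewBracket P e₂ e₁ e' y x) (fun y => ⟨fun a b => ?_, fun c a => ?_⟩)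
    (fun x => ⟨fun a b => ?_, fun c a => ?_⟩) (fun A p L₁ L₂ h₁ h₂ hd => ?_) x y
  · simp only [map_add, LinearMap.add_apply, smul_add]; abel
  · simp only [map_smul, LinearMap.smul_apply, smul_sub, smul_comm c]
  · simp only [map_add, LinearMap.add_apply, smul_add]; abel
  · simp only [map_smul, LinearMap.smul_apply, smul_sub, smul_comm c]
  · have hD : Disj (L₂ ++ L₁) := disj_append.2 ⟨h₂.disj, h₁.disj, hd.symm⟩
    have hc : ∀ p, Compat (clsL e' A p : List (Cor P _) → _) := fun p => compat_clsL e' A p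
    rw [sewBracket_clsL e' h₁ h₂ subset_rfl subset_rfl hd,
      sewBracket_clsL e' h₂ h₁ subset_rfl subset_rfl hd.symm, sub_eq_zero,
      opS_cross_comm (labels L₂) (labels L₁) hD hc]
    have := (compat_opS hc (A.cross (labels L₁) (labels L₂)) p).append_swap L₁ L₂ []
    simp only [List.append_nil] at this
    rw [this]
    congr 1
    exact sgn_mul_congr (sgn_degSum h₁.deg) (sgn_degSum h₂.deg)

theorem cross_congr_pow {e₁ : ℤ} {L₁ L₂ L' : List (Cor P H)} {p' : H → ℕ} {e₂ : ℤ}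
    (hd : Disjoint (labels L₁) (labels L₂)) (hs : Step A p L₁ p' L') (h₂ : Good e₂ A p L₂)
    (h : Good e₁ A p' L') (e' : ℤ) :
    _root_.sewBracket P e₁ e₂ e' (clsL e₁ A p' L') (clsL e₂ A p L₂) =
      opS (A.cross (labels L₁) (labels L₂)) p' (L' ++ L₂) (clsL e' A) := by
  have hp : ∀ h ∈ labels L₂, p' h = p h := fun h hh =>
    hs.pow h fun hh' => Set.disjoint_left.1 hd hh' hh
  rw [clsL_congr (L := L₂) (fun _ _ _ _ => Iff.rfl) fun h hh => (hp h hh).symm]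
  exact sewBracket_clsL e' h (h₂.congr_pow hp) hs.sub subset_rfl hd

theorem differential_sewBracket {e₁ e₂ e₁' e₂' e' e'' : ℤ} (he₁ : e₁' + 1 = e₁)
    (he₂ : e₂' + 1 = e₂) (he : e'' + 1 = e') (x : FeynmanTotal P e₁) (y : FeynmanTotal P e₂) :
    _root_.differential P e' e'' (_root_.sewBracket P e₁ e₂ e' x y) +
      _root_.sewBracket P e₁' e₂ e'' (_root_.differential P e₁ e₁' x) y +
      sgn e₁ • _root_.sewBracket P e₁ e₂' e'' x (_root_.differential P e₂ e₂' y) = 0 := by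
  refine bracket_ext (F := fun x y => _root_.differential P e' e'' (_root_.sewBracket P e₁ e₂ e' x y) +
      _root_.sewBracket P e₁' e₂ e'' (_root_.differential P e₁ e₁' x) y +
      sgn e₁ • _root_.sewBracket P e₁ e₂' e'' x (_root_.differential P e₂ e₂' y))
    (fun y => ⟨fun a b => ?_, fun c a => ?_⟩)
    (fun x => ⟨fun a b => ?_, fun c a => ?_⟩) (fun A p L₁ L₂ h₁ h₂ hd => ?_) x y
  · simp only [map_add, LinearMap.add_apply, smul_add]; abel
  · simp only [map_smul, LinearMap.smul_apply, smul_add, smul_comm c]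
  · simp only [map_add, smul_add]; abel
  · simp only [map_smul, smul_add, smul_comm c]
  · have hD : Disj (L₁ ++ L₂) := disj_append.2 ⟨h₁.disj, h₂.disj, hd⟩
    have hc : ∀ p, Compat (clsL e'' A p : List (Cor P _) → _) := fun p => compat_clsL e'' A p
    set C := A.cross (labels L₁) (labels L₂) with hC
    have hS : ∀ p, Compat fun L : List (Cor P _) => opS C p L (clsL e'' A) :=
      fun p => compat_opS hc C p
    have t₁ : _root_.differential P e' e'' (opS C p (L₁ ++ L₂) (clsL e' A)) =
        -opQ A p (L₁ ++ L₂) fun p' l => opS C p' l (clsL e'' A) := by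
      rw [← opS_map, opS_congr hD (fun p => (compat_clsL e' A p).map _)
        (fun p => compat_opQ A p hc) fun h k L' _ _ _ hs => differential_clsL he hs.disj,
        opQ_opS A C p hD hc, neg_neg]
    have t₂ : _root_.sewBracket P e₁' e₂ e'' (_root_.differential P e₁ e₁' (clsL e₁ A p L₁))
        (clsL e₂ A p L₂) = opQ A p L₁ fun p' l => opS C p' (l ++ L₂) (clsL e'' A) := by
      rw [differential_clsL he₁ h₁.disj, ← LinearMap.flip_apply, ← opQ_map]
      exact opQ_clsL_congr he₁ h₁ (fun p => (compat_clsL e₁' A p).map _)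
        (fun p => (hS p).append_right L₂) fun p' L' hs hG => cross_congr_pow hd hs h₂ hG e''
    have t₃ : _root_.sewBracket P e₁ e₂' e'' (clsL e₁ A p L₁) (_root_.differential P e₂ e₂'
        (clsL e₂ A p L₂)) = opQ A p L₂ fun p' l => opS C p' (L₁ ++ l) (clsL e'' A) := by
      rw [differential_clsL he₂ h₂.disj, ← opQ_map]
      refine opQ_clsL_congr he₂ h₂ (fun p => (compat_clsL e₂' A p).map _)
        (fun p => (hS p).append L₁) fun p' L' hs hG => ?_
      have hp : ∀ h ∈ labels L₁, p' h = p h := fun h hh =>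
        hs.pow h fun hh' => Set.disjoint_left.1 hd hh hh'
      rw [clsL_congr (L := L₁) (fun _ _ _ _ => Iff.rfl) fun h hh => (hp h hh).symm]
      exact sewBracket_clsL e'' (h₁.congr_pow hp) hG subset_rfl hs.sub hd
    rw [sewBracket_clsL e' h₁ h₂ subset_rfl subset_rfl hd, t₁, t₂, t₃,
      opQ_append hD h₁.sat h₂.sat hS, sgn_degSum h₁.deg]
    abel

theorem degL_append {L₁ L₂ : List (Cor P H)} (hd : Disjoint (labels L₁) (labels L₂))
    (h₁ : A.Sat (labels L₁)) (h₂ : A.Sat (labels L₂)) :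
    degL A p (L₁ ++ L₂) = degL A p L₁ + degL A p L₂ := by
  classical
  have hd' := Set.disjoint_left.1 hd
  have e₁ : (allOf H).filter (· ∈ labels (L₁ ++ L₂)) =
      (allOf H).filter (· ∈ labels L₁) ∪ (allOf H).filter (· ∈ labels L₂) := by
    ext; simp [labels_append]
  have e₂ : ((allOf H).filter fun h => h ∈ labels (L₁ ++ L₂) ∧ ∃ k ∈ labels (L₁ ++ L₂), A.Adj h k) =
      ((allOf H).filter fun h => h ∈ labels L₁ ∧ ∃ k ∈ labels L₁, A.Adj h k) ∪
      (allOf H).filter fun h => h ∈ labels L₂ ∧ ∃ k ∈ labels L₂, A.Adj h k := by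
    ext x
    simp only [Finset.mem_filter, mem_allOf, true_and, labels_append, Finset.mem_union,
      Set.mem_union]
    constructor
    · rintro ⟨hx | hx, y, -, hxy⟩
      · exact Or.inl ⟨hx, y, h₁ x hx y hxy, hxy⟩
      · exact Or.inr ⟨hx, y, h₂ x hx y hxy, hxy⟩
    · rintro (⟨hx, y, hy, hxy⟩ | ⟨hx, y, hy, hxy⟩)
      · exact ⟨Or.inl hx, y, Or.inl hy, hxy⟩
      · exact ⟨Or.inr hx, y, Or.inr hy, hxy⟩
  rw [degL, degL, degL, degSum_append, e₁, e₂, Finset.sum_union, Finset.card_union_of_disjoint]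
  · push_cast
    ring
  · rw [Finset.disjoint_left]
    intro x hx hx'
    exact hd' (Finset.mem_filter.1 hx).2.1 (Finset.mem_filter.1 hx').2.1
  · rw [Finset.disjoint_left]
    intro x hx hx'
    exact hd' (Finset.mem_filter.1 hx).2 (Finset.mem_filter.1 hx').2

theorem Sat.union {S T : Set H} (hS : A.Sat S) (hT : A.Sat T) : A.Sat (S ∪ T) := by
  rintro h (hh | hh) k hk
  · exact Or.inl (hS h hh k hk)
  · exact Or.inr (hT h hh k hk)

/-- Sewing a leaf of one connected graph with a leaf of another one. -/
theorem good_cross {e₁ e₂ e' : ℤ} {L₁ L₂ L' : List (Cor P H)} {h k : H} (h₁ : Good e₁ A p L₁)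
    (h₂ : Good e₂ A p L₂) (hd : Disjoint (labels L₁) (labels L₂)) (he : e₁ + e₂ + 1 = e')
    (hA : A.cross (labels L₁) (labels L₂) h k) (hh : p h = 0) (hk : p k = 0)
    (hs : SewStep h k (L₁ ++ L₂) L') : Good e' A p L' := by
  refine good_of_sewStep (e := e₁ + e₂) ?_ ?_ (fun A' hA' hhk => ?_) hs hA.2.2 hh hk he
  · rw [labels_append]
    exact Sat.union h₁.sat h₂.sat
  · rw [degL_append hd h₁.sat h₂.sat, h₁.deg, h₂.deg]
  · rw [List.map_append]
    obtain ⟨s, hs, hs'⟩ := hA.1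
    obtain ⟨t, ht, ht'⟩ := hA.2.1
    exact (h₁.conn.mono hA').append (h₂.conn.mono hA') hs ht hs' ht' hhk

theorem opS_leafPair_split {L : List (Cor P H)} (hL : Disj L) {S T : Set H} (hST : Disjoint S T)
    (hl : labels L ⊆ S ∪ T) {f : (H → ℕ) → List (Cor P H) → M} (hf : ∀ p, Compat (f p)) :
    opS A.leafPair p L f = opS (A.cross S S) p L f + opS (A.cross T T) p L f +
      (2 : ℚ) • opS (A.cross S T) p L f := by
  have hST' := Set.disjoint_left.1 hST
  rw [opS_or (R' := fun h k => A.cross S S h k ∨ A.cross T T h k)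
    (R'' := fun h k => A.cross S T h k ∨ A.cross T S h k) hL hf ?_ ?_,
    opS_or (R' := A.cross S S) (R'' := A.cross T T) hL hf (fun _ _ _ _ => Iff.rfl)
      fun h k e => hST' e.1.1 e.2.1,
    opS_or (R' := A.cross S T) (R'' := A.cross T S) hL hf (fun _ _ _ _ => Iff.rfl)
      fun h k e => hST' e.1.1 e.2.1, opS_cross_comm T S hL hf,
    two_smul]
  · intro h hh k hk
    have a := hl hh
    have b := hl hk
    simp only [Matching.cross]
    rcases a with a | a <;> rcases b with b | b <;> simp only [a, b] <;> tauto
  · rintro h k ⟨a | a, b | b⟩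
    · exact hST' a.2.1 b.2.1
    · exact hST' a.1 b.1
    · exact hST' b.1 a.1
    · exact hST' b.2.1 a.2.1

theorem bv_sewBracket {e₁ e₂ e₁' e₂' e' e'' : ℤ} (he₁ : e₁ + 1 = e₁')
    (he₂ : e₂ + 1 = e₂') (he : e₁ + e₂ + 1 = e') (x : FeynmanTotal P e₁) (y : FeynmanTotal P e₂) :
    _root_.bv P e' e'' (_root_.sewBracket P e₁ e₂ e' x y) +
      _root_.sewBracket P e₁' e₂ e'' (_root_.bv P e₁ e₁' x) y +
      sgn e₁ • _root_.sewBracket P e₁ e₂' e'' x (_root_.bv P e₂ e₂' y) = 0 := by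
  refine bracket_ext (F := fun x y => _root_.bv P e' e'' (_root_.sewBracket P e₁ e₂ e' x y) +
      _root_.sewBracket P e₁' e₂ e'' (_root_.bv P e₁ e₁' x) y +
      sgn e₁ • _root_.sewBracket P e₁ e₂' e'' x (_root_.bv P e₂ e₂' y))
    (fun y => ⟨fun a b => ?_, fun c a => ?_⟩)
    (fun x => ⟨fun a b => ?_, fun c a => ?_⟩) (fun A p L₁ L₂ h₁ h₂ hd => ?_) x y
  · simp only [map_add, LinearMap.add_apply, smul_add]; abel
  · simp only [map_smul, LinearMap.smul_apply, smul_add, smul_comm c]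
  · simp only [map_add, smul_add]; abel
  · simp only [map_smul, smul_add, smul_comm c]
  · have hD : Disj (L₁ ++ L₂) := disj_append.2 ⟨h₁.disj, h₂.disj, hd⟩
    have hd' := Set.disjoint_left.1 hd
    have hc : ∀ p, Compat (clsL e'' A p : List (Cor P _) → _) := fun p => compat_clsL e'' A p
    set C := A.cross (labels L₁) (labels L₂) with hC
    set C₁ := A.cross (labels L₁) (labels L₁) with hC₁
    set C₂ := A.cross (labels L₂) (labels L₂) with hC₂
    have hS : ∀ (R : _ → _ → Prop) p, Compat fun L : List (Cor P _) => opS R p L (clsL e'' A) :=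
      fun R p => compat_opS hc R p
    have t₁ : _root_.bv P e' e'' (opS C p (L₁ ++ L₂) (clsL e' A)) =
        -((1 / 2 : ℚ) • (opS C₁ p L₁ (fun p' l => opS C p' (l ++ L₂) (clsL e'' A)) +
          sgn (degSum L₁) • opS C₂ p L₂ fun p' l => opS C p' (L₁ ++ l) (clsL e'' A))) := by
      rw [← opS_map, opS_congr (g := fun p' l => (1 / 2 : ℚ) • (opS C₁ p' l (clsL e'' A) +
            opS C₂ p' l (clsL e'' A) + (2 : ℚ) • opS C p' l (clsL e'' A)))
          hD (fun p => (compat_clsL e' A p).map _)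
          (fun p => ((((hS _ p).fun_add (hS _ p)).fun_add ((hS _ p).fun_smul _)).fun_smul _))
          fun h k L' hR hh hk hs => ?_, opS_smul, opS_add, opS_add, opS_smul, opS_self hD hc,
        opS_opS hc C C₁ p hD, opS_opS hc C C₂ p hD,
        opS_append_left L₁ L₂ (hS C) fun h k e => ⟨hd' e.1, hd' e.2.1⟩,
        opS_append_right L₁ L₂ (hS C) fun h k e => ⟨fun h => hd' h e.1, fun h => hd' h e.2.1⟩]
      · module
      · rw [bv_clsL e'' (good_cross h₁ h₂ hd he hR hh hk hs),
          opS_leafPair_split hs.disj hd (by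
            rw [hs.labels, labels_append]
            exact Set.sdiff_subset) hc]
    have t₂ : _root_.sewBracket P e₁' e₂ e'' (_root_.bv P e₁ e₁' (clsL e₁ A p L₁))
        (clsL e₂ A p L₂) =
        (1 / 2 : ℚ) • opS C₁ p L₁ fun p' l => opS C p' (l ++ L₂) (clsL e'' A) := by
      rw [bv_clsL e₁' h₁, ← LinearMap.flip_apply, map_smul, ← opS_map,
        opS_congr_rel (R' := C₁) h₁.disj (fun p => (compat_clsL e₁' A p).map _)
          fun h hh k hk _ => ⟨fun e => ⟨hh, hk, e⟩, fun e => e.2.2⟩]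
      congr 1
      refine opS_congr h₁.disj (fun p => (compat_clsL e₁' A p).map _)
        (fun p => (hS C p).append_right L₂) fun h k L' hR hh hk hs => ?_
      exact sewBracket_clsL e'' (h₁.sewStep hs hR.2.2 hh hk he₁) h₂
        (hs.labels ▸ Set.sdiff_subset) subset_rfl hd
    have t₃ : _root_.sewBracket P e₁ e₂' e'' (clsL e₁ A p L₁) (_root_.bv P e₂ e₂'
        (clsL e₂ A p L₂)) =
        (1 / 2 : ℚ) • opS C₂ p L₂ fun p' l => opS C p' (L₁ ++ l) (clsL e'' A) := by
      rw [bv_clsL e₂' h₂, map_smul, ← opS_map,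
        opS_congr_rel (R' := C₂) h₂.disj (fun p => (compat_clsL e₂' A p).map _)
          fun h hh k hk _ => ⟨fun e => ⟨hh, hk, e⟩, fun e => e.2.2⟩]
      congr 1
      refine opS_congr h₂.disj (fun p => (compat_clsL e₂' A p).map _)
        (fun p => (hS C p).append L₁) fun h k L' hR hh hk hs => ?_
      exact sewBracket_clsL e'' h₁ (h₂.sewStep hs hR.2.2 hh hk he₂) subset_rfl
        (hs.labels ▸ Set.sdiff_subset) hd
    rw [sewBracket_clsL e' h₁ h₂ subset_rfl subset_rfl hd, t₁, t₂, t₃, sgn_degSum h₁.deg]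
    module

theorem opS_cross_union {L : List (Cor P H)} (hL : Disj L) {S S' T : Set H} (hS : Disjoint S S')
    {f : (H → ℕ) → List (Cor P H) → M} (hf : ∀ p, Compat (f p)) :
    opS (A.cross (S ∪ S') T) p L f = opS (A.cross S T) p L f + opS (A.cross S' T) p L f :=
  opS_or hL hf (fun _ _ _ _ => or_and_right) fun _ _ e => Set.disjoint_left.1 hS e.1.1 e.2.1

theorem sewBracket_jacobi {e₁ e₂ e₃ e₁₂ e₁₃ e₂₃ : ℤ} (h₁₂ : e₁ + e₂ + 1 = e₁₂)
    (h₁₃ : e₁ + e₃ + 1 = e₁₃) (h₂₃ : e₂ + e₃ + 1 = e₂₃) (e' : ℤ) (x : FeynmanTotal P e₁)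
    (y : FeynmanTotal P e₂) (z : FeynmanTotal P e₃) :
    sgn e₁ • _root_.sewBracket P e₁ e₂₃ e' x (_root_.sewBracket P e₂ e₃ e₂₃ y z) +
      _root_.sewBracket P e₁₂ e₃ e' (_root_.sewBracket P e₁ e₂ e₁₂ x y) z +
      sgn (e₁ * e₂ + e₂) •
        _root_.sewBracket P e₂ e₁₃ e' y (_root_.sewBracket P e₁ e₃ e₁₃ x z) = 0 := by
  refine bracket_ext₃ (F := fun x y z =>
      sgn e₁ • _root_.sewBracket P e₁ e₂₃ e' x (_root_.sewBracket P e₂ e₃ e₂₃ y z) +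
      _root_.sewBracket P e₁₂ e₃ e' (_root_.sewBracket P e₁ e₂ e₁₂ x y) z +
      sgn (e₁ * e₂ + e₂) •
        _root_.sewBracket P e₂ e₁₃ e' y (_root_.sewBracket P e₁ e₃ e₁₃ x z))
    (fun y z => ⟨fun a b => ?_, fun c a => ?_⟩) (fun x z => ⟨fun a b => ?_, fun c a => ?_⟩)
    (fun x y => ⟨fun a b => ?_, fun c a => ?_⟩)
    (fun A p L₁ L₂ L₃ h₁ h₂ h₃ d₁₂ d₁₃ d₂₃ => ?_) x y z
  · simp only [map_add, LinearMap.add_apply, smul_add]; abel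
  · simp only [map_smul, LinearMap.smul_apply, smul_add, smul_comm c]
  · simp only [map_add, LinearMap.add_apply, smul_add]; abel
  · simp only [map_smul, LinearMap.smul_apply, smul_add, smul_comm c]
  · simp only [map_add, smul_add]; abel
  · simp only [map_smul, smul_add, smul_comm c]
  · have hc : ∀ p, Compat (clsL e' A p : List (Cor P _) → _) := fun p => compat_clsL e' A p
    have d₁₂' := Set.disjoint_left.1 d₁₂
    have d₁₃' := Set.disjoint_left.1 d₁₃
    have d₂₃' := Set.disjoint_left.1 d₂₃
    have D₁₂ : Disj (L₁ ++ L₂) := disj_append.2 ⟨h₁.disj, h₂.disj, d₁₂⟩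
    have D₁₃ : Disj (L₁ ++ L₃) := disj_append.2 ⟨h₁.disj, h₃.disj, d₁₃⟩
    have D₂₃ : Disj (L₂ ++ L₃) := disj_append.2 ⟨h₂.disj, h₃.disj, d₂₃⟩
    have d₁ : Disjoint (labels L₁) (labels L₂ ∪ labels L₃) := d₁₂.union_right d₁₃
    have d₂ : Disjoint (labels L₂) (labels L₁ ∪ labels L₃) := d₁₂.symm.union_right d₂₃
    have d₃ : Disjoint (labels L₁ ∪ labels L₂) (labels L₃) := d₁₃.union_left d₂₃
    have D : Disj (L₁ ++ (L₂ ++ L₃)) := disj_append.2 ⟨h₁.disj, D₂₃, by rwa [labels_append]⟩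
    set C₁₂ := A.cross (labels L₁) (labels L₂) with hC₁₂
    set C₁₃ := A.cross (labels L₁) (labels L₃) with hC₁₃
    set C₂₃ := A.cross (labels L₂) (labels L₃) with hC₂₃
    have hS : ∀ (R : _ → _ → Prop) p, Compat fun L : List (Cor P _) => opS R p L (clsL e' A) :=
      fun R p => compat_opS hc R p
    have t₁ : _root_.sewBracket P e₁ e₂₃ e' (clsL e₁ A p L₁) (_root_.sewBracket P e₂ e₃ e₂₃
        (clsL e₂ A p L₂) (clsL e₃ A p L₃)) = sgn (degSum L₁) • opS C₂₃ p (L₁ ++ (L₂ ++ L₃))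
          fun p' l => opS C₁₂ p' l (clsL e' A) + opS C₁₃ p' l (clsL e' A) := by
      rw [sewBracket_clsL e₂₃ h₂ h₃ subset_rfl subset_rfl d₂₃, ← opS_map,
        opS_append_right L₁ (L₂ ++ L₃) (fun p => (hS _ p).fun_add (hS _ p))
          fun h k e => ⟨fun h' => d₁₂' h' e.1, fun h' => d₁₃' h' e.2.1⟩, smul_smul, sgn_mul_self,
        one_smul]
      refine opS_congr D₂₃ (fun p => (compat_clsL e₂₃ A p).map _)
        (fun p => ((hS _ p).fun_add (hS _ p)).append L₁) fun h k L' hR hh hk hs => ?_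
      have hl : labels L' ⊆ labels L₂ ∪ labels L₃ := by
        rw [← labels_append]
        exact hs.labels ▸ Set.sdiff_subset
      have hD : Disj (L₁ ++ L') := disj_append.2 ⟨h₁.disj, hs.disj, d₁.mono_right hl⟩
      rw [sewBracket_clsL e' h₁ (good_cross h₂ h₃ d₂₃ h₂₃ hR hh hk hs) subset_rfl hl d₁,
        opS_cross_comm _ _ hD hc, opS_cross_union hD d₂₃ hc,
        opS_cross_comm (labels L₂) (labels L₁) hD hc, opS_cross_comm (labels L₃) (labels L₁) hD hc]
    have t₂ : _root_.sewBracket P e₁₂ e₃ e' (_root_.sewBracket P e₁ e₂ e₁₂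
        (clsL e₁ A p L₁) (clsL e₂ A p L₂)) (clsL e₃ A p L₃) = opS C₁₂ p (L₁ ++ (L₂ ++ L₃))
          fun p' l => opS C₁₃ p' l (clsL e' A) + opS C₂₃ p' l (clsL e' A) := by
      rw [sewBracket_clsL e₁₂ h₁ h₂ subset_rfl subset_rfl d₁₂, ← LinearMap.flip_apply, ← opS_map,
        ← List.append_assoc, opS_append_left (L₁ ++ L₂) L₃ (fun p => (hS _ p).fun_add (hS _ p))
          fun h k e => ⟨d₁₃' e.1, d₂₃' e.2.1⟩]
      refine opS_congr D₁₂ (fun p => (compat_clsL e₁₂ A p).map _)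
        (fun p => ((hS _ p).fun_add (hS _ p)).append_right L₃) fun h k L' hR hh hk hs => ?_
      have hl : labels L' ⊆ labels L₁ ∪ labels L₂ := by
        rw [← labels_append]
        exact hs.labels ▸ Set.sdiff_subset
      have hD : Disj (L' ++ L₃) := disj_append.2 ⟨hs.disj, h₃.disj, d₃.mono_left hl⟩
      refine (sewBracket_clsL e' (good_cross h₁ h₂ d₁₂ h₁₂ hR hh hk hs) h₃ hl subset_rfl d₃).trans ?_
      rw [opS_cross_union hD d₁₂ hc]
    have t₃ : _root_.sewBracket P e₂ e₁₃ e' (clsL e₂ A p L₂) (_root_.sewBracket P e₁ e₃ e₁₃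
        (clsL e₁ A p L₁) (clsL e₃ A p L₃)) = sgn (degSum L₂ + degSum L₂ * degSum L₁) •
          opS C₁₃ p (L₁ ++ (L₂ ++ L₃))
          fun p' l => opS C₁₂ p' l (clsL e' A) + opS C₂₃ p' l (clsL e' A) := by
      rw [sewBracket_clsL e₁₃ h₁ h₃ subset_rfl subset_rfl d₁₃, ← opS_map,
        (compat_opS (fun p => (hS C₁₂ p).fun_add (hS C₂₃ p)) C₁₃ p).append_swap L₁ L₂ L₃,
        opS_append_right L₂ (L₁ ++ L₃) (fun p => (hS _ p).fun_add (hS _ p))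
          fun h k e => ⟨d₁₂' e.1, fun h' => d₂₃' h' e.2.1⟩, smul_smul, smul_smul, ← sgn_add,
        ← sgn_add, show degSum L₂ + degSum L₂ * degSum L₁ + degSum L₁ * degSum L₂ + degSum L₂ =
          2 * (degSum L₂ + degSum L₂ * degSum L₁) by ring, sgn_two_mul, one_smul]
      refine opS_congr D₁₃ (fun p => (compat_clsL e₁₃ A p).map _)
        (fun p => ((hS _ p).fun_add (hS _ p)).append L₂) fun h k L' hR hh hk hs => ?_
      have hl : labels L' ⊆ labels L₁ ∪ labels L₃ := by
        rw [← labels_append]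
        exact hs.labels ▸ Set.sdiff_subset
      have hD : Disj (L₂ ++ L') := disj_append.2 ⟨h₂.disj, hs.disj, d₂.mono_right hl⟩
      rw [sewBracket_clsL e' h₂ (good_cross h₁ h₃ d₁₃ h₁₃ hR hh hk hs) subset_rfl hl d₂,
        opS_cross_comm _ _ hD hc, opS_cross_union hD d₁₃ hc,
        opS_cross_comm (labels L₃) (labels L₂) hD hc]
    have s₂ : sgn (degSum L₂ + degSum L₂ * degSum L₁) = sgn (e₁ * e₂ + e₂) := by
      rw [sgn_add, sgn_add, sgn_degSum h₂.deg, sgn_mul_congr (sgn_degSum h₂.deg)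
        (sgn_degSum h₁.deg), mul_comm, mul_comm e₁]
    rw [t₁, t₂, t₃, s₂, sgn_degSum h₁.deg, smul_smul, smul_smul, sgn_mul_self, sgn_mul_self,
      one_smul, one_smul, opS_add, opS_add, opS_add, opS_opS hc C₂₃ C₁₂ p D,
      opS_opS hc C₂₃ C₁₃ p D, opS_opS hc C₁₃ C₁₂ p D]
    abel

end DecGraph

end

noncomputable section

open DecGraph

variable {P : S1FramedModularOperad.{u}}

/-! ### The differential graded Lie algebras -/

theorem GBar.diff_apply {i j : ℤ} (x : GBar P i) (a b : ℕ) :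
    GBar.diff P i j x a b = differential P _ _ (x a b) := rfl

theorem GBar.hbarBV_zero {i j : ℤ} (x : GBar P i) (b : ℕ) : GBar.hbarBV P i j x 0 b = 0 := rfl

theorem GBar.hbarBV_succ {i j : ℤ} (x : GBar P i) (a b : ℕ) :
    GBar.hbarBV P i j x (a + 1) b = bv P _ _ (x a b) := rfl

theorem GBar.bracket_apply {i j k : ℤ} (x : GBar P i) (y : GBar P j) (a b : ℕ) :
    GBar.bracket P i j k x y a b = ∑ p ∈ Finset.HasAntidiagonal.antidiagonal a,
      ∑ q ∈ Finset.HasAntidiagonal.antidiagonal b,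
        sgn (i - 1) • sewBracket P _ _ _ (x p.1 q.1) (y p.2 q.2) := rfl

theorem GBar.diff_diff {i j k : ℤ} (h : j + 1 = i) (h' : k + 1 = j) (x : GBar P i) :
    GBar.diff P j k (GBar.diff P i j x) = 0 := by
  funext a b
  exact differential_differential (by omega) (by omega) (x a b)

theorem GBar.d_d {i j k : ℤ} (h : j + 1 = i) (h' : k + 1 = j) (x : GBar P i) :
    (GBar.diff P j k + GBar.hbarBV P j k) ((GBar.diff P i j + GBar.hbarBV P i j) x) = 0 := by
  simp only [LinearMap.add_apply, map_add]
  rw [GBar.diff_diff h h', zero_add]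
  funext a b
  change GBar.hbarBV P j k (GBar.diff P i j x) a b + (GBar.diff P j k (GBar.hbarBV P i j x) a b +
    GBar.hbarBV P j k (GBar.hbarBV P i j x) a b) = 0
  match a with
  | 0 =>
    rw [GBar.hbarBV_zero, GBar.hbarBV_zero, GBar.diff_apply, GBar.hbarBV_zero, map_zero]
    simp
  | 1 =>
    rw [GBar.hbarBV_succ, GBar.hbarBV_succ, GBar.diff_apply, GBar.diff_apply, GBar.hbarBV_succ,
      GBar.hbarBV_zero, map_zero, add_zero]
    exact (add_comm _ _).trans (differential_bv (by push_cast; omega) (by push_cast; omega) _)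
  | a + 2 =>
    rw [GBar.hbarBV_succ, GBar.hbarBV_succ, GBar.diff_apply, GBar.diff_apply, GBar.hbarBV_succ,
      GBar.hbarBV_succ, bv_bv (by push_cast; omega), add_zero]
    exact (add_comm _ _).trans (differential_bv (by push_cast; omega) (by push_cast; omega) _)

theorem GBar.antisymm {i j k : ℤ} (x : GBar P i) (y : GBar P j) :
    GBar.bracket P i j k x y = -(sgn (i * j) • GBar.bracket P j i k y x) := by
  funext a b
  change GBar.bracket P i j k x y a b = -(sgn (i * j) • GBar.bracket P j i k y x a b)
  rw [GBar.bracket_apply, GBar.bracket_apply, ← Finset.Nat.sum_antidiagonal_swap, Finset.smul_sum,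
    ← Finset.sum_neg_distrib]
  refine Finset.sum_congr rfl fun p _ => ?_
  rw [← Finset.Nat.sum_antidiagonal_swap, Finset.smul_sum, ← Finset.sum_neg_distrib]
  refine Finset.sum_congr rfl fun q _ => ?_
  have hs : ∀ c d c' d' : ℤ, sgn (i - 1) * sgn ((i - 1 + 2 * c + 2 * d) * (j - 1 + 2 * c' + 2 * d')) =
      -(sgn (i * j) * sgn (j - 1)) := by
    intro c d c' d'
    rw [← neg_one_mul (sgn (i * j) * _), ← sgn_one, ← sgn_add, ← sgn_add, ← sgn_add]
    exact sgn_congr ⟨-j + (c' + d') * (i - 1) + (c + d) * (j - 1) + 2 * (c + d) * (c' + d'),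
      by ring⟩
  rw [sewBracket_comm, smul_smul, smul_smul, ← neg_smul, hs]
  rfl

theorem GBar.diff_leibniz {i i' j j' k k' : ℤ} (h : i + j = k) (hi : i' + 1 = i) (hj : j' + 1 = j)
    (hk : k' + 1 = k) (x : GBar P i) (y : GBar P j) :
    GBar.diff P k k' (GBar.bracket P i j k x y) =
      GBar.bracket P i' j k' (GBar.diff P i i' x) y +
        sgn i • GBar.bracket P i j' k' x (GBar.diff P j j' y) := by
  funext a b
  change GBar.diff P k k' (GBar.bracket P i j k x y) a b =
    GBar.bracket P i' j k' (GBar.diff P i i' x) y a b +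
      sgn i • GBar.bracket P i j' k' x (GBar.diff P j j' y) a b
  rw [GBar.diff_apply, GBar.bracket_apply, GBar.bracket_apply, GBar.bracket_apply, map_sum,
    Finset.smul_sum, ← Finset.sum_add_distrib]
  refine Finset.sum_congr rfl fun p hp => ?_
  rw [map_sum, Finset.smul_sum, ← Finset.sum_add_distrib]
  refine Finset.sum_congr rfl fun q hq => ?_
  have hp' : ((p.1 : ℕ) : ℤ) + p.2 = a := by exact_mod_cast Finset.HasAntidiagonal.mem_antidiagonal.1 hp
  have hq' : ((q.1 : ℕ) : ℤ) + q.2 = b := by exact_mod_cast Finset.HasAntidiagonal.mem_antidiagonal.1 hq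
  have := differential_sewBracket (P := P) (e₁ := i - 1 + 2 * p.1 + 2 * q.1)
    (e₂ := j - 1 + 2 * p.2 + 2 * q.2) (e₁' := i' - 1 + 2 * p.1 + 2 * q.1)
    (e₂' := j' - 1 + 2 * p.2 + 2 * q.2) (e' := k - 1 + 2 * a + 2 * b)
    (e'' := k' - 1 + 2 * a + 2 * b) (by omega) (by omega) (by omega) (x p.1 q.1) (y p.2 q.2)
  rw [map_smul, GBar.diff_apply, GBar.diff_apply, eq_neg_of_add_eq_zero_left
    ((add_assoc _ _ _).symm.trans this), smul_smul, neg_add, smul_add, smul_neg, smul_neg, smul_smul]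
  have s₁ : sgn (i' - 1) = -sgn (i - 1) := by
    rw [← neg_one_mul, ← sgn_one, ← sgn_add]
    exact sgn_congr ⟨-1, by rw [← hi]; ring⟩
  have s₂ : sgn (i - 1) * sgn (i - 1 + 2 * p.1 + 2 * q.1) = -(sgn i * sgn (i - 1)) := by
    rw [← neg_one_mul (sgn i * _), ← sgn_one, ← sgn_add, ← sgn_add, ← sgn_add]
    exact sgn_congr ⟨p.1 + q.1 - 1, by ring⟩
  rw [s₁, s₂, neg_smul, neg_smul, neg_neg]

theorem GBar.hbarBV_leibniz {i i' j j' k k' : ℤ} (h : i + j = k) (hi : i' + 1 = i)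
    (hj : j' + 1 = j) (x : GBar P i) (y : GBar P j) :
    GBar.hbarBV P k k' (GBar.bracket P i j k x y) =
      GBar.bracket P i' j k' (GBar.hbarBV P i i' x) y +
        sgn i • GBar.bracket P i j' k' x (GBar.hbarBV P j j' y) := by
  funext a b
  change GBar.hbarBV P k k' (GBar.bracket P i j k x y) a b =
    GBar.bracket P i' j k' (GBar.hbarBV P i i' x) y a b +
      sgn i • GBar.bracket P i j' k' x (GBar.hbarBV P j j' y) a b
  match a with
  | 0 =>
    rw [GBar.hbarBV_zero, GBar.bracket_apply, GBar.bracket_apply]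
    simp [GBar.hbarBV_zero]
  | a + 1 =>
    rw [GBar.hbarBV_succ, GBar.bracket_apply, GBar.bracket_apply, GBar.bracket_apply,
      Finset.Nat.sum_antidiagonal_succ, Finset.Nat.sum_antidiagonal_succ', map_sum]
    simp only [GBar.hbarBV_zero, map_zero, LinearMap.zero_apply, smul_zero, Finset.sum_const_zero,
      zero_add, Finset.smul_sum, map_sum]
    rw [← Finset.sum_add_distrib]
    refine Finset.sum_congr rfl fun p hp => ?_
    rw [← Finset.sum_add_distrib]
    refine Finset.sum_congr rfl fun q hq => ?_
    have hp' : ((p.1 : ℕ) : ℤ) + p.2 = a := by exact_mod_cast Finset.HasAntidiagonal.mem_antidiagonal.1 hp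
    have hq' : ((q.1 : ℕ) : ℤ) + q.2 = b := by exact_mod_cast Finset.HasAntidiagonal.mem_antidiagonal.1 hq
    have := bv_sewBracket (P := P) (e₁ := i - 1 + 2 * p.1 + 2 * q.1)
      (e₂ := j - 1 + 2 * p.2 + 2 * q.2) (e₁' := i' - 1 + 2 * (p.1 + 1 : ℕ) + 2 * q.1)
      (e₂' := j' - 1 + 2 * (p.2 + 1 : ℕ) + 2 * q.2) (e' := k - 1 + 2 * a + 2 * b)
      (e'' := k' - 1 + 2 * (a + 1 : ℕ) + 2 * b) (by push_cast; omega) (by push_cast; omega)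
      (by omega) (x p.1 q.1) (y p.2 q.2)
    rw [map_smul, GBar.hbarBV_succ, GBar.hbarBV_succ, eq_neg_of_add_eq_zero_left
      ((add_assoc _ _ _).symm.trans this), smul_smul, neg_add, smul_add, smul_neg, smul_neg,
      smul_smul]
    have s₁ : sgn (i' - 1) = -sgn (i - 1) := by
      rw [← neg_one_mul, ← sgn_one, ← sgn_add]
      exact sgn_congr ⟨-1, by rw [← hi]; ring⟩
    have s₂ : sgn (i - 1) * sgn (i - 1 + 2 * p.1 + 2 * q.1) = -(sgn i * sgn (i - 1)) := by
      rw [← neg_one_mul (sgn i * _), ← sgn_one, ← sgn_add, ← sgn_add, ← sgn_add]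
      exact sgn_congr ⟨p.1 + q.1 - 1, by ring⟩
    rw [s₁, s₂, neg_smul, neg_smul, neg_neg]

theorem sum_antidiagonal_assoc {N : Type*} [AddCommMonoid N] (a : ℕ) (f : ℕ → ℕ → ℕ → N) :
    ∑ p ∈ Finset.HasAntidiagonal.antidiagonal a, ∑ r ∈ Finset.HasAntidiagonal.antidiagonal p.1,
      f r.1 r.2 p.2 =
    ∑ p ∈ Finset.HasAntidiagonal.antidiagonal a, ∑ r ∈ Finset.HasAntidiagonal.antidiagonal p.2,
      f p.1 r.1 r.2 := by
  rw [Finset.sum_sigma', Finset.sum_sigma']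
  refine Finset.sum_nbij' (fun x => ⟨(x.2.1, x.2.2 + x.1.2), (x.2.2, x.1.2)⟩)
    (fun x => ⟨(x.1.1 + x.2.1, x.2.2), (x.1.1, x.2.1)⟩) ?_ ?_ ?_ ?_ fun _ _ => rfl
  all_goals
    rintro ⟨⟨i, j⟩, k, l⟩ h
    simp only [Finset.mem_sigma, Finset.HasAntidiagonal.mem_antidiagonal] at h ⊢
    obtain ⟨rfl, rfl⟩ := h
    simp [add_assoc]

theorem sum_antidiagonal_left_comm {N : Type*} [AddCommMonoid N] (a : ℕ) (f : ℕ → ℕ → ℕ → N) :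
    ∑ p ∈ Finset.HasAntidiagonal.antidiagonal a, ∑ r ∈ Finset.HasAntidiagonal.antidiagonal p.2,
      f r.1 p.1 r.2 =
    ∑ p ∈ Finset.HasAntidiagonal.antidiagonal a, ∑ r ∈ Finset.HasAntidiagonal.antidiagonal p.2,
      f p.1 r.1 r.2 := by
  rw [Finset.sum_sigma', Finset.sum_sigma']
  refine Finset.sum_nbij' (fun x => ⟨(x.2.1, x.1.1 + x.2.2), (x.1.1, x.2.2)⟩)
    (fun x => ⟨(x.2.1, x.1.1 + x.2.2), (x.1.1, x.2.2)⟩) ?_ ?_ ?_ ?_ fun _ _ => rfl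
  all_goals
    rintro ⟨⟨i, j⟩, k, l⟩ h
    simp only [Finset.mem_sigma, Finset.HasAntidiagonal.mem_antidiagonal] at h ⊢
    obtain ⟨rfl, rfl⟩ := h
    simp [add_left_comm]

theorem GBar.bracket_bracket_right {i j k jk n : ℤ} (x : GBar P i) (y : GBar P j) (z : GBar P k)
    (a b : ℕ) : GBar.bracket P i jk n x (GBar.bracket P j k jk y z) a b =
      ∑ p ∈ Finset.HasAntidiagonal.antidiagonal a, ∑ r ∈ Finset.HasAntidiagonal.antidiagonal p.2,
      ∑ q ∈ Finset.HasAntidiagonal.antidiagonal b, ∑ s ∈ Finset.HasAntidiagonal.antidiagonal q.2,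
        (sgn (i - 1) * sgn (j - 1)) • sewBracket P _ _ _ (x p.1 q.1) (sewBracket P _ _
          (jk - 1 + 2 * (r.1 + r.2 : ℕ) + 2 * (s.1 + s.2 : ℕ)) (y r.1 s.1) (z r.2 s.2)) := by
  rw [GBar.bracket_apply]
  refine Finset.sum_congr rfl fun p hp => ?_
  rw [Finset.sum_comm]
  refine Finset.sum_congr rfl fun q hq => ?_
  rw [GBar.bracket_apply]
  simp only [map_sum, Finset.smul_sum, map_smul, smul_smul]
  refine Finset.sum_congr rfl fun r hr => Finset.sum_congr rfl fun s hs => ?_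
  rw [Finset.HasAntidiagonal.mem_antidiagonal.1 hr, Finset.HasAntidiagonal.mem_antidiagonal.1 hs]

theorem GBar.bracket_bracket_left {i j k ij n : ℤ} (x : GBar P i) (y : GBar P j) (z : GBar P k)
    (a b : ℕ) : GBar.bracket P ij k n (GBar.bracket P i j ij x y) z a b =
      ∑ p ∈ Finset.HasAntidiagonal.antidiagonal a, ∑ r ∈ Finset.HasAntidiagonal.antidiagonal p.1,
      ∑ q ∈ Finset.HasAntidiagonal.antidiagonal b, ∑ s ∈ Finset.HasAntidiagonal.antidiagonal q.1,
        (sgn (ij - 1) * sgn (i - 1)) • sewBracket P _ _ _ (sewBracket P _ _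
          (ij - 1 + 2 * (r.1 + r.2 : ℕ) + 2 * (s.1 + s.2 : ℕ)) (x r.1 s.1) (y r.2 s.2))
          (z p.2 q.2) := by
  rw [GBar.bracket_apply]
  refine Finset.sum_congr rfl fun p hp => ?_
  rw [Finset.sum_comm]
  refine Finset.sum_congr rfl fun q hq => ?_
  rw [GBar.bracket_apply]
  simp only [map_sum, Finset.smul_sum, map_smul, smul_smul, LinearMap.sum_apply,
    LinearMap.smul_apply]
  refine Finset.sum_congr rfl fun r hr => Finset.sum_congr rfl fun s hs => ?_
  rw [Finset.HasAntidiagonal.mem_antidiagonal.1 hr, Finset.HasAntidiagonal.mem_antidiagonal.1 hs]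

theorem GBar.jacobi {i j k ij jk ik n : ℤ} (hij : i + j = ij) (hjk : j + k = jk) (hik : i + k = ik)
    (x : GBar P i) (y : GBar P j) (z : GBar P k) :
    GBar.bracket P i jk n x (GBar.bracket P j k jk y z) =
      GBar.bracket P ij k n (GBar.bracket P i j ij x y) z +
        sgn (i * j) • GBar.bracket P j ik n y (GBar.bracket P i k ik x z) := by
  funext a b
  change GBar.bracket P i jk n x (GBar.bracket P j k jk y z) a b =
    GBar.bracket P ij k n (GBar.bracket P i j ij x y) z a b +
      sgn (i * j) • GBar.bracket P j ik n y (GBar.bracket P i k ik x z) a b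
  rw [GBar.bracket_bracket_right, GBar.bracket_bracket_left, GBar.bracket_bracket_right,
    sum_antidiagonal_assoc a fun u v w => ∑ q ∈ Finset.HasAntidiagonal.antidiagonal b,
      ∑ s ∈ Finset.HasAntidiagonal.antidiagonal q.1,
        (sgn (ij - 1) * sgn (i - 1)) • sewBracket P _ _ (n - 1 + 2 * a + 2 * b) (sewBracket P _ _
          (ij - 1 + 2 * (u + v : ℕ) + 2 * (s.1 + s.2 : ℕ)) (x u s.1) (y v s.2)) (z w q.2),
    ← sum_antidiagonal_left_comm a fun v u w => ∑ q ∈ Finset.HasAntidiagonal.antidiagonal b,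
      ∑ s ∈ Finset.HasAntidiagonal.antidiagonal q.2,
        (sgn (j - 1) * sgn (i - 1)) • sewBracket P _ _ (n - 1 + 2 * a + 2 * b) (y v q.1)
          (sewBracket P _ _ (ik - 1 + 2 * (u + w : ℕ) + 2 * (s.1 + s.2 : ℕ)) (x u s.1) (z w s.2)),
    Finset.smul_sum, ← Finset.sum_add_distrib]
  refine Finset.sum_congr rfl fun p hp => ?_
  rw [Finset.smul_sum, ← Finset.sum_add_distrib]
  refine Finset.sum_congr rfl fun r hr => ?_
  rw [sum_antidiagonal_assoc b fun u v w =>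
        (sgn (ij - 1) * sgn (i - 1)) • sewBracket P _ _ (n - 1 + 2 * a + 2 * b) (sewBracket P _ _
          (ij - 1 + 2 * (p.1 + r.1 : ℕ) + 2 * (u + v : ℕ)) (x p.1 u) (y r.1 v)) (z r.2 w),
    ← sum_antidiagonal_left_comm b fun v u w =>
        (sgn (j - 1) * sgn (i - 1)) • sewBracket P _ _ (n - 1 + 2 * a + 2 * b) (y r.1 v)
          (sewBracket P _ _ (ik - 1 + 2 * (p.1 + r.2 : ℕ) + 2 * (u + w : ℕ)) (x p.1 u) (z r.2 w)),
    Finset.smul_sum, ← Finset.sum_add_distrib]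
  refine Finset.sum_congr rfl fun q hq => ?_
  rw [Finset.smul_sum, ← Finset.sum_add_distrib]
  refine Finset.sum_congr rfl fun s hs => ?_
  have hJ := sewBracket_jacobi (P := P) (e₁ := i - 1 + 2 * p.1 + 2 * q.1)
    (e₂ := j - 1 + 2 * r.1 + 2 * s.1) (e₃ := k - 1 + 2 * r.2 + 2 * s.2)
    (e₁₂ := ij - 1 + 2 * (p.1 + r.1 : ℕ) + 2 * (q.1 + s.1 : ℕ))
    (e₁₃ := ik - 1 + 2 * (p.1 + r.2 : ℕ) + 2 * (q.1 + s.2 : ℕ))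
    (e₂₃ := jk - 1 + 2 * (r.1 + r.2 : ℕ) + 2 * (s.1 + s.2 : ℕ))
    (by push_cast; omega) (by push_cast; omega) (by push_cast; omega) (n - 1 + 2 * a + 2 * b)
    (x p.1 q.1) (y r.1 s.1) (z r.2 s.2)
  have h₁ := eq_neg_of_add_eq_zero_left ((add_assoc _ _ _).symm.trans hJ)
  have h₂ := congrArg (sgn (i - 1 + 2 * p.1 + 2 * q.1) • ·) h₁
  simp only [smul_smul, sgn_mul_self, one_smul, smul_neg, smul_add] at h₂
  have s₁ : -(sgn (i - 1) * sgn (j - 1) * sgn (i - 1 + 2 * p.1 + 2 * q.1)) =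
      sgn (ij - 1) * sgn (i - 1) := by
    rw [← neg_one_mul (_ * _), ← sgn_one, ← sgn_add, ← sgn_add, ← sgn_add, ← sgn_add]
    exact sgn_congr ⟨p.1 + q.1, by rw [← hij]; ring⟩
  have s₂ : -(sgn (i - 1) * sgn (j - 1) * (sgn (i - 1 + 2 * p.1 + 2 * q.1) *
      sgn ((i - 1 + 2 * p.1 + 2 * q.1) * (j - 1 + 2 * r.1 + 2 * s.1) +
        (j - 1 + 2 * r.1 + 2 * s.1)))) = sgn (i * j) * (sgn (j - 1) * sgn (i - 1)) := by
    rw [← neg_one_mul (_ * _), ← sgn_one, ← sgn_add, ← sgn_add, ← sgn_add, ← sgn_add, ← sgn_add,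
      ← sgn_add]
    exact sgn_congr ⟨i * (r.1 + s.1) + (p.1 + q.1) * j + 2 * (p.1 + q.1) * (r.1 + s.1), by ring⟩
  rw [h₂, smul_neg, smul_add, smul_smul, smul_smul, smul_smul, neg_add, ← neg_smul, ← neg_smul,
    s₁, s₂]

theorem GBar.leibniz {i i' j j' k k' : ℤ} (h : i + j = k) (hi : i' + 1 = i) (hj : j' + 1 = j)
    (hk : k' + 1 = k) (x : GBar P i) (y : GBar P j) :
    (GBar.diff P k k' + GBar.hbarBV P k k') (GBar.bracket P i j k x y) =
      GBar.bracket P i' j k' ((GBar.diff P i i' + GBar.hbarBV P i i') x) y +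
        sgn i • GBar.bracket P i j' k' x ((GBar.diff P j j' + GBar.hbarBV P j j') y) := by
  simp only [LinearMap.add_apply, map_add, smul_add, GBar.diff_leibniz h hi hj hk x y,
    GBar.hbarBV_leibniz (k' := k') h hi hj x y]
  abel

theorem isDGLA_gBar (P : S1FramedModularOperad.{u}) : (gBar P).IsDGLA where
  d_d h h' x := GBar.d_d h h' x
  antisymm _ _ x y := GBar.antisymm x y
  leibniz h _ _ hi hj hk x y := GBar.leibniz h hi hj hk x y
  jacobi hij hjk hik _ _ _ x y z := GBar.jacobi hij hjk hik x y z

theorem isDGLA_gBarTriv (P : S1FramedModularOperad.{u}) : (gBarTriv P).IsDGLA where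
  d_d h h' x := GBar.diff_diff h h' x
  antisymm {i j k} _ _ x y := by
    change (0 : GBar P k) = -(sgn (i * j) • (0 : GBar P k))
    simp
  leibniz {i i' j j' k k'} _ _ _ _ _ _ x y := by
    change GBar.diff P k k' 0 = (0 : GBar P k') + sgn i • (0 : GBar P k')
    simp
  jacobi {i j k ij jk ik n} _ _ _ _ _ _ x y z := by
    change (0 : GBar P n) = (0 : GBar P n) + sgn (i * j) • (0 : GBar P n)
    simp

end

noncomputable section

open Cor

variable {P : S1FramedModularOperad.{u}} {H : Type} [Finite H]
variable {M : Type w} [AddCommGroup M] [Module ℚ M]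

/-! ### Adding edges between leaves -/

namespace Matching

variable {A B : Matching H} {S : Set H} {n : ℕ} {h k : H}

/-- The matched half-edges. -/
def supp (B : Matching H) : Set H := {h | ∃ k, B.Adj h k}

instance : Finite (Matching H) :=
  Finite.of_injective (fun B : Matching H => B.Adj) fun _ _ h => Matching.ext h

/-- The edges of `A`, and those edges of `B` that join leaves of `A`. -/
def join (A B : Matching H) : Matching H where
  Adj h k := A.Adj h k ∨ B.Adj h k ∧ A.leafPair h k
  symm := by
    rintro h k (e | e)
    · exact Or.inl (A.symm e)
    · exact Or.inr ⟨B.symm e.1, e.2.2, e.2.1⟩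
  irrefl := by
    rintro h (e | e)
    · exact A.irrefl e
    · exact B.irrefl e.1
  unique := by
    rintro h k l (e | e) (e' | e')
    · exact A.unique e e'
    · exact absurd e (e'.2.1 _)
    · exact absurd e' (e.2.1 _)
    · exact B.unique e.1 e'.1

/-- Remove the edges at `h` and `k`. -/
def remove (B : Matching H) (h k : H) : Matching H where
  Adj a b := B.Adj a b ∧ (a ≠ h ∧ a ≠ k) ∧ b ≠ h ∧ b ≠ k
  symm e := ⟨B.symm e.1, e.2.2, e.2.1⟩
  irrefl e := B.irrefl e.1
  unique e e' := B.unique e.1 e'.1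

/-- Replace the edges at `h` and `k` by an edge joining `h` and `k`. -/
def add (B : Matching H) (h k : H) : Matching H where
  Adj a b := (B.remove h k).Adj a b ∨ h ≠ k ∧ (a = h ∧ b = k ∨ a = k ∧ b = h)
  symm := by
    rintro a b (e | ⟨e, e' | e'⟩)
    · exact Or.inl ((B.remove h k).symm e)
    · exact Or.inr ⟨e, Or.inr e'.symm⟩
    · exact Or.inr ⟨e, Or.inl e'.symm⟩
  irrefl := by
    rintro a (e | ⟨e, ⟨rfl, e'⟩ | ⟨rfl, e'⟩⟩)
    · exact B.irrefl e.1
    · exact e e'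
    · exact e e'.symm
  unique := by
    rintro a b c (e | ⟨e, ⟨rfl, rfl⟩ | ⟨rfl, rfl⟩⟩) (e' | ⟨-, ⟨h₁, h₂⟩ | ⟨h₁, h₂⟩⟩)
    · exact B.unique e.1 e'.1
    · exact absurd h₁ e.2.1.1
    · exact absurd h₁ e.2.1.2
    · exact absurd rfl e'.2.1.1
    · exact h₂.symm
    · exact absurd h₁ e
    · exact absurd rfl e'.2.1.2
    · exact absurd h₁.symm e
    · exact h₂.symm

theorem remove_add (hh : h ∉ B.supp) (hk : k ∉ B.supp) : (B.add h k).remove h k = B := by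
  refine Matching.ext ?_
  funext a b
  refine propext ⟨?_, fun e => ?_⟩
  · rintro ⟨e | ⟨-, ⟨rfl, -⟩ | ⟨rfl, -⟩⟩, e'⟩
    · exact e.1
    · exact absurd rfl e'.1.1
    · exact absurd rfl e'.1.2
  · have : (a ≠ h ∧ a ≠ k) ∧ b ≠ h ∧ b ≠ k := by
      refine ⟨⟨?_, ?_⟩, ?_, ?_⟩
      · rintro rfl; exact hh ⟨_, e⟩
      · rintro rfl; exact hk ⟨_, e⟩
      · rintro rfl; exact hh ⟨_, B.symm e⟩
      · rintro rfl; exact hk ⟨_, B.symm e⟩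
    exact ⟨Or.inl ⟨e, this⟩, this⟩

theorem add_remove (hB : B.Adj h k) : (B.remove h k).add h k = B := by
  refine Matching.ext ?_
  funext a b
  refine propext ⟨?_, fun e => ?_⟩
  · rintro (e | ⟨-, ⟨rfl, rfl⟩ | ⟨rfl, rfl⟩⟩)
    · exact e.1.1
    · exact hB
    · exact B.symm hB
  · have hne : h ≠ k := fun e => B.irrefl (h := h) (by rwa [← e] at hB)
    by_cases a₁ : a = h
    · subst a₁
      exact Or.inr ⟨hne, Or.inl ⟨rfl, B.unique e hB⟩⟩
    by_cases a₂ : a = k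
    · subst a₂
      exact Or.inr ⟨hne, Or.inr ⟨rfl, B.unique e (B.symm hB)⟩⟩
    have : (a ≠ h ∧ a ≠ k) ∧ b ≠ h ∧ b ≠ k := by
      refine ⟨⟨a₁, a₂⟩, ?_, ?_⟩
      · rintro rfl; exact a₂ (B.unique (B.symm e) hB)
      · rintro rfl; exact a₁ (B.unique (B.symm e) (B.symm hB))
    exact Or.inl ⟨⟨e, this⟩, this⟩

theorem supp_remove (hB : B.Adj h k) : (B.remove h k).supp = B.supp \ {h, k} := by
  ext a
  constructor
  · rintro ⟨b, e, ⟨h₁, h₂⟩, -⟩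
    exact ⟨⟨b, e⟩, by simp [h₁, h₂]⟩
  · rintro ⟨⟨b, e⟩, ha⟩
    simp only [Set.mem_insert_iff, Set.mem_singleton_iff, not_or] at ha
    refine ⟨b, e, ha, ?_, ?_⟩
    · rintro rfl; exact ha.2 (B.unique (B.symm e) hB)
    · rintro rfl; exact ha.1 (B.unique (B.symm e) (B.symm hB))

open Classical in
/-- The sets of `n` edges between the leaves of `A` in `S`. -/
def leafMatchings (A : Matching H) (S : Set H) (n : ℕ) : Finset (Matching H) :=
  (allOf (Matching H)).filter fun B => B.supp ⊆ {h | h ∈ S ∧ ∀ k, ¬ A.Adj h k} ∧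
    B.supp.ncard = 2 * n

theorem mem_leafMatchings : B ∈ A.leafMatchings S n ↔
    B.supp ⊆ {h | h ∈ S ∧ ∀ k, ¬ A.Adj h k} ∧ B.supp.ncard = 2 * n := by
  simp [leafMatchings]

theorem leafPair_of_mem (hB : B ∈ A.leafMatchings S n) (e : B.Adj h k) : A.leafPair h k :=
  ⟨((mem_leafMatchings.1 hB).1 ⟨k, e⟩).2, ((mem_leafMatchings.1 hB).1 ⟨h, B.symm e⟩).2⟩

theorem remove_mem (hB : B ∈ A.leafMatchings S (n + 1)) (e : B.Adj h k) :
    B.remove h k ∈ A.leafMatchings (S \ {h, k}) n := by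
  have hne : h ≠ k := fun e' => B.irrefl (h := h) (by rwa [← e'] at e)
  obtain ⟨h₁, h₂⟩ := mem_leafMatchings.1 hB
  refine mem_leafMatchings.2 ⟨fun a ha => ?_, ?_⟩
  · rw [supp_remove e] at ha
    exact ⟨⟨(h₁ ha.1).1, ha.2⟩, (h₁ ha.1).2⟩
  · have hs : ({h, k} : Set H) ⊆ B.supp := by
      rintro _ (rfl | rfl)
      · exact ⟨_, e⟩
      · exact ⟨_, B.symm e⟩
    rw [supp_remove e, Set.ncard_sdiff hs, h₂, Set.ncard_pair hne]
    omega

theorem add_mem (hne : h ≠ k) (hh : h ∈ S) (hk : k ∈ S) (hA : A.leafPair h k)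
    (hB : B ∈ A.leafMatchings (S \ {h, k}) n) : B.add h k ∈ A.leafMatchings S (n + 1) := by
  obtain ⟨h₁, h₂⟩ := mem_leafMatchings.1 hB
  have e₁ : h ∉ B.supp := fun e => (h₁ e).1.2 (Or.inl rfl)
  have e₂ : k ∉ B.supp := fun e => (h₁ e).1.2 (Or.inr rfl)
  have hs : (B.add h k).supp = insert h (insert k B.supp) := by
    have h₃ : (B.add h k).Adj h k := Or.inr ⟨hne, Or.inl ⟨rfl, rfl⟩⟩
    have := supp_remove h₃
    rw [remove_add e₁ e₂] at this
    rw [this]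
    ext a
    simp only [Set.mem_insert_iff, Set.mem_sdiff, Set.mem_singleton_iff]
    constructor
    · tauto
    · rintro (rfl | rfl | h')
      · exact ⟨_, h₃⟩
      · exact ⟨_, (B.add h a).symm h₃⟩
      · exact h'.1
  refine mem_leafMatchings.2 ⟨?_, ?_⟩
  · rw [hs]
    rintro a (rfl | rfl | ha)
    · exact ⟨hh, hA.1⟩
    · exact ⟨hk, hA.2⟩
    · exact ⟨(h₁ ha).1.1, (h₁ ha).2⟩
  · rw [hs, Set.ncard_insert_of_notMem (by simp [hne, e₁]), Set.ncard_insert_of_notMem e₂, h₂]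
    ring

end Matching

namespace DecGraph

variable {A : Matching H} {p : H → ℕ} {L : List (Cor P H)}

/-- The sum over all ways of adding `n` edges between the leaves. -/
def insertL (n : ℕ) (e : ℤ) (A : Matching H) (p : H → ℕ) (L : List (Cor P H)) : FeynmanTotal P e :=
  ∑ B ∈ A.leafMatchings (labels L) n, clsL e (A.join B) p L

theorem compat_insertL (n : ℕ) (e : ℤ) (A : Matching H) (p : H → ℕ) :
    Compat (insertL n e A p : List (Cor P H) → _) where
  add {s g d} x y l := by
    rw [insertL, insertL, insertL, labels_cons, labels_cons, labels_cons, ← Finset.sum_add_distrib]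
    exact Finset.sum_congr rfl fun B _ => (compat_clsL e _ p).add x y l
  smul c {s g d} x l := by
    rw [insertL, insertL, labels_cons, labels_cons, Finset.smul_sum]
    exact Finset.sum_congr rfl fun B _ => (compat_clsL e _ p).smul c x l
  swap l₁ a b l₂ := by
    rw [insertL, insertL, labels_perm ((List.Perm.swap b a l₂).append_left l₁), Finset.smul_sum]
    exact Finset.sum_congr rfl fun B _ => (compat_clsL e _ p).swap l₁ a b l₂

theorem leafMatchings_congr {S T : Set H} (hST : T ⊆ S)
    (h : ∀ x ∈ S, (∀ k, ¬ A.Adj x k) → x ∈ T) (n : ℕ) :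
    A.leafMatchings S n = A.leafMatchings T n := by
  ext B
  rw [Matching.mem_leafMatchings, Matching.mem_leafMatchings]
  have : {h | h ∈ S ∧ ∀ k, ¬ A.Adj h k} = {h | h ∈ T ∧ ∀ k, ¬ A.Adj h k} := by
    ext x
    exact ⟨fun e => ⟨h x e.1 e.2, e.2⟩, fun e => ⟨hST e.1, e.2⟩⟩
  rw [this]

theorem opQ_sum {ι : Type*} (s : Finset ι) (f : ι → (H → ℕ) → List (Cor P H) → M) :
    opQ A p L (fun p' l => ∑ i ∈ s, f i p' l) = ∑ i ∈ s, opQ A p L (f i) := by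
  simp only [opQ, opI_sum, opS_sum, Finset.sum_add_distrib, Finset.smul_sum]

theorem differential_insertL_aux (n : ℕ) {e e' : ℤ} (he : e' + 1 = e) (hL : Disj L) :
    _root_.differential P e e' (insertL n e A p L) = opQ A p L (insertL n e' A) +
      (1 / 2 : ℚ) • ∑ B ∈ A.leafMatchings (labels L) n,
        opS B.Adj p L (clsL e' (A.join B)) := by
  have hc : ∀ B p, Compat (clsL e' (A.join B) p : List (Cor P H) → _) :=
    fun B p => compat_clsL e' _ p
  rw [insertL, map_sum, opQ_congr (g := fun p' l => ∑ B ∈ A.leafMatchings (labels L) n,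
      clsL e' (A.join B) p' l) hL (fun p => compat_insertL n e' A p)
      (fun p => Compat.fun_sum _ fun B _ => hc B p)
      fun p' L' hs => by rw [insertL, leafMatchings_congr hs.sub hs.leaf n],
    opQ_sum, Finset.smul_sum, ← Finset.sum_add_distrib]
  refine Finset.sum_congr rfl fun B hB => ?_
  rw [differential_clsL he hL, opQ, opQ, add_assoc, ← smul_add]
  congr 2
  exact opS_or hL (hc B) (fun h _ k _ => or_congr_right
    (and_iff_left_of_imp fun e => Matching.leafPair_of_mem hB e))
    fun h k e => (Matching.leafPair_of_mem hB e.2).1 _ e.1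

theorem differential_insertL_zero {e e' : ℤ} (he : e' + 1 = e) (hL : Disj L) :
    _root_.differential P e e' (insertL 0 e A p L) = opQ A p L (insertL 0 e' A) := by
  rw [differential_insertL_aux 0 he hL, Finset.sum_eq_zero, smul_zero, add_zero]
  intro B hB
  refine opS_eq_zero hL (fun p => compat_clsL e' _ p) fun h _ k _ e => ?_
  have := (Matching.mem_leafMatchings.1 hB).2
  rw [mul_zero, Set.ncard_eq_zero] at this
  exact this.le ⟨k, e⟩

theorem differential_insertL_succ (n : ℕ) {e e' : ℤ} (he : e' + 1 = e) (hL : Disj L) :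
    _root_.differential P e e' (insertL (n + 1) e A p L) = opQ A p L (insertL (n + 1) e' A) +
      (1 / 2 : ℚ) • opS A.leafPair p L (insertL n e' A) := by
  classical
  rw [differential_insertL_aux (n + 1) he hL]
  congr 2
  have hc : ∀ B p, Compat (clsL e' (A.join B) p : List (Cor P H) → _) :=
    fun B p => compat_clsL e' _ p
  simp only [opS]
  rw [Finset.sum_comm]
  refine Finset.sum_congr rfl fun h _ => ?_
  rw [Finset.sum_comm]
  refine Finset.sum_congr rfl fun k _ => ?_
  rcases sew_cases h k hL with h₀ | ⟨s, L', h₁, h₂, h₃, h₄, h₅, h₆, -, -⟩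
  · rw [h₀ _ (compat_insertL n e' A p), ite_self]
    exact Finset.sum_eq_zero fun B _ => by rw [h₀ _ (hc B p), ite_self]
  · simp only [h₁ _ (hc _ p)]
    rw [h₁ _ (compat_insertL n e' A p), ← Finset.sum_filter, ← Finset.smul_sum]
    split_ifs with hA
    · congr 1
      rw [insertL, h₆]
      refine Finset.sum_nbij' (fun B => B.remove h k) (fun B => B.add h k) (fun B hB => ?_)
        (fun B hB => ?_) (fun B hB => ?_) (fun B hB => ?_) fun B hB => ?_
      · exact Matching.remove_mem (Finset.mem_filter.1 hB).1 (Finset.mem_filter.1 hB).2.1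
      · exact Finset.mem_filter.2 ⟨Matching.add_mem h₂ h₃ h₄ hA.1 hB,
          Or.inr ⟨h₂, Or.inl ⟨rfl, rfl⟩⟩, hA.2⟩
      · exact Matching.add_remove (Finset.mem_filter.1 hB).2.1
      · have := (Matching.mem_leafMatchings.1 hB).1
        exact Matching.remove_add (fun e => (this e).1.2 (Or.inl rfl))
          fun e => (this e).1.2 (Or.inr rfl)
      · refine clsL_congr (fun a ha b hb => or_congr_right (and_congr_left fun _ => ?_))
          fun _ _ => rfl
        rw [h₆] at ha hb
        simp only [Set.mem_sdiff, Set.mem_insert_iff, Set.mem_singleton_iff, not_or] at ha hb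
        exact (and_iff_left ⟨ha.2, hb.2⟩).symm
    · rw [Finset.filter_false_of_mem, Finset.sum_empty, smul_zero]
      exact fun B hB e => hA ⟨Matching.leafPair_of_mem hB e.1, e.2⟩

end DecGraph

end

noncomputable section

open Cor

variable {P : S1FramedModularOperad.{u}} {H : Type} [Finite H]
variable {M : Type w} [AddCommGroup M] [Module ℚ M]

/-! ### Sums over isomorphism classes of marked graphs -/

namespace MarkedGraph

variable {m : ℕ} {n : Fin m → ℕ}

theorem ext_adj {A B : MarkedGraph n} (h : ∀ a b, A.Adj a b ↔ B.Adj a b) : A = B := by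
  obtain ⟨A, _, _, _⟩ := A
  obtain ⟨B, _, _, _⟩ := B
  obtain rfl : A = B := funext fun a => funext fun b => propext (h a b)
  rfl

instance : Finite (MarkedGraph n) :=
  Finite.of_injective MarkedGraph.Adj fun _ _ h => ext_adj fun a b => iff_of_eq (congrFun₂ h a b)

/-- Renumbering of the half-edges at the vertices. -/
def renumber (τ : ∀ j, Equiv.Perm (Fin (n j))) (A : MarkedGraph n) : MarkedGraph n where
  Adj a b := A.Adj ⟨a.1, (τ a.1).symm a.2⟩ ⟨b.1, (τ b.1).symm b.2⟩
  symm := A.symm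
  irrefl := A.irrefl
  unique h h' := (Equiv.sigmaCongrRight fun j => (τ j).symm).injective (A.unique h h')

theorem renumber_eq_iff {τ : ∀ j, Equiv.Perm (Fin (n j))} {A B : MarkedGraph n} :
    A.renumber τ = B ↔ ∀ a b, A.Adj a b ↔ B.Adj ⟨a.1, τ a.1 a.2⟩ ⟨b.1, τ b.1 b.2⟩ := by
  constructor
  · rintro rfl a b
    simp [renumber]
  · intro h
    refine ext_adj fun a b => ?_
    rw [renumber, h]
    simp

theorem card_iso {A B : MarkedGraph n} (h : Nonempty (Iso A B)) :
    Nat.card (Iso A B) = A.autCard := by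
  obtain ⟨ρ⟩ := h
  refine Nat.card_congr ⟨fun τ => ⟨fun j => (τ.1 j).trans (ρ.1 j).symm, fun a b => ?_⟩,
    fun τ => ⟨fun j => (τ.1 j).trans (ρ.1 j), fun a b => (τ.2 a b).trans (ρ.2 _ _)⟩,
    fun τ => Subtype.ext (funext fun j => Equiv.ext fun a => by simp),
    fun τ => Subtype.ext (funext fun j => Equiv.ext fun a => by simp)⟩
  rw [τ.2, ρ.2]
  simp

theorem edgeCount_congr {A B : MarkedGraph n} (h : Nonempty (Iso A B)) :
    A.edgeCount = B.edgeCount := by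
  obtain ⟨ρ⟩ := h
  refine congrArg (· / 2) (Nat.card_congr ((Equiv.sigmaCongrRight ρ.1).subtypeEquiv fun a => ?_))
  refine ⟨fun ⟨b, hb⟩ => ⟨_, (ρ.2 a b).1 hb⟩, fun ⟨b, hb⟩ =>
    ⟨⟨b.1, (ρ.1 b.1).symm b.2⟩, (ρ.2 _ _).2 ?_⟩⟩
  simpa using hb

open Classical in
/-- The sum over the isomorphism classes, weighted by the automorphisms, of the sums over all
renumberings is the sum over all marked graphs. -/
theorem sum_classes [Fintype (Quotient (isoSetoid n))] [Fintype (MarkedGraph n)]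
    (Φ : MarkedGraph n → M) (N : ℕ) :
    (∑ c : Quotient (isoSetoid n), if c.out.edgeCount = N then
      (1 / (c.out.autCard : ℚ)) • ∑ τ : ∀ j, Equiv.Perm (Fin (n j)), Φ (c.out.renumber τ) else 0) =
      ∑ A : MarkedGraph n, if A.edgeCount = N then Φ A else 0 := by
  rw [← Finset.sum_fiberwise (s := Finset.univ) (g := fun A => (⟦A⟧ : Quotient (isoSetoid n)))
    (f := fun A : MarkedGraph n => if A.edgeCount = N then Φ A else 0)]
  refine Finset.sum_congr rfl fun c _ => ?_
  have hc : ∀ B : MarkedGraph n, (⟦B⟧ : Quotient (isoSetoid n)) = c ↔ Nonempty (Iso c.out B) := by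
    intro B
    conv_lhs => rw [← c.out_eq]
    rw [eq_comm]
    exact Quotient.eq
  have hpos : (c.out.autCard : ℚ) ≠ 0 := by
    have : Finite (Iso c.out c.out) := Subtype.finite
    have : Nonempty (Iso c.out c.out) := ⟨⟨fun _ => Equiv.refl _, fun _ _ => Iff.rfl⟩⟩
    exact Nat.cast_ne_zero.2 Nat.card_pos.ne'
  have h₁ : ∑ τ : ∀ j, Equiv.Perm (Fin (n j)), Φ (c.out.renumber τ) =
      ∑ B : MarkedGraph n with (⟦B⟧ : Quotient (isoSetoid n)) = c, (c.out.autCard : ℚ) • Φ B := by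
    rw [← Finset.sum_fiberwise (s := Finset.univ) (g := fun τ => c.out.renumber τ), Finset.sum_filter]
    refine Finset.sum_congr rfl fun B _ => ?_
    have h₂ : ((Finset.univ.filter fun τ => c.out.renumber τ = B).card : ℕ) =
        Nat.card (Iso c.out B) := by
      rw [← Fintype.card_subtype, ← Nat.card_eq_fintype_card]
      exact Nat.card_congr (Equiv.subtypeEquivRight fun τ => renumber_eq_iff)
    rw [Finset.sum_congr rfl fun τ hτ => congrArg Φ (Finset.mem_filter.1 hτ).2, Finset.sum_const, h₂,
      ← Nat.cast_smul_eq_nsmul ℚ]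
    split_ifs with hB
    · rw [card_iso ((hc B).1 hB)]
    · have : IsEmpty (Iso c.out B) := not_nonempty_iff.1 fun h => hB ((hc B).2 h)
      rw [Nat.card_of_isEmpty, Nat.cast_zero, zero_smul]
  have h₃ : ∀ B ∈ Finset.univ.filter fun B => (⟦B⟧ : Quotient (isoSetoid n)) = c,
      (if B.edgeCount = N then Φ B else 0) = if c.out.edgeCount = N then Φ B else 0 := fun B hB => by
    rw [edgeCount_congr ((hc B).1 (Finset.mem_filter.1 hB).2)]
  rw [Finset.sum_congr rfl h₃]
  split_ifs
  · rw [h₁, Finset.smul_sum]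
    exact Finset.sum_congr rfl fun B _ => by rw [smul_smul, one_div_mul_cancel hpos, one_smul]
  · rw [Finset.sum_const_zero]

/-- The matching that corresponds to a marked graph when its half-edges are named by `ι`. -/
def push (ι : (Σ j, Fin (n j)) ↪ H) (A : MarkedGraph n) : Matching H where
  Adj h k := ∃ a b, ι a = h ∧ ι b = k ∧ A.Adj a b
  symm := fun ⟨a, b, h₁, h₂, h⟩ => ⟨b, a, h₂, h₁, A.symm h⟩
  irrefl := by
    rintro _ ⟨a, b, rfl, h₂, h⟩
    obtain rfl := ι.injective h₂
    exact A.irrefl h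
  unique := by
    rintro _ _ _ ⟨a, b, rfl, rfl, h⟩ ⟨a', c, h₁, rfl, h'⟩
    obtain rfl := ι.injective h₁
    rw [A.unique h h']

theorem push_adj (ι : (Σ j, Fin (n j)) ↪ H) (A : MarkedGraph n) (a b : Σ j, Fin (n j)) :
    (A.push ι).Adj (ι a) (ι b) ↔ A.Adj a b := by
  refine ⟨?_, fun h => ⟨a, b, rfl, rfl, h⟩⟩
  rintro ⟨a', b', h₁, h₂, h⟩
  rwa [ι.injective h₁, ι.injective h₂] at h

/-- The marked graph of a matching of its half-edges. -/
def pull (ι : (Σ j, Fin (n j)) ↪ H) (B : Matching H) : MarkedGraph n where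
  Adj a b := B.Adj (ι a) (ι b)
  symm := B.symm
  irrefl := B.irrefl
  unique h h' := ι.injective (B.unique h h')

theorem pull_push (ι : (Σ j, Fin (n j)) ↪ H) (A : MarkedGraph n) : pull ι (A.push ι) = A :=
  ext_adj fun a b => A.push_adj ι a b

theorem push_pull (ι : (Σ j, Fin (n j)) ↪ H) {B : Matching H} (h : B.supp ⊆ Set.range ι) :
    (pull ι B).push ι = B := by
  refine Matching.ext (funext fun x => funext fun y => propext ⟨?_, fun e => ?_⟩)
  · rintro ⟨a, b, rfl, rfl, e⟩
    exact e
  · obtain ⟨a, rfl⟩ := h ⟨y, e⟩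
    obtain ⟨b, rfl⟩ := h ⟨_, B.symm e⟩
    exact ⟨a, b, rfl, rfl, e⟩

theorem supp_push (ι : (Σ j, Fin (n j)) ↪ H) (A : MarkedGraph n) :
    (A.push ι).supp = ι '' {a | ∃ b, A.Adj a b} := by
  ext x
  constructor
  · rintro ⟨_, a, b, rfl, rfl, h⟩
    exact ⟨a, ⟨b, h⟩, rfl⟩
  · rintro ⟨a, ⟨b, h⟩, rfl⟩
    exact ⟨ι b, a, b, rfl, rfl, h⟩

theorem even_card (A : MarkedGraph n) : Even (Nat.card {a // ∃ b, A.Adj a b}) := by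
  classical
  let f : Function.End {a // ∃ b, A.Adj a b} := fun a => ⟨a.2.choose, _, A.symm a.2.choose_spec⟩
  have hf : ∀ a, A.Adj a.1 (f a).1 := fun a => a.2.choose_spec
  have := Fintype.ofFinite {a // ∃ b, A.Adj a b}
  have h₂ := Equiv.Perm.card_fixedPoints_modEq (f := f) (p := 2) (n := 1) (funext fun a =>
    Subtype.ext (A.unique (hf (f a)) (A.symm (hf a))))
  have : IsEmpty (Function.fixedPoints f) := ⟨fun a => A.irrefl (a := a.1.1) (by
    have := hf a.1
    rwa [show f a.1 = a.1 from a.2] at this)⟩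
  rw [Fintype.card_of_isEmpty (α := Function.fixedPoints f)] at h₂
  rw [Nat.card_eq_fintype_card, even_iff_two_dvd]
  exact (Nat.modEq_zero_iff_dvd).1 h₂

theorem ncard_supp_push (ι : (Σ j, Fin (n j)) ↪ H) (A : MarkedGraph n) :
    (A.push ι).supp.ncard = 2 * A.edgeCount := by
  rw [supp_push, Set.ncard_image_of_injective _ ι.injective, edgeCount,
    Nat.two_mul_div_two_of_even A.even_card]
  exact (Nat.card_coe_set_eq _).symm

end MarkedGraph

end

noncomputable section

open Cor

variable {P : S1FramedModularOperad.{u}} {H : Type} [Finite H]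
variable {M : Type w} [AddCommGroup M] [Module ℚ M]

/-! ### Graph insertion in terms of lists -/

namespace DecGraph

variable {A : Matching H} {p : H → ℕ} {m : ℕ} (Γ : Fin m → LabGraph P A p)
  (hd : ∀ i j, i ≠ j → Disjoint (Set.range (Γ i).lab) (Set.range (Γ j).lab))

/-- The names of the leaves, numbered by `σ`. -/
def LabGraph.leafNames {n : Fin m → ℕ} (σ : ∀ j, (Γ j).graph.Leaf ≃ Fin (n j)) :
    (Σ j, Fin (n j)) ↪ H where
  toFun a := (Γ a.1).lab ((σ a.1).symm a.2).1
  inj' := by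
    rintro ⟨i, a⟩ ⟨j, b⟩ e
    by_cases hij : i = j
    · subst hij
      have := (σ i).symm.injective (Subtype.ext ((Γ i).lab.injective e))
      exact congrArg (Sigma.mk i) this
    · exact absurd rfl ((hd i j hij).ne_of_mem ⟨_, e⟩ ⟨_, rfl⟩)

theorem LabGraph.range_leafNames {n : Fin m → ℕ} (σ : ∀ j, (Γ j).graph.Leaf ≃ Fin (n j)) :
    Set.range (leafNames Γ hd σ) =
      {h | h ∈ labels ((List.finRange m).flatMap fun j => (Γ j).list) ∧ ∀ k, ¬ A.Adj h k} := by
  rw [← list_union Γ hd, labels_list, range_union]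
  ext x
  simp only [Set.mem_ofPred_eq, Set.mem_iUnion]
  constructor
  · rintro ⟨a, rfl⟩
    exact ⟨⟨a.1, _, rfl⟩, ((Γ a.1).leaf_iff _).1 ((σ a.1).symm a.2).2⟩
  · rintro ⟨⟨j, a, rfl⟩, h⟩
    refine ⟨⟨j, σ j ⟨a, ((Γ j).leaf_iff a).2 h⟩⟩, ?_⟩
    change (Γ j).lab ((σ j).symm (σ j _)).1 = _
    rw [Equiv.symm_apply_apply]

theorem LabGraph.cls_insert {n : Fin m → ℕ} (B : MarkedGraph n)
    (σ : ∀ j, (Γ j).graph.Leaf ≃ Fin (n j)) (e : ℤ) :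
    (B.insert (fun j => (Γ j).graph) σ).cls e = clsL e (A.join (B.push (leafNames Γ hd σ))) p
      ((List.finRange m).flatMap fun j => (Γ j).list) := by
  have hlab : (B.insert (fun j => (Γ j).graph) σ).IsLab (union Γ hd).lab
      (A.join (B.push (leafNames Γ hd σ))) p := by
    have key₀ : ∀ x : Σ j, (Γ j).graph.Leaf,
        leafNames Γ hd σ ⟨x.1, σ _ x.2⟩ = (Γ x.1).lab x.2.1 := fun x =>
      congrArg (fun y : (Γ x.1).graph.Leaf => (Γ x.1).lab y.1) ((σ x.1).symm_apply_apply x.2)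
    have key : ∀ h : (disjUnion fun j => (Γ j).graph).Leaf, leafNames Γ hd σ
        ⟨(leafPart (fun j => (Γ j).graph) h).1, σ _ (leafPart (fun j => (Γ j).graph) h).2⟩ =
        (union Γ hd).lab h.1 := fun h => key₀ _
    refine ⟨fun h k => or_congr ((union Γ hd).isLab.adj h k) ?_, (union Γ hd).isLab.pow⟩
    constructor
    · rintro ⟨hl, kl, hB⟩
      refine ⟨⟨_, _, key ⟨h, hl⟩, key ⟨k, kl⟩, hB⟩, ?_, ?_⟩
      · exact ((union Γ hd).leaf_iff h).1 hl
      · exact ((union Γ hd).leaf_iff k).1 kl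
    · rintro ⟨hB, hl, kl⟩
      have hl' := ((union Γ hd).leaf_iff h).2 hl
      have kl' := ((union Γ hd).leaf_iff k).2 kl
      refine ⟨hl', kl', (B.push_adj (leafNames Γ hd σ) _ _).1 ?_⟩
      exact (iff_of_eq (congrArg₂ _ (key ⟨h, hl'⟩) (key ⟨k, kl'⟩))).2 hB
  rw [cls_eq_clsL hlab e, ← list_union Γ hd]
  rfl

/-- The sum over all marked graphs with `N` edges. -/
def edgeInsertion (N : ℕ) (e : ℤ) {m : ℕ} (γ : Fin m → DecGraph P) : FeynmanTotal P e :=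
  ∑ᶠ (c : Quotient (MarkedGraph.isoSetoid fun j => (γ j).leafCount)) (_ : c.out.edgeCount = N),
    (1 / (c.out.autCard : ℚ)) • c.out.graphMap e γ

theorem edgeInsertion_eq (Γ : Fin m → LabGraph P A p)
    (hd : ∀ i j, i ≠ j → Disjoint (Set.range (Γ i).lab) (Set.range (Γ j).lab)) (N : ℕ) (e : ℤ) :
    edgeInsertion N e (fun j => (Γ j).graph) =
    insertL N e A p ((List.finRange m).flatMap fun j => (Γ j).list) := by
  classical
  set L := (List.finRange m).flatMap fun j => (Γ j).list with hL
  let n : Fin m → ℕ := fun j => (Γ j).graph.leafCount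
  have := Fintype.ofFinite (MarkedGraph n)
  have := Fintype.ofFinite (Quotient (MarkedGraph.isoSetoid n))
  have := fun j => Fintype.ofFinite ((Γ j).graph.Leaf)
  let σ₀ : ∀ j, (Γ j).graph.Leaf ≃ Fin (n j) := fun j => Finite.equivFin _
  let ι := LabGraph.leafNames Γ hd σ₀
  let F : Matching H → FeynmanTotal P e := fun B => clsL e (A.join B) p L
  have h₁ : ∀ B : MarkedGraph n, B.graphMap e (fun j => (Γ j).graph) =
      ∑ τ : ∀ j, Equiv.Perm (Fin (n j)), F ((B.renumber τ).push ι) := by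
    intro B
    rw [MarkedGraph.graphMap, finsum_eq_sum_of_fintype]
    refine Fintype.sum_equiv (Equiv.piCongrRight fun j =>
      ⟨fun σ => σ.symm.trans (σ₀ j), fun τ => (σ₀ j).trans τ.symm, fun σ => Equiv.ext fun a => by simp,
        fun τ => Equiv.ext fun a => by simp⟩) _ _ fun σ => ?_
    rw [LabGraph.cls_insert Γ hd B σ e]
    refine congrArg F (Matching.ext (funext fun x => funext fun y => propext ?_))
    have hι : ∀ a : Σ j, Fin (n j), LabGraph.leafNames Γ hd σ a =
        ι ⟨a.1, ((σ a.1).symm.trans (σ₀ a.1)) a.2⟩ := fun a =>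
      congrArg (fun y : (Γ a.1).graph.Leaf => (Γ a.1).lab y.1)
        ((σ₀ a.1).symm_apply_apply ((σ a.1).symm a.2)).symm
    constructor
    · rintro ⟨a, b, rfl, rfl, h⟩
      refine ⟨_, _, (hι a).symm, (hι b).symm, ?_⟩
      simpa [MarkedGraph.renumber] using h
    · rintro ⟨a, b, rfl, rfl, h⟩
      refine ⟨_, _, (hι _).trans ?_, (hι _).trans ?_, h⟩
      · simp
      · simp
  have h₂ := MarkedGraph.sum_classes (fun B : MarkedGraph n => F (B.push ι)) N
  have h₃ : edgeInsertion N e (fun j => (Γ j).graph) =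
      ∑ c : Quotient (MarkedGraph.isoSetoid n), if c.out.edgeCount = N then
      (1 / (c.out.autCard : ℚ)) • ∑ τ : ∀ j, Equiv.Perm (Fin (n j)), F ((c.out.renumber τ).push ι)
      else 0 := by
    rw [edgeInsertion, finsum_eq_sum_of_fintype]
    refine Finset.sum_congr rfl fun c _ => ?_
    rw [finsum_eq_if]
    simp only [h₁]
  rw [h₃, h₂, insertL, ← Finset.sum_filter]
  have hr := LabGraph.range_leafNames Γ hd σ₀
  refine Finset.sum_nbij' (fun B => B.push ι) (fun B => MarkedGraph.pull ι B) (fun B hB => ?_)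
    (fun B hB => ?_) (fun B _ => B.pull_push ι) (fun B hB => ?_) fun B _ => rfl
  · refine Matching.mem_leafMatchings.2 ⟨?_, ?_⟩
    · rw [← hr, B.supp_push]
      exact Set.image_subset_range _ _
    · rw [B.ncard_supp_push, (Finset.mem_filter.1 hB).2]
  · obtain ⟨h₄, h₅⟩ := Matching.mem_leafMatchings.1 hB
    rw [← hr] at h₄
    have := (MarkedGraph.pull ι B).ncard_supp_push ι
    rw [MarkedGraph.push_pull ι h₄, h₅] at this
    exact Finset.mem_filter.2 ⟨Finset.mem_univ _, by omega⟩
  · exact MarkedGraph.push_pull ι (hr ▸ (Matching.mem_leafMatchings.1 hB).1)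

theorem connected_of_insert {n : Fin m → ℕ} {B : MarkedGraph n} {γ : Fin m → DecGraph P}
    {σ : ∀ j, (γ j).Leaf ≃ Fin (n j)} (hγ : ∀ j, (γ j).Connected) (h : (B.insert γ σ).Connected) :
    B.Connected := by
  obtain ⟨v⟩ := h.1
  refine ⟨Fin.pos v.1, fun i j => ?_⟩
  obtain ⟨v⟩ := (hγ i).1
  obtain ⟨w⟩ := (hγ j).1
  refine (h.2 ⟨i, v⟩ ⟨j, w⟩).lift' (fun x => x.1) ?_
  rintro ⟨i, v⟩ ⟨j, w⟩ ⟨a, b, ⟨e, -⟩ | ⟨hl, kl, h⟩⟩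
  · obtain rfl : i = j := e
    exact Relation.ReflTransGen.refl
  · exact Relation.ReflTransGen.single ⟨_, _, h⟩

theorem graphMap_eq_zero {n : Fin m → ℕ} {B : MarkedGraph n} (hB : ¬ B.Connected)
    {γ : Fin m → DecGraph P} (hγ : ∀ j, (γ j).Connected) (e : ℤ) : B.graphMap e γ = 0 :=
  finsum_eq_zero_of_forall_eq_zero fun _ => cls_eq_zero fun h => hB (connected_of_insert hγ h.1)

theorem graphInsertion_eq_edgeInsertion (b : ℕ) (e : ℤ) (γ : Fin (m + 1) → DecGraph P)
    (hγ : ∀ j, (γ j).Connected) : graphInsertion b e γ = edgeInsertion (b + m) e γ := by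
  classical
  refine finsum_congr fun c => ?_
  by_cases hN : c.out.edgeCount = b + m
  · rw [finsum_eq_if, finsum_eq_if, if_pos hN]
    split_ifs with hc
    · rfl
    · rw [graphMap_eq_zero (fun h => hc ⟨h, by omega⟩) hγ, smul_zero]
  · rw [finsum_eq_if, finsum_eq_if, if_neg hN, if_neg fun h => hN (by omega)]

theorem _root_.MarkedGraph.Connected.le_edgeCount {n : Fin m → ℕ} {B : MarkedGraph n}
    (h : B.Connected) : m ≤ B.edgeCount + 1 := by
  classical
  let S : SimpleGraph (Fin m) :=
    { Adj := fun i j => i ≠ j ∧ ∃ a b, B.Adj ⟨i, a⟩ ⟨j, b⟩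
      symm := ⟨fun i j ⟨e, a, b, h⟩ => ⟨e.symm, b, a, B.symm h⟩⟩
      loopless := ⟨fun i h => h.1 rfl⟩ }
  have : Nonempty (Fin m) := ⟨⟨0, h.1⟩⟩
  have hS : S.Connected := ⟨fun i j => by
    induction h.2 i j with
    | refl => exact SimpleGraph.Reachable.refl _
    | @tail k l _ h₁ ih =>
      by_cases e : k = l
      · exact e ▸ ih
      · exact ih.trans (SimpleGraph.Adj.reachable ⟨e, h₁⟩)⟩
  have h₁ := hS.card_vert_le_card_edgeSet_add_one
  have h₂ := S.dart_card_eq_twice_card_edges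
  let φ : S.Dart → {a // ∃ b, B.Adj a b} := fun d =>
    ⟨⟨d.fst, d.adj.2.choose⟩, _, d.adj.2.choose_spec.choose_spec⟩
  have hφ : Function.Injective φ := by
    intro d d' e
    obtain ⟨b, h₃⟩ := d.adj.2.choose_spec
    obtain ⟨b', h₄⟩ := d'.adj.2.choose_spec
    have e' : (⟨d.fst, d.adj.2.choose⟩ : Σ j, Fin (n j)) = ⟨d'.fst, d'.adj.2.choose⟩ :=
      congrArg Subtype.val e
    rw [e'] at h₃
    exact SimpleGraph.Dart.ext _ _ (Prod.ext (congrArg Sigma.fst e') (congrArg Sigma.fst (B.unique h₃ h₄)))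
  have h₅ := Nat.card_le_card_of_injective φ hφ
  rw [Nat.card_eq_fintype_card, h₂] at h₅
  rw [Nat.card_fin, Nat.card_eq_fintype_card, ← SimpleGraph.edgeFinset_card] at h₁
  rw [MarkedGraph.edgeCount]
  omega

theorem edgeInsertion_eq_zero {N : ℕ} (hN : N + 1 < m) (e : ℤ) {γ : Fin m → DecGraph P}
    (hγ : ∀ j, (γ j).Connected) : edgeInsertion N e γ = 0 := by
  classical
  refine finsum_eq_zero_of_forall_eq_zero fun c => ?_
  rw [finsum_eq_if]
  split_ifs with hc
  · rw [graphMap_eq_zero (fun h => by have := h.le_edgeCount; omega) hγ, smul_zero]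
  · rfl

theorem exists_labGraph {c : Fin m → List (Cor P H)} {e : Fin m → ℤ}
    (hc : ∀ t, Good (e t) A p (c t)) : ∃ Γ : Fin m → LabGraph P A p, (∀ t, (Γ t).list = c t) ∧
      ∀ t, (Γ t).graph.Connected ∧ (Γ t).graph.degree = e t := by
  refine ⟨fun t => LabGraph.ofList (c t) (hc t).disj (hc t).sat, fun t => LabGraph.list_ofList _ _ _,
    fun t => ?_⟩
  have h := LabGraph.list_ofList (p := p) (c t) (hc t).disj (hc t).sat
  have h' := hc t
  rw [← h] at h'
  exact ⟨LabGraph.connected _ h', LabGraph.degree _ h'⟩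

/-- A connected graph with `N` edges has at most `N + 1` vertices. -/
theorem insertL_eq_zero {N : ℕ} (hN : N + 1 < m) (e' : ℤ) {c : Fin m → List (Cor P H)}
    {e : Fin m → ℤ} (hc : ∀ t, Good (e t) A p (c t))
    (hd : ∀ s t, s ≠ t → Disjoint (labels (c s)) (labels (c t))) :
    insertL N e' A p ((List.finRange m).flatMap c) = 0 := by
  obtain ⟨Γ, h₁, h₂⟩ := exists_labGraph hc
  rw [← edgeInsertion_eq_zero hN e' fun t => (h₂ t).1, edgeInsertion_eq Γ fun i j hij => by
    rw [← LabGraph.labels_list, ← LabGraph.labels_list, h₁, h₁]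
    exact hd i j hij]
  simp only [h₁]

end DecGraph

end

noncomputable section

open Cor

variable {P : S1FramedModularOperad.{u}} {H : Type} [Finite H]
variable {M : Type w} [AddCommGroup M] [Module ℚ M]

namespace DecGraph

/-! ### Multilinear extension -/

/-- To prove an equation between functions that are linear in every argument, it suffices to
prove it for tuples of connected decorated graphs. -/
theorem forall_of_cls {m : ℕ} {e : Fin m → ℤ} {C : (∀ j, FeynmanTotal P (e j)) → Prop}
    (hcls : ∀ G : Fin m → DecGraph P, (∀ j, (G j).Connected ∧ (G j).degree = e j) →
      C fun j => (G j).cls (e j))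
    (hzero : ∀ x j, C (Function.update x j 0))
    (hadd : ∀ x j a b, C (Function.update x j a) → C (Function.update x j b) →
      C (Function.update x j (a + b)))
    (hsmul : ∀ x j (c : ℚ) a, C (Function.update x j a) → C (Function.update x j (c • a)))
    (x : ∀ j, FeynmanTotal P (e j)) : C x := by
  classical
  suffices key : ∀ (s : Finset (Fin m)) (x : ∀ j, FeynmanTotal P (e j)),
      (∀ j ∉ s, ∃ G : DecGraph P, G.Connected ∧ G.degree = e j ∧ G.cls (e j) = x j) → C x from
    key Finset.univ x fun j hj => absurd (Finset.mem_univ j) hj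
  intro s
  induction s using Finset.induction_on with
  | empty =>
    intro x hx
    choose G h₁ h₂ h₃ using fun j => hx j (Finset.notMem_empty j)
    rw [← show (fun j => (G j).cls (e j)) = x from funext h₃]
    exact hcls G fun j => ⟨h₁ j, h₂ j⟩
  | insert j s _ ih =>
    intro x hx
    rw [← Function.update_eq_self j x]
    have hm : x j ∈ Submodule.span ℚ _ := (span_cls (P := P) (e j)).symm ▸ Submodule.mem_top
    refine Submodule.span_induction (p := fun y _ => C (Function.update x j y)) ?_ (hzero x j)
      (fun a b _ _ ha hb => hadd x j a b ha hb) (fun c a _ ha => hsmul x j c a ha) hm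
    rintro _ ⟨G, h₁, h₂, rfl⟩
    refine ih _ fun k hk => ?_
    by_cases e' : k = j
    · subst e'
      exact ⟨G, h₁, h₂, by simp⟩
    · rw [Function.update_of_ne e']
      exact hx k (by simp [e', hk])

theorem multilinearMap_ext {m : ℕ} {e : Fin m → ℤ}
    {F F' : MultilinearMap ℚ (fun j => FeynmanTotal P (e j)) M}
    (h : ∀ G : Fin m → DecGraph P, (∀ j, (G j).Connected ∧ (G j).degree = e j) →
      F (fun j => (G j).cls (e j)) = F' fun j => (G j).cls (e j)) : F = F' :=
  MultilinearMap.ext <| forall_of_cls h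
    (fun x j => by rw [F.map_update_zero, F'.map_update_zero])
    (fun x j a b h₁ h₂ => by rw [F.map_update_add, F'.map_update_add, h₁, h₂])
    fun x j c a h => by rw [F.map_update_smul, F'.map_update_smul, h]

theorem exists_multilinearMap {m : ℕ} (e : Fin m → ℤ) {M : Type*} [AddCommGroup M] [Module ℚ M]
    {f : (Fin m → DecGraph P) → M} (hf : ∀ G j, Respects fun X => f (Function.update G j X)) :
    ∃ F : MultilinearMap ℚ (fun j => FeynmanTotal P (e j)) M, ∀ G : Fin m → DecGraph P,
      (∀ j, (G j).Connected ∧ (G j).degree = e j) → F (fun j => (G j).cls (e j)) = f G := by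
  induction m with
  | zero =>
    exact ⟨MultilinearMap.constOfIsEmpty ℚ _ (f Fin.elim0), fun G _ =>
      congrArg f (Subsingleton.elim _ _)⟩
  | succ m ih =>
    have h₁ : ∀ X : DecGraph P, ∃ F : MultilinearMap ℚ (fun j : Fin m => FeynmanTotal P (e j.succ)) M,
        ∀ G : Fin m → DecGraph P, (∀ j, (G j).Connected ∧ (G j).degree = e j.succ) →
          F (fun j => (G j).cls (e j.succ)) = f (Fin.cons X G) := fun X =>
      ih (fun j => e j.succ) (f := fun G => f (Fin.cons X G)) fun G j => by
        have := hf (Fin.cons X G) j.succ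
        simpa only [← Fin.cons_update] using this
    choose F hF using h₁
    have h₂ : ∀ G : Fin m → DecGraph P, Respects fun X => f (Fin.cons X G) := fun G => by
      have := hf (Fin.cons (ofList [] (by simp [Disj]) ⟨fun (_ _ : Empty) => False, id, id, by simp⟩ 0) G) 0
      simpa only [Fin.update_cons_zero] using this
    have h₃ : Respects F :=
      { add := fun G v x y => multilinearMap_ext fun G' h => by
          rw [add_apply, hF _ _ h, hF _ _ h, hF _ _ h]
          exact (h₂ G').add G v x y
        smul := fun G v c x => multilinearMap_ext fun G' h => by
          rw [smul_apply, hF _ _ h, hF _ _ h]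
          exact (h₂ G').smul G v c x
        relabel := fun G W _ _ φ l _ ψ => multilinearMap_ext fun G' h => by
          rw [smul_apply, hF _ _ h, hF _ _ h]
          exact (h₂ G').relabel G W φ l ψ }
    obtain ⟨Λ, hΛ⟩ := h₃.exists_linearMap (e 0)
    refine ⟨Λ.uncurryLeft, fun G h => ?_⟩
    rw [LinearMap.uncurryLeft_apply, hΛ (G 0) (h 0).1 (h 0).2]
    exact (hF (G 0) (fun j => G j.succ) fun j => h j.succ).trans
      (congrArg f (Fin.cons_self_tail G))

/-! ### Graph insertion is well defined -/

theorem respects_edgeInsertion (N : ℕ) (e : ℤ) {m : ℕ} (G : Fin m → DecGraph P) (j : Fin m) :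
    Respects fun X => edgeInsertion N e (Function.update G j X) :=
  respects_update (fun {_} _ {A p} Γ hd => ⟨insertL N e A p, compat_insertL N e A p,
    fun Γ' h => edgeInsertion_eq Γ' (fun i j hij => by rw [h, h]; exact hd i j hij) N e⟩) G j

theorem graphInsertionMap_cls (b : ℕ) {m : ℕ} {e : Fin m → ℤ} (e' : ℤ) {G : Fin m → DecGraph P}
    (hG : ∀ j, (G j).Connected ∧ (G j).degree = e j) :
    graphInsertionMap P b e e' (fun j => (G j).cls (e j)) = graphInsertion b e' G := by
  have h : ∃ F : MultilinearMap ℚ (fun j => FeynmanTotal P (e j)) (FeynmanTotal P e'),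
      ∀ G : Fin m → DecGraph P, (∀ j, (G j).Connected ∧ (G j).degree = e j) →
        F (fun j => (G j).cls (e j)) = graphInsertion b e' G := by
    cases m with
    | zero =>
      exact ⟨MultilinearMap.constOfIsEmpty ℚ _ (graphInsertion b e' Fin.elim0), fun G _ =>
        congrArg (graphInsertion b e') (Subsingleton.elim _ _)⟩
    | succ m =>
      obtain ⟨F, hF⟩ := exists_multilinearMap e (respects_edgeInsertion (P := P) (b + m) e')
      exact ⟨F, fun G hG => (hF G hG).trans
        (graphInsertion_eq_edgeInsertion b e' G fun j => (hG j).1).symm⟩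
  rw [graphInsertionMap, multilinearExtension, dif_pos h]
  exact h.choose_spec G hG

variable {A : Matching H} {p : H → ℕ} {m : ℕ}

theorem graphInsertionMap_clsL (b : ℕ) {e : Fin (m + 1) → ℤ} (e' : ℤ)
    {c : Fin (m + 1) → List (Cor P H)} (hc : ∀ t, Good (e t) A p (c t))
    (hd : ∀ s t, s ≠ t → Disjoint (labels (c s)) (labels (c t))) :
    graphInsertionMap P b e e' (fun t => clsL (e t) A p (c t)) =
      insertL (b + m) e' A p ((List.finRange (m + 1)).flatMap c) := by
  obtain ⟨Γ, h₁, h₂⟩ := exists_labGraph hc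
  have h₃ := edgeInsertion_eq Γ (fun i j hij => by
    rw [← LabGraph.labels_list, ← LabGraph.labels_list, h₁, h₁]
    exact hd i j hij) (b + m) e'
  rw [← graphInsertion_eq_edgeInsertion b e' _ fun t => (h₂ t).1, ← graphInsertionMap_cls b e' h₂] at h₃
  simp only [LabGraph.cls_eq, h₁] at h₃
  exact h₃

/-- Graph insertion with a separate first argument. -/
def insertFirst (b : ℕ) (e₀ : ℤ) (e : Fin m → ℤ) (e' : ℤ) :
    FeynmanTotal P e₀ →ₗ[ℚ] MultilinearMap ℚ (fun j => FeynmanTotal P (e j)) (FeynmanTotal P e') :=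
  (graphInsertionMap P b (Fin.cons e₀ e : Fin (m + 1) → ℤ) e').curryLeft

theorem blocks_cons {e₀ : ℤ} {e : Fin m → ℤ} {l : List (Cor P H)} {c : Fin m → List (Cor P H)}
    (hl : Good e₀ A p l) (hc : ∀ t, Good (e t) A p (c t))
    (hlc : ∀ t, Disjoint (labels l) (labels (c t)))
    (hd : ∀ s t, s ≠ t → Disjoint (labels (c s)) (labels (c t))) :
    (∀ t, Good ((Fin.cons e₀ e : Fin (m + 1) → ℤ) t) A p ((Fin.cons l c : Fin (m + 1) → List (Cor P H)) t)) ∧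
      (∀ s t, s ≠ t → Disjoint (labels ((Fin.cons l c : Fin (m + 1) → List (Cor P H)) s))
        (labels ((Fin.cons l c : Fin (m + 1) → List (Cor P H)) t))) ∧
      (List.finRange (m + 1)).flatMap (Fin.cons l c) = l ++ (List.finRange m).flatMap c := by
  refine ⟨fun t => ?_, fun s t hst => ?_, ?_⟩
  · cases t using Fin.cases with
    | zero => exact hl
    | succ t => exact hc t
  · cases s using Fin.cases with
    | zero =>
      cases t using Fin.cases with
      | zero => exact absurd rfl hst
      | succ t => exact hlc t
    | succ s =>
      cases t using Fin.cases with
      | zero => exact (hlc s).symm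
      | succ t => exact hd s t fun h => hst (h ▸ rfl)
  · rw [List.finRange_succ, List.flatMap_cons, List.flatMap_map]
    rfl

theorem insertFirst_clsL (b : ℕ) {e₀ : ℤ} {e : Fin m → ℤ} (e' : ℤ) {l : List (Cor P H)}
    {c : Fin m → List (Cor P H)} (hl : Good e₀ A p l) (hc : ∀ t, Good (e t) A p (c t))
    (hlc : ∀ t, Disjoint (labels l) (labels (c t)))
    (hd : ∀ s t, s ≠ t → Disjoint (labels (c s)) (labels (c t))) :
    insertFirst b e₀ e e' (clsL e₀ A p l) (fun t => clsL (e t) A p (c t)) =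
      insertL (b + m) e' A p (l ++ (List.finRange m).flatMap c) := by
  obtain ⟨h₁, h₂, h₃⟩ := blocks_cons hl hc hlc hd
  rw [← h₃, ← graphInsertionMap_clsL b e' h₁ h₂]
  refine congrArg (graphInsertionMap P b (Fin.cons e₀ e : Fin (m + 1) → ℤ) e') (funext fun t => ?_)
  cases t using Fin.cases with
  | zero => rfl
  | succ t => rfl

end DecGraph

end

noncomputable section

open Cor

variable {P : S1FramedModularOperad.{u}} {H : Type} [Finite H]
variable {M : Type w} [AddCommGroup M] [Module ℚ M]

/-! ### Decomposition of the operators into blocks -/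

theorem finRange_filter_ne {m : ℕ} (t : Fin (m + 1)) :
    (List.finRange (m + 1)).filter (· ≠ t) = (List.finRange m).map t.succAbove := by
  refine List.Perm.eq_of_pairwise (le := (· < ·)) (fun a b _ _ h h' => absurd h h'.asymm)
    ((List.pairwise_lt_finRange _).filter _)
    (List.pairwise_map.2 ((List.pairwise_lt_finRange m).imp fun h => Fin.succAbove_lt_succAbove_iff.2 h)) ?_
  refine (List.perm_ext_iff_of_nodup ((List.nodup_finRange _).filter _)
    ((List.nodup_finRange m).map Fin.succAbove_right_injective)).2 fun s => ?_
  simp [Fin.exists_succAbove_eq_iff]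

/-- The sign exponent of moving the element `t` to the front. -/
def frontE {m : ℕ} (d : Fin m → ℤ) (t : Fin m) : ℤ := ∑ s with s < t, d t * d s

theorem sgn_frontE_congr {m : ℕ} {d d' : Fin m → ℤ} (h : ∀ t, sgn (d t) = sgn (d' t)) (t : Fin m) :
    sgn (frontE d t) = sgn (frontE d' t) := by
  rw [frontE, frontE]
  induction (Finset.univ.filter (· < t)) using Finset.induction_on with
  | empty => rfl
  | insert s S hs ih =>
    rw [Finset.sum_insert hs, Finset.sum_insert hs, sgn_add, sgn_add, ih, sgn_mul_congr (h t) (h s)]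

namespace DecGraph

section Blocks

variable {m : ℕ} (c : Fin (m + 1) → List (Cor P H))

/-- The concatenation of all blocks but one. -/
def restL (t : Fin (m + 1)) : List (Cor P H) :=
  (List.finRange m).flatMap fun s => c (t.succAbove s)

theorem frontExp_finRange (t : Fin (m + 1)) :
    frontExp c (List.finRange (m + 1)) t = frontE (fun s => degSum (c s)) t := by
  rw [frontExp, frontE, Finset.sum_filter, Fin.sum_univ_def]

theorem front_fin {f : List (Cor P H) → M} (hf : Compat f) (t : Fin (m + 1)) :
    f ((List.finRange (m + 1)).flatMap c) =
      sgn (frontE (fun s => degSum (c s)) t) • f (c t ++ restL c t) := by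
  rw [hf.front c (List.pairwise_lt_finRange _) (List.mem_finRange t), frontExp_finRange,
    finRange_filter_ne, List.flatMap_map]
  rfl

theorem opI_blocks {p : H → ℕ} {f : (H → ℕ) → List (Cor P H) → M} (hf : ∀ p, Compat (f p)) :
    opI p ((List.finRange (m + 1)).flatMap c) f = ∑ t, sgn (frontE (fun s => degSum (c s)) t) •
      opI p (c t) fun p' l => f p' (l ++ restL c t) := by
  classical
  have h : ∀ (θ : Cor P H → Cor P H) (n : ℤ) (_ : IsLin n θ) (f : List (Cor P H) → M) (_ : Compat f),
      der θ n ((List.finRange (m + 1)).flatMap c) f = ∑ t, sgn (frontE (fun s => degSum (c s)) t) •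
        der θ n (c t) fun l => f (l ++ restL c t) := by
    intro θ n hθ f hf
    rw [der_blocks c hf hθ (List.pairwise_lt_finRange _), Fin.sum_univ_def]
    refine congrArg List.sum (List.map_congr_left fun t _ => ?_)
    rw [frontExp_finRange, finRange_filter_ne, List.flatMap_map]
    rfl
  simp only [opI, opU, smul_add, Finset.sum_add_distrib]
  rw [h _ _ isLin_bd _ (hf p)]
  congr 1
  simp only [Finset.smul_sum]
  rw [Finset.sum_comm]
  refine Finset.sum_congr rfl fun x _ => ?_
  split_ifs
  · exact h _ _ (isLin_act x) _ (hf _)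
  · simp

theorem opS_exists {ι : Type*} [Fintype ι] {R : H → H → Prop} {R' : ι → H → H → Prop} {p : H → ℕ}
    {L : List (Cor P H)} (hL : Disj L) {f : (H → ℕ) → List (Cor P H) → M} (hf : ∀ p, Compat (f p))
    (h₁ : ∀ h ∈ labels L, ∀ k ∈ labels L, (R h k ↔ ∃ i, R' i h k))
    (h₂ : ∀ i j h k, R' i h k → R' j h k → i = j) :
    opS R p L f = ∑ i, opS (R' i) p L f := by
  classical
  rw [opS_congr_rel (R' := fun h k => ∃ i, R' i h k) hL hf fun h hh k hk _ => h₁ h hh k hk]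
  simp only [opS]
  refine Eq.trans (Finset.sum_congr rfl fun h _ => Eq.trans (Finset.sum_congr rfl fun k _ => ?_)
    Finset.sum_comm) Finset.sum_comm
  split_ifs with hc
  · obtain ⟨⟨i, hi⟩, hp⟩ := hc
    refine Eq.trans ?_ (Finset.sum_eq_single i (fun j _ hj => ?_) (by simp)).symm
    · rw [if_pos ⟨hi, hp⟩]
    · exact if_neg fun e => hj (h₂ _ _ _ _ e.1 hi)
  · exact (Finset.sum_eq_zero fun i _ => if_neg fun e => hc ⟨⟨i, e.1⟩, e.2⟩).symm

variable {A : Matching H} {p : H → ℕ} {c} {f : (H → ℕ) → List (Cor P H) → M}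

theorem labels_flatMap {m : ℕ} (c : Fin m → List (Cor P H)) {h : H} :
    h ∈ labels ((List.finRange m).flatMap c) ↔ ∃ t, h ∈ labels (c t) := by
  simp only [mem_labels, List.mem_flatMap, List.mem_finRange, true_and]
  exact ⟨fun ⟨x, ⟨t, h⟩, h'⟩ => ⟨t, x, h, h'⟩, fun ⟨t, x, h, h'⟩ => ⟨x, ⟨t, h⟩, h'⟩⟩

theorem disj_flatMap {m : ℕ} {c : Fin m → List (Cor P H)} (hc : ∀ t, Disj (c t))
    (hd : ∀ s t, s ≠ t → Disjoint (labels (c s)) (labels (c t))) :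
    Disj ((List.finRange m).flatMap c) := by
  rw [Disj, List.map_flatMap, List.pairwise_flatMap]
  refine ⟨fun t _ => hc t, (List.nodup_finRange m).imp fun {s t} hst x hx y hy => ?_⟩
  have hx' : x ⊆ labels (c s) := fun a ha => ⟨x, hx, ha⟩
  have hy' : y ⊆ labels (c t) := fun a ha => ⟨y, hy, ha⟩
  exact (hd s t hst).mono hx' hy'

variable (hd : ∀ s t, s ≠ t → Disjoint (labels (c s)) (labels (c t))) (hf : ∀ p, Compat (f p))
include hd hf

theorem opS_block {R : H → H → Prop} (t : Fin (m + 1))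
    (hR : ∀ h k, R h k → h ∈ labels (c t) ∧ k ∈ labels (c t)) :
    opS R p ((List.finRange (m + 1)).flatMap c) f = sgn (frontE (fun s => degSum (c s)) t) •
      opS R p (c t) fun p' l => f p' (l ++ restL c t) := by
  have hr : ∀ h ∈ labels (c t), h ∉ labels (restL c t) := by
    intro h hh hh'
    obtain ⟨s, hs⟩ := (labels_flatMap _).1 hh'
    exact Set.disjoint_left.1 (hd t _ (t.succAbove_ne s).symm) hh hs
  rw [front_fin c (compat_opS hf R p) t, opS_append_left _ _ hf fun h k e =>
    ⟨hr h (hR h k e).1, hr k (hR h k e).2⟩]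

theorem opQ_blocks (hc : ∀ t, Disj (c t)) (hA : ∀ t, A.Sat (labels (c t))) :
    opQ A p ((List.finRange (m + 1)).flatMap c) f = ∑ t, sgn (frontE (fun s => degSum (c s)) t) •
      opQ A p (c t) fun p' l => f p' (l ++ restL c t) := by
  have hD := disj_flatMap hc hd
  rw [opQ, opI_blocks c hf, opS_exists (R' := fun t h k => A.Adj h k ∧ h ∈ labels (c t) ∧ k ∈ labels (c t))
    hD hf (fun h hh k _ => ⟨fun e => ?_, fun ⟨_, e⟩ => e.1⟩) fun s t h k e e' => ?_, Finset.smul_sum,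
    ← Finset.sum_add_distrib]
  · refine Finset.sum_congr rfl fun t _ => ?_
    rw [opS_block hd hf t fun h k e => e.2, opQ, smul_add, smul_comm (1 / 2 : ℚ),
      opS_congr_rel (R := A.Adj) (R' := fun h k => A.Adj h k ∧ h ∈ labels (c t) ∧ k ∈ labels (c t))
        (hc t) (fun p => (hf p).append_right _) fun h hh k hk _ => (and_iff_left ⟨hh, hk⟩).symm]
  · obtain ⟨t, ht⟩ := (labels_flatMap _).1 hh
    exact ⟨t, e, ht, hA t h ht k e⟩
  · by_contra hst
    exact Set.disjoint_left.1 (hd s t hst) e.2.1 e'.2.1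

theorem opS_leafPair_blocks (hc : ∀ t, Disj (c t)) :
    opS A.leafPair p ((List.finRange (m + 1)).flatMap c) f =
      (∑ t, sgn (frontE (fun s => degSum (c s)) t) •
        opS A.leafPair p (c t) fun p' l => f p' (l ++ restL c t)) +
      ∑ s, ∑ r, opS (A.cross (labels (c s)) (labels (c (s.succAbove r)))) p
        ((List.finRange (m + 1)).flatMap c) f := by
  have hD := disj_flatMap hc hd
  rw [opS_exists (R' := fun (x : Fin (m + 1) × Fin (m + 1)) h k =>
      A.cross (labels (c x.1)) (labels (c x.2)) h k) hD hf (fun h hh k hk => ⟨fun e => ?_, fun ⟨_, e⟩ => e.2.2⟩)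
      fun x y h k e e' => ?_, Fintype.sum_prod_type]
  · rw [← Finset.sum_add_distrib]
    refine Finset.sum_congr rfl fun t _ => ?_
    rw [Fin.sum_univ_succAbove _ t, opS_block hd hf t fun h k e => ⟨e.1, e.2.1⟩,
      opS_congr_rel (R := A.leafPair) (R' := A.cross (labels (c t)) (labels (c t)))
        (hc t) (fun p => (hf p).append_right _) fun h hh k hk _ => ⟨fun e => ⟨hh, hk, e⟩, fun e => e.2.2⟩]
  · obtain ⟨s, hs⟩ := (labels_flatMap _).1 hh
    obtain ⟨t, ht⟩ := (labels_flatMap _).1 hk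
    exact ⟨(s, t), hs, ht, e⟩
  · by_contra hst
    rw [Prod.ext_iff, not_and_or] at hst
    rcases hst with h' | h'
    · exact Set.disjoint_left.1 (hd _ _ h') e.1 e'.1
    · exact Set.disjoint_left.1 (hd _ _ h') e.2.1 e'.2.1

end Blocks

theorem opS_cross_blocks {m : ℕ} {c : Fin (m + 2) → List (Cor P H)} {A : Matching H} {p : H → ℕ}
    {f : (H → ℕ) → List (Cor P H) → M}
    (hd : ∀ s t, s ≠ t → Disjoint (labels (c s)) (labels (c t))) (hf : ∀ p, Compat (f p))
    (s : Fin (m + 2)) (r : Fin (m + 1)) :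
    opS (A.cross (labels (c s)) (labels (c (s.succAbove r)))) p ((List.finRange (m + 2)).flatMap c) f =
      (sgn (frontE (fun t => degSum (c t)) s) *
        sgn (frontE (fun t => degSum (c (s.succAbove t))) r)) •
      opS (A.cross (labels (c s)) (labels (c (s.succAbove r)))) p (c s ++ c (s.succAbove r))
        fun p' l => f p' (l ++ restL (fun t => c (s.succAbove t)) r) := by
  have hr : ∀ h, h ∈ labels (c s) ∨ h ∈ labels (c (s.succAbove r)) →
      h ∉ labels (restL (fun t => c (s.succAbove t)) r) := by
    intro h hh hh'
    obtain ⟨q, hq⟩ := (labels_flatMap _).1 hh'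
    rcases hh with hh | hh
    · exact Set.disjoint_left.1 (hd s _ (s.succAbove_ne _).symm) hh hq
    · exact Set.disjoint_left.1 (hd _ _ (Fin.succAbove_right_injective.ne (r.succAbove_ne q).symm))
        hh hq
  have hS := compat_opS hf (A.cross (labels (c s)) (labels (c (s.succAbove r)))) p
  rw [front_fin c hS s, restL, front_fin (fun t => c (s.succAbove t)) (hS.append (c s)) r, smul_smul,
    ← List.append_assoc, opS_append_left _ _ hf fun h k e => ⟨hr h (Or.inl e.1), hr k (Or.inr e.2.1)⟩]

end DecGraph

end

noncomputable section

open Cor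

variable {P : S1FramedModularOperad.{u}} {H : Type} [Finite H]
variable {M : Type w} [AddCommGroup M] [Module ℚ M]

namespace DecGraph

/-! ### The operators in the first argument of graph insertion -/

section First

variable {A : Matching H} {p : H → ℕ} {m : ℕ} {b : ℕ} {e₀ e₁ e'' : ℤ} {e : Fin m → ℤ}
  {l : List (Cor P H)} {c : Fin m → List (Cor P H)}

/-- Graph insertion as a linear map of the first argument. -/
def insertEval (b : ℕ) (e₀ : ℤ) (e : Fin m → ℤ) (e' : ℤ) (x : ∀ j, FeynmanTotal P (e j)) :
    FeynmanTotal P e₀ →ₗ[ℚ] FeynmanTotal P e' where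
  toFun y := insertFirst b e₀ e e' y x
  map_add' y z := by rw [map_add]; rfl
  map_smul' r y := by rw [map_smul]; rfl

variable (hc : ∀ t, Good (e t) A p (c t))
  (hd : ∀ s t, s ≠ t → Disjoint (labels (c s)) (labels (c t)))
include hc hd

theorem insertEval_clsL {p' : H → ℕ} {l' : List (Cor P H)} (hl' : Good e₁ A p' l')
    (hlc : ∀ t, Disjoint (labels l') (labels (c t)))
    (hp : ∀ t, ∀ h ∈ labels (c t), p' h = p h) :
    insertEval b e₁ e e'' (fun t => clsL (e t) A p (c t)) (clsL e₁ A p' l') =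
      insertL (b + m) e'' A p' (l' ++ (List.finRange m).flatMap c) := by
  rw [show (fun t => clsL (e t) A p (c t)) = fun t => clsL (e t) A p' (c t) from funext fun t =>
    clsL_congr (fun _ _ _ _ => Iff.rfl) fun h hh => (hp t h hh).symm]
  exact insertFirst_clsL b e'' hl' (fun t => (hc t).congr_pow (hp t)) hlc hd

theorem insertFirst_differential (he : e₁ + 1 = e₀) (hl : Good e₀ A p l)
    (hlc : ∀ t, Disjoint (labels l) (labels (c t))) :
    insertFirst b e₁ e e'' (_root_.differential P e₀ e₁ (clsL e₀ A p l))
      (fun t => clsL (e t) A p (c t)) =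
      opQ A p l fun p' l' => insertL (b + m) e'' A p' (l' ++ (List.finRange m).flatMap c) := by
  rw [differential_clsL he hl.disj]
  refine (opQ_map A p (insertEval b e₁ e e'' fun t => clsL (e t) A p (c t)) l (clsL e₁ A)).symm.trans ?_
  refine opQ_clsL_congr he hl (fun p => (compat_clsL e₁ A p).map _)
    (fun p => (compat_insertL _ e'' A p).append_right _) fun p' l' hs hG => ?_
  exact insertEval_clsL hc hd hG (fun t => (hlc t).mono_left hs.sub) fun t h hh =>
    hs.pow h fun hh' => Set.disjoint_left.1 (hlc t) hh' hh

theorem insertFirst_bv (he : e₀ + 1 = e₁) (hl : Good e₀ A p l)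
    (hlc : ∀ t, Disjoint (labels l) (labels (c t))) :
    insertFirst b e₁ e e'' (_root_.bv P e₀ e₁ (clsL e₀ A p l))
      (fun t => clsL (e t) A p (c t)) = (1 / 2 : ℚ) •
      opS A.leafPair p l fun p' l' => insertL (b + m) e'' A p' (l' ++ (List.finRange m).flatMap c) := by
  rw [bv_clsL e₁ hl, map_smul, smul_apply]
  congr 1
  refine (opS_map _ p (insertEval b e₁ e e'' fun t => clsL (e t) A p (c t)) l (clsL e₁ A)).symm.trans ?_
  refine opS_congr hl.disj (fun p => (compat_clsL e₁ A p).map _)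
    (fun p => (compat_insertL _ e'' A p).append_right _) fun h k l' hA hh hk hs => ?_
  exact insertEval_clsL hc hd (hl.sewStep hs hA hh hk he)
    (fun t => (hlc t).mono_left (hs.labels ▸ Set.sdiff_subset)) fun _ _ _ => rfl

theorem insertFirst_sewBracket {e₀' : ℤ} {r : List (Cor P H)} (he : e₀ + e₀' + 1 = e₁)
    (hl : Good e₀ A p l) (hr : Good e₀' A p r) (hlr : Disjoint (labels l) (labels r))
    (hlc : ∀ t, Disjoint (labels l) (labels (c t))) (hrc : ∀ t, Disjoint (labels r) (labels (c t))) :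
    insertFirst b e₁ e e'' (_root_.sewBracket P e₀ e₀' e₁ (clsL e₀ A p l) (clsL e₀' A p r))
      (fun t => clsL (e t) A p (c t)) = opS (A.cross (labels l) (labels r)) p (l ++ r)
        fun p' l' => insertL (b + m) e'' A p' (l' ++ (List.finRange m).flatMap c) := by
  rw [sewBracket_clsL e₁ hl hr subset_rfl subset_rfl hlr]
  refine (opS_map _ p (insertEval b e₁ e e'' fun t => clsL (e t) A p (c t)) _ (clsL e₁ A)).symm.trans ?_
  refine opS_congr (disj_append.2 ⟨hl.disj, hr.disj, hlr⟩) (fun p => (compat_clsL e₁ A p).map _)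
    (fun p => (compat_insertL _ e'' A p).append_right _) fun h k l' hA hh hk hs => ?_
  refine insertEval_clsL hc hd (good_cross hl hr hlr he hA hh hk hs)
    (fun t => Set.disjoint_of_subset_left (hs.labels ▸ Set.sdiff_subset) ?_) fun _ _ _ => rfl
  rw [labels_append]
  exact Set.disjoint_union_left.2 ⟨hlc t, hrc t⟩

/-- There are no connected trees with an additional edge at the first vertex. -/
theorem opS_leafPair_eq_zero {N : ℕ} (hN : N < m) (hl : Good e₀ A p l)
    (hlc : ∀ t, Disjoint (labels l) (labels (c t))) :
    opS A.leafPair p l (fun p' l' => insertL N e'' A p' (l' ++ (List.finRange m).flatMap c)) = 0 := by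
  rw [opS_congr (g := fun _ _ => 0) hl.disj (fun p => (compat_insertL _ e'' A p).append_right _)
    (fun _ => Compat.fun_zero) fun h k l' hA hh hk hs => ?_, opS_fun_zero]
  obtain ⟨h₁, h₂, h₃⟩ := blocks_cons (hl.sewStep hs hA hh hk rfl) hc
    (fun t => (hlc t).mono_left (hs.labels ▸ Set.sdiff_subset)) hd
  rw [← h₃]
  exact insertL_eq_zero (Nat.succ_lt_succ hN) e'' h₁ h₂

end First

/-! ### The differential of graph insertion -/

section Equation

/-- An operator is applied to one argument, which is moved to the front. -/
def termOne (b : ℕ) {m : ℕ} (e : Fin (m + 1) → ℤ) (e'' : ℤ) (t : Fin (m + 1)) {e₁ : ℤ}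
    (φ : FeynmanTotal P (e t) →ₗ[ℚ] FeynmanTotal P e₁) :
    MultilinearMap ℚ (fun j => FeynmanTotal P (e j)) (FeynmanTotal P e'') :=
  (insertFirst b e₁ (fun s => e (t.succAbove s)) e'' ∘ₗ φ).uncurryMid t

/-- Two arguments are moved to the front and replaced by their bracket. -/
def termTwo (b : ℕ) {m : ℕ} (e : Fin (m + 2) → ℤ) (e₁ e'' : ℤ) (s : Fin (m + 2)) (r : Fin (m + 1)) :
    MultilinearMap ℚ (fun j => FeynmanTotal P (e j)) (FeynmanTotal P e'') :=
  LinearMap.uncurryMid s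
    ((MultilinearMap.curryMidLinearEquiv ℚ (fun q => FeynmanTotal P (e (s.succAbove q))) _
      r).symm.toLinearMap ∘ₗ (_root_.sewBracket P (e s) (e (s.succAbove r)) e₁).compr₂
        (insertFirst b e₁ (fun q => e (s.succAbove (r.succAbove q))) e''))

theorem termOne_apply (b : ℕ) {m : ℕ} (e : Fin (m + 1) → ℤ) (e'' : ℤ) (t : Fin (m + 1)) {e₁ : ℤ}
    (φ : FeynmanTotal P (e t) →ₗ[ℚ] FeynmanTotal P e₁) (x : ∀ j, FeynmanTotal P (e j)) :
    termOne b e e'' t φ x = insertFirst b e₁ (fun s => e (t.succAbove s)) e'' (φ (x t))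
      fun s => x (t.succAbove s) := rfl

theorem termTwo_apply (b : ℕ) {m : ℕ} (e : Fin (m + 2) → ℤ) (e₁ e'' : ℤ) (s : Fin (m + 2))
    (r : Fin (m + 1)) (x : ∀ j, FeynmanTotal P (e j)) :
    termTwo b e e₁ e'' s r x = insertFirst b e₁ (fun q => e (s.succAbove (r.succAbove q))) e''
      (_root_.sewBracket P _ _ e₁ (x s) (x (s.succAbove r)))
      fun q => x (s.succAbove (r.succAbove q)) := rfl

variable {m : ℕ} {e : Fin (m + 1) → ℤ} {e' e'' : ℤ} {e₁ e₂ : Fin (m + 1) → ℤ}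

/-- The contribution of the BV operator to the differential of graph insertion. -/
def bvTerms (e : Fin (m + 1) → ℤ) (e₂ : Fin (m + 1) → ℤ) (e'' : ℤ) :
    ℕ → MultilinearMap ℚ (fun j => FeynmanTotal P (e j)) (FeynmanTotal P e'')
  | 0 => 0
  | b + 1 => ∑ t, sgn (frontE e t) • termOne b e e'' t (_root_.bv P (e t) (e₂ t))

section Generators

variable {A : Matching H} {p : H → ℕ} {c : Fin (m + 1) → List (Cor P H)}
  (hc : ∀ t, Good (e t) A p (c t)) (hd : ∀ s t, s ≠ t → Disjoint (labels (c s)) (labels (c t)))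
include hc hd

theorem sum_termOne_differential (b : ℕ) (h₁ : ∀ t, e₁ t + 1 = e t) :
    (∑ t, sgn (frontE e t) • termOne b e e'' t (_root_.differential P (e t) (e₁ t)))
      (fun t => clsL (e t) A p (c t)) =
      opQ A p ((List.finRange (m + 1)).flatMap c) (insertL (b + m) e'' A) := by
  rw [opQ_blocks hd (fun p => compat_insertL _ _ A p) (fun t => (hc t).disj) fun t => (hc t).sat,
    sum_apply]
  refine Finset.sum_congr rfl fun t _ => ?_
  rw [smul_apply, termOne_apply, insertFirst_differential (fun s => hc _)
    (fun i j hij => hd _ _ (Fin.succAbove_right_injective.ne hij)) (h₁ t) (hc t)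
    fun s => hd _ _ (t.succAbove_ne s).symm, sgn_frontE_congr fun s => (sgn_degSum (hc s).deg).symm]
  rfl

theorem bvTerms_clsL (b : ℕ) (h₂ : ∀ t, e t + 1 = e₂ t) :
    bvTerms e e₂ e'' (b + 1) (fun t => clsL (e t) A p (c t)) = (1 / 2 : ℚ) •
      ∑ t, sgn (frontE (fun s => degSum (c s)) t) • opS A.leafPair p (c t)
        fun p' l => insertL (b + m) e'' A p' (l ++ restL c t) := by
  rw [bvTerms, sum_apply, Finset.smul_sum]
  refine Finset.sum_congr rfl fun t _ => ?_
  rw [smul_apply, termOne_apply, insertFirst_bv (fun s => hc _)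
    (fun i j hij => hd _ _ (Fin.succAbove_right_injective.ne hij)) (h₂ t) (hc t)
    fun s => hd _ _ (t.succAbove_ne s).symm, sgn_frontE_congr fun s => (sgn_degSum (hc s).deg).symm,
    smul_comm]
  rfl

end Generators

theorem sum_termTwo_clsL {e : Fin (m + 2) → ℤ} {A : Matching H} {p : H → ℕ}
    {c : Fin (m + 2) → List (Cor P H)} (hc : ∀ t, Good (e t) A p (c t))
    (hd : ∀ s t, s ≠ t → Disjoint (labels (c s)) (labels (c t))) (b : ℕ)
    {e₃ : Fin (m + 2) → Fin (m + 1) → ℤ} (h₃ : ∀ s r, e s + e (s.succAbove r) + 1 = e₃ s r) :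
    (∑ s, ∑ r, (sgn (frontE e s) * sgn (frontE (fun t => e (s.succAbove t)) r)) •
      termTwo b e (e₃ s r) e'' s r) (fun t => clsL (e t) A p (c t)) =
      ∑ s, ∑ r, opS (A.cross (labels (c s)) (labels (c (s.succAbove r)))) p
        ((List.finRange (m + 2)).flatMap c) (insertL (b + m) e'' A) := by
  rw [sum_apply]
  refine Finset.sum_congr rfl fun s _ => ?_
  rw [sum_apply]
  refine Finset.sum_congr rfl fun r _ => ?_
  have hr : ∀ q, s.succAbove r ≠ s.succAbove (r.succAbove q) := fun q =>
    Fin.succAbove_right_injective.ne (r.succAbove_ne q).symm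
  rw [opS_cross_blocks hd fun p => compat_insertL _ _ A p, smul_apply, termTwo_apply,
    insertFirst_sewBracket (fun s => hc _) (fun i j hij => hd _ _ (Fin.succAbove_right_injective.ne
      (Fin.succAbove_right_injective.ne hij))) (h₃ s r) (hc s) (hc _) (hd _ _ (s.succAbove_ne r).symm)
      (fun q => hd _ _ (s.succAbove_ne _).symm) (fun q => hd _ _ (hr q)),
    sgn_frontE_congr fun s => (sgn_degSum (hc s).deg).symm,
    sgn_frontE_congr fun t => (sgn_degSum (hc (s.succAbove t)).deg).symm]
  rfl

theorem multilinearMap_ext_clsL {m : ℕ} {e : Fin m → ℤ}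
    {F F' : MultilinearMap ℚ (fun j => FeynmanTotal P (e j)) M}
    (h : ∀ {H : Type} [Finite H] (A : Matching H) (p : H → ℕ) (c : Fin m → List (Cor P H)),
      (∀ t, Good (e t) A p (c t)) → (∀ s t, s ≠ t → Disjoint (labels (c s)) (labels (c t))) →
      F (fun t => clsL (e t) A p (c t)) = F' fun t => clsL (e t) A p (c t)) : F = F' := by
  refine multilinearMap_ext fun G hG => ?_
  rw [show (fun j => (G j).cls (e j)) = _ from funext fun j => (LabGraph.part G j).cls_eq (e j)]
  refine h _ _ _ (fun t => (LabGraph.part G t).good (hG t).1 (hG t).2) fun s t hst => ?_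
  rw [LabGraph.labels_list, LabGraph.labels_list]
  exact LabGraph.disjoint_part G s t hst

theorem differential_insertion_one {e e₁ e₂ : Fin 1 → ℤ} (b : ℕ) (he : e'' + 1 = e')
    (h₁ : ∀ t, e₁ t + 1 = e t) (h₂ : ∀ t, e t + 1 = e₂ t) :
    (_root_.differential P e' e'').compMultilinearMap (graphInsertionMap P b e e') =
      (∑ t, sgn (frontE e t) • termOne b e e'' t (_root_.differential P (e t) (e₁ t))) +
        bvTerms e e₂ e'' b := by
  refine multilinearMap_ext_clsL fun A p c hc hd => ?_
  have hD := disj_flatMap (fun t => (hc t).disj) hd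
  rw [LinearMap.compMultilinearMap_apply, graphInsertionMap_clsL b e' hc hd, add_apply,
    sum_termOne_differential hc hd b h₁]
  cases b with
  | zero => rw [differential_insertL_zero he hD, bvTerms, zero_apply, add_zero]
  | succ b =>
    rw [bvTerms_clsL hc hd b h₂, Nat.add_right_comm, differential_insertL_succ _ he hD,
      opS_leafPair_blocks hd (fun p => compat_insertL _ _ A p) fun t => (hc t).disj]
    simp

theorem differential_insertion {e e₁ e₂ : Fin (m + 2) → ℤ} {e₃ : Fin (m + 2) → Fin (m + 1) → ℤ}
    (b : ℕ) (he : e'' + 1 = e') (h₁ : ∀ t, e₁ t + 1 = e t) (h₂ : ∀ t, e t + 1 = e₂ t)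
    (h₃ : ∀ s r, e s + e (s.succAbove r) + 1 = e₃ s r) :
    (_root_.differential P e' e'').compMultilinearMap (graphInsertionMap P b e e') =
      (∑ t, sgn (frontE e t) • termOne b e e'' t (_root_.differential P (e t) (e₁ t))) +
        bvTerms e e₂ e'' b + (1 / 2 : ℚ) • ∑ s, ∑ r,
          (sgn (frontE e s) * sgn (frontE (fun t => e (s.succAbove t)) r)) •
            termTwo b e (e₃ s r) e'' s r := by
  refine multilinearMap_ext_clsL fun A p c hc hd => ?_
  have hD := disj_flatMap (fun t => (hc t).disj) hd
  have hS := opS_leafPair_blocks (A := A) (p := p) hd (fun p => compat_insertL (b + m) e'' A p)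
    fun t => (hc t).disj
  rw [LinearMap.compMultilinearMap_apply, graphInsertionMap_clsL b e' hc hd, add_apply, add_apply,
    sum_termOne_differential hc hd b h₁, smul_apply, sum_termTwo_clsL hc hd b h₃,
    show b + (m + 1) = b + m + 1 from rfl, differential_insertL_succ _ he hD, hS, smul_add, ← add_assoc]
  refine congrArg₂ _ (congrArg₂ _ rfl ?_) rfl
  cases b with
  | zero =>
    rw [bvTerms, zero_apply, Finset.sum_eq_zero fun t _ => ?_, smul_zero]
    refine smul_eq_zero_of_right _ (opS_leafPair_eq_zero (fun s => hc _)
      (fun i j hij => hd _ _ (Fin.succAbove_right_injective.ne hij)) ?_ (hc t)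
      fun s => hd _ _ (t.succAbove_ne s).symm)
    omega
  | succ b => rw [bvTerms_clsL hc hd b h₂, show b + 1 + m = b + (m + 1) by ring]

end Equation

end DecGraph

end

noncomputable section

open Cor

variable {P : S1FramedModularOperad.{u}} {H : Type} [Finite H]
variable {M : Type w} [AddCommGroup M] [Module ℚ M]

/-! ### Sums over tuples -/

theorem sgn_sum_congr {ι : Type*} {s : Finset ι} {a b : ι → ℤ} (h : ∀ i ∈ s, sgn (a i) = sgn (b i)) :
    sgn (∑ i ∈ s, a i) = sgn (∑ i ∈ s, b i) := by
  classical
  induction s using Finset.induction_on with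
  | empty => rfl
  | insert i s hi ih =>
    rw [Finset.sum_insert hi, Finset.sum_insert hi, sgn_add, sgn_add, h i (Finset.mem_insert_self ..),
      ih fun j hj => h j (Finset.mem_insert_of_mem hj)]

theorem mem_antidiagonal {n : ℕ} {p : ℕ × ℕ} :
    p ∈ Finset.HasAntidiagonal.antidiagonal n ↔ p.1 + p.2 = n :=
  Finset.HasAntidiagonal.mem_antidiagonal

open Finset.HasAntidiagonal in
/-- One entry of a tuple is moved to the front. -/
theorem sum_tuple_move {n : ℕ} (t : Fin (n + 1)) (a : ℕ) (F : ℕ → (Fin n → ℕ) → M) :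
    ∑ A ∈ Finset.Nat.antidiagonalTuple (n + 1) a, F (A t) (fun s => A (t.succAbove s)) =
      ∑ q ∈ antidiagonal a, ∑ A ∈ Finset.Nat.antidiagonalTuple n q.2, F q.1 A := by
  rw [Finset.sum_sigma']
  refine Finset.sum_bij' (fun A _ => ⟨(A t, ∑ s, A (t.succAbove s)), fun s => A (t.succAbove s)⟩)
    (fun q _ => t.insertNth (α := fun _ => ℕ) q.1.1 q.2) (fun A hA => ?_) (fun q hq => ?_)
    (fun A _ => Fin.insertNth_self_removeNth t A) (fun q hq => ?_) fun A _ => rfl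
  · rw [Finset.Nat.mem_antidiagonalTuple, Fin.sum_univ_succAbove _ t] at hA
    simp [mem_antidiagonal, Finset.Nat.mem_antidiagonalTuple, hA]
  · simp only [Finset.mem_sigma, mem_antidiagonal, Finset.Nat.mem_antidiagonalTuple] at hq
    rw [Finset.Nat.mem_antidiagonalTuple, Fin.sum_univ_succAbove _ t]
    simp [hq]
  · simp only [Finset.mem_sigma, mem_antidiagonal, Finset.Nat.mem_antidiagonalTuple] at hq
    obtain ⟨⟨q₁, q₂⟩, A⟩ := q
    simp only at hq
    simp [hq.2]

theorem sum_tuple_perm {n : ℕ} (σ : Equiv.Perm (Fin n)) (a : ℕ) (F : (Fin n → ℕ) → M) :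
    ∑ A ∈ Finset.Nat.antidiagonalTuple n a, F (fun t => A (σ t)) =
      ∑ A ∈ Finset.Nat.antidiagonalTuple n a, F A := by
  refine Finset.sum_nbij' (fun A t => A (σ t)) (fun A t => A (σ.symm t)) (fun A hA => ?_)
    (fun A hA => ?_) (fun A _ => by simp) (fun A _ => by simp) fun A _ => rfl
  · rw [Finset.Nat.mem_antidiagonalTuple] at hA ⊢
    rw [← hA]
    exact Equiv.sum_comp σ A
  · rw [Finset.Nat.mem_antidiagonalTuple] at hA ⊢
    rw [← hA]
    exact Equiv.sum_comp σ.symm A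

open Finset.HasAntidiagonal in
/-- Multiplication by a variable commutes past the other factors. -/
theorem sum_shift (a : ℕ) (G : ℕ → ℕ → ℕ → M) :
    (∑ p ∈ antidiagonal a, ∑ q ∈ antidiagonal p.2,
      match p.1 with | 0 => 0 | x + 1 => G x q.1 q.2) =
    ∑ p ∈ antidiagonal a, ∑ q ∈ antidiagonal p.2,
      match q.1 with | 0 => 0 | y + 1 => G p.1 y q.2 := by
  refine Eq.trans ?_ (sum_antidiagonal_left_comm a fun x y z =>
    match y with | 0 => 0 | y + 1 => G x y z)
  cases a with
  | zero => simp
  | succ a =>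
    rw [Finset.Nat.sum_antidiagonal_succ]
    simp only [Finset.sum_const_zero, zero_add]
    rw [Finset.Nat.sum_antidiagonal_succ]
    simp only [Finset.sum_const_zero, zero_add]
    exact (sum_antidiagonal_left_comm a fun x y z => G x y z).symm

namespace DecGraph

/-! ### Symmetry of graph insertion -/

theorem graphInsertionMap_perm (b : ℕ) {m : ℕ} (e : Fin m → ℤ) (e' : ℤ) (σ : Equiv.Perm (Fin m))
    (x : ∀ t, FeynmanTotal P (e t)) :
    graphInsertionMap P b (fun t => e (σ t)) e' (fun t => x (σ t)) =
      sgn (∑ p : Fin m × Fin m with p.1 < p.2 ∧ σ p.2 < σ p.1, e (σ p.1) * e (σ p.2)) •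
        graphInsertionMap P b e e' x := by
  cases m with
  | zero =>
    obtain rfl : σ = 1 := Subsingleton.elim _ _
    rw [Finset.sum_of_isEmpty, sgn_zero, one_smul]
    rfl
  | succ m =>
    let F := (MultilinearMap.domDomCongrLinearEquiv' ℚ ℚ (fun t => FeynmanTotal P (e t))
      (FeynmanTotal P e') σ.symm).symm (graphInsertionMap P b (fun t => e (σ t)) e')
    refine MultilinearMap.congr_fun (f := F) (g := sgn (∑ p : Fin (m + 1) × Fin (m + 1) with
      p.1 < p.2 ∧ σ p.2 < σ p.1, e (σ p.1) * e (σ p.2)) • graphInsertionMap P b e e')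
      (multilinearMap_ext_clsL fun A p c hc hd => ?_) x
    change graphInsertionMap P b (fun t => e (σ t)) e' (fun t => clsL (e (σ t)) A p (c (σ t))) = _
    have h := (compat_insertL (b + m) e' A p).sort c σ
    rw [enum_fin] at h
    rw [graphInsertionMap_clsL b e' (fun t => hc (σ t)) fun s t hst => hd _ _ (σ.injective.ne hst), h,
      smul_apply, graphInsertionMap_clsL b e' hc hd]
    congr 1
    rw [sortExp, ← Fin.sum_univ_def]
    simp only [← Fin.sum_univ_def]
    rw [← Fintype.sum_prod_type' (f := fun a b => if a < b ∧ σ b < σ a then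
      degSum (c (σ a)) * degSum (c (σ b)) else 0), ← Finset.sum_filter]
    exact sgn_sum_congr fun q _ => sgn_mul_congr (sgn_degSum (hc _).deg) (sgn_degSum (hc _).deg)

theorem graphInsertionMap_eq_insertFirst (b : ℕ) {m : ℕ} (e : Fin (m + 1) → ℤ) (e' : ℤ)
    (x : ∀ t, FeynmanTotal P (e t)) : graphInsertionMap P b e e' x =
      insertFirst b (e 0) (fun s => e s.succ) e' (x 0) fun s => x s.succ := by
  induction e using Fin.consCases with
  | cons e₀ e =>
    induction x using Fin.consCases with
    | cons x₀ x => rfl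

end DecGraph

end

noncomputable section

open Cor

variable {P : S1FramedModularOperad.{u}} {M : Type w} [AddCommGroup M] [Module ℚ M]

theorem sum_comm_three {α β γ ι : Type*} (s : Finset α) (t : α → Finset β) (r : α → β → Finset γ)
    (u : Finset ι) (f : α → β → γ → ι → M) :
    ∑ a ∈ s, ∑ b ∈ t a, ∑ c ∈ r a b, ∑ i ∈ u, f a b c i =
      ∑ i ∈ u, ∑ a ∈ s, ∑ b ∈ t a, ∑ c ∈ r a b, f a b c i :=
  (Finset.sum_congr rfl fun _ _ => (Finset.sum_congr rfl fun _ _ => Finset.sum_comm).trans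
    Finset.sum_comm).trans Finset.sum_comm

section Tuples

open Finset.HasAntidiagonal Finset.Nat

theorem sum_tuples_move {n : ℕ} (t : Fin (n + 1)) (a b : ℕ)
    (F : ℕ → ℕ → (Fin n → ℕ) → (Fin n → ℕ) → M) :
    ∑ A ∈ antidiagonalTuple (n + 1) a, ∑ B ∈ antidiagonalTuple (n + 1) b,
      F (A t) (B t) (fun s => A (t.succAbove s)) (fun s => B (t.succAbove s)) =
    ∑ q ∈ antidiagonal a, ∑ A ∈ antidiagonalTuple n q.2, ∑ r ∈ antidiagonal b,
      ∑ B ∈ antidiagonalTuple n r.2, F q.1 r.1 A B :=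
  (Finset.sum_congr rfl fun A _ => sum_tuple_move t b fun r B =>
    F (A t) r (fun s => A (t.succAbove s)) B).trans
    (sum_tuple_move t a fun q A => ∑ r ∈ antidiagonal b, ∑ B ∈ antidiagonalTuple n r.2, F q r.1 A B)

/-- Two entries of a tuple are moved to the front and added. -/
theorem sum_tuple_move_two {n : ℕ} (s : Fin (n + 2)) (r : Fin (n + 1)) (a : ℕ)
    (F : ℕ → ℕ → (Fin n → ℕ) → M) :
    ∑ A ∈ antidiagonalTuple (n + 2) a,
      F (A s) (A (s.succAbove r)) (fun q => A (s.succAbove (r.succAbove q))) =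
    ∑ q ∈ antidiagonal a, ∑ A ∈ antidiagonalTuple n q.2, ∑ u ∈ antidiagonal q.1, F u.1 u.2 A := by
  rw [sum_tuple_move s a fun x A => F x (A r) fun q => A (r.succAbove q)]
  refine (Finset.sum_congr rfl fun u _ => sum_tuple_move r u.2 fun y A => F u.1 y A).trans ?_
  refine (sum_antidiagonal_assoc a fun x y z => ∑ A ∈ antidiagonalTuple n z, F x y A).symm.trans ?_
  exact Finset.sum_congr rfl fun q _ => Finset.sum_comm

theorem sum_tuples_move_two {n : ℕ} (s : Fin (n + 2)) (r : Fin (n + 1)) (a b : ℕ)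
    (F : ℕ → ℕ → ℕ → ℕ → (Fin n → ℕ) → (Fin n → ℕ) → M) :
    ∑ A ∈ antidiagonalTuple (n + 2) a, ∑ B ∈ antidiagonalTuple (n + 2) b,
      F (A s) (A (s.succAbove r)) (B s) (B (s.succAbove r))
        (fun q => A (s.succAbove (r.succAbove q))) (fun q => B (s.succAbove (r.succAbove q))) =
    ∑ p ∈ antidiagonal a, ∑ A ∈ antidiagonalTuple n p.2, ∑ q ∈ antidiagonal b,
      ∑ B ∈ antidiagonalTuple n q.2, ∑ u ∈ antidiagonal p.1, ∑ v ∈ antidiagonal q.1,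
        F u.1 u.2 v.1 v.2 A B := by
  refine (Finset.sum_congr rfl fun A _ => sum_tuple_move_two s r b fun v₁ v₂ B =>
    F (A s) (A (s.succAbove r)) v₁ v₂ (fun q => A (s.succAbove (r.succAbove q))) B).trans ?_
  refine (sum_tuple_move_two s r a fun u₁ u₂ A => ∑ q ∈ antidiagonal b,
    ∑ B ∈ antidiagonalTuple n q.2, ∑ v ∈ antidiagonal q.1, F u₁ u₂ v.1 v.2 A B).trans ?_
  refine Finset.sum_congr rfl fun p _ => Finset.sum_congr rfl fun A _ => ?_
  rw [Finset.sum_comm]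
  exact Finset.sum_congr rfl fun q _ => Finset.sum_comm

end Tuples

namespace DecGraph

open Finset.HasAntidiagonal Finset.Nat

/-! ### Coefficients of the components of `𝒦` -/

theorem graphInsertionMaps_apply {m : ℕ} (i : Fin m → ℤ) (k : ℤ) (h : k + 1 = ∑ t, (i t + 1))
    (x : ∀ t, GBar P (i t)) (a b : ℕ) :
    (graphInsertionMaps P m i k h x : GBar P k) a b =
      ∑ p ∈ antidiagonal a, ∑ A ∈ antidiagonalTuple m p.2, ∑ B ∈ antidiagonalTuple m b,
        graphInsertionMap P p.1 (fun t => i t - 1 + 2 * (A t) + 2 * (B t)) (k - 1 + 2 * a + 2 * b)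
          fun t => x t (A t) (B t) := by
  refine Eq.trans ?_ (sum_tuple_move 0 a fun c A => ∑ B ∈ antidiagonalTuple m b,
    graphInsertionMap P c (fun t => i t - 1 + 2 * (A t) + 2 * (B t)) (k - 1 + 2 * a + 2 * b)
      fun t => x t (A t) (B t))
  refine Eq.trans (b := (∑ A ∈ antidiagonalTuple (m + 1) a, ∑ B ∈ antidiagonalTuple m b,
      (graphInsertionMap P (A 0) (fun t => i t - 1 + 2 * (A t.succ) + 2 * (B t))
        (k - 1 + 2 * a + 2 * b)).compLinearMap fun t => GBar.coeff (A t.succ) (B t)) x) rfl ?_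
  simp only [sum_apply]
  rfl

theorem graphInsertionMaps_cons {m : ℕ} (i₀ : ℤ) (i : Fin m → ℤ) (k : ℤ)
    (h : k + 1 = ∑ t, ((Fin.cons i₀ i : Fin (m + 1) → ℤ) t + 1)) (x₀ : GBar P i₀)
    (x : ∀ t, GBar P (i t)) (a b : ℕ) :
    (graphInsertionMaps P (m + 1) (Fin.cons i₀ i) k h
      (Fin.cons (α := fun s => GBar P ((Fin.cons i₀ i : Fin (m + 1) → ℤ) s)) x₀ x) : GBar P k) a b =
      ∑ p ∈ antidiagonal a, ∑ q ∈ antidiagonal p.2, ∑ A ∈ antidiagonalTuple m q.2,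
        ∑ r ∈ antidiagonal b, ∑ B ∈ antidiagonalTuple m r.2,
          insertFirst p.1 (i₀ - 1 + 2 * q.1 + 2 * r.1)
            (fun t => i t - 1 + 2 * (A t) + 2 * (B t)) (k - 1 + 2 * a + 2 * b)
            (x₀ q.1 r.1) fun t => x t (A t) (B t) := by
  rw [graphInsertionMaps_apply]
  refine Finset.sum_congr rfl fun p _ => ?_
  refine Eq.trans ?_ (sum_tuples_move 0 p.2 b fun q r A B =>
    insertFirst p.1 (i₀ - 1 + 2 * q + 2 * r)
      (fun t => i t - 1 + 2 * (A t) + 2 * (B t)) (k - 1 + 2 * a + 2 * b)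
      (x₀ q r) fun t => x t (A t) (B t))
  exact Finset.sum_congr rfl fun A _ => Finset.sum_congr rfl fun B _ =>
    graphInsertionMap_eq_insertFirst p.1 _ _ _

theorem sgn_coeff (i : ℤ) (a b : ℕ) : sgn (i - 1 + 2 * a + 2 * b) = sgn (i + 1) :=
  sgn_congr ⟨a + b - 1, by ring⟩

theorem sgn_frontE_coeff {m : ℕ} (i : Fin m → ℤ) (A B : Fin m → ℕ) (t : Fin m) :
    sgn (frontE (fun t => i t - 1 + 2 * (A t) + 2 * (B t)) t) =
      sgn (∑ s with s < t, (i t + 1) * (i s + 1)) :=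
  sgn_frontE_congr (d' := fun t => i t + 1) (fun _ => sgn_coeff _ _ _) t

/-- The coefficients of the value of `𝒦` at `x₀, x`. -/
def consSum {m : ℕ} {i₀ : ℤ} {i : Fin m → ℤ} (x₀ : GBar P i₀) (x : ∀ t, GBar P (i t)) (e' : ℤ)
    (a b : ℕ) : FeynmanTotal P e' :=
  ∑ p ∈ antidiagonal a, ∑ q ∈ antidiagonal p.2, ∑ A ∈ antidiagonalTuple m q.2,
    ∑ r ∈ antidiagonal b, ∑ B ∈ antidiagonalTuple m r.2,
      insertFirst p.1 (i₀ - 1 + 2 * q.1 + 2 * r.1) (fun t => i t - 1 + 2 * (A t) + 2 * (B t)) e'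
        (x₀ q.1 r.1) fun t => x t (A t) (B t)

theorem consSum_add {m : ℕ} {i₀ : ℤ} {i : Fin m → ℤ} (x₀ y₀ : GBar P i₀) (x : ∀ t, GBar P (i t))
    (e' : ℤ) (a b : ℕ) : consSum (x₀ + y₀) x e' a b = consSum x₀ x e' a b + consSum y₀ x e' a b := by
  simp only [consSum, Pi.add_apply, map_add, add_apply, Finset.sum_add_distrib]

section Equations

variable {m : ℕ} (i : Fin (m + 1) → ℤ) (e' : ℤ) (x : ∀ t, GBar P (i t)) (a b : ℕ)

theorem sum_termOne_differential_coeff :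
    ∑ p ∈ antidiagonal a, ∑ A ∈ antidiagonalTuple (m + 1) p.2, ∑ B ∈ antidiagonalTuple (m + 1) b,
      (∑ t, sgn (frontE (fun t => i t - 1 + 2 * (A t) + 2 * (B t)) t) •
        termOne p.1 (fun t => i t - 1 + 2 * (A t) + 2 * (B t)) e' t
          (_root_.differential P _ (i t - 1 - 1 + 2 * (A t) + 2 * (B t))))
        (fun t => x t (A t) (B t)) =
    ∑ t, sgn (∑ s with s < t, (i t + 1) * (i s + 1)) •
      consSum (GBar.diff P (i t) (i t - 1) (x t)) (fun s => x (t.succAbove s)) e' a b := by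
  simp only [sum_apply, smul_apply, termOne_apply, sgn_frontE_coeff, Finset.smul_sum, consSum]
  rw [Finset.sum_comm (s := Finset.univ)]
  refine Finset.sum_congr rfl fun p _ => ?_
  simp only [Finset.sum_comm (t := Finset.univ)]
  refine Finset.sum_congr rfl fun t _ => ?_
  exact sum_tuples_move t p.2 b fun q r A B => sgn (∑ s with s < t, (i t + 1) * (i s + 1)) •
    insertFirst p.1 (i t - 1 - 1 + 2 * q + 2 * r)
      (fun s => i (t.succAbove s) - 1 + 2 * (A s) + 2 * (B s)) e'
      (_root_.differential P _ _ (x t q r)) fun s => x (t.succAbove s) (A s) (B s)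

theorem sum_bvTerms_coeff :
    ∑ p ∈ antidiagonal a, ∑ A ∈ antidiagonalTuple (m + 1) p.2, ∑ B ∈ antidiagonalTuple (m + 1) b,
      bvTerms (fun t => i t - 1 + 2 * (A t) + 2 * (B t))
        (fun t => i t - 1 - 1 + 2 * (A t + 1 : ℕ) + 2 * (B t)) e' p.1 (fun t => x t (A t) (B t)) =
    ∑ t, sgn (∑ s with s < t, (i t + 1) * (i s + 1)) •
      consSum (GBar.hbarBV P (i t) (i t - 1) (x t)) (fun s => x (t.succAbove s)) e' a b := by
  have h₁ : ∀ p : ℕ × ℕ, (∑ A ∈ antidiagonalTuple (m + 1) p.2, ∑ B ∈ antidiagonalTuple (m + 1) b,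
      bvTerms (fun t => i t - 1 + 2 * (A t) + 2 * (B t))
        (fun t => i t - 1 - 1 + 2 * (A t + 1 : ℕ) + 2 * (B t)) e' p.1 (fun t => x t (A t) (B t))) =
      ∑ t, ∑ q ∈ antidiagonal p.2, sgn (∑ s with s < t, (i t + 1) * (i s + 1)) •
        match p.1 with
        | 0 => 0
        | c + 1 => ∑ A ∈ antidiagonalTuple m q.2, ∑ r ∈ antidiagonal b, ∑ B ∈ antidiagonalTuple m r.2,
          insertFirst c (i t - 1 - 1 + 2 * (q.1 + 1 : ℕ) + 2 * r.1)
            (fun s => i (t.succAbove s) - 1 + 2 * (A s) + 2 * (B s)) e'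
            (_root_.bv P _ _ (x t q.1 r.1)) fun s => x (t.succAbove s) (A s) (B s) := by
    rintro ⟨_ | c, p⟩
    · simp [bvTerms]
    · simp only [bvTerms, sum_apply, smul_apply, termOne_apply, sgn_frontE_coeff, Finset.smul_sum]
      simp only [Finset.sum_comm (t := Finset.univ)]
      refine Finset.sum_congr rfl fun t _ => ?_
      exact sum_tuples_move t p b fun q r A B => sgn (∑ s with s < t, (i t + 1) * (i s + 1)) •
        insertFirst c (i t - 1 - 1 + 2 * (q + 1 : ℕ) + 2 * r)
          (fun s => i (t.succAbove s) - 1 + 2 * (A s) + 2 * (B s)) e'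
          (_root_.bv P _ _ (x t q r)) fun s => x (t.succAbove s) (A s) (B s)
  rw [Finset.sum_congr rfl fun p _ => h₁ p, Finset.sum_comm]
  refine Finset.sum_congr rfl fun t _ => ?_
  simp only [← Finset.smul_sum]
  refine congrArg _ ((sum_shift a fun c q z => ∑ A ∈ antidiagonalTuple m z, ∑ r ∈ antidiagonal b,
    ∑ B ∈ antidiagonalTuple m r.2,
      insertFirst c (i t - 1 - 1 + 2 * (q + 1 : ℕ) + 2 * r.1)
        (fun s => i (t.succAbove s) - 1 + 2 * (A s) + 2 * (B s)) e'
        (_root_.bv P _ _ (x t q r.1)) fun s => x (t.succAbove s) (A s) (B s)).trans ?_)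
  refine Finset.sum_congr rfl fun p _ => Finset.sum_congr rfl ?_
  rintro ⟨_ | q, z⟩ _
  · simp [GBar.hbarBV_zero]
  · rfl

theorem insertDifferential_apply (k : ℤ) (h : k + 2 = ∑ t, (i t + 1)) :
    ((graphInsertionMaps P).insertDifferential i k h x : GBar P k) a b =
      (∑ t, sgn (∑ s with s < t, (i t + 1) * (i s + 1)) •
        consSum (GBar.diff P (i t) (i t - 1) (x t)) (fun s => x (t.succAbove s))
          (k - 1 + 2 * a + 2 * b) a b) +
      ∑ t, sgn (∑ s with s < t, (i t + 1) * (i s + 1)) •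
        consSum (GBar.hbarBV P (i t) (i t - 1) (x t)) (fun s => x (t.succAbove s))
          (k - 1 + 2 * a + 2 * b) a b := by
  have hk : ∀ t, k + 1 = ∑ s, ((Fin.cons (i t - 1) fun s => i (t.succAbove s) :
      Fin (m + 1) → ℤ) s + 1) := fun t => by
    rw [Fin.sum_univ_succAbove _ t] at h
    rw [Fin.sum_univ_succ]
    simp only [Fin.cons_zero, Fin.cons_succ]
    omega
  rw [← Finset.sum_add_distrib]
  change GBar.coeff (P := P) (i := k) a b ((graphInsertionMaps P).insertDifferential i k h x) = _
  refine (map_sum (GBar.coeff (P := P) (i := k) a b) _ _).trans (Finset.sum_congr rfl fun t _ => ?_)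
  rw [← smul_add, ← consSum_add]
  refine (map_smul (GBar.coeff (P := P) (i := k) a b) _ _).trans (congrArg _ ?_)
  exact (graphInsertionMaps_cons (i t - 1) _ k (hk t) _ _ a b)

end Equations

section Bracket

variable {m : ℕ} (i : Fin (m + 2) → ℤ) (x : ∀ t, GBar P (i t)) (a b : ℕ)

theorem consSum_bracket (e' : ℤ) (s : Fin (m + 2)) (r : Fin (m + 1)) :
    ∑ p ∈ antidiagonal a, ∑ A ∈ antidiagonalTuple (m + 2) p.2, ∑ B ∈ antidiagonalTuple (m + 2) b,
      termTwo p.1 (fun t => i t - 1 + 2 * (A t) + 2 * (B t))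
        (i s + i (s.succAbove r) - 1 + 2 * (A s + A (s.succAbove r) : ℕ) +
          2 * (B s + B (s.succAbove r) : ℕ)) e' s r (fun t => x t (A t) (B t)) =
      sgn (i s + 1) • consSum (GBar.bracket P (i s) (i (s.succAbove r)) (i s + i (s.succAbove r))
        (x s) (x (s.succAbove r))) (fun q => x (s.succAbove (r.succAbove q))) e' a b := by
  rw [consSum, Finset.smul_sum]
  refine Finset.sum_congr rfl fun p _ => ?_
  refine (sum_tuples_move_two s r p.2 b fun u₁ u₂ v₁ v₂ A B =>
    insertFirst p.1 (i s + i (s.succAbove r) - 1 + 2 * (u₁ + u₂ : ℕ) + 2 * (v₁ + v₂ : ℕ))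
      (fun q => i (s.succAbove (r.succAbove q)) - 1 + 2 * (A q) + 2 * (B q)) e'
      (_root_.sewBracket P _ _ _ (x s u₁ v₁) (x (s.succAbove r) u₂ v₂))
      fun q => x (s.succAbove (r.succAbove q)) (A q) (B q)).trans ?_
  simp only [Finset.smul_sum]
  refine Finset.sum_congr rfl fun q _ => Finset.sum_congr rfl fun A _ =>
    Finset.sum_congr rfl fun q' _ => Finset.sum_congr rfl fun B _ => ?_
  rw [GBar.bracket_apply]
  simp only [map_sum, sum_apply, Finset.smul_sum, map_smul, smul_apply, smul_smul]
  refine Finset.sum_congr rfl fun u hu => Finset.sum_congr rfl fun v hv => ?_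
  rw [← sgn_add, sgn_congr (b := 0) ⟨i s, by ring⟩, sgn_zero, one_smul]
  obtain ⟨q₁, q₂⟩ := q
  obtain ⟨r₁, r₂⟩ := q'
  obtain rfl := _root_.mem_antidiagonal.1 hu
  obtain rfl := _root_.mem_antidiagonal.1 hv
  rfl

theorem sum_termTwo_coeff (e' : ℤ) :
    ∑ p ∈ antidiagonal a, ∑ A ∈ antidiagonalTuple (m + 2) p.2, ∑ B ∈ antidiagonalTuple (m + 2) b,
      ((1 / 2 : ℚ) • ∑ s, ∑ r : Fin (m + 1),
        (sgn (frontE (fun t => i t - 1 + 2 * (A t) + 2 * (B t)) s) *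
          sgn (frontE (fun t => i (s.succAbove t) - 1 + 2 * (A (s.succAbove t)) +
            2 * (B (s.succAbove t))) r)) •
        termTwo p.1 (fun t => i t - 1 + 2 * (A t) + 2 * (B t))
          (i s + i (s.succAbove r) - 1 + 2 * (A s + A (s.succAbove r) : ℕ) +
            2 * (B s + B (s.succAbove r) : ℕ)) e' s r) (fun t => x t (A t) (B t)) =
    (1 / 2 : ℚ) • ∑ s, ∑ r, (sgn (∑ q with q < s, (i s + 1) * (i q + 1)) *
      sgn (∑ q with q < r, (i (s.succAbove r) + 1) * (i (s.succAbove q) + 1)) *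
      sgn (i s + 1)) • consSum (GBar.bracket P (i s) (i (s.succAbove r)) (i s + i (s.succAbove r))
        (x s) (x (s.succAbove r))) (fun q => x (s.succAbove (r.succAbove q))) e' a b := by
  have hs : ∀ (A B : Fin (m + 2) → ℕ) (s : Fin (m + 2)) (r : Fin (m + 1)),
      sgn (frontE (fun t => i (s.succAbove t) - 1 + 2 * (A (s.succAbove t)) +
        2 * (B (s.succAbove t))) r) =
      sgn (∑ q with q < r, (i (s.succAbove r) + 1) * (i (s.succAbove q) + 1)) := fun A B s r =>
    sgn_frontE_coeff (fun t => i (s.succAbove t)) (fun t => A (s.succAbove t))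
      (fun t => B (s.succAbove t)) r
  simp only [smul_apply, sum_apply, sgn_frontE_coeff, hs, ← Finset.smul_sum, mul_smul,
    ← consSum_bracket]
  refine congrArg _ ?_
  simp only [Finset.smul_sum]
  refine (sum_comm_three ..).trans (Finset.sum_congr rfl fun s _ => ?_)
  exact sum_comm_three ..

theorem insertBracket_apply (k : ℤ) (h : k + 2 = ∑ t, (i t + 1)) :
    ((graphInsertionMaps P).insertBracket i k h x : GBar P k) a b =
      (1 / 2 : ℚ) • ∑ s, ∑ r, (sgn (∑ q with q < s, (i s + 1) * (i q + 1)) *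
        sgn (∑ q with q < r, (i (s.succAbove r) + 1) * (i (s.succAbove q) + 1)) *
        sgn (i s + 1)) • consSum (GBar.bracket P (i s) (i (s.succAbove r)) (i s + i (s.succAbove r))
          (x s) (x (s.succAbove r))) (fun q => x (s.succAbove (r.succAbove q)))
          (k - 1 + 2 * a + 2 * b) a b := by
  have hk : ∀ s r, k + 1 = ∑ q, ((Fin.cons (i s + i (s.succAbove r)) fun q =>
      i (s.succAbove (r.succAbove q)) : Fin (m + 1) → ℤ) q + 1) := fun s r => by
    rw [Fin.sum_univ_succAbove _ s, Fin.sum_univ_succAbove _ r] at h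
    rw [Fin.sum_univ_succ]
    simp only [Fin.cons_zero, Fin.cons_succ]
    omega
  refine (map_smul (GBar.coeff (P := P) (i := k) a b) (1 / 2 : ℚ) _).trans (congrArg _ ?_)
  refine (map_sum (GBar.coeff (P := P) (i := k) a b) _ _).trans (Finset.sum_congr rfl fun s _ => ?_)
  refine (map_sum (GBar.coeff (P := P) (i := k) a b) _ _).trans (Finset.sum_congr rfl fun r _ => ?_)
  refine (map_smul (GBar.coeff (P := P) (i := k) a b) _ _).trans (congrArg _ ?_)
  exact (graphInsertionMaps_cons (i s + i (s.succAbove r)) _ k (hk s r) _ _ a b)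

end Bracket

end DecGraph
end

noncomputable section

open Cor

variable {P : S1FramedModularOperad.{u}}

namespace DecGraph

open Finset.HasAntidiagonal Finset.Nat

/-! ### The equations of an `L_∞`-morphism -/

theorem graphInsertionMaps_isSymmetric : (graphInsertionMaps P).IsSymmetric := by
  intro m i k h σ h' x
  change (graphInsertionMaps P m (fun t => i (σ t)) k h' (fun t => x (σ t)) : GBar P k) =
    sgn _ • (graphInsertionMaps P m i k h x : GBar P k)
  funext a b
  refine (graphInsertionMaps_apply (fun t => i (σ t)) k h' (fun t => x (σ t)) a b).trans
    (Eq.trans ?_ (congrArg (fun y => sgn (∑ q : Fin m × Fin m with q.1 < q.2 ∧ σ q.2 < σ q.1,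
      (i (σ q.1) + 1) * (i (σ q.2) + 1)) • y) (graphInsertionMaps_apply i k h x a b)).symm)
  simp only [Finset.smul_sum]
  refine Finset.sum_congr rfl fun p _ => ?_
  rw [← sum_tuple_perm σ]
  refine Finset.sum_congr rfl fun A _ => ?_
  rw [← sum_tuple_perm σ]
  refine Finset.sum_congr rfl fun B _ => ?_
  refine (graphInsertionMap_perm p.1 (fun t => i t - 1 + 2 * (A t) + 2 * (B t)) _ σ
    fun t => x t (A t) (B t)).trans ?_
  exact congrArg (· • _) (sgn_sum_congr fun q _ => sgn_mul_congr (sgn_coeff ..) (sgn_coeff ..))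

theorem diff_graphInsertionMaps {m : ℕ} (i : Fin m → ℤ) (k k' : ℤ) (h : k + 1 = ∑ t, (i t + 1))
    (x : ∀ t, GBar P (i t)) (a b : ℕ) :
    GBar.diff P k k' (graphInsertionMaps P m i k h x : GBar P k) a b =
      ∑ p ∈ antidiagonal a, ∑ A ∈ antidiagonalTuple m p.2, ∑ B ∈ antidiagonalTuple m b,
        (_root_.differential P _ (k' - 1 + 2 * a + 2 * b)).compMultilinearMap
          (graphInsertionMap P p.1 (fun t => i t - 1 + 2 * (A t) + 2 * (B t))
            (k - 1 + 2 * a + 2 * b)) fun t => x t (A t) (B t) := by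
  refine (congrArg (_root_.differential P (k - 1 + 2 * a + 2 * b) (k' - 1 + 2 * a + 2 * b))
    (graphInsertionMaps_apply i k h x a b)).trans ?_
  simp only [map_sum]
  rfl

theorem graphInsertionMaps_diff_one (i : Fin 1 → ℤ) (k k' : ℤ) (h : k + 1 = ∑ t, (i t + 1))
    (h' : k' + 2 = ∑ t, (i t + 1)) (x : ∀ t, GBar P (i t)) :
    GBar.diff P k k' (graphInsertionMaps P 1 i k h x : GBar P k) =
      ((graphInsertionMaps P).insertDifferential i k' h' x : GBar P k') := by
  funext a b
  rw [diff_graphInsertionMaps, insertDifferential_apply, ← sum_termOne_differential_coeff,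
    ← sum_bvTerms_coeff]
  simp only [← Finset.sum_add_distrib, ← add_apply]
  refine Finset.sum_congr rfl fun p _ => Finset.sum_congr rfl fun A _ =>
    Finset.sum_congr rfl fun B _ => ?_
  exact MultilinearMap.congr_fun (differential_insertion_one p.1 (by omega) (fun t => by omega)
    fun t => by push_cast; omega) _

theorem graphInsertionMaps_diff {m : ℕ} (i : Fin (m + 2) → ℤ) (k k' : ℤ)
    (h : k + 1 = ∑ t, (i t + 1)) (h' : k' + 2 = ∑ t, (i t + 1)) (x : ∀ t, GBar P (i t)) :
    GBar.diff P k k' (graphInsertionMaps P (m + 2) i k h x : GBar P k) =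
      ((graphInsertionMaps P).insertDifferential i k' h' x : GBar P k') +
        ((graphInsertionMaps P).insertBracket i k' h' x : GBar P k') := by
  funext a b
  refine Eq.trans ?_ (congrArg₂ (· + ·) (insertDifferential_apply i x a b k' h')
    (insertBracket_apply i x a b k' h')).symm
  rw [diff_graphInsertionMaps, ← sum_termOne_differential_coeff, ← sum_bvTerms_coeff,
    ← sum_termTwo_coeff]
  simp only [← Finset.sum_add_distrib, ← add_apply]
  refine Finset.sum_congr rfl fun p _ => Finset.sum_congr rfl fun A _ =>
    Finset.sum_congr rfl fun B _ => ?_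
  exact MultilinearMap.congr_fun (differential_insertion p.1 (by omega) (fun t => by omega)
    (fun t => by push_cast; omega) fun s r => by push_cast; omega) _

theorem graphInsertionMaps_isLInftyMorphism : (graphInsertionMaps P).IsLInftyMorphism := by
  refine ⟨graphInsertionMaps_isSymmetric, fun i k k' h h' _ x =>
    graphInsertionMaps_diff_one i k k' h h' x, fun m i k k' h h' _ x => ?_⟩
  have : (graphInsertionMaps P).bracketSplit i k' h' x = 0 :=
    smul_eq_zero_of_right _ (Finset.sum_eq_zero fun S _ => smul_zero _)
  rw [this, add_zero]
  exact graphInsertionMaps_diff i k k' h h' x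

/-! ### The linear part -/

theorem graphInsertionMap_zero_one (e : ℤ) (y : FeynmanTotal P e) :
    graphInsertionMap P 0 (fun _ : Fin 1 => e) e (fun _ => y) = y := by
  have : graphInsertionMap P 0 (fun _ : Fin 1 => e) e =
      MultilinearMap.ofSubsingleton ℚ (FeynmanTotal P e) (FeynmanTotal P e) (0 : Fin 1)
        LinearMap.id := by
    refine multilinearMap_ext_clsL fun {H} _ A p c hc hd => ?_
    rw [graphInsertionMap_clsL 0 e hc hd, insertL]
    have hB : ∀ B : Matching H, B.supp.ncard = 2 * (0 + 0) ↔ ∀ h k, ¬ B.Adj h k := fun B => by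
      rw [Nat.mul_eq_zero.2 (Or.inr rfl), Set.ncard_eq_zero (Set.toFinite _), Set.eq_empty_iff_forall_notMem]
      exact ⟨fun h k l e => h k ⟨l, e⟩, fun h k ⟨l, e⟩ => h k l e⟩
    let E : Matching H := ⟨fun _ _ => False, fun {_ _} h => h, fun {_} h => h, fun {_ _ _} h => h.elim⟩
    rw [Finset.sum_eq_single_of_mem E (Matching.mem_leafMatchings.2
      ⟨fun h ⟨_, e⟩ => e.elim, (hB E).2 fun _ _ e => e⟩) fun B hB' hne => (hne ?_).elim]
    · refine (clsL_congr (fun h _ k _ => ?_) fun _ _ => rfl).trans (congrArg (clsL e A p) ?_)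
      · exact or_iff_left fun h => h.1
      · simp [List.finRange_succ]
    · have := (hB B).1 (Matching.mem_leafMatchings.1 hB').2
      exact Matching.ext (funext fun h => funext fun k => propext (iff_false_intro (this h k)))
  rw [this]
  rfl

theorem linearPart_apply (i : ℤ) (x : GBar P i) (a b : ℕ) :
    ((graphInsertionMaps P).linearPart i x : GBar P i) a b = x a b +
      ∑ p ∈ (antidiagonal a).erase (0, a), graphInsertionMap P p.1
        (fun _ : Fin 1 => i - 1 + 2 * p.2 + 2 * b) (i - 1 + 2 * a + 2 * b) fun _ => x p.2 b := by
  have h₁ : ∀ (n : ℕ) (F : (Fin 1 → ℕ) → FeynmanTotal P (i - 1 + 2 * a + 2 * b)),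
      ∑ A ∈ antidiagonalTuple 1 n, F A = F fun _ => n := fun n F => by
    rw [antidiagonalTuple_one, Finset.sum_singleton]
    exact congrArg F (funext fun t => by rw [Subsingleton.elim t 0]; rfl)
  refine (graphInsertionMaps_apply (fun _ => i) i _ (fun _ => x) a b).trans ?_
  simp only [h₁]
  rw [← Finset.add_sum_erase _ _ (_root_.mem_antidiagonal.2 (zero_add a) :
    ((0, a) : ℕ × ℕ) ∈ antidiagonal a)]
  exact congrArg (· + _) (graphInsertionMap_zero_one _ _)

theorem snd_lt_of_mem_erase {a : ℕ} {p : ℕ × ℕ} (h : p ∈ (antidiagonal a).erase (0, a)) :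
    p.2 < a := by
  obtain ⟨h₁, h₂⟩ := Finset.mem_erase.1 h
  have := _root_.mem_antidiagonal.1 h₂
  obtain ⟨p, q⟩ := p
  have : ¬ (p = 0 ∧ q = a) := fun e => h₁ (Prod.ext e.1 e.2)
  simp only at *
  omega

theorem linearPart_injective (i : ℤ) {x y : GBar P i}
    (h : (graphInsertionMaps P).linearPart i x = (graphInsertionMaps P).linearPart i y) : x = y := by
  funext a
  induction a using Nat.strong_induction_on with
  | _ a ih =>
    funext b
    have hab := (linearPart_apply i x a b).symm.trans
      ((congrFun (congrFun h a) b).trans (linearPart_apply i y a b))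
    rw [Finset.sum_congr rfl fun p hp => by rw [ih p.2 (snd_lt_of_mem_erase hp)]] at hab
    exact add_right_cancel hab

/-- The inverse of the linear part. -/
def linearPartInv {i : ℤ} (y : GBar P i) (a : ℕ) :
    ∀ b : ℕ, FeynmanTotal P (i - 1 + 2 * a + 2 * b) :=
  fun b => y a b - ∑ p : (antidiagonal a).erase (0, a), graphInsertionMap P p.1.1
    (fun _ : Fin 1 => i - 1 + 2 * p.1.2 + 2 * b) (i - 1 + 2 * a + 2 * b)
      fun _ => linearPartInv y p.1.2 b
termination_by a
decreasing_by exact snd_lt_of_mem_erase p.2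

theorem linearPart_linearPartInv {i : ℤ} (y : GBar P i) :
    (graphInsertionMaps P).linearPart i (linearPartInv y : GBar P i) = y := by
  refine funext fun a => funext fun b => ?_
  refine (linearPart_apply i (linearPartInv y) a b).trans ?_
  rw [linearPartInv, Finset.sum_coe_sort ((antidiagonal a).erase (0, a)) fun p =>
    graphInsertionMap P p.1 (fun _ : Fin 1 => i - 1 + 2 * p.2 + 2 * b) (i - 1 + 2 * a + 2 * b)
      fun _ => linearPartInv y p.2 b]
  exact sub_add_cancel _ _

theorem _root_.LInftyMaps.apply_one {L L' : DGLieData.{w}} (K : LInftyMaps L L') (i : Fin 1 → ℤ)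
    (k : ℤ) (h : k + 1 = ∑ t, (i t + 1)) (h' : k + 1 = ∑ _t : Fin 1, (i 0 + 1))
    (x : ∀ t, L.X (i t)) : K 1 i k h x = K 1 (fun _ => i 0) k h' fun _ => x 0 := by
  obtain ⟨i₀, rfl⟩ : ∃ i₀, i = fun _ => i₀ :=
    ⟨i 0, funext fun t => congrArg i (Subsingleton.elim t 0)⟩
  exact congrArg _ (funext fun t => by rw [Subsingleton.elim t 0])

theorem linearPart_d {i j : ℤ} (h : j + 1 = i) (x : (gBar P).X i) :
    (gBarTriv P).d h ((graphInsertionMaps P).linearPart i x) =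
      (graphInsertionMaps P).linearPart j ((gBar P).d h x) := by
  obtain rfl : j = i - 1 := by omega
  refine (graphInsertionMaps_isLInftyMorphism.2.1 (fun _ => i) i (i - 1) (by simp) (by simp; ring) h
    fun _ => x).trans ?_
  refine (Fin.sum_univ_one _).trans ?_
  rw [Finset.sum_eq_zero fun s hs => absurd (Finset.mem_filter.1 hs).2 (by simp), sgn_zero, one_smul]
  exact LInftyMaps.apply_one _ _ _ _ (by simp) _

theorem graphInsertionMaps_isQuasiIso : (graphInsertionMaps P).IsQuasiIso := by
  have h₀ : ∀ i, (graphInsertionMaps P).linearPart i (0 : (gBar P).X i) = 0 := fun i =>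
    (graphInsertionMaps P 1 (fun _ => i) i (by simp)).map_coord_zero (0 : Fin 1) rfl
  have hs : ∀ i (y : (gBarTriv P).X i), ∃ x, (graphInsertionMaps P).linearPart i x = y := fun i y =>
    ⟨_, linearPart_linearPartInv y⟩
  refine ⟨fun i j k h h' x y _ hy => ?_, fun i j k h h' y hy => ?_⟩
  · obtain ⟨z, rfl⟩ := hs k y
    refine ⟨z, linearPart_injective i ?_⟩
    rw [← linearPart_d, hy]
  · obtain ⟨x, rfl⟩ := hs i y
    refine ⟨x, 0, linearPart_injective j ?_, ?_⟩
    · rw [h₀, ← linearPart_d, hy]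
    · rw [map_zero, add_zero]

theorem operationsWellDefined : OperationsWellDefined P :=
  ⟨fun _ e' _ h₁ h₂ => (respects_differential e').linearExtension_cls h₁ h₂,
    fun _ e' _ h₁ h₂ => (respects_bv e').linearExtension_cls h₁ h₂,
    fun _ _ _ _ _ h₁ h₂ h₃ h₄ => sewBracket_cls h₁ h₂ h₃ h₄,
    fun b _ _ e' _ hG => graphInsertionMap_cls b e' hG⟩

end DecGraph

end

theorem mainTheorem4 (P : S1FramedModularOperad.{u}) :
    OperationsWellDefined P ∧ (gBar P).IsDGLA ∧ (gBarTriv P).IsDGLA ∧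
      ∃ K : LInftyMaps (gBar P) (gBarTriv P),
        K = graphInsertionMaps P ∧ K.IsLInftyMorphism ∧ K.IsQuasiIso :=
  ⟨DecGraph.operationsWellDefined, isDGLA_gBar P, isDGLA_gBarTriv P, _, rfl,
    DecGraph.graphInsertionMaps_isLInftyMorphism, DecGraph.graphInsertionMaps_isQuasiIso⟩
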